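/- Proposition 7.1. Let $D_0=\{z\in\mathbb C:|z|>1\}$. A basic map of logarithmic capacity $c>0$ is a univalent analytic map $F:D_0\to D_0$ with $F(z)/z\to e^c$ as $z\to\infty$; it has regularity $\Lambda\in[0,\infty)$ if, for all $|z|>1$, $$\left|\log\frac{F(z)}z-c\,\frac{z+1}{z-1}\right|\le\frac{\Lambda c^{3/2}|z|}{|z-1|(|z|-1)},$$ where the branch of the logarithm is continuous on $D_0$ with limit $c$ at $\infty$. Given $\eta\in\mathbb R$ and $\sigma\ge0$, an ALE$(\eta)$ process with basic map $F$ and regularization parameter $\sigma$ is given by random angles $\Theta_1,\Theta_2,\dots$ and the maps $\Phi_0(z)=z$, $\Phi_n=\Phi_{n-1}\circ F_n$, $F_n(z)=e^{i\Theta_n}F(e^{-i\Theta_n}z)$, where, for all $n\ge1$ and all Borel sets $B$, almost surely, $$\mathbb P(\Theta_n\in B\mid\Theta_1,\dots,\Theta_{n-1})=\frac1{2\pi}\int_0^{2\pi}1_B(\theta)h_n(\theta)\,d\theta,\qquad h_n(\theta)=\frac{|\Phi_{n-1}'(e^{\sigma+i\theta})|^{-\eta}}{\frac1{2\pi}\int_0^{2\pi}|\Phi_{n-1}'(e^{\sigma+is})|^{-\eta}ds}.$$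 Set $\tilde\Phi_n(z)=e^{-cn}\Phi_n(z)-z$ and $\Psi_n(z)=z\tilde\Phi_n'(z)$. For $\delta_0>0$ set $$N_0=\min\Big\{n\ge0:\sup_{\theta\in[0,2\pi)}|\tilde\Phi_n'(e^{\sigma+i\theta})|>\delta_0\Big\}\in\{0,1,2,\dots\}\cup\{\infty\}$$ and, for a random function $f$ on $D_0$, $p\in[1,\infty)$ and $r>1$, write $$|||f|||_{p,r}=\left(\mathbb E\,\frac1{2\pi}\int_0^{2\pi}|f(re^{i\theta})|^p\,d\theta\right)^{1/p}.$$ (a) For all $\Lambda\in[0,\infty)$, $\eta\in[0,1)$, $T\in(0,\infty)$, $\varepsilon\in(0,1/2)$, $\nu\in(0,\varepsilon/2)$ and $p\in[2,\infty)$, there is a constant $C=C(\Lambda,\eta,T,\varepsilon,\nu,p)\in[1,\infty)$ with the following property. For all $c\in(0,1]$, every basic map $F$ of logarithmic capacity $c$ and regularity $\Lambda$, all $r,e^\sigma\ge1+c^{1/2-\varepsilon}$, every ALE$(\eta)$ process with basic map $F$ and regularization parameter $\sigma$, and all integers $0\le n\le T/c$, $$|||\Psi_n1_{\{n\le N_0\}}|||_{p,r}\le\frac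 Cr\left(\sqrt c\left(\frac r{r-1}\right)+\frac{c^{1-3\nu}}{(e^\sigma-1)^2}\right),$$ where $N_0$ is taken with $\delta_0=c^{1/2-\nu}/(e^\sigma-1)$. (b) For all $\Lambda\in[0,\infty)$, $T\in(0,\infty)$, $\varepsilon\in(0,1/5)$, $\nu\in(0,3\varepsilon/2)$ and $p\in[2,\infty)$, there is a constant $C=C(\Lambda,T,\varepsilon,\nu,p)\in[1,\infty)$ with the following property. For all $c\in(0,1]$, every basic map $F$ of logarithmic capacity $c$ and regularity $\Lambda$, all $r,e^\sigma\ge1+c^{1/5-\varepsilon}$, every ALE$(1)$ process with basic map $F$ and regularization parameter $\sigma$, and all integers $0\le n\le T/c$, $$|||\Psi_n1_{\{n\le N_0\}}|||_{p,r}\le\frac Cr\left(\sqrt c\left(\frac r{r-1}\right)^{3/2}+\frac{c^{1-3\nu}}{(e^\sigma-1)^3}\left(\frac r{r-1}\right)\right),$$ where $N_0$ is taken with $\delta_0=c^{1/2-\nu}/(e^\sigma-1)^{3/2}$. -/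

import Mathlib

open MeasureTheory Filter Topology
open scoped ENNReal

noncomputable section

namespace ALE

/-- The exterior disk `D₀ = {|z| > 1}`. -/
def exteriorDisk : Set ℂ := {z | 1 < ‖z‖}

/-- `F` is a basic map of logarithmic capacity `c`: it is univalent from `{|z| > 1}` into
`{|z| > 1}` and `F z / z → e ^ c` as `z → ∞`. Only the values of `F` on `{|z| > 1}` matter. -/
structure IsBasicMap (F : ℂ → ℂ) (c : ℝ) : Prop where
  capacity_pos : 0 < c
  differentiableOn : DifferentiableOn ℂ F exteriorDisk
  mapsTo : Set.MapsTo F exteriorDisk exteriorDisk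
  injOn : Set.InjOn F exteriorDisk
  tendsto_div : Tendsto (fun z => F z / z) (Bornology.cobounded ℂ) (𝓝 (Real.exp c : ℂ))

/-- `L` is the branch of `z ↦ log (F z / z)` which is continuous on `{|z| > 1}` and has limit `c`
at `∞`. -/
structure IsLogBranch (F : ℂ → ℂ) (c : ℝ) (L : ℂ → ℂ) : Prop where
  continuousOn : ContinuousOn L exteriorDisk
  exp_eq : ∀ z ∈ exteriorDisk, Complex.exp (L z) = F z / z
  tendsto : Tendsto L (Bornology.cobounded ℂ) (𝓝 (c : ℂ))

/-- The basic map `F` of logarithmic capacity `c` has regularity `Λ`: for all `|z| > 1`,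
`|log (F z / z) - c (z + 1) / (z - 1)| ≤ Λ c ^ (3/2) |z| / (|z - 1| (|z| - 1))`.
The branch of the logarithm exists and is unique on `{|z| > 1}`. -/
def HasRegularity (F : ℂ → ℂ) (c Λ : ℝ) : Prop :=
  ∃ L : ℂ → ℂ, IsLogBranch F c L ∧ ∀ z ∈ exteriorDisk,
    ‖L z - c * ((z + 1) / (z - 1))‖ ≤ Λ * c ^ (3 / 2 : ℝ) * ‖z‖ / (‖z - 1‖ * (‖z‖ - 1))

/-- The map `z ↦ e ^ (i t) F (e ^ (-i t) z)` which attaches a particle at angle `t`. -/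
def rotatedMap (F : ℂ → ℂ) (t : ℝ) (z : ℂ) : ℂ :=
  Complex.exp (t * Complex.I) * F (Complex.exp (-(t * Complex.I)) * z)

/-- The map `Φ_n = F_1 ∘ ⋯ ∘ F_n` built from the attachment angles `θ 1, …, θ n`, where `F_k` is
`F` rotated by `θ k`. (The value `θ 0` is not used.) -/
def clusterMap (F : ℂ → ℂ) (θ : ℕ → ℝ) : ℕ → ℂ → ℂ
  | 0 => fun z => z
  | n + 1 => fun z => clusterMap F θ n (rotatedMap F (θ (n + 1)) z)

/-- The density `h_{n+1}(t) = |Φ_n'(e^{σ+it})|^{-η} / ⨍ |Φ_n'(e^{σ+is})|^{-η} ds` on `[0, 2π]`, with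
respect to `dt / 2π`, of the angle of the `(n+1)`st particle, given the first `n` angles. -/
def angleDensity (F : ℂ → ℂ) (η σ : ℝ) (θ : ℕ → ℝ) (n : ℕ) (t : ℝ) : ℝ :=
  ‖deriv (clusterMap F θ n) (circleMap 0 (Real.exp σ) t)‖ ^ (-η) /
    ⨍ s in (0 : ℝ)..(2 * Real.pi),
      ‖deriv (clusterMap F θ n) (circleMap 0 (Real.exp σ) s)‖ ^ (-η)

/-- The σ-algebra `σ(Θ_1, …, Θ_n)`. -/
abbrev history {Ω : Type*} (Θ : ℕ → Ω → ℝ) (n : ℕ) : MeasurableSpace Ω :=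
  ⨆ k ∈ Finset.Icc 1 n, MeasurableSpace.comap (Θ k) inferInstance

/-- `Θ_1, Θ_2, …` are the attachment angles of an ALE(`η`) process with basic map `F` and
regularization parameter `σ`: conditionally on `Θ_1, …, Θ_n`, the angle `Θ_{n+1}` has
density `h_{n+1}` with respect to the uniform distribution on `[0, 2π]`. -/
structure IsALE {Ω : Type*} [MeasurableSpace Ω] (μ : Measure Ω) (F : ℂ → ℂ) (η σ : ℝ)
    (Θ : ℕ → Ω → ℝ) : Prop where
  measurable : ∀ n : ℕ, Measurable (Θ (n + 1))
  condProb : ∀ (n : ℕ) (B : Set ℝ), MeasurableSet B →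
    μ[(Θ (n + 1) ⁻¹' B).indicator (fun _ => (1 : ℝ)) | history Θ n] =ᵐ[μ]
      fun ω => ⨍ t in (0 : ℝ)..(2 * Real.pi),
        B.indicator (angleDensity F η σ (fun k => Θ k ω) n) t

/-- The fluctuation `Φ̃_n(z) = e ^ (-c n) Φ_n(z) - z`. -/
def fluctuation (F : ℂ → ℂ) (c : ℝ) (θ : ℕ → ℝ) (n : ℕ) (z : ℂ) : ℂ :=
  (Real.exp (-(c * n)) : ℂ) * clusterMap F θ n z - z

/-- The differentiated fluctuation `Ψ_n(z) = z Φ̃_n'(z)`. -/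
def diffFluctuation (F : ℂ → ℂ) (c : ℝ) (θ : ℕ → ℝ) (n : ℕ) (z : ℂ) : ℂ :=
  z * deriv (fluctuation F c θ n) z

/-- `‖f‖_{∞,r}`, the supremum of `|f|` on the circle of radius `r`. -/
def supNorm (f : ℂ → ℂ) (r : ℝ) : ℝ≥0∞ :=
  ⨆ t ∈ Set.Ico 0 (2 * Real.pi), ‖f (circleMap 0 r t)‖ₑ

/-- `N(δ) = min {n ≥ 0 : ‖Φ̃_n'‖_{∞, e^σ} > δ}`, which is `⊤` if there is no such `n`. -/
def exitTime (F : ℂ → ℂ) (c σ δ : ℝ) (θ : ℕ → ℝ) : ℕ∞ :=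
  ⨅ (n : ℕ) (_ : ENNReal.ofReal δ < supNorm (deriv (fluctuation F c θ n)) (Real.exp σ)), (n : ℕ∞)

/-- The norm `(𝔼 ⨍ |f(r e^{it})|^p dt) ^ (1/p)` of a random function `f`, as an extended
nonnegative real. -/
def tripleNorm {Ω : Type*} [MeasurableSpace Ω] (μ : Measure Ω) (p r : ℝ) (f : Ω → ℂ → ℂ) : ℝ≥0∞ :=
  (∫⁻ ω, (⨍⁻ t in Set.Ico 0 (2 * Real.pi), ‖f ω (circleMap 0 r t)‖ₑ ^ p ∂volume) ∂μ) ^ (1 / p)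

/-- The random function `Ψ_n 1_{n ≤ N(δ)}`. -/
def stoppedDiffFluctuation {Ω : Type*} (F : ℂ → ℂ) (c σ δ : ℝ) (Θ : ℕ → Ω → ℝ) (n : ℕ) :
    Ω → ℂ → ℂ :=
  {ω | (n : ℕ∞) ≤ exitTime F c σ δ (fun k => Θ k ω)}.indicator
    (fun ω => diffFluctuation F c (fun k => Θ k ω) n)

end ALE

end

/-!
# Moment bounds for the differentiated fluctuations of an ALE process

Write `ψ_n` for the differentiated fluctuation `Ψ_n`, and `y = |z| - 1`. Attaching a particle at angle `t` replaces `ψ_n` by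
`E(t, z) = z (e^{-c} F'(u) - 1) + e^{-c} (u F'(u) / F(u)) ψ_n(z F(u) / u)` with `u = e^{-it} z`
(`diffFluctuation_succ`). The proof compares the conditional moments of `E` over one step with
those of a linear operator which contracts, and then sums over the steps.

*The drift is a contraction.* As long as `|Φ̃_n'| ≤ δ` on the circle of radius `e^σ`, the density
of the next angle is `1 - η Re (ψ_n(v) / v) + O(δ²)` with `v = e^{σ + it}` (`angleDensity_bounds`).
With uniform angle one step maps `ψ_n` on average to `e^{-c} ψ_n(e^c z)`, by the mean value
property at infinity. The main part `-2 c z / (u - 1)²` of the first term, integrated against the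
linear part of the density, adds `-c η e^{-σ} (D ψ_n)(e^σ z)`, where `D = z d/dz`
(`integral_linear_drift`). The sum of the two is `driftOperator`. On a circle of radius `R` it is
convolution with a real kernel against the values of `ψ_n` on the circle of radius `e^b R`, and
this kernel is nonnegative of total mass `e^{-c}` as soon as
`c η (1 + e^{2 (b - σ)}) ≤ 1 - e^{-2 (c - b)}` (`driftKernel_nonneg`). By Jensen's inequality it
contracts all moments, from the circle of radius `e^b R` to that of radius `R`
(`circleMoment_driftOperator_le`). For `η < 1` there is room for `b = (1 - η) c / 2`; for `η = 1`
only `b = 0` is possible, which explains the worse exponents in this case.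

*One step.* The error of the drift is of second order in `δ` and `ψ_n`, up to a logarithm coming
from `⨍ |u - 1|⁻¹`, and the fluctuations have conditional variance of order `c² / y³`. The values
of `ψ_n` that enter these errors are controlled by a Poisson integral over a smaller circle
(`RegularAtInfty.norm_le_poissonMajorant`). Expanding `|a + b|^{2q}` to second order gives
`exists_one_step_circleMoment_le`, and then a recursive inequality for the moments of the process
stopped at the exit time (`exists_stoppedMoment_succ_le`). Only this inequality uses the law of the
angles, in the form `IsALE.lintegral_eq`. A discrete Gronwall argument turns an a priori bound `Z`
on the circle of radius `1 + y / 2` into a bound on the circle of radius `1 + y`, of the form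
`C (a(y) + Q Z)` with `a(y)` of the size claimed and `Q` a positive power of `c`
(`exists_stoppedMoment_le_of_inner`).

*Bootstrap.* Since `Φ_n` is univalent, `|ψ_n(z)| ≤ C / (|z| - 1)` without any probability
(`exists_norm_diffFluctuation_le`). Starting from this crude bound at `y / 2^K` and applying the
previous step `K` times, with `Q^K ≤ c`, removes the second term (`iterate_bound`). This proves the
claim for small `c`, even exponents and radii at most `2`; larger radii follow because `z ψ_n(z)`
is regular at infinity, other exponents by Jensen's inequality, and capacities bounded below from
the crude bound.
-/

namespace ALE

/-! ### Averages over circles -/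

/-- The uniform probability measure on the angles `(0, 2π]`, normalised so that
`∫ t, f t ∂uniformAngle` is by definition the interval average `⨍ t in 0..2π, f t`. -/
noncomputable def uniformAngle : Measure ℝ :=
  (volume.restrict (Set.uIoc 0 (2 * Real.pi)) Set.univ)⁻¹ •
    volume.restrict (Set.uIoc 0 (2 * Real.pi))

lemma intervalAverage_eq_integral_uniformAngle {E : Type*} [NormedAddCommGroup E]
    [NormedSpace ℝ E] (f : ℝ → E) :
    (⨍ s in (0 : ℝ)..(2 * Real.pi), f s) = ∫ s, f s ∂uniformAngle := rfl

lemma uniformAngle_eq :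
    uniformAngle = (ENNReal.ofReal (2 * Real.pi))⁻¹ •
      volume.restrict (Set.Ioc 0 (2 * Real.pi)) := by
  simp [uniformAngle, Set.uIoc_of_le Real.two_pi_pos.le]

instance isProbabilityMeasure_uniformAngle : IsProbabilityMeasure uniformAngle := by
  constructor
  rw [uniformAngle_eq, Measure.smul_apply, Measure.restrict_apply_univ, Real.volume_Ioc, sub_zero,
    smul_eq_mul, ENNReal.inv_mul_cancel]
  · simp [Real.pi_pos]
  · exact ENNReal.ofReal_ne_top

lemma integral_uniformAngle {E : Type*} [NormedAddCommGroup E] [NormedSpace ℝ E] (f : ℝ → E) :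
    ∫ t, f t ∂uniformAngle = (2 * Real.pi)⁻¹ • ∫ t in (0 : ℝ)..(2 * Real.pi), f t := by
  rw [uniformAngle_eq, integral_smul_measure, intervalIntegral.integral_of_le Real.two_pi_pos.le,
    ENNReal.toReal_inv, ENNReal.toReal_ofReal Real.two_pi_pos.le]

lemma lintegral_uniformAngle (f : ℝ → ℝ≥0∞) :
    ∫⁻ t, f t ∂uniformAngle =
      (ENNReal.ofReal (2 * Real.pi))⁻¹ * ∫⁻ t in Set.Ioc 0 (2 * Real.pi), f t := by
  rw [uniformAngle_eq, lintegral_smul_measure, smul_eq_mul]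

lemma laverage_Ico_eq_lintegral_uniformAngle (f : ℝ → ℝ≥0∞) :
    (⨍⁻ t in Set.Ico 0 (2 * Real.pi), f t ∂volume) = ∫⁻ t, f t ∂uniformAngle := by
  rw [setLAverage_eq, lintegral_uniformAngle, Real.volume_Ico, sub_zero, ENNReal.div_eq_inv_mul,
    setLIntegral_congr Ico_ae_eq_Ioc]

lemma integrable_uniformAngle {E : Type*} [NormedAddCommGroup E] {f : ℝ → E}
    (hf : Continuous f) : Integrable f uniformAngle := by
  rw [uniformAngle_eq]
  refine Integrable.smul_measure ?_ (by simp [Real.pi_pos])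
  exact (hf.continuousOn.integrableOn_Icc (a := 0) (b := 2 * Real.pi)).mono_set
    Set.Ioc_subset_Icc_self

lemma lintegral_uniformAngle_sub_left {f : ℝ → ℝ≥0∞} (hf : Function.Periodic f (2 * Real.pi))
    (a : ℝ) : ∫⁻ t, f (a - t) ∂uniformAngle = ∫⁻ t, f t ∂uniformAngle := by
  have key : ∀ b : ℝ, ∫⁻ t in Set.Ioc b (b + 2 * Real.pi), f t
      = ∫⁻ t in Set.Ioc 0 (0 + 2 * Real.pi), f t := by
    intro b
    refine IsAddFundamentalDomain.setLIntegral_eq (isAddFundamentalDomain_Ioc Real.two_pi_pos b)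
      (isAddFundamentalDomain_Ioc Real.two_pi_pos 0) f ?_
    rintro ⟨g, hg⟩ x
    obtain ⟨n, rfl⟩ := AddSubgroup.mem_zmultiples_iff.1 hg
    have := hf.zsmul n x
    rw [add_comm] at this
    exact this
  rw [lintegral_uniformAngle, lintegral_uniformAngle]
  congr 1
  have h1 : ∫⁻ t in Set.Ioc 0 (2 * Real.pi), f (a - t)
      = ∫⁻ t in Set.Ico (a - 2 * Real.pi) a, f t := by
    have hmp : MeasurePreserving (fun t : ℝ => a - t) volume volume :=
      Measure.measurePreserving_sub_left volume a
    have hemb : MeasurableEmbedding (fun t : ℝ => a - t) :=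
      (MeasurableEquiv.subLeft a).measurableEmbedding
    rw [← hmp.setLIntegral_comp_preimage_emb hemb]
    congr 2
    · ext t
      simp only [Set.mem_Ioc, Set.mem_preimage, Set.mem_Ico]
      constructor <;> rintro ⟨h, h'⟩ <;> constructor <;> linarith
    · simp
  rw [h1, setLIntegral_congr Ico_ae_eq_Ioc]
  have := key (a - 2 * Real.pi)
  simpa using this

lemma integral_uniformAngle_sub_left {E : Type*} [NormedAddCommGroup E] [NormedSpace ℝ E]
    {f : ℝ → E} (hf : Function.Periodic f (2 * Real.pi)) (a : ℝ) :
    ∫ t, f (a - t) ∂uniformAngle = ∫ t, f t ∂uniformAngle := by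
  rw [integral_uniformAngle, integral_uniformAngle, intervalIntegral.integral_comp_sub_left]
  have := hf.intervalIntegral_add_eq (a - 2 * Real.pi) 0
  simp only [sub_add_cancel, zero_add] at this
  rw [sub_zero, this]

lemma circleAverage_eq_integral_uniformAngle {E : Type*} [NormedAddCommGroup E]
    [NormedSpace ℝ E] (g : ℂ → E) (r : ℝ) :
    Real.circleAverage g 0 r = ∫ t, g (circleMap 0 r t) ∂uniformAngle := by
  rw [integral_uniformAngle, Real.circleAverage_def]

lemma norm_circleMap_zero_of_nonneg {r : ℝ} (hr : 0 ≤ r) (t : ℝ) : ‖circleMap 0 r t‖ = r := by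
  simp [abs_of_nonneg hr]

/-- Mean value property at infinity: a function which is holomorphic outside a disk and has a limit
at infinity has this limit as its mean over each circle. -/
lemma integral_circleMap_of_tendsto {g : ℂ → ℂ} {ρ r : ℝ} {l : ℂ} (hρ : 0 ≤ ρ) (hr : ρ < r)
    (hg : DifferentiableOn ℂ g {z | ρ < ‖z‖}) (hl : Tendsto g (Bornology.cobounded ℂ) (𝓝 l)) :
    ∫ t, g (circleMap 0 r t) ∂uniformAngle = l := by
  have hr0 : 0 < r := hρ.trans_lt hr
  have hopen : IsOpen {z : ℂ | ρ < ‖z‖} := isOpen_lt continuous_const continuous_norm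
  have hconst : ∀ R, r ≤ R → ∫ t, g (circleMap 0 R t) ∂uniformAngle
      = ∫ t, g (circleMap 0 r t) ∂uniformAngle := by
    intro R hR
    rw [← circleAverage_eq_integral_uniformAngle, ← circleAverage_eq_integral_uniformAngle,
      Real.circleAverage_eq_circleIntegral (hr0.trans_le hR).ne',
      Real.circleAverage_eq_circleIntegral hr0.ne',
      Complex.circleIntegral_sub_center_inv_smul_eq_of_differentiable_on_annulus_off_countable
        hr0 hR Set.countable_empty]
    · refine hg.continuousOn.mono ?_
      rintro z ⟨-, hz⟩
      simp only [Metric.mem_ball, dist_zero_right, not_lt] at hz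
      exact hr.trans_le hz
    · rintro z ⟨⟨-, hz⟩, -⟩
      simp only [Metric.mem_closedBall, dist_zero_right, not_le] at hz
      exact hg.differentiableAt (hopen.mem_nhds (hr.trans hz))
  refine eq_of_norm_sub_le_zero (le_of_forall_pos_le_add fun ε hε => ?_)
  have h1 := hl (Metric.closedBall_mem_nhds l hε)
  rw [Filter.mem_map, ← comap_norm_atTop, mem_comap] at h1
  obtain ⟨s, hs, hs'⟩ := h1
  obtain ⟨R, hR⟩ := mem_atTop_sets.1 hs
  set R' := max R r with hR'
  have hb : ∀ t, ‖g (circleMap 0 R' t) - l‖ ≤ ε := by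
    intro t
    have : circleMap 0 R' t ∈ g ⁻¹' Metric.closedBall l ε := by
      apply hs'
      rw [Set.mem_preimage, norm_circleMap_zero_of_nonneg (hr0.le.trans (le_max_right _ _))]
      exact hR _ (le_max_left _ _)
    simpa [dist_eq_norm] using this
  have hcont : Continuous fun t => g (circleMap 0 R' t) := by
    refine hg.continuousOn.comp_continuous (continuous_circleMap 0 R') fun t => ?_
    rw [Set.mem_ofPred_eq, norm_circleMap_zero_of_nonneg (hr0.le.trans (le_max_right _ _))]
    exact hr.trans_le (le_max_right _ _)
  rw [← hconst R' (le_max_right _ _)]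
  have : ∫ t, g (circleMap 0 R' t) ∂uniformAngle - l
      = ∫ t, (g (circleMap 0 R' t) - l) ∂uniformAngle := by
    rw [integral_sub (integrable_uniformAngle hcont) (integrable_const l)]
    simp
  rw [this, zero_add]
  simpa using norm_integral_le_of_norm_le_const (μ := uniformAngle) (Eventually.of_forall hb)

/-- Mean value property at the centre of a disk. -/
lemma integral_circleMap_of_differentiableOn {g : ℂ → ℂ} {ρ R : ℝ} (hρ : 0 ≤ ρ) (hR : ρ < R)
    (hg : DifferentiableOn ℂ g {z | ‖z‖ < R}) :
    ∫ t, g (circleMap 0 ρ t) ∂uniformAngle = g 0 := by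
  rw [← circleAverage_eq_integral_uniformAngle]
  apply DiffContOnCl.circleAverage
  apply DifferentiableOn.diffContOnCl
  refine hg.mono ?_
  refine Metric.closure_ball_subset_closedBall.trans fun z hz => ?_
  rw [abs_of_nonneg hρ] at hz
  simp only [Metric.mem_closedBall, dist_zero_right] at hz
  exact hz.trans_lt hR

/-- The mean of a function of `e ^ (-i t) z` over `t`. -/
lemma integral_rotate_of_tendsto {g : ℂ → ℂ} {ρ : ℝ} {z l : ℂ} (hρ : 0 ≤ ρ) (hr : ρ < ‖z‖)
    (hg : DifferentiableOn ℂ g {z | ρ < ‖z‖}) (hl : Tendsto g (Bornology.cobounded ℂ) (𝓝 l)) :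
    ∫ t : ℝ, g (Complex.exp (-(t * Complex.I)) * z) ∂uniformAngle = l := by
  have h1 : ∀ t : ℝ, Complex.exp (-(t * Complex.I)) * z = circleMap 0 ‖z‖ (z.arg - t) := by
    intro t
    rw [circleMap_zero]
    conv_lhs => rw [← Complex.norm_mul_exp_arg_mul_I z]
    rw [mul_left_comm, ← Complex.exp_add]
    push_cast
    congr 2
    ring
  simp only [h1]
  rw [integral_uniformAngle_sub_left (f := fun t => g (circleMap 0 ‖z‖ t)),
    integral_circleMap_of_tendsto hρ hr hg hl]
  intro t
  simp only [periodic_circleMap 0 ‖z‖ t]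

/-! ### Functions holomorphic outside the unit disk and regular at infinity -/

lemma isOpen_exteriorDisk : IsOpen exteriorDisk :=
  isOpen_lt continuous_const continuous_norm

lemma mem_exteriorDisk {z : ℂ} : z ∈ exteriorDisk ↔ 1 < ‖z‖ := Iff.rfl

/-- `f` is holomorphic on `{|z| > 1}` and has a finite limit at `∞`. -/
structure RegularAtInfty (f : ℂ → ℂ) : Prop where
  differentiableOn : DifferentiableOn ℂ f exteriorDisk
  exists_tendsto : ∃ l, Tendsto f (Bornology.cobounded ℂ) (𝓝 l)

lemma RegularAtInfty.differentiableAt {f : ℂ → ℂ} (hf : RegularAtInfty f) {z : ℂ} (hz : 1 < ‖z‖) :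
    DifferentiableAt ℂ f z :=
  hf.differentiableOn.differentiableAt (isOpen_exteriorDisk.mem_nhds hz)

lemma RegularAtInfty.continuous_comp_circleMap {f : ℂ → ℂ} (hf : RegularAtInfty f) {r : ℝ}
    (hr : 1 < r) : Continuous fun t => f (circleMap 0 r t) := by
  refine hf.differentiableOn.continuousOn.comp_continuous (continuous_circleMap 0 r) fun t => ?_
  rw [mem_exteriorDisk, norm_circleMap_zero_of_nonneg (by linarith)]
  exact hr

lemma eventually_cobounded_lt_norm (a : ℝ) : ∀ᶠ z in Bornology.cobounded ℂ, a < ‖z‖ :=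
  tendsto_norm_cobounded_atTop.eventually_gt_atTop a

lemma differentiableOn_update_comp_inv {f : ℂ → ℂ} {l : ℂ}
    (hf : DifferentiableOn ℂ f exteriorDisk)
    (hl : Tendsto f (Bornology.cobounded ℂ) (𝓝 l)) :
    DifferentiableOn ℂ (Function.update (fun ζ => f ζ⁻¹) 0 l) (Metric.ball 0 1) := by
  rw [← Complex.differentiableOn_compl_singleton_and_continuousAt_iff (c := 0)
    (Metric.ball_mem_nhds 0 one_pos)]
  constructor
  · have : DifferentiableOn ℂ (fun ζ : ℂ => f ζ⁻¹) (Metric.ball 0 1 \ {0}) := by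
      refine hf.comp (differentiableOn_inv.mono fun ζ hζ => hζ.2) ?_
      rintro ζ ⟨hζ, h0⟩
      rw [mem_exteriorDisk, norm_inv]
      have h0' : 0 < ‖ζ‖ := norm_pos_iff.2 h0
      exact (one_lt_inv₀ h0').2 (by simpa using hζ)
    refine this.congr ?_
    rintro ζ ⟨-, h0⟩
    exact Function.update_of_ne h0 _ _
  · rw [continuousAt_update_same]
    exact hl.comp tendsto_inv₀_nhdsNE_zero

/-- The coefficient of `1 / z` in the Laurent expansion at infinity. -/
lemma exists_tendsto_mul_sub {f : ℂ → ℂ} {l : ℂ} (hf : DifferentiableOn ℂ f exteriorDisk)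
    (hl : Tendsto f (Bornology.cobounded ℂ) (𝓝 l)) :
    ∃ a, Tendsto (fun z => z * (f z - l)) (Bornology.cobounded ℂ) (𝓝 a) := by
  have h := (differentiableOn_update_comp_inv hf hl).differentiableAt
    (Metric.ball_mem_nhds 0 one_pos)
  refine ⟨_, Tendsto.congr' ?_
    (h.hasDerivAt.tendsto_slope.comp (tendsto_inv₀_cobounded' (α := ℂ)))⟩
  filter_upwards [eventually_cobounded_lt_norm 0] with z hz
  have hz0 : z ≠ 0 := norm_pos_iff.1 hz
  simp [slope, Function.update_of_ne (inv_ne_zero hz0)]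

lemma tendsto_mul_deriv {f : ℂ → ℂ} {l : ℂ} (hf : DifferentiableOn ℂ f exteriorDisk)
    (hl : Tendsto f (Bornology.cobounded ℂ) (𝓝 l)) :
    Tendsto (fun z => z * deriv f z) (Bornology.cobounded ℂ) (𝓝 0) := by
  rw [Metric.tendsto_nhds]
  intro ε hε
  have h1 := hl (Metric.closedBall_mem_nhds l (show 0 < ε / 4 by positivity))
  rw [Filter.mem_map, ← comap_norm_atTop, mem_comap] at h1
  obtain ⟨s, hs, hs'⟩ := h1
  obtain ⟨R, hR⟩ := mem_atTop_sets.1 hs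
  filter_upwards [eventually_cobounded_lt_norm (2 * max R 2)] with z hz
  have hR2 : R ≤ max R 2 := le_max_left _ _
  have h22 : 2 ≤ max R 2 := le_max_right _ _
  have hz0 : 0 < ‖z‖ := by linarith
  have hball : ∀ w ∈ Metric.closedBall z (‖z‖ / 2), max R 2 < ‖w‖ := by
    intro w hw
    have : ‖z‖ - ‖w‖ ≤ ‖z - w‖ := norm_sub_norm_le z w
    rw [mem_closedBall_iff_norm'] at hw
    linarith
  have hd : DifferentiableOn ℂ (fun w => f w - l) (Metric.closedBall z (‖z‖ / 2)) :=
    (hf.mono fun w hw => by rw [mem_exteriorDisk]; linarith [hball w hw]).sub_const l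
  have := Complex.norm_deriv_le_of_forall_mem_sphere_norm_le (half_pos hz0) 
    (c := z) (f := fun w => f w - l) (C := ε / 4)
    (hd.diffContOnCl_ball Set.Subset.rfl)  (fun w hw => by
      have hw' := hball w (Metric.sphere_subset_closedBall hw)
      have : w ∈ f ⁻¹' Metric.closedBall l (ε / 4) := hs' (hR _ (by linarith))
      simpa [dist_eq_norm] using this)
  rw [deriv_sub_const] at this
  rw [dist_zero_right, norm_mul]
  calc ‖z‖ * ‖deriv f z‖ ≤ ‖z‖ * (ε / 4 / (‖z‖ / 2)) := by gcongr
    _ = ε / 2 := by field_simp; norm_num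
    _ < ε := by linarith

lemma tendsto_sub_inv_cobounded (w : ℂ) :
    Tendsto (fun v => (v - w)⁻¹) (Bornology.cobounded ℂ) (𝓝 0) :=
  tendsto_inv₀_cobounded.comp (tendsto_sub_const_cobounded w)

lemma exteriorDisk_mem_nhds {w : ℂ} (hw : 1 < ‖w‖) : exteriorDisk ∈ 𝓝 w :=
  isOpen_exteriorDisk.mem_nhds hw

lemma RegularAtInfty.tendsto_dslope {f : ℂ → ℂ} (hf : RegularAtInfty f) (w : ℂ) :
    Tendsto (dslope f w) (Bornology.cobounded ℂ) (𝓝 0) := by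
  obtain ⟨l, hl⟩ := hf.exists_tendsto
  have h := (tendsto_sub_inv_cobounded w).mul (hl.sub_const (f w))
  rw [zero_mul] at h
  refine h.congr' ?_
  filter_upwards [eventually_cobounded_lt_norm ‖w‖] with v hv
  have : v ≠ w := by rintro rfl; exact lt_irrefl _ hv
  simp [dslope_of_ne _ this, slope]

lemma integral_div_sub {ρ : ℝ} {w : ℂ} (hρ : 0 ≤ ρ) (hw : ρ < ‖w‖) :
    ∫ t, w / (w - circleMap 0 ρ t) ∂uniformAngle = 1 := by
  have hw0 : w ≠ 0 := norm_pos_iff.1 (hρ.trans_lt hw)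
  rw [integral_circleMap_of_differentiableOn (g := fun v => w / (w - v)) hρ hw]
  · simp [hw0]
  · intro v hv
    have : w - v ≠ 0 := by
      rw [sub_ne_zero]; rintro rfl; exact lt_irrefl _ (show ‖_‖ < ‖_‖ from hv)
    fun_prop (disch := exact this)

/-- Cauchy's formula in the exterior domain. -/
lemma RegularAtInfty.integral_mul_div_sub {f : ℂ → ℂ} (hf : RegularAtInfty f) {ρ : ℝ} {w : ℂ}
    (hρ : 1 < ρ) (hw : ρ < ‖w‖) :
    ∫ t, f (circleMap 0 ρ t) * (w / (w - circleMap 0 ρ t)) ∂uniformAngle = f w := by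
  have hw1 : 1 < ‖w‖ := hρ.trans hw
  have hne : ∀ t, w - circleMap 0 ρ t ≠ 0 := by
    intro t h
    rw [sub_eq_zero] at h
    rw [h, norm_circleMap_zero_of_nonneg (by linarith)] at hw
    exact lt_irrefl _ hw
  have hds : DifferentiableOn ℂ (dslope f w) exteriorDisk :=
    (Complex.differentiableOn_dslope (exteriorDisk_mem_nhds hw1)).2 hf.differentiableOn
  have h1 : ∫ t, dslope f w (circleMap 0 ρ t) ∂uniformAngle = 0 :=
    integral_circleMap_of_tendsto zero_le_one hρ hds (hf.tendsto_dslope w)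
  have hcont : Continuous fun t => dslope f w (circleMap 0 ρ t) := by
    refine hds.continuousOn.comp_continuous (continuous_circleMap 0 ρ) fun t => ?_
    rw [mem_exteriorDisk, norm_circleMap_zero_of_nonneg (by linarith)]
    exact hρ
  have h2 : ∀ t, f (circleMap 0 ρ t) * (w / (w - circleMap 0 ρ t))
      = f w * (w / (w - circleMap 0 ρ t)) - w * dslope f w (circleMap 0 ρ t) := by
    intro t
    have h3 := hne t
    have h4 : circleMap 0 ρ t - w ≠ 0 := fun h => h3 (by rw [← neg_sub, h, neg_zero])
    rw [dslope_of_ne _ (sub_ne_zero.1 h4), slope_def_field]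
    field_simp
    ring
  have hc2 : Continuous fun t => w / (w - circleMap 0 ρ t) := by
    have := continuous_circleMap 0 ρ
    fun_prop (disch := exact hne _)
  simp only [h2]
  rw [integral_sub (integrable_uniformAngle (by fun_prop)) (integrable_uniformAngle (by fun_prop)),
    integral_const_mul, integral_const_mul, integral_div_sub (by linarith) hw, h1]
  ring

/-- Cauchy's formula for the derivative in the exterior domain. -/
lemma RegularAtInfty.integral_mul_div_sub_sq {f : ℂ → ℂ} (hf : RegularAtInfty f) {ρ : ℝ} {w : ℂ}
    (hρ : 1 < ρ) (hw : ρ < ‖w‖) :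
    ∫ t, f (circleMap 0 ρ t) * (circleMap 0 ρ t * w / (circleMap 0 ρ t - w) ^ 2) ∂uniformAngle
      = -(w * deriv f w) := by
  have hw1 : 1 < ‖w‖ := hρ.trans hw
  have hne : ∀ t, circleMap 0 ρ t - w ≠ 0 := by
    intro t h
    rw [sub_eq_zero] at h
    rw [← h, norm_circleMap_zero_of_nonneg (by linarith)] at hw
    exact lt_irrefl _ hw
  have hds : DifferentiableOn ℂ (dslope f w) exteriorDisk :=
    (Complex.differentiableOn_dslope (exteriorDisk_mem_nhds hw1)).2 hf.differentiableOn
  -- `v * dslope f w v` is again regular at infinity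
  have hreg : RegularAtInfty fun v => v * dslope f w v := by
    refine ⟨differentiableOn_id.mul hds, ?_⟩
    obtain ⟨a, ha⟩ := exists_tendsto_mul_sub hds (hf.tendsto_dslope w)
    exact ⟨a, by simpa using ha⟩
  have h1 := hreg.integral_mul_div_sub hρ hw
  rw [dslope_same] at h1
  have h2 : ∫ t, circleMap 0 ρ t * w / (circleMap 0 ρ t - w) ^ 2 ∂uniformAngle = 0 := by
    rw [integral_circleMap_of_differentiableOn (g := fun v => v * w / (v - w) ^ 2)
      (by linarith) hw]
    · simp
    · intro v hv
      have : v - w ≠ 0 := by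
        rw [sub_ne_zero]; rintro rfl; exact lt_irrefl _ (show ‖_‖ < ‖_‖ from hv)
      fun_prop (disch := exact pow_ne_zero 2 this)
  have h3 : ∀ t, f (circleMap 0 ρ t) * (circleMap 0 ρ t * w / (circleMap 0 ρ t - w) ^ 2)
      = f w * (circleMap 0 ρ t * w / (circleMap 0 ρ t - w) ^ 2)
        - circleMap 0 ρ t * dslope f w (circleMap 0 ρ t) * (w / (w - circleMap 0 ρ t)) := by
    intro t
    have h4 := hne t
    have h5 : w - circleMap 0 ρ t ≠ 0 := fun h => h4 (by rw [← neg_sub, h, neg_zero])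
    rw [dslope_of_ne _ (sub_ne_zero.1 h4), slope_def_field]
    rw [show w - circleMap 0 ρ t = -(circleMap 0 ρ t - w) by ring]
    field_simp
    ring
  have hc0 := continuous_circleMap 0 ρ
  have hc1 : Continuous fun t => dslope f w (circleMap 0 ρ t) := by
    refine hds.continuousOn.comp_continuous (continuous_circleMap 0 ρ) fun t => ?_
    rw [mem_exteriorDisk, norm_circleMap_zero_of_nonneg (by linarith)]
    exact hρ
  have hc2 : Continuous fun t => w / (w - circleMap 0 ρ t) := by
    exact continuous_const.div (by fun_prop) fun t h => hne t (by rw [← neg_sub, h, neg_zero])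
  have hc3 : Continuous fun t => circleMap 0 ρ t * w / (circleMap 0 ρ t - w) ^ 2 := by
    exact (hc0.mul continuous_const).div (by fun_prop) fun t => pow_ne_zero 2 (hne t)
  simp only [h3]
  rw [integral_sub (integrable_uniformAngle (by fun_prop)) (integrable_uniformAngle (by fun_prop)),
    integral_const_mul, h2, h1]
  ring

lemma circleMap_conj {ρ : ℝ} (hρ : 0 < ρ) (t : ℝ) :
    (starRingEnd ℂ) (circleMap 0 ρ t) = (ρ : ℂ) ^ 2 / circleMap 0 ρ t := by
  have h0 : circleMap 0 ρ t ≠ 0 := circleMap_ne_center hρ.ne'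
  rw [eq_div_iff h0, ← Complex.normSq_eq_conj_mul_self, Complex.normSq_eq_norm_sq,
    norm_circleMap_zero_of_nonneg hρ.le]
  push_cast; rfl

/-- The pole of the reflected kernel lies strictly inside the circle of radius `ρ`. -/
lemma reflected_ne_zero {ρ : ℝ} {w v : ℂ} (hw : ρ < ‖w‖) (hρ : 0 < ρ)
    (hv : max 1 (ρ ^ 2 / ‖w‖) < ‖v‖) : (starRingEnd ℂ) w * v - (ρ : ℂ) ^ 2 ≠ 0 := by
  intro h
  rw [sub_eq_zero] at h
  have h1 := congrArg norm h
  rw [norm_mul, RCLike.norm_conj, norm_pow, Complex.norm_real, Real.norm_eq_abs, sq_abs] at h1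
  have h2 : ρ ^ 2 / ‖w‖ < ‖v‖ := (le_max_right _ _).trans_lt hv
  rw [div_lt_iff₀ (hρ.trans hw)] at h2
  linarith

lemma reflected_radius_lt {ρ : ℝ} {w : ℂ} (hρ : 1 < ρ) (hw : ρ < ‖w‖) :
    max 1 (ρ ^ 2 / ‖w‖) < ρ := by
  refine max_lt hρ ?_
  rw [div_lt_iff₀ (by linarith)]
  nlinarith

lemma tendsto_reflected {w : ℂ} (hw : w ≠ 0) (a : ℂ) :
    Tendsto (fun v => ((starRingEnd ℂ) w * v - a)⁻¹) (Bornology.cobounded ℂ) (𝓝 0) := by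
  have h0 : (starRingEnd ℂ) w ≠ 0 := by simpa using hw
  have h := (tendsto_sub_inv_cobounded (a / (starRingEnd ℂ) w)).const_mul ((starRingEnd ℂ) w)⁻¹
  rw [mul_zero] at h
  refine h.congr fun v => ?_
  rw [← mul_inv]
  congr 1
  field_simp

/-- On the circle of radius `ρ`, the conjugate of the Cauchy kernel at `w` extends holomorphically to
the exterior and vanishes at infinity: its pole is the reflected point `ρ² / conj w`. -/
lemma RegularAtInfty.integral_mul_conj_eq_zero {f : ℂ → ℂ} (hf : RegularAtInfty f) {ρ : ℝ} {w : ℂ}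
    (hρ : 1 < ρ) (hw : ρ < ‖w‖) :
    ∫ t, f (circleMap 0 ρ t) *
      (starRingEnd ℂ) (circleMap 0 ρ t / (w - circleMap 0 ρ t)) ∂uniformAngle = 0 := by
  have hρ0 : 0 < ρ := by linarith
  have hw0 : w ≠ 0 := norm_pos_iff.1 (hρ0.trans hw)
  obtain ⟨l, hl⟩ := hf.exists_tendsto
  refine Eq.trans (integral_congr_ae (Eventually.of_forall fun t => ?_))
    (integral_circleMap_of_tendsto (ρ := max 1 (ρ ^ 2 / ‖w‖)) (r := ρ) (l := 0)
    (g := fun v => f v * ((ρ : ℂ) ^ 2 * ((starRingEnd ℂ) w * v - (ρ : ℂ) ^ 2)⁻¹))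
    (by positivity) (reflected_radius_lt hρ hw) ?_ ?_)
  · show _ = _
    have h0 : circleMap 0 ρ t ≠ 0 := circleMap_ne_center hρ0.ne'
    simp only [map_div₀, map_sub, circleMap_conj hρ0]
    congr 1
    have h1 := reflected_ne_zero (v := circleMap 0 ρ t) hw hρ0 (by
      rw [norm_circleMap_zero_of_nonneg hρ0.le]; exact reflected_radius_lt hρ hw)
    have h2 : (starRingEnd ℂ) w - (ρ : ℂ) ^ 2 / circleMap 0 ρ t ≠ 0 := by
      intro h
      apply h1
      field_simp at h
      linear_combination h
    field_simp
  · intro v hv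
    have hne := reflected_ne_zero hw hρ0 hv
    have hfd : DifferentiableAt ℂ f v := hf.differentiableAt ((le_max_left _ _).trans_lt hv)
    apply DifferentiableAt.differentiableWithinAt
    fun_prop (disch := exact hne)
  · simpa using hl.mul ((tendsto_reflected hw0 ((ρ : ℂ) ^ 2)).const_mul ((ρ : ℂ) ^ 2))

lemma RegularAtInfty.integral_mul_conj_sq_eq_zero {f : ℂ → ℂ} (hf : RegularAtInfty f) {ρ : ℝ}
    {w : ℂ} (hρ : 1 < ρ) (hw : ρ < ‖w‖) :
    ∫ t, f (circleMap 0 ρ t) *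
      (starRingEnd ℂ) (circleMap 0 ρ t * w / (circleMap 0 ρ t - w) ^ 2) ∂uniformAngle = 0 := by
  have hρ0 : 0 < ρ := by linarith
  have hw0 : w ≠ 0 := norm_pos_iff.1 (hρ0.trans hw)
  obtain ⟨l, hl⟩ := hf.exists_tendsto
  have hrw : ∀ v : ℂ, ((starRingEnd ℂ) w * v - (ρ : ℂ) ^ 2) ≠ 0 →
      (ρ : ℂ) ^ 2 * ((starRingEnd ℂ) w * v) / ((starRingEnd ℂ) w * v - (ρ : ℂ) ^ 2) ^ 2
      = (ρ : ℂ) ^ 2 * (((starRingEnd ℂ) w * v - (ρ : ℂ) ^ 2)⁻¹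
        + (ρ : ℂ) ^ 2 * (((starRingEnd ℂ) w * v - (ρ : ℂ) ^ 2)⁻¹) ^ 2) := by
    intro v hv
    field_simp
    ring
  refine Eq.trans (integral_congr_ae (Eventually.of_forall fun t => ?_))
    (integral_circleMap_of_tendsto (ρ := max 1 (ρ ^ 2 / ‖w‖)) (r := ρ) (l := 0)
    (g := fun v => f v * ((ρ : ℂ) ^ 2 * (((starRingEnd ℂ) w * v - (ρ : ℂ) ^ 2)⁻¹
        + (ρ : ℂ) ^ 2 * (((starRingEnd ℂ) w * v - (ρ : ℂ) ^ 2)⁻¹) ^ 2)))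
    (by positivity) (reflected_radius_lt hρ hw) ?_ ?_)
  · show _ = _
    have h0 : circleMap 0 ρ t ≠ 0 := circleMap_ne_center hρ0.ne'
    have h1 := reflected_ne_zero (v := circleMap 0 ρ t) hw hρ0 (by
      rw [norm_circleMap_zero_of_nonneg hρ0.le]; exact reflected_radius_lt hρ hw)
    simp only [map_div₀, map_sub, map_mul, map_pow, circleMap_conj hρ0]
    rw [← hrw _ h1]
    congr 1
    have h2 : (ρ : ℂ) ^ 2 / circleMap 0 ρ t - (starRingEnd ℂ) w ≠ 0 := by
      intro h
      apply h1
      field_simp at h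
      linear_combination -h
    have h3 : (ρ : ℂ) ^ 2 / circleMap 0 ρ t - (starRingEnd ℂ) w
      = -((starRingEnd ℂ) w * circleMap 0 ρ t - (ρ : ℂ) ^ 2) / circleMap 0 ρ t := by
      field_simp; ring
    rw [h3]
    field_simp
  · intro v hv
    have hne := reflected_ne_zero hw hρ0 hv
    have hfd : DifferentiableAt ℂ f v := hf.differentiableAt ((le_max_left _ _).trans_lt hv)
    apply DifferentiableAt.differentiableWithinAt
    fun_prop (disch := exact hne)
  · have h := tendsto_reflected hw0 ((ρ : ℂ) ^ 2)
    simpa using hl.mul ((h.add ((h.pow 2).const_mul ((ρ : ℂ) ^ 2))).const_mul ((ρ : ℂ) ^ 2))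

/-- Poisson's formula in the exterior domain. -/
lemma RegularAtInfty.integral_poisson {f : ℂ → ℂ} (hf : RegularAtInfty f) {ρ : ℝ} {w : ℂ}
    (hρ : 1 < ρ) (hw : ρ < ‖w‖) :
    ∫ t, (((‖w‖ ^ 2 - ρ ^ 2) / ‖w - circleMap 0 ρ t‖ ^ 2 : ℝ) : ℂ) * f (circleMap 0 ρ t)
      ∂uniformAngle = f w := by
  have hρ0 : 0 < ρ := by linarith
  have hne : ∀ t, w - circleMap 0 ρ t ≠ 0 := by
    intro t h
    rw [sub_eq_zero] at h
    rw [h, norm_circleMap_zero_of_nonneg (by linarith)] at hw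
    exact lt_irrefl _ hw
  have h1 : ∀ t, (((‖w‖ ^ 2 - ρ ^ 2) / ‖w - circleMap 0 ρ t‖ ^ 2 : ℝ) : ℂ) * f (circleMap 0 ρ t)
      = f (circleMap 0 ρ t) * (w / (w - circleMap 0 ρ t)) + f (circleMap 0 ρ t) *
        (starRingEnd ℂ) (circleMap 0 ρ t / (w - circleMap 0 ρ t)) := by
    intro t
    have h2 := hne t
    have h3 : (starRingEnd ℂ) (w - circleMap 0 ρ t) ≠ 0 := (map_ne_zero _).2 h2
    have h4 : ρ = ‖circleMap 0 ρ t‖ := (norm_circleMap_zero_of_nonneg hρ0.le t).symm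
    rw [mul_comm, ← mul_add]
    congr 1
    rw [h4]
    push_cast
    simp only [← Complex.conj_mul']
    rw [← h4, map_div₀]
    field_simp
    simp only [map_sub]
    ring
  simp only [h1]
  have hc := hf.continuous_comp_circleMap hρ
  have hc0 := continuous_circleMap 0 ρ
  have hc2 : Continuous fun t => w / (w - circleMap 0 ρ t) := by
    fun_prop (disch := exact hne _)
  have hc3 : Continuous fun t => (starRingEnd ℂ) (circleMap 0 ρ t / (w - circleMap 0 ρ t)) := by
    refine Complex.continuous_conj.comp ?_
    fun_prop (disch := exact hne _)
  have hc4 : Continuous fun t => f (circleMap 0 ρ t) * (w / (w - circleMap 0 ρ t)) := hc.mul hc2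
  have hc5 : Continuous fun t => f (circleMap 0 ρ t) *
      (starRingEnd ℂ) (circleMap 0 ρ t / (w - circleMap 0 ρ t)) := hc.mul hc3
  rw [integral_add (integrable_uniformAngle hc4) (integrable_uniformAngle hc5),
    hf.integral_mul_div_sub hρ hw, hf.integral_mul_conj_eq_zero hρ hw, add_zero]

/-- A formula of Poisson type, with a real kernel, for the logarithmic derivative. -/
lemma RegularAtInfty.integral_deriv_poisson {f : ℂ → ℂ} (hf : RegularAtInfty f) {ρ : ℝ} {w : ℂ}
    (hρ : 1 < ρ) (hw : ρ < ‖w‖) :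
    ∫ t, ((2 * (circleMap 0 ρ t * w / (circleMap 0 ρ t - w) ^ 2).re : ℝ) : ℂ) *
      f (circleMap 0 ρ t) ∂uniformAngle = -(w * deriv f w) := by
  have hne : ∀ t, circleMap 0 ρ t - w ≠ 0 := by
    intro t h
    rw [sub_eq_zero] at h
    rw [← h, norm_circleMap_zero_of_nonneg (by linarith)] at hw
    exact lt_irrefl _ hw
  have h1 : ∀ t, ((2 * (circleMap 0 ρ t * w / (circleMap 0 ρ t - w) ^ 2).re : ℝ) : ℂ) *
      f (circleMap 0 ρ t) =
      f (circleMap 0 ρ t) * (circleMap 0 ρ t * w / (circleMap 0 ρ t - w) ^ 2) +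
      f (circleMap 0 ρ t) *
        (starRingEnd ℂ) (circleMap 0 ρ t * w / (circleMap 0 ρ t - w) ^ 2) := by
    intro t
    rw [mul_comm, ← mul_add, Complex.add_conj]
  simp only [h1]
  have hc := hf.continuous_comp_circleMap hρ
  have hc0 := continuous_circleMap 0 ρ
  have hc2 : Continuous fun t => circleMap 0 ρ t * w / (circleMap 0 ρ t - w) ^ 2 := by
    exact (hc0.mul continuous_const).div (by fun_prop) fun t => pow_ne_zero 2 (hne t)
  have hc3 : Continuous fun t =>
      (starRingEnd ℂ) (circleMap 0 ρ t * w / (circleMap 0 ρ t - w) ^ 2) :=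
    Complex.continuous_conj.comp hc2
  have hc4 : Continuous fun t => f (circleMap 0 ρ t) * (circleMap 0 ρ t * w / (circleMap 0 ρ t - w) ^ 2) := hc.mul hc2
  have hc5 : Continuous fun t => f (circleMap 0 ρ t) *
      (starRingEnd ℂ) (circleMap 0 ρ t * w / (circleMap 0 ρ t - w) ^ 2) := hc.mul hc3
  rw [integral_add (integrable_uniformAngle hc4) (integrable_uniformAngle hc5),
    hf.integral_mul_div_sub_sq hρ hw, hf.integral_mul_conj_sq_eq_zero hρ hw, add_zero]

/-! ### Contraction by positive kernels -/

/-- The graph of a power lies above its tangent lines on `[0, ∞)`. -/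
lemma pow_add_mul_sub_le_pow {a x : ℝ} (ha : 0 ≤ a) (hx : 0 ≤ x) (n : ℕ) :
    a ^ (n + 1) + (n + 1) * a ^ n * (x - a) ≤ x ^ (n + 1) := by
  induction n with
  | zero => simp
  | succ n ih =>
    have h1 := mul_le_mul_of_nonneg_left ih hx
    have h2 : 0 ≤ (n + 1 : ℝ) * a ^ n * (x - a) ^ 2 := by positivity
    have h3 : x ^ (n + 1 + 1) = x * x ^ (n + 1) := by ring
    rw [h3]
    refine le_trans ?_ h1
    push_cast
    have h4 : x * (a ^ (n + 1) + (n + 1) * a ^ n * (x - a)) -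
      (a ^ (n + 1 + 1) + (n + 1 + 1) * a ^ (n + 1) * (x - a)) = (n + 1) * a ^ n * (x - a) ^ 2 := by
      ring
    linarith

/-- Jensen's inequality for an average of a continuous function. -/
lemma pow_integral_mul_le {k f : ℝ → ℝ} (hk : Continuous k) (hk0 : ∀ s, 0 ≤ k s)
    (hk1 : ∫ s, k s ∂uniformAngle = 1) (hf : Continuous f) (hf0 : ∀ s, 0 ≤ f s) {n : ℕ}
    (hn : n ≠ 0) :
    (∫ s, k s * f s ∂uniformAngle) ^ n ≤ ∫ s, k s * f s ^ n ∂uniformAngle := by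
  obtain ⟨n, rfl⟩ := Nat.exists_eq_succ_of_ne_zero hn
  set a := ∫ s, k s * f s ∂uniformAngle with ha
  have ha0 : 0 ≤ a := integral_nonneg fun s => mul_nonneg (hk0 s) (hf0 s)
  have h1 : ∫ s, (a ^ (n + 1) * k s + (n + 1) * a ^ n * (k s * f s - a * k s)) ∂uniformAngle
      = a ^ (n + 1) := by
    rw [integral_add (integrable_uniformAngle (by fun_prop))
      (integrable_uniformAngle (by fun_prop)), integral_const_mul, integral_const_mul,
      integral_sub (integrable_uniformAngle (by fun_prop))
      (integrable_uniformAngle (by fun_prop)), integral_const_mul, hk1, ← ha]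
    ring
  rw [← h1]
  refine integral_mono (integrable_uniformAngle (by fun_prop))
    (integrable_uniformAngle (by fun_prop)) fun s => ?_
  have := mul_le_mul_of_nonneg_left (pow_add_mul_sub_le_pow ha0 (hf0 s) n) (hk0 s)
  refine le_trans (le_of_eq ?_) this
  ring

/-- Convolution with a positive kernel of mass one contracts the moments over a circle. -/
lemma lintegral_pow_le_of_le_convolution {k f g : ℝ → ℝ} (hk : Continuous k)
    (hkp : Function.Periodic k (2 * Real.pi)) (hk0 : ∀ s, 0 ≤ k s)
    (hk1 : ∫ s, k s ∂uniformAngle = 1) (hf : Continuous f) (hf0 : ∀ s, 0 ≤ f s)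
    (hg0 : ∀ t, 0 ≤ g t) (hg : ∀ t, g t ≤ ∫ s, k (t - s) * f s ∂uniformAngle) {n : ℕ}
    (hn : n ≠ 0) :
    ∫⁻ t, ENNReal.ofReal (g t) ^ n ∂uniformAngle ≤
      ∫⁻ s, ENNReal.ofReal (f s) ^ n ∂uniformAngle := by
  have h1 : ∀ t, ENNReal.ofReal (g t) ^ n ≤
      ∫⁻ s, ENNReal.ofReal (k (t - s)) * ENNReal.ofReal (f s) ^ n ∂uniformAngle := by
    intro t
    have h2 : g t ^ n ≤ ∫ s, k (t - s) * f s ^ n ∂uniformAngle := by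
      refine (pow_le_pow_left₀ (hg0 t) (hg t) n).trans ?_
      refine pow_integral_mul_le (k := fun s => k (t - s)) (by fun_prop) (fun s => hk0 _) ?_ hf
        hf0 hn
      rw [integral_uniformAngle_sub_left hkp, hk1]
    rw [← ENNReal.ofReal_pow (hg0 t)]
    refine (ENNReal.ofReal_le_ofReal h2).trans (le_of_eq ?_)
    rw [ofReal_integral_eq_lintegral_ofReal (integrable_uniformAngle (by fun_prop))
      (Eventually.of_forall fun s => mul_nonneg (hk0 _) (pow_nonneg (hf0 s) n))]
    refine lintegral_congr fun s => ?_
    rw [ENNReal.ofReal_mul (hk0 _), ENNReal.ofReal_pow (hf0 s)]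
  have hm : Measurable fun p : ℝ × ℝ =>
      ENNReal.ofReal (k (p.1 - p.2)) * ENNReal.ofReal (f p.2) ^ n := by
    have h3 : Measurable fun p : ℝ × ℝ => k (p.1 - p.2) := by fun_prop
    have h4 : Measurable fun p : ℝ × ℝ => f p.2 := by fun_prop
    fun_prop
  calc ∫⁻ t, ENNReal.ofReal (g t) ^ n ∂uniformAngle
      ≤ ∫⁻ t, ∫⁻ s, ENNReal.ofReal (k (t - s)) * ENNReal.ofReal (f s) ^ n
          ∂uniformAngle ∂uniformAngle := lintegral_mono h1
    _ = ∫⁻ s, ∫⁻ t, ENNReal.ofReal (k (t - s)) * ENNReal.ofReal (f s) ^ n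
          ∂uniformAngle ∂uniformAngle := lintegral_lintegral_swap hm.aemeasurable
    _ = ∫⁻ s, ENNReal.ofReal (f s) ^ n ∂uniformAngle := by
      refine lintegral_congr fun s => ?_
      rw [lintegral_mul_const _ (by fun_prop)]
      have hper : Function.Periodic (fun x => ENNReal.ofReal (k (-x))) (2 * Real.pi) := by
        intro x
        have := hkp (-(x + 2 * Real.pi))
        simp only [neg_add_rev] at this ⊢
        rw [← this]
        congr 2
        ring
      have h5 := lintegral_uniformAngle_sub_left hper s
      have h6 := lintegral_uniformAngle_sub_left
        (f := fun x => ENNReal.ofReal (k x)) (fun x => by simp only [hkp x]) 0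
      simp only [neg_sub, zero_sub] at h5 h6
      rw [h5, h6, ← ofReal_integral_eq_lintegral_ofReal (integrable_uniformAngle hk)
        (Eventually.of_forall hk0), hk1, ENNReal.ofReal_one, one_mul]

/-- The mean of `|f| ^ n` over the circle of radius `R`. -/
noncomputable def circleMoment (f : ℂ → ℂ) (n : ℕ) (R : ℝ) : ℝ≥0∞ :=
  ∫⁻ t, ‖f (circleMap 0 R t)‖ₑ ^ n ∂uniformAngle

lemma circleMap_eq_mul_exp (R x s : ℝ) :
    circleMap 0 R (x + s) = circleMap 0 R x * Complex.exp (s * Complex.I) := by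
  simp only [circleMap_zero, Complex.ofReal_add, add_mul, Complex.exp_add]
  ring

lemma norm_circleMap_sub_circleMap (R ρ t s : ℝ) :
    ‖circleMap 0 R t - circleMap 0 ρ s‖ = ‖circleMap 0 R (t - s) - ρ‖ := by
  have h1 : circleMap 0 R t = circleMap 0 R (t - s) * Complex.exp (s * Complex.I) := by
    rw [← circleMap_eq_mul_exp, sub_add_cancel]
  have h2 : circleMap 0 ρ s = ρ * Complex.exp (s * Complex.I) := by rw [circleMap_zero]
  rw [h1, h2, ← sub_mul, norm_mul, Complex.norm_exp_ofReal_mul_I, mul_one]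

lemma circleMap_ne_ofReal {R ρ : ℝ} (hρ : 0 ≤ ρ) (hR : ρ < R) (x : ℝ) :
    circleMap 0 R x - ρ ≠ 0 := by
  intro h
  have := congrArg norm (sub_eq_zero.1 h)
  rw [norm_circleMap_zero_of_nonneg (hρ.trans hR.le), Complex.norm_real, Real.norm_eq_abs,
    abs_of_nonneg hρ] at this
  exact hR.ne' this

/-- The Poisson kernel of the exterior of the disk of radius `ρ`. -/
noncomputable def extPoisson (R ρ x : ℝ) : ℝ := (R ^ 2 - ρ ^ 2) / ‖circleMap 0 R x - ρ‖ ^ 2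

/-- The real kernel which represents `-z f'(z)` on `|z| = R` through the values of `f` on the
circle of radius `ρ`. -/
noncomputable def extDerivPoisson (R ρ x : ℝ) : ℝ :=
  2 * (ρ * circleMap 0 R x / (ρ - circleMap 0 R x) ^ 2).re

lemma continuous_extPoisson {R ρ : ℝ} (hρ : 0 ≤ ρ) (hR : ρ < R) :
    Continuous (extPoisson R ρ) := by
  have := continuous_circleMap 0 R
  unfold extPoisson
  exact continuous_const.div (by fun_prop) fun x =>
    pow_ne_zero 2 (norm_ne_zero_iff.2 (circleMap_ne_ofReal hρ hR x))

lemma continuous_extDerivPoisson {R ρ : ℝ} (hρ : 0 ≤ ρ) (hR : ρ < R) :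
    Continuous (extDerivPoisson R ρ) := by
  have := continuous_circleMap 0 R
  unfold extDerivPoisson
  refine continuous_const.mul (Complex.continuous_re.comp ?_)
  refine (continuous_const.mul this).div (by fun_prop) fun x => pow_ne_zero 2 fun h => ?_
  exact circleMap_ne_ofReal hρ hR x (by rw [← neg_sub, h, neg_zero])

lemma periodic_extPoisson (R ρ : ℝ) : Function.Periodic (extPoisson R ρ) (2 * Real.pi) :=
  fun x => by simp only [extPoisson, periodic_circleMap 0 R x]

lemma periodic_extDerivPoisson (R ρ : ℝ) :
    Function.Periodic (extDerivPoisson R ρ) (2 * Real.pi) :=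
  fun x => by simp only [extDerivPoisson, periodic_circleMap 0 R x]

lemma extPoisson_nonneg {R ρ : ℝ} (hρ : 0 ≤ ρ) (hR : ρ ≤ R) (x : ℝ) : 0 ≤ extPoisson R ρ x :=
  div_nonneg (by nlinarith) (by positivity)

lemma extPoisson_sub {R : ℝ} (hR : 0 ≤ R) (ρ t s : ℝ) :
    extPoisson R ρ (t - s) =
      (‖circleMap 0 R t‖ ^ 2 - ρ ^ 2) / ‖circleMap 0 R t - circleMap 0 ρ s‖ ^ 2 := by
  rw [extPoisson, norm_circleMap_sub_circleMap, norm_circleMap_zero_of_nonneg hR]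

lemma extDerivPoisson_sub (R ρ t s : ℝ) :
    extDerivPoisson R ρ (t - s) =
      2 * (circleMap 0 ρ s * circleMap 0 R t / (circleMap 0 ρ s - circleMap 0 R t) ^ 2).re := by
  have h1 : circleMap 0 R t = circleMap 0 R (t - s) * Complex.exp (s * Complex.I) := by
    rw [← circleMap_eq_mul_exp, sub_add_cancel]
  have h2 : circleMap 0 ρ s = ρ * Complex.exp (s * Complex.I) := by rw [circleMap_zero]
  have he := Complex.exp_ne_zero (s * Complex.I)
  rw [extDerivPoisson, h1, h2]
  congr 2
  rw [← sub_mul, mul_pow, show ρ * Complex.exp (s * Complex.I) *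
    (circleMap 0 R (t - s) * Complex.exp (s * Complex.I)) =
    ρ * circleMap 0 R (t - s) * Complex.exp (s * Complex.I) ^ 2 by ring,
    mul_div_mul_right _ _ (pow_ne_zero 2 he)]

lemma regularAtInfty_const (a : ℂ) : RegularAtInfty fun _ => a :=
  ⟨differentiableOn_const a, a, tendsto_const_nhds⟩

lemma RegularAtInfty.eq_integral_extPoisson {f : ℂ → ℂ} (hf : RegularAtInfty f) {R ρ : ℝ}
    (hρ : 1 < ρ) (hR : ρ < R) (t : ℝ) :
    f (circleMap 0 R t) =
      ∫ s, (extPoisson R ρ (t - s) : ℂ) * f (circleMap 0 ρ s) ∂uniformAngle := by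
  have hR0 : 0 ≤ R := by linarith
  rw [← hf.integral_poisson (w := circleMap 0 R t) hρ
    (by rwa [norm_circleMap_zero_of_nonneg hR0])]
  simp only [extPoisson_sub hR0]

lemma RegularAtInfty.eq_integral_extDerivPoisson {f : ℂ → ℂ} (hf : RegularAtInfty f) {R ρ : ℝ}
    (hρ : 1 < ρ) (hR : ρ < R) (t : ℝ) :
    -(circleMap 0 R t * deriv f (circleMap 0 R t)) =
      ∫ s, (extDerivPoisson R ρ (t - s) : ℂ) * f (circleMap 0 ρ s) ∂uniformAngle := by
  have hR0 : 0 ≤ R := by linarith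
  rw [← hf.integral_deriv_poisson (w := circleMap 0 R t) hρ
    (by rwa [norm_circleMap_zero_of_nonneg hR0])]
  simp only [extDerivPoisson_sub]

lemma integral_extPoisson {R ρ : ℝ} (hρ : 1 < ρ) (hR : ρ < R) :
    ∫ x, extPoisson R ρ x ∂uniformAngle = 1 := by
  have h := (regularAtInfty_const 1).eq_integral_extPoisson hρ hR 0
  simp only [mul_one] at h
  rw [integral_complex_ofReal, integral_uniformAngle_sub_left (periodic_extPoisson R ρ)] at h
  exact_mod_cast h.symm

lemma integral_extDerivPoisson {R ρ : ℝ} (hρ : 1 < ρ) (hR : ρ < R) :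
    ∫ x, extDerivPoisson R ρ x ∂uniformAngle = 0 := by
  have h := (regularAtInfty_const 1).eq_integral_extDerivPoisson hρ hR 0
  simp only [mul_one, deriv_const, mul_zero, neg_zero] at h
  rw [integral_complex_ofReal, integral_uniformAngle_sub_left (periodic_extDerivPoisson R ρ)] at h
  exact_mod_cast h.symm

/-- The drift operator: the linearisation of the conditional expectation of one step of the
process, acting on the differentiated fluctuation. It multiplies `z ^ (-k)` by
`e ^ (-c (k + 1)) + c η k e ^ (-σ (k + 1))`. -/
noncomputable def driftOperator (c η σ : ℝ) (f : ℂ → ℂ) (z : ℂ) : ℂ :=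
  (Real.exp (-c) : ℂ) * f (Real.exp c * z) -
    ((c * η * Real.exp (-σ) : ℝ) : ℂ) * ((Real.exp σ * z) * deriv f (Real.exp σ * z))

lemma exp_mul_circleMap (τ R t : ℝ) :
    (Real.exp τ : ℂ) * circleMap 0 R t = circleMap 0 (Real.exp τ * R) t := by
  simp [circleMap_zero, mul_assoc]

/-- The kernel of the drift operator, on the circle of radius `R e ^ b`. -/
noncomputable def driftKernel (c η σ b R x : ℝ) : ℝ :=
  Real.exp (-c) * extPoisson (Real.exp c * R) (Real.exp b * R) x +
    c * η * Real.exp (-σ) * extDerivPoisson (Real.exp σ * R) (Real.exp b * R) x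

lemma driftOperator_eq_integral {f : ℂ → ℂ} (hf : RegularAtInfty f) {c η σ b R : ℝ}
    (hR : 1 < R) (hb : 0 ≤ b) (hbc : b < c) (hcσ : c ≤ σ) (t : ℝ) :
    driftOperator c η σ f (circleMap 0 R t) =
      ∫ s, (driftKernel c η σ b R (t - s) : ℂ) * f (circleMap 0 (Real.exp b * R) s)
        ∂uniformAngle := by
  have hR0 : 0 < R := by linarith
  have hρ : 1 < Real.exp b * R := by nlinarith [Real.add_one_le_exp b]
  have h1 : Real.exp b * R < Real.exp c * R := by gcongr
  have h2 : Real.exp b * R < Real.exp σ * R := by gcongr; linarith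
  have hc1 := continuous_extPoisson (by linarith) h1
  have hc2 := continuous_extDerivPoisson (by linarith) h2
  have hcf := hf.continuous_comp_circleMap hρ
  have hk1 : Continuous fun s => (extPoisson (Real.exp c * R) (Real.exp b * R) (t - s) : ℂ) *
      f (circleMap 0 (Real.exp b * R) s) := by
    exact (Complex.continuous_ofReal.comp (hc1.comp (continuous_const.sub continuous_id))).mul hcf
  have hk2 : Continuous fun s => (extDerivPoisson (Real.exp σ * R) (Real.exp b * R) (t - s) : ℂ) *
      f (circleMap 0 (Real.exp b * R) s) := by
    exact (Complex.continuous_ofReal.comp (hc2.comp (continuous_const.sub continuous_id))).mul hcf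
  rw [driftOperator, exp_mul_circleMap, exp_mul_circleMap, sub_eq_add_neg, ← mul_neg,
    hf.eq_integral_extPoisson hρ h1, hf.eq_integral_extDerivPoisson hρ h2,
    ← integral_const_mul, ← integral_const_mul, ← integral_add
      ((integrable_uniformAngle hk1).const_mul _) ((integrable_uniformAngle hk2).const_mul _)]
  refine integral_congr_ae (Eventually.of_forall fun s => ?_)
  simp only [driftKernel]
  push_cast
  ring

lemma two_mul_re_div_sq {ρ W : ℝ} {w : ℂ} (hw : ‖w‖ = W) (h : w - ρ ≠ 0) :
    2 * (ρ * w / (ρ - w) ^ 2).re =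
      (W ^ 2 - ρ ^ 2) ^ 2 / (‖w - ρ‖ ^ 2) ^ 2 - (W ^ 2 + ρ ^ 2) / ‖w - ρ‖ ^ 2 := by
  have h0 : ‖w - ρ‖ ≠ 0 := norm_ne_zero_iff.2 h
  have hconj : (starRingEnd ℂ) (w - ρ) ≠ 0 := (map_ne_zero _).2 h
  have hC : ((2 * (ρ * w / (ρ - w) ^ 2).re : ℝ) : ℂ) =
      (((W ^ 2 - ρ ^ 2) ^ 2 / (‖w - ρ‖ ^ 2) ^ 2 - (W ^ 2 + ρ ^ 2) / ‖w - ρ‖ ^ 2 : ℝ) : ℂ) := by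
    rw [← Complex.add_conj]
    push_cast
    rw [← hw, ← Complex.conj_mul', ← Complex.conj_mul']
    simp only [map_div₀, map_mul, map_pow, map_sub, Complex.conj_ofReal] at hconj ⊢
    have h3 : (ρ : ℂ) - w ≠ 0 := fun h' => h (by rw [← neg_sub, h', neg_zero])
    have h4 : (ρ : ℂ) - (starRingEnd ℂ) w ≠ 0 := fun h' => hconj (by rw [← neg_sub, h', neg_zero])
    rw [show w - (ρ : ℂ) = -(ρ - w) by ring,
      show (starRingEnd ℂ) w - (ρ : ℂ) = -(ρ - (starRingEnd ℂ) w) by ring]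
    field_simp
    ring
  exact_mod_cast hC

lemma norm_circleMap_sub_sq (W ρ x : ℝ) :
    ‖circleMap 0 W x - ρ‖ ^ 2 = W ^ 2 + ρ ^ 2 - 2 * W * ρ * Real.cos x := by
  rw [← Complex.normSq_eq_norm_sq, Complex.normSq_apply, circleMap_zero, Complex.exp_mul_I]
  have h1 : (W * (Complex.cos x + Complex.sin x * Complex.I) - ρ : ℂ).re
      = W * Real.cos x - ρ := by
    simp [← Complex.ofReal_cos, ← Complex.ofReal_sin]
  have h2 : (W * (Complex.cos x + Complex.sin x * Complex.I) - ρ : ℂ).im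
      = W * Real.sin x := by
    simp [← Complex.ofReal_cos, ← Complex.ofReal_sin]
  rw [h1, h2]
  have := Real.sin_sq_add_cos_sq x
  linear_combination (W ^ 2) * this

/-- The kernel of the drift operator is nonnegative: far from the diagonal the negative part of the
derivative kernel is dominated by the Poisson kernel. -/
lemma driftKernel_nonneg {c η σ b R : ℝ} (hη : 0 ≤ η) (hR : 0 < R) (hb : 0 ≤ b) (hbc : b < c)
    (hcσ : c ≤ σ)
    (hpos : c * η * (1 + Real.exp (2 * (b - σ))) ≤ 1 - Real.exp (-(2 * (c - b)))) (x : ℝ) :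
    0 ≤ driftKernel c η σ b R x := by
  have h1 : Real.exp b * R < Real.exp c * R := by gcongr
  have h2 : Real.exp b * R < Real.exp σ * R := by gcongr; linarith
  have hb0 : 0 < Real.exp b * R := by positivity
  have hX1 : 0 < ‖circleMap 0 (Real.exp c * R) x - (Real.exp b * R : ℝ)‖ ^ 2 :=
    pow_pos (norm_pos_iff.2 (circleMap_ne_ofReal hb0.le h1 x)) 2
  have hX2 : 0 < ‖circleMap 0 (Real.exp σ * R) x - (Real.exp b * R : ℝ)‖ ^ 2 :=
    pow_pos (norm_pos_iff.2 (circleMap_ne_ofReal hb0.le h2 x)) 2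
  rw [driftKernel, extPoisson, extDerivPoisson, two_mul_re_div_sq (W := Real.exp σ * R)
    (norm_circleMap_zero_of_nonneg (by positivity) _) (circleMap_ne_ofReal hb0.le h2 x)]
  rw [norm_circleMap_sub_sq] at hX1 hX2 ⊢
  rw [norm_circleMap_sub_sq]
  set X1 := (Real.exp c * R) ^ 2 + (Real.exp b * R) ^ 2 -
    2 * (Real.exp c * R) * (Real.exp b * R) * Real.cos x with hX1d
  set X2 := (Real.exp σ * R) ^ 2 + (Real.exp b * R) ^ 2 -
    2 * (Real.exp σ * R) * (Real.exp b * R) * Real.cos x with hX2d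
  -- `X / W` increases with the outer radius `W`
  have hcomp : Real.exp σ * X1 ≤ Real.exp c * X2 := by
    have : Real.exp c * X2 - Real.exp σ * X1 =
        R ^ 2 * (Real.exp σ - Real.exp c) * (Real.exp c * Real.exp σ - Real.exp b ^ 2) := by
      rw [hX1d, hX2d]; ring
    have h3 : Real.exp c ≤ Real.exp σ := Real.exp_le_exp.2 hcσ
    have h4 : Real.exp b ≤ Real.exp c := Real.exp_le_exp.2 hbc.le
    have h5 : Real.exp b ^ 2 ≤ Real.exp c * Real.exp σ := by
      rw [sq]
      exact mul_le_mul h4 (h4.trans h3) (Real.exp_pos _).le (Real.exp_pos _).le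
    have : 0 ≤ Real.exp c * X2 - Real.exp σ * X1 := by
      rw [this]
      exact mul_nonneg (mul_nonneg (sq_nonneg R) (by linarith)) (by linarith)
    linarith
  have hc0 : 0 ≤ c := hb.trans hbc.le
  have hmain : c * η * Real.exp (-σ) * (((Real.exp σ * R) ^ 2 + (Real.exp b * R) ^ 2) / X2)
      ≤ Real.exp (-c) * (((Real.exp c * R) ^ 2 - (Real.exp b * R) ^ 2) / X1) := by
    rw [mul_div_assoc', mul_div_assoc', div_le_div_iff₀ hX2 hX1]
    have e1 : Real.exp (2 * (b - σ)) = Real.exp b ^ 2 * Real.exp (-σ) ^ 2 := by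
      rw [← Real.exp_nat_mul, ← Real.exp_nat_mul, ← Real.exp_add]; congr 1; push_cast; ring
    have e2 : Real.exp (-(2 * (c - b))) = Real.exp b ^ 2 * Real.exp (-c) ^ 2 := by
      rw [← Real.exp_nat_mul, ← Real.exp_nat_mul, ← Real.exp_add]; congr 1; push_cast; ring
    rw [e1, e2] at hpos
    have e3 : Real.exp (-σ) * Real.exp σ = 1 := by rw [← Real.exp_add]; simp
    have e4 : Real.exp (-c) * Real.exp c = 1 := by rw [← Real.exp_add]; simp
    have l1 : c * η * Real.exp (-σ) * ((Real.exp σ * R) ^ 2 + (Real.exp b * R) ^ 2) * X1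
        = c * η * (1 + Real.exp b ^ 2 * Real.exp (-σ) ^ 2) * R ^ 2 * (Real.exp σ * X1) := by
      linear_combination (c * η * R ^ 2 * X1 * Real.exp σ) * e3 +
        (-(c * η * R ^ 2 * Real.exp b ^ 2 * Real.exp (-σ) * X1)) * e3
    have l2 : Real.exp (-c) * ((Real.exp c * R) ^ 2 - (Real.exp b * R) ^ 2) * X2
        = (1 - Real.exp b ^ 2 * Real.exp (-c) ^ 2) * R ^ 2 * (Real.exp c * X2) := by
      linear_combination (R ^ 2 * X2 * Real.exp c) * e4 +
        (R ^ 2 * Real.exp b ^ 2 * Real.exp (-c) * X2) * e4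
    rw [l1, l2]
    have hX1' : 0 ≤ Real.exp σ * X1 := by positivity
    have h6 : 0 ≤ c * η * (1 + Real.exp b ^ 2 * Real.exp (-σ) ^ 2) := by positivity
    gcongr
    exact mul_nonneg (h6.trans hpos) (sq_nonneg R)
  have h7 : 0 ≤ c * η * Real.exp (-σ) *
      (((Real.exp σ * R) ^ 2 - (Real.exp b * R) ^ 2) ^ 2 / X2 ^ 2) := by positivity
  rw [mul_sub]
  linarith

/-- The drift operator contracts the moments over circles, with a gain `e ^ b` in the radius. -/
lemma circleMoment_driftOperator_le {f : ℂ → ℂ} (hf : RegularAtInfty f) {c η σ b R : ℝ}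
    (hR : 1 < R) (hη : 0 ≤ η) (hb : 0 ≤ b) (hbc : b < c) (hcσ : c ≤ σ)
    (hpos : c * η * (1 + Real.exp (2 * (b - σ))) ≤ 1 - Real.exp (-(2 * (c - b)))) {n : ℕ}
    (hn : n ≠ 0) :
    circleMoment (driftOperator c η σ f) n R ≤ circleMoment f n (Real.exp b * R) := by
  have hR0 : 0 < R := by linarith
  have hρ : 1 < Real.exp b * R := by nlinarith [Real.add_one_le_exp b]
  have h1 : Real.exp b * R < Real.exp c * R := by gcongr
  have h2 : Real.exp b * R < Real.exp σ * R := by gcongr; linarith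
  have hc1 := continuous_extPoisson (by linarith) h1
  have hc2 := continuous_extDerivPoisson (by linarith) h2
  have hcf := hf.continuous_comp_circleMap hρ
  have hk0 := driftKernel_nonneg hη hR0 hb hbc hcσ hpos
  have hkc : Continuous (driftKernel c η σ b R) := by
    unfold driftKernel
    fun_prop
  have hkp : Function.Periodic (driftKernel c η σ b R) (2 * Real.pi) := fun x => by
    simp only [driftKernel, periodic_extPoisson _ _ x, periodic_extDerivPoisson _ _ x]
  have hki : ∫ x, driftKernel c η σ b R x ∂uniformAngle = Real.exp (-c) := by
    unfold driftKernel
    rw [integral_add (integrable_uniformAngle (by fun_prop))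
      (integrable_uniformAngle (by fun_prop)), integral_const_mul, integral_const_mul,
      integral_extPoisson hρ h1, integral_extDerivPoisson hρ h2]
    simp
  have key := lintegral_pow_le_of_le_convolution
    (k := fun x => Real.exp c * driftKernel c η σ b R x)
    (f := fun s => ‖f (circleMap 0 (Real.exp b * R) s)‖)
    (g := fun t => ‖driftOperator c η σ f (circleMap 0 R t)‖) (by fun_prop)
    (fun x => by simp only [hkp x]) (fun x => mul_nonneg (Real.exp_pos c).le (hk0 x))
    (by rw [integral_const_mul, hki, ← Real.exp_add]; simp) hcf.norm (fun _ => norm_nonneg _)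
    (fun _ => norm_nonneg _) (fun t => ?_) hn
  · simpa only [circleMoment, ofReal_norm] using key
  · rw [driftOperator_eq_integral hf hR hb hbc hcσ]
    refine (norm_integral_le_integral_norm _).trans ?_
    refine integral_mono (integrable_uniformAngle ?_) (integrable_uniformAngle ?_) fun s => ?_
    · exact ((Complex.continuous_ofReal.comp
        (hkc.comp (continuous_const.sub continuous_id))).mul hcf).norm
    · exact (continuous_const.mul (hkc.comp (continuous_const.sub continuous_id))).mul hcf.norm
    · simp only [norm_mul, Complex.norm_real, Real.norm_eq_abs, abs_of_nonneg (hk0 _)]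
      have : 1 ≤ Real.exp c := Real.one_le_exp (hb.trans hbc.le)
      gcongr
      exact le_mul_of_one_le_left (hk0 _) this

/-! ### The Poisson majorant and Harnack estimates -/

/-- The Poisson integral at `z` of the values of `‖f‖` on the circle of radius `ρ`. It dominates
`‖f‖` near `z`, up to a constant. -/
noncomputable def poissonMajorant (f : ℂ → ℂ) (ρ : ℝ) (z : ℂ) : ℝ :=
  ∫ s, (‖z‖ ^ 2 - ρ ^ 2) / ‖z - circleMap 0 ρ s‖ ^ 2 * ‖f (circleMap 0 ρ s)‖ ∂uniformAngle

lemma poissonMajorant_nonneg (f : ℂ → ℂ) {ρ : ℝ} {z : ℂ} (hρ : 0 ≤ ρ) (hz : ρ ≤ ‖z‖) :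
    0 ≤ poissonMajorant f ρ z := by
  refine integral_nonneg fun s => mul_nonneg (div_nonneg ?_ (by positivity)) (norm_nonneg _)
  nlinarith

lemma lintegral_poissonMajorant_le {f : ℂ → ℂ} (hf : RegularAtInfty f) {ρ R : ℝ} (hρ : 1 < ρ)
    (hR : ρ < R) {n : ℕ} (hn : n ≠ 0) :
    ∫⁻ t, ENNReal.ofReal (poissonMajorant f ρ (circleMap 0 R t)) ^ n ∂uniformAngle ≤
      circleMoment f n ρ := by
  have hR0 : 0 ≤ R := by linarith
  have key := lintegral_pow_le_of_le_convolution (k := extPoisson R ρ)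
    (f := fun s => ‖f (circleMap 0 ρ s)‖)
    (g := fun t => poissonMajorant f ρ (circleMap 0 R t)) (continuous_extPoisson (by linarith) hR)
    (periodic_extPoisson R ρ) (extPoisson_nonneg (by linarith) hR.le) (integral_extPoisson hρ hR)
    (hf.continuous_comp_circleMap hρ).norm (fun _ => norm_nonneg _)
    (fun t => poissonMajorant_nonneg f (by linarith)
      (by rw [norm_circleMap_zero_of_nonneg hR0]; exact hR.le)) (fun t => ?_) hn
  · simpa only [circleMoment, ofReal_norm] using key
  · simp only [extPoisson_sub hR0]
    exact le_rfl

lemma continuous_poissonKernel {ρ : ℝ} {w : ℂ} (hρ : 0 ≤ ρ) (hw : ρ < ‖w‖) :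
    Continuous fun s => (‖w‖ ^ 2 - ρ ^ 2) / ‖w - circleMap 0 ρ s‖ ^ 2 := by
  have := continuous_circleMap 0 ρ
  refine continuous_const.div (by fun_prop) fun s => pow_ne_zero 2 (norm_ne_zero_iff.2 fun h => ?_)
  rw [sub_eq_zero] at h
  rw [h, norm_circleMap_zero_of_nonneg hρ] at hw
  exact lt_irrefl _ hw

/-- Harnack's inequality for the Poisson majorant. -/
lemma RegularAtInfty.norm_le_poissonMajorant {f : ℂ → ℂ} (hf : RegularAtInfty f) {ρ : ℝ}
    {z w : ℂ} (hρ : 1 < ρ) (hz : ρ - 1 ≤ (‖z‖ - 1) / 2) (hw : ‖w - z‖ ≤ (‖z‖ - 1) / 4) :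
    ‖f w‖ ≤ 9 * poissonMajorant f ρ z := by
  have hzw : ‖z‖ - ‖w‖ ≤ ‖w - z‖ := by
    rw [norm_sub_rev]; exact norm_sub_norm_le z w
  have hwz : ‖w‖ - ‖z‖ ≤ ‖w - z‖ := norm_sub_norm_le w z
  have hwρ : ρ < ‖w‖ := by linarith
  have hzρ : ρ < ‖z‖ := by linarith
  have hcf := (hf.continuous_comp_circleMap hρ).norm
  rw [← hf.integral_poisson hρ hwρ, poissonMajorant, ← integral_const_mul]
  refine (norm_integral_le_integral_norm _).trans ?_
  have hk1 := continuous_poissonKernel (by linarith) hwρ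
  have hk2 := continuous_poissonKernel (by linarith) hzρ
  refine integral_mono (integrable_uniformAngle ?_)
    (integrable_uniformAngle (continuous_const.mul (hk2.mul hcf))) fun s => ?_
  · exact ((Complex.continuous_ofReal.comp hk1).mul (hf.continuous_comp_circleMap hρ)).norm
  · have hn1 : 0 ≤ (‖w‖ ^ 2 - ρ ^ 2) / ‖w - circleMap 0 ρ s‖ ^ 2 :=
      div_nonneg (by nlinarith) (by positivity)
    simp only [norm_mul, Complex.norm_real, Real.norm_eq_abs, abs_of_nonneg hn1]
    rw [← mul_assoc]
    refine mul_le_mul_of_nonneg_right ?_ (norm_nonneg _)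
    have hv : ‖circleMap 0 ρ s‖ = ρ := norm_circleMap_zero_of_nonneg (by linarith) s
    have h1 : ‖z‖ - ρ ≤ ‖z - circleMap 0 ρ s‖ := by
      have := norm_sub_norm_le z (circleMap 0 ρ s)
      rwa [hv] at this
    have h2 : ‖z - circleMap 0 ρ s‖ ≤ ‖w - circleMap 0 ρ s‖ + ‖w - z‖ := by
      have := norm_sub_le (w - circleMap 0 ρ s) (w - z)
      rwa [sub_sub_sub_cancel_left] at this
    have h3 : 0 < ‖z - circleMap 0 ρ s‖ := by linarith
    have h4 : ‖z - circleMap 0 ρ s‖ / 2 ≤ ‖w - circleMap 0 ρ s‖ := by linarith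
    have h5 : 0 < ‖w - circleMap 0 ρ s‖ := by linarith
    rw [mul_div_assoc', div_le_div_iff₀ (by positivity) (by positivity)]
    have h6 : ‖z - circleMap 0 ρ s‖ ^ 2 ≤ 4 * ‖w - circleMap 0 ρ s‖ ^ 2 := by nlinarith
    have h7 : ‖w‖ ^ 2 - ρ ^ 2 ≤ 9 / 4 * (‖z‖ ^ 2 - ρ ^ 2) := by
      have : ‖w‖ - ρ ≤ 3 / 2 * (‖z‖ - ρ) := by linarith
      have : ‖w‖ + ρ ≤ 3 / 2 * (‖z‖ + ρ) := by linarith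
      nlinarith
    calc (‖w‖ ^ 2 - ρ ^ 2) * ‖z - circleMap 0 ρ s‖ ^ 2
        ≤ (9 / 4 * (‖z‖ ^ 2 - ρ ^ 2)) * (4 * ‖w - circleMap 0 ρ s‖ ^ 2) := by
          gcongr
          nlinarith
      _ = 9 * (‖z‖ ^ 2 - ρ ^ 2) * ‖w - circleMap 0 ρ s‖ ^ 2 := by ring

/-- A Lipschitz form of the previous bound, from Cauchy's estimate. -/
lemma RegularAtInfty.norm_sub_le_poissonMajorant {f : ℂ → ℂ} (hf : RegularAtInfty f) {ρ : ℝ}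
    {z w w' : ℂ} (hρ : 1 < ρ) (hz : ρ - 1 ≤ (‖z‖ - 1) / 2) (hw : ‖w - z‖ ≤ (‖z‖ - 1) / 8)
    (hw' : ‖w' - z‖ ≤ (‖z‖ - 1) / 8) :
    ‖f w - f w'‖ ≤ 72 * poissonMajorant f ρ z / (‖z‖ - 1) * ‖w - w'‖ := by
  have hy : 0 < ‖z‖ - 1 := by linarith
  have hmem : ∀ v ∈ Metric.closedBall z ((‖z‖ - 1) / 4), v ∈ exteriorDisk := by
    intro v hv
    rw [mem_closedBall_iff_norm'] at hv
    have := norm_sub_norm_le z v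
    rw [mem_exteriorDisk]
    linarith
  have hsub : ∀ v ∈ Metric.closedBall z ((‖z‖ - 1) / 8), ∀ x ∈ Metric.closedBall v ((‖z‖ - 1) / 8),
      x ∈ Metric.closedBall z ((‖z‖ - 1) / 4) := by
    intro v hv x hx
    rw [mem_closedBall_iff_norm] at hv hx ⊢
    have := norm_add_le (x - v) (v - z)
    rw [sub_add_sub_cancel] at this
    linarith
  refine (convex_closedBall z ((‖z‖ - 1) / 8)).norm_image_sub_le_of_norm_deriv_le (𝕜 := ℂ)
    (fun v hv => ?_) (fun v hv => ?_) (mem_closedBall_iff_norm.2 hw') (mem_closedBall_iff_norm.2 hw)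
  · exact hf.differentiableAt (hmem v (hsub v hv v (Metric.mem_closedBall_self (by linarith))))
  · have hd : DifferentiableOn ℂ f (Metric.closedBall v ((‖z‖ - 1) / 8)) :=
      hf.differentiableOn.mono fun x hx => hmem x (hsub v hv x hx)
    have := Complex.norm_deriv_le_of_forall_mem_sphere_norm_le (c := v) (f := f)
      (C := 9 * poissonMajorant f ρ z) (show 0 < (‖z‖ - 1) / 8 by linarith)
      (hd.diffContOnCl_ball Set.Subset.rfl) (fun x hx => hf.norm_le_poissonMajorant hρ hz
        (mem_closedBall_iff_norm.1 (hsub v hv x (Metric.sphere_subset_closedBall hx))))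
    refine this.trans (le_of_eq ?_)
    field_simp
    ring

section

/-! ### Estimates for the basic map -/

lemma IsLogBranch.differentiableOn {F : ℂ → ℂ} {c : ℝ} {L : ℂ → ℂ}
    (hF : DifferentiableOn ℂ F exteriorDisk) (hL : IsLogBranch F c L) :
    DifferentiableOn ℂ L exteriorDisk := by
  intro z hz
  have hnhds := exteriorDisk_mem_nhds hz
  have hz0 : z ≠ 0 := norm_pos_iff.1 (one_pos.trans hz)
  apply DifferentiableAt.differentiableWithinAt
  have hg : DifferentiableAt ℂ (fun w => F w / w) z :=
    (hF.differentiableAt hnhds).div differentiableAt_id hz0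
  have hgz : F z / z ≠ 0 := by rw [← hL.exp_eq z hz]; exact Complex.exp_ne_zero _
  have hlog : DifferentiableAt ℂ (fun w => L z + Complex.log (F w / w / (F z / z))) z := by
    exact (differentiableAt_const _).add
      ((hg.div_const _).clog (by rw [div_self hgz]; exact Complex.one_mem_slitPlane))
  refine hlog.congr_of_eventuallyEq ?_
  have hcont : ContinuousAt L z := hL.continuousOn.continuousAt hnhds
  filter_upwards [hnhds, hcont (Metric.ball_mem_nhds (L z) Real.pi_pos)] with w hw hw2
  rw [← hL.exp_eq w hw, ← hL.exp_eq z hz, ← Complex.exp_sub, Complex.log_exp]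
  · ring
  · rw [Set.mem_preimage, mem_ball_iff_norm] at hw2
    have := (abs_lt.1 ((Complex.abs_im_le_norm (L w - L z)).trans_lt hw2)).1
    linarith
  · rw [Set.mem_preimage, mem_ball_iff_norm] at hw2
    exact ((abs_lt.1 ((Complex.abs_im_le_norm (L w - L z)).trans_lt hw2)).2).le

lemma IsBasicMap.ne_zero {F : ℂ → ℂ} {c : ℝ} (hF : IsBasicMap F c) {u : ℂ} (hu : 1 < ‖u‖) :
    F u ≠ 0 :=
  norm_pos_iff.1 (one_pos.trans (hF.mapsTo hu))

lemma IsLogBranch.deriv_eq {F : ℂ → ℂ} {c : ℝ} {L : ℂ → ℂ} (hF : IsBasicMap F c)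
    (hL : IsLogBranch F c L) {u : ℂ} (hu : 1 < ‖u‖) :
    deriv F u = Complex.exp (L u) * (1 + u * deriv L u) := by
  have hLd := (hL.differentiableOn hF.differentiableOn).differentiableAt (exteriorDisk_mem_nhds hu)
  have h1 : F =ᶠ[𝓝 u] fun v => v * Complex.exp (L v) := by
    filter_upwards [exteriorDisk_mem_nhds hu] with v hv
    have hv0 : v ≠ 0 := norm_pos_iff.1 (one_pos.trans hv)
    rw [hL.exp_eq v hv, mul_div_cancel₀ _ hv0]
  rw [h1.deriv_eq]
  have := (hasDerivAt_id u).mul hLd.hasDerivAt.cexp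
  rw [show (fun v => v * Complex.exp (L v)) = id * fun v => Complex.exp (L v) from rfl, this.deriv]
  simp
  ring

lemma IsLogBranch.mul_deriv_div {F : ℂ → ℂ} {c : ℝ} {L : ℂ → ℂ} (hF : IsBasicMap F c)
    (hL : IsLogBranch F c L) {u : ℂ} (hu : 1 < ‖u‖) :
    u * deriv F u / F u = 1 + u * deriv L u := by
  have hu0 : u ≠ 0 := norm_pos_iff.1 (one_pos.trans hu)
  have h1 : F u = u * Complex.exp (L u) := by rw [hL.exp_eq u hu, mul_div_cancel₀ _ hu0]
  rw [hL.deriv_eq hF hu, h1]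
  have := Complex.exp_ne_zero (L u)
  field_simp

/-- The error `log (F u / u) - c (u + 1) / (u - 1)`. -/
noncomputable def logError (c : ℝ) (L : ℂ → ℂ) (u : ℂ) : ℂ := L u - c * ((u + 1) / (u - 1))

lemma ne_one_of_one_lt_norm {u : ℂ} (hu : 1 < ‖u‖) : u - 1 ≠ 0 := by
  intro h
  rw [sub_eq_zero] at h
  rw [h] at hu
  simp at hu

lemma rpow_three_halves {c : ℝ} (hc : 0 ≤ c) : c ^ (3 / 2 : ℝ) = c * √c := by
  rw [Real.sqrt_eq_rpow, show (3 / 2 : ℝ) = 1 + 1 / 2 by norm_num, Real.rpow_add' hc (by norm_num),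
    Real.rpow_one]

section Estimates

variable {F L : ℂ → ℂ} {c Λ Rb : ℝ}

lemma norm_sub_one_le_norm_sub_one (u : ℂ) : ‖u‖ - 1 ≤ ‖u - 1‖ := by
  simpa using norm_sub_norm_le u 1

lemma differentiableOn_logError (hF : IsBasicMap F c) (hL : IsLogBranch F c L) :
    DifferentiableOn ℂ (logError c L) exteriorDisk := by
  refine (hL.differentiableOn hF.differentiableOn).sub ?_
  refine DifferentiableOn.const_mul ?_ _
  intro u hu
  apply DifferentiableAt.differentiableWithinAt
  have := ne_one_of_one_lt_norm hu
  fun_prop (disch := exact this)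

lemma norm_logError_le (hΛ : 0 ≤ Λ) (hc : 0 < c)
    (hreg : ∀ z ∈ exteriorDisk, ‖L z - c * ((z + 1) / (z - 1))‖ ≤
      Λ * c ^ (3 / 2 : ℝ) * ‖z‖ / (‖z - 1‖ * (‖z‖ - 1))) {u : ℂ} (hu : 1 < ‖u‖) (hR : ‖u‖ ≤ Rb) :
    ‖logError c L u‖ ≤ Λ * Rb * (c * √c) / (‖u - 1‖ * (‖u‖ - 1)) := by
  refine (hreg u hu).trans ?_
  have h1 : 0 < ‖u‖ - 1 := by linarith
  have h2 := norm_sub_one_le_norm_sub_one u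
  have h3 : 0 < ‖u - 1‖ := by linarith
  rw [rpow_three_halves hc.le]
  have : Λ * (c * √c) * ‖u‖ ≤ Λ * Rb * (c * √c) := by
    have : 0 ≤ Λ * (c * √c) := by positivity
    nlinarith
  gcongr

lemma norm_deriv_logError_le (hF : IsBasicMap F c) (hL : IsLogBranch F c L) (hΛ : 0 ≤ Λ)
    (hreg : ∀ z ∈ exteriorDisk, ‖L z - c * ((z + 1) / (z - 1))‖ ≤
      Λ * c ^ (3 / 2 : ℝ) * ‖z‖ / (‖z - 1‖ * (‖z‖ - 1))) {u : ℂ} (hu : 1 < ‖u‖) (hR : ‖u‖ ≤ Rb) :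
    ‖deriv (logError c L) u‖ ≤ 16 * Λ * Rb * (c * √c) / (‖u - 1‖ * (‖u‖ - 1) ^ 2) := by
  have hc := hF.capacity_pos
  set y := ‖u‖ - 1 with hy
  have hy0 : 0 < y := by linarith
  have h2 : y ≤ ‖u - 1‖ := norm_sub_one_le_norm_sub_one u
  have h3 : 0 < ‖u - 1‖ := by linarith
  have hRb : 0 < Rb := by linarith
  have hball : ∀ v ∈ Metric.closedBall u (y / 2), 1 + y / 2 ≤ ‖v‖ ∧ ‖v‖ ≤ 2 * Rb ∧
      ‖u - 1‖ / 2 ≤ ‖v - 1‖ := by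
    intro v hv
    rw [mem_closedBall_iff_norm] at hv
    have e1 : ‖u‖ - ‖v‖ ≤ ‖v - u‖ := by rw [norm_sub_rev]; exact norm_sub_norm_le u v
    have e2 := norm_sub_norm_le v u
    have e3 : ‖u - 1‖ - ‖v - 1‖ ≤ ‖v - u‖ := by
      have := norm_sub_norm_le (u - 1) (v - 1)
      rwa [sub_sub_sub_cancel_right, norm_sub_rev u v] at this
    refine ⟨by linarith, by linarith, by linarith⟩
  have hd : DifferentiableOn ℂ (logError c L) (Metric.closedBall u (y / 2)) :=
    (differentiableOn_logError hF hL).mono fun v hv => by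
      rw [mem_exteriorDisk]; linarith [(hball v hv).1]
  have := Complex.norm_deriv_le_of_forall_mem_sphere_norm_le (c := u) (f := logError c L)
    (C := 8 * Λ * Rb * (c * √c) / (‖u - 1‖ * y)) (half_pos hy0)
    (hd.diffContOnCl_ball Set.Subset.rfl) (fun v hv => by
      obtain ⟨h4, h5, h6⟩ := hball v (Metric.sphere_subset_closedBall hv)
      refine (norm_logError_le hΛ hc hreg (by linarith) h5).trans ?_
      rw [div_le_div_iff₀ (mul_pos (by linarith) (by linarith)) (by positivity)]
      have h7 : ‖u - 1‖ * y ≤ 4 * (‖v - 1‖ * (‖v‖ - 1)) := by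
        have : ‖u - 1‖ / 2 * (y / 2) ≤ ‖v - 1‖ * (‖v‖ - 1) :=
          mul_le_mul h6 (by linarith) (by linarith) (by linarith)
        linarith
      have h8 : 0 ≤ 2 * Λ * Rb * (c * √c) := by positivity
      have h9 := mul_le_mul_of_nonneg_left h7 h8
      calc Λ * (2 * Rb) * (c * √c) * (‖u - 1‖ * y) = 2 * Λ * Rb * (c * √c) * (‖u - 1‖ * y) := by
            ring
        _ ≤ _ := h9
        _ = _ := by ring)
  refine this.trans (le_of_eq ?_)
  field_simp
  ring

end Estimates

lemma norm_exp_sub_one_sub_self_le {q : ℂ} (hq : ‖q‖ ≤ 1) :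
    ‖Complex.exp q - 1 - q‖ ≤ ‖q‖ ^ 2 := Complex.norm_exp_sub_one_sub_id_le hq

set_option maxHeartbeats 1000000 in
/-- On circles of radius larger than `1 + k √c`, the basic map is close to `z ↦ e ^ c z`: the first
three quantities are bounded by multiples of `c / (|u - 1| (|u| - 1))` and the fourth identifies
the main part of `e ^ (-c) F' - 1`. -/
lemma exists_basicMap_bounds (Λ Rb : ℝ) (hΛ : 0 ≤ Λ) (hRb : 1 ≤ Rb) :
    ∃ C k : ℝ, 1 ≤ C ∧ 1 ≤ k ∧ ∀ (c : ℝ) (F L : ℂ → ℂ), c ≤ 1 → IsBasicMap F c →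
      IsLogBranch F c L → (∀ z ∈ exteriorDisk, ‖L z - c * ((z + 1) / (z - 1))‖ ≤
        Λ * c ^ (3 / 2 : ℝ) * ‖z‖ / (‖z - 1‖ * (‖z‖ - 1))) →
      ∀ u : ℂ, 1 < ‖u‖ → ‖u‖ ≤ Rb → k * √c ≤ ‖u‖ - 1 →
        ‖u * deriv F u / F u - 1‖ ≤ C * (c / (‖u - 1‖ * (‖u‖ - 1))) ∧
        ‖(Real.exp (-c) : ℂ) * deriv F u - 1‖ ≤ C * (c / (‖u - 1‖ * (‖u‖ - 1))) ∧
        ‖F u / u - Real.exp c‖ ≤ C * (c / ‖u - 1‖) ∧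
        ‖(Real.exp (-c) : ℂ) * deriv F u - 1 + 2 * c / (u - 1) ^ 2‖ ≤
          C * (c * √c / (‖u - 1‖ * (‖u‖ - 1) ^ 2)) := by
  set C1 := 2 + Λ * Rb with hC1
  set C2 := 2 * Rb + 16 * Λ * Rb ^ 2 with hC2
  have hC1p : 2 ≤ C1 := by
    have : 0 ≤ Λ * Rb := by positivity
    linarith
  have hC2p : 2 ≤ C2 := by
    have : 0 ≤ 16 * Λ * Rb ^ 2 := by positivity
    linarith
  refine ⟨C2 + 2 * C1 * Rb * (1 + C2) + 6 * C1 + (C1 ^ 2 * Rb * (1 + C2) + C1 * C2 +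
    Λ * Rb * Rb + 16 * Λ * Rb ^ 2), C1, ?_, by linarith, ?_⟩
  · have : 0 ≤ 2 * C1 * Rb * (1 + C2) + 6 * C1 + (C1 ^ 2 * Rb * (1 + C2) + C1 * C2 +
      Λ * Rb * Rb + 16 * Λ * Rb ^ 2) := by positivity
    linarith
  intro c F L hc1 hF hL hreg u hu hR hk
  have hc := hF.capacity_pos
  set s := √c with hs
  have hs0 : 0 < s := Real.sqrt_pos.2 hc
  have hs1 : s ≤ 1 := by rw [hs]; exact Real.sqrt_le_one.2 hc1
  have hcs : c = s ^ 2 := (Real.sq_sqrt hc.le).symm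
  set y := ‖u‖ - 1 with hy
  set x := ‖u - 1‖ with hx
  have hy0 : 0 < y := by linarith
  have hyx : y ≤ x := norm_sub_one_le_norm_sub_one u
  have hx0 : 0 < x := by linarith
  have hyR : y ≤ Rb := by linarith
  have hsy : s ≤ y := by nlinarith
  have hu0 : u ≠ 0 := norm_pos_iff.1 (one_pos.trans hu)
  have hu1 : u - 1 ≠ 0 := ne_one_of_one_lt_norm hu
  set q := L u - c with hq
  have hqe : q = 2 * c / (u - 1) + logError c L u := by
    rw [hq, logError]; field_simp; ring
  have hell : ‖logError c L u‖ ≤ Λ * Rb * (s ^ 3 / (x * y)) := by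
    refine (norm_logError_le hΛ hc hreg hu hR).trans (le_of_eq ?_)
    rw [← hs, hcs]; ring
  have hell' : ‖deriv (logError c L) u‖ ≤ 16 * Λ * Rb * (s ^ 3 / (x * y ^ 2)) := by
    refine (norm_deriv_logError_le hF hL hΛ hreg hu hR).trans (le_of_eq ?_)
    rw [← hs, hcs]; ring
  have hnc : ‖(2 * c : ℂ)‖ = 2 * s ^ 2 := by
    rw [norm_mul, Complex.norm_real, Real.norm_eq_abs, abs_of_pos hc, hcs]; simp
  have hq1 : ‖q‖ ≤ C1 * (s ^ 2 / x) := by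
    rw [hqe]
    refine (norm_add_le _ _).trans ?_
    rw [norm_div, hnc]
    have e1 : s ^ 3 / (x * y) ≤ s ^ 2 / x := by
      rw [div_le_div_iff₀ (by positivity) hx0]
      nlinarith [mul_le_mul_of_nonneg_left hsy (show 0 ≤ s ^ 2 * x by positivity)]
    have e2 := mul_le_mul_of_nonneg_left e1 (show 0 ≤ Λ * Rb by positivity)
    rw [hC1, add_mul]
    have : 2 * s ^ 2 / ‖u - 1‖ = 2 * (s ^ 2 / x) := by rw [← hx]; ring
    linarith
  have hq2 : ‖q‖ ≤ 1 := by
    refine hq1.trans ?_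
    rw [mul_div_assoc', div_le_one hx0]
    calc C1 * s ^ 2 = (C1 * s) * s := by ring
      _ ≤ y * 1 := mul_le_mul hk hs1 hs0.le hy0.le
      _ ≤ x := by linarith
  have hLd : deriv L u = -(2 * c) / (u - 1) ^ 2 + deriv (logError c L) u := by
    have hd1 := (hL.differentiableOn hF.differentiableOn).differentiableAt
      (exteriorDisk_mem_nhds hu)
    have h1 : HasDerivAt (fun v : ℂ => (c : ℂ) * ((v + 1) / (v - 1)))
        (-(2 * c) / (u - 1) ^ 2) u := by
      have := (((hasDerivAt_id u).add_const (1 : ℂ)).div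
        ((hasDerivAt_id u).sub_const (1 : ℂ)) hu1).const_mul (c : ℂ)
      refine this.congr_deriv ?_
      simp only [id_eq]
      field_simp
      ring
    have h2 : deriv (logError c L) u = deriv L u - (-(2 * c) / (u - 1) ^ 2) :=
      (hd1.hasDerivAt.sub h1).deriv
    rw [h2]; ring
  set D := u * deriv L u with hD
  have hB : s ^ 2 / x ^ 2 ≤ s ^ 2 / (x * y) := by
    rw [sq x]; gcongr
  have hD1 : ‖D‖ ≤ C2 * (s ^ 2 / (x * y)) := by
    have e1 : ‖D‖ ≤ Rb * (2 * (s ^ 2 / x ^ 2) + 16 * Λ * Rb * (s ^ 3 / (x * y ^ 2))) := by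
      rw [hD, norm_mul, hLd]
      refine mul_le_mul hR ((norm_add_le _ _).trans (add_le_add ?_ hell')) (norm_nonneg _)
        (by linarith)
      rw [norm_div, norm_neg, hnc, norm_pow, ← hx]
      exact le_of_eq (by ring)
    have e2 : s ^ 3 / (x * y ^ 2) ≤ s ^ 2 / (x * y) := by
      rw [div_le_div_iff₀ (by positivity) (by positivity)]
      nlinarith [mul_le_mul_of_nonneg_left hsy (show 0 ≤ s ^ 2 * (x * y) by positivity)]
    refine e1.trans ?_
    calc Rb * (2 * (s ^ 2 / x ^ 2) + 16 * Λ * Rb * (s ^ 3 / (x * y ^ 2)))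
        ≤ Rb * (2 * (s ^ 2 / (x * y)) + 16 * Λ * Rb * (s ^ 2 / (x * y))) := by gcongr
      _ = C2 * (s ^ 2 / (x * y)) := by rw [hC2]; ring
  have hB1 : s ^ 2 / (x * y) ≤ 1 := by
    rw [div_le_one (by positivity)]
    nlinarith
  have hD2 : ‖D‖ ≤ C2 := hD1.trans (by nlinarith)
  have hB0 : 0 ≤ s ^ 2 / (x * y) := by positivity
  have hexp1 : ‖Complex.exp q - 1‖ ≤ 2 * C1 * (s ^ 2 / x) := by
    have := Complex.norm_exp_sub_one_le hq2
    linarith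
  have hexp2 : ‖Complex.exp q - 1 - q‖ ≤ C1 ^ 2 * (s ^ 2 / x) ^ 2 := by
    refine (norm_exp_sub_one_sub_self_le hq2).trans ?_
    rw [← mul_pow]
    gcongr
  have hxB : s ^ 2 / x ≤ Rb * (s ^ 2 / (x * y)) := by
    rw [mul_div_assoc', div_le_div_iff₀ hx0 (by positivity)]
    nlinarith [mul_le_mul_of_nonneg_left hyR (show 0 ≤ s ^ 2 * x by positivity)]
  have hA : (Real.exp (-c) : ℂ) * deriv F u - 1 = Complex.exp q * (1 + D) - 1 := by
    rw [hL.deriv_eq hF hu, hq, sub_eq_add_neg (L u), Complex.exp_add]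
    push_cast
    ring
  have hone : ‖1 + D‖ ≤ 1 + C2 := (norm_add_le _ _).trans (by simpa using hD2)
  rw [hcs]
  have hrest1 : 0 ≤ C1 ^ 2 * Rb * (1 + C2) + C1 * C2 + Λ * Rb * Rb + 16 * Λ * Rb ^ 2 := by
    positivity
  have hrest2 : 0 ≤ 2 * C1 * Rb * (1 + C2) := by positivity
  refine ⟨?_, ?_, ?_, ?_⟩
  · rw [hL.mul_deriv_div hF hu, add_sub_cancel_left]
    refine hD1.trans (mul_le_mul_of_nonneg_right ?_ hB0)
    linarith
  · rw [← hcs, hA, show Complex.exp q * (1 + D) - 1 = (Complex.exp q - 1) * (1 + D) + D by ring]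
    refine (norm_add_le _ _).trans ?_
    rw [norm_mul]
    have e1 : ‖Complex.exp q - 1‖ * ‖1 + D‖ ≤ (2 * C1 * (Rb * (s ^ 2 / (x * y)))) * (1 + C2) := by
      refine mul_le_mul (hexp1.trans (by gcongr)) hone (norm_nonneg _) (by positivity)
    have e2 : (2 * C1 * (Rb * (s ^ 2 / (x * y)))) * (1 + C2) + C2 * (s ^ 2 / (x * y)) =
        (2 * C1 * Rb * (1 + C2) + C2) * (s ^ 2 / (x * y)) := by ring
    refine (add_le_add e1 hD1).trans (e2.le.trans ?_)
    rw [hcs]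
    refine mul_le_mul_of_nonneg_right ?_ hB0
    linarith
  · have e1 : F u / u - Real.exp c = Real.exp c * (Complex.exp q - 1) := by
      rw [← hL.exp_eq u hu, hq, Complex.exp_sub]
      push_cast
      have := Complex.exp_ne_zero (c : ℂ)
      field_simp
    rw [← hcs, e1, norm_mul, Complex.norm_real, Real.norm_eq_abs, abs_of_pos (Real.exp_pos _)]
    have e2 : Real.exp c ≤ 3 := by
      have := Real.exp_one_lt_d9
      have := Real.exp_le_exp.2 hc1
      linarith
    have e3 : 0 ≤ s ^ 2 / x := by positivity
    calc Real.exp c * ‖Complex.exp q - 1‖ ≤ 3 * (2 * C1 * (s ^ 2 / x)) := by gcongr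
      _ = 6 * C1 * (s ^ 2 / x) := by ring
      _ ≤ _ := by
        rw [← hcs]
        refine mul_le_mul_of_nonneg_right ?_ (by rw [hcs]; exact e3)
        linarith
  · have e0 : (Real.exp (-c) : ℂ) * deriv F u - 1 + 2 * c / (u - 1) ^ 2 =
        (Complex.exp q - 1 - q) * (1 + D) + q * D + logError c L u +
          u * deriv (logError c L) u := by
      rw [hA]
      have : D + q + 2 * c / (u - 1) ^ 2 = logError c L u + u * deriv (logError c L) u := by
        rw [hD, hLd, hqe]
        field_simp
        ring
      linear_combination this
    rw [← hcs, e0]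
    set Q := s ^ 3 / (x * y ^ 2) with hQ
    have hQ0 : 0 ≤ Q := by positivity
    have f1 : (s ^ 2 / x) ^ 2 ≤ Rb * Q := by
      rw [hQ, div_pow, mul_div_assoc', div_le_div_iff₀ (by positivity) (by positivity)]
      have : s * y ^ 2 ≤ Rb * x := by
        calc s * y ^ 2 ≤ 1 * y ^ 2 := by gcongr
          _ = y * y := by ring
          _ ≤ Rb * x := mul_le_mul hyR hyx hy0.le (by linarith)
      calc (s ^ 2) ^ 2 * (x * y ^ 2) = s ^ 3 * x * (s * y ^ 2) := by ring
        _ ≤ s ^ 3 * x * (Rb * x) := by gcongr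
        _ = _ := by ring
    have f2 : (s ^ 2 / x) * (s ^ 2 / (x * y)) ≤ Q := by
      rw [hQ, div_mul_div_comm, div_le_div_iff₀ (by positivity) (by positivity)]
      have : s * y ≤ x := by nlinarith
      calc s ^ 2 * s ^ 2 * (x * y ^ 2) = s ^ 3 * (x * y) * (s * y) := by ring
        _ ≤ s ^ 3 * (x * y) * x := by gcongr
        _ = _ := by ring
    have f3 : s ^ 3 / (x * y) ≤ Rb * Q := by
      rw [hQ, mul_div_assoc', div_le_div_iff₀ (by positivity) (by positivity)]
      nlinarith [mul_le_mul_of_nonneg_left hyR (show 0 ≤ s ^ 3 * (x * y) by positivity)]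
    have g1 : ‖(Complex.exp q - 1 - q) * (1 + D)‖ ≤ C1 ^ 2 * (Rb * Q) * (1 + C2) := by
      rw [norm_mul]
      exact mul_le_mul (hexp2.trans (by gcongr)) hone (norm_nonneg _) (by positivity)
    have g2 : ‖q * D‖ ≤ C1 * C2 * Q := by
      rw [norm_mul]
      calc ‖q‖ * ‖D‖ ≤ (C1 * (s ^ 2 / x)) * (C2 * (s ^ 2 / (x * y))) :=
            mul_le_mul hq1 hD1 (norm_nonneg _) (by positivity)
        _ = C1 * C2 * ((s ^ 2 / x) * (s ^ 2 / (x * y))) := by ring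
        _ ≤ _ := by gcongr
    have g3 : ‖logError c L u‖ ≤ Λ * Rb * (Rb * Q) := hell.trans (by gcongr)
    have g4 : ‖u * deriv (logError c L) u‖ ≤ Rb * (16 * Λ * Rb * Q) := by
      rw [norm_mul]
      exact mul_le_mul hR hell' (norm_nonneg _) (by linarith)
    have hfin : ‖(Complex.exp q - 1 - q) * (1 + D) + q * D + logError c L u +
          u * deriv (logError c L) u‖ ≤ C1 ^ 2 * (Rb * Q) * (1 + C2) + C1 * C2 * Q +
          Λ * Rb * (Rb * Q) + Rb * (16 * Λ * Rb * Q) := by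
      refine (norm_add_le _ _).trans (add_le_add ((norm_add_le _ _).trans
        (add_le_add ((norm_add_le _ _).trans (add_le_add g1 g2)) g3)) g4)
    have hQc : c * s / (x * y ^ 2) = Q := by rw [hQ, hcs]; ring
    rw [hQc]
    have e2 : C1 ^ 2 * (Rb * Q) * (1 + C2) + C1 * C2 * Q + Λ * Rb * (Rb * Q) +
        Rb * (16 * Λ * Rb * Q) = (C1 ^ 2 * Rb * (1 + C2) + C1 * C2 + Λ * Rb * Rb +
        16 * Λ * Rb ^ 2) * Q := by ring
    refine hfin.trans (e2.le.trans (mul_le_mul_of_nonneg_right ?_ hQ0))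
    linarith

end

/-! ### Univalent maps of the exterior disk and the cluster maps -/

/-- `F` is a univalent map of `{|z| > 1}` into itself with `F z / z → a` at infinity. -/
structure IsExteriorMap (F : ℂ → ℂ) (a : ℝ) : Prop where
  differentiableOn : DifferentiableOn ℂ F exteriorDisk
  mapsTo : Set.MapsTo F exteriorDisk exteriorDisk
  injOn : Set.InjOn F exteriorDisk
  tendsto_div : Tendsto (fun z => F z / z) (Bornology.cobounded ℂ) (𝓝 (a : ℂ))

lemma IsExteriorMap.tendsto_cobounded {F : ℂ → ℂ} {a : ℝ} (hF : IsExteriorMap F a) (ha : 0 < a) :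
    Tendsto F (Bornology.cobounded ℂ) (Bornology.cobounded ℂ) := by
  rw [← tendsto_norm_atTop_iff_cobounded]
  have h1 := hF.tendsto_div.norm
  have h2 : 0 < ‖(a : ℂ)‖ := by simpa using ha.ne'
  refine (h1.pos_mul_atTop h2 tendsto_norm_cobounded_atTop).congr' ?_
  filter_upwards [eventually_cobounded_lt_norm 0] with z hz
  rw [norm_div, div_mul_cancel₀ _ hz.ne']

lemma IsExteriorMap.comp {F G : ℂ → ℂ} {a b : ℝ} (hF : IsExteriorMap F a) (hG : IsExteriorMap G b)
    (hb : 0 < b) : IsExteriorMap (fun z => F (G z)) (a * b) where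
  differentiableOn := hF.differentiableOn.comp hG.differentiableOn hG.mapsTo
  mapsTo := hF.mapsTo.comp hG.mapsTo
  injOn := hF.injOn.comp hG.injOn hG.mapsTo
  tendsto_div := by
    have h1 := (hF.tendsto_div.comp (hG.tendsto_cobounded hb)).mul hG.tendsto_div
    rw [← Complex.ofReal_mul] at h1
    refine h1.congr' ?_
    filter_upwards [eventually_cobounded_lt_norm 1] with z hz
    have h2 : G z ≠ 0 := norm_pos_iff.1 (one_pos.trans (hG.mapsTo hz))
    simp only [Function.comp_apply]
    rw [div_mul_div_cancel₀ h2]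

lemma IsBasicMap.isExteriorMap {F : ℂ → ℂ} {c : ℝ} (hF : IsBasicMap F c) :
    IsExteriorMap F (Real.exp c) :=
  ⟨hF.differentiableOn, hF.mapsTo, hF.injOn, hF.tendsto_div⟩

lemma norm_exp_neg_mul_I (t : ℝ) : ‖Complex.exp (-(t * Complex.I))‖ = 1 := by
  have := Complex.norm_exp_ofReal_mul_I (-t)
  rwa [Complex.ofReal_neg, neg_mul] at this

lemma isExteriorMap_mul {a : ℂ} (ha : ‖a‖ = 1) {F : ℂ → ℂ} {b : ℝ} (hF : IsExteriorMap F b) :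
    IsExteriorMap (fun z => a⁻¹ * F (a * z)) b := by
  have ha0 : a ≠ 0 := norm_pos_iff.1 (by rw [ha]; exact one_pos)
  have hmaps : Set.MapsTo (fun z : ℂ => a * z) exteriorDisk exteriorDisk := fun z hz => by
    rw [mem_exteriorDisk, norm_mul, ha, one_mul]; exact hz
  refine ⟨?_, ?_, ?_, ?_⟩
  · exact (hF.differentiableOn.comp (differentiableOn_id.const_mul a) hmaps).const_mul _
  · intro z hz
    have := hF.mapsTo (hmaps hz)
    rw [mem_exteriorDisk] at this ⊢
    rwa [norm_mul, norm_inv, ha, inv_one, one_mul]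
  · intro z hz w hw h
    have := hF.injOn (hmaps hz) (hmaps hw) (mul_left_cancel₀ (inv_ne_zero ha0) h)
    exact mul_left_cancel₀ ha0 this
  · have h1 : Tendsto (fun z : ℂ => a * z) (Bornology.cobounded ℂ) (Bornology.cobounded ℂ) := by
      rw [← tendsto_norm_atTop_iff_cobounded]
      simpa [norm_mul, ha] using tendsto_norm_cobounded_atTop (E := ℂ)
    refine (hF.tendsto_div.comp h1).congr fun z => ?_
    simp only [Function.comp_apply]
    rw [div_mul_eq_div_div]
    ring

lemma isExteriorMap_rotatedMap {F : ℂ → ℂ} {a : ℝ} (hF : IsExteriorMap F a) (t : ℝ) :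
    IsExteriorMap (rotatedMap F t) a := by
  have h := isExteriorMap_mul (norm_exp_neg_mul_I t) hF
  rw [← Complex.exp_neg, neg_neg] at h
  exact h

lemma isExteriorMap_clusterMap {F : ℂ → ℂ} {c : ℝ} (hF : IsBasicMap F c) (θ : ℕ → ℝ) (n : ℕ) :
    IsExteriorMap (clusterMap F θ n) (Real.exp (c * n)) := by
  induction n with
  | zero =>
    refine ⟨differentiableOn_id, fun z hz => hz, fun z _ w _ h => h, ?_⟩
    simp only [Nat.cast_zero, mul_zero, Real.exp_zero, Complex.ofReal_one]
    refine tendsto_const_nhds.congr' ?_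
    filter_upwards [eventually_cobounded_lt_norm 0] with z hz
    simp only [clusterMap]
    rw [div_self (norm_pos_iff.1 hz)]
  | succ n ih =>
    have h := ih.comp (isExteriorMap_rotatedMap hF.isExteriorMap (θ (n + 1))) (Real.exp_pos c)
    rw [← Real.exp_add] at h
    have e : c * (n : ℝ) + c = c * ((n + 1 : ℕ) : ℝ) := by push_cast; ring
    rw [e] at h
    exact h

lemma norm_exp_neg_mul (t : ℝ) (z : ℂ) : ‖Complex.exp (-(t * Complex.I)) * z‖ = ‖z‖ := by
  rw [norm_mul, norm_exp_neg_mul_I, one_mul]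

lemma rotatedMap_eq (F : ℂ → ℂ) (t : ℝ) {z : ℂ} (hz : z ≠ 0) :
    rotatedMap F t z = z * (F (Complex.exp (-(t * Complex.I)) * z) /
      (Complex.exp (-(t * Complex.I)) * z)) := by
  have h := Complex.exp_ne_zero (-(t * Complex.I))
  have h2 : Complex.exp (t * Complex.I) = (Complex.exp (-(t * Complex.I)))⁻¹ := by
    rw [← Complex.exp_neg, neg_neg]
  rw [rotatedMap, h2]
  field_simp

/-- One step of the differentiated fluctuation: if `ψ` is the differentiated fluctuation of `Φ`,
then `updateMap F c ψ z (e ^ (-i t) z)` is that of `Φ ∘ F_t` at `z`. -/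
noncomputable def updateMap (F : ℂ → ℂ) (c : ℝ) (ψ : ℂ → ℂ) (z u : ℂ) : ℂ :=
  z * ((Real.exp (-c) : ℂ) * deriv F u - 1) +
    (Real.exp (-c) : ℂ) * (u * deriv F u / F u) * ψ (z * (F u / u))

lemma deriv_fluctuation {F : ℂ → ℂ} {c : ℝ} (hF : IsBasicMap F c) (θ : ℕ → ℝ) (n : ℕ) {z : ℂ}
    (hz : 1 < ‖z‖) : deriv (fluctuation F c θ n) z =
      (Real.exp (-(c * n)) : ℂ) * deriv (clusterMap F θ n) z - 1 := by
  have hd := (isExteriorMap_clusterMap hF θ n).differentiableOn.differentiableAt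
    (exteriorDisk_mem_nhds hz)
  exact ((hd.hasDerivAt.const_mul _).sub (hasDerivAt_id z)).deriv

lemma deriv_rotatedMap {F : ℂ → ℂ} {c : ℝ} (hF : IsBasicMap F c) (t : ℝ) {z : ℂ} (hz : 1 < ‖z‖) :
    deriv (rotatedMap F t) z = deriv F (Complex.exp (-(t * Complex.I)) * z) := by
  have hu : 1 < ‖Complex.exp (-(t * Complex.I)) * z‖ := by rwa [norm_exp_neg_mul]
  have hd := hF.differentiableOn.differentiableAt (exteriorDisk_mem_nhds hu)
  have h1 : HasDerivAt (fun w => Complex.exp (-(t * Complex.I)) * w)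
      (Complex.exp (-(t * Complex.I))) z := by
    simpa using (hasDerivAt_id z).const_mul (Complex.exp (-(t * Complex.I)))
  have h2 : HasDerivAt (rotatedMap F t) _ z :=
    (hd.hasDerivAt.comp z h1).const_mul (Complex.exp (t * Complex.I))
  rw [h2.deriv]
  have : Complex.exp (t * Complex.I) * Complex.exp (-(t * Complex.I)) = 1 := by
    rw [← Complex.exp_add]; simp
  linear_combination (deriv F (Complex.exp (-(t * Complex.I)) * z)) * this

lemma diffFluctuation_zero {F : ℂ → ℂ} {c : ℝ} (θ : ℕ → ℝ) (z : ℂ) :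
    diffFluctuation F c θ 0 z = 0 := by
  have : fluctuation F c θ 0 = fun _ => 0 := by
    funext w
    simp [fluctuation, clusterMap]
  simp [diffFluctuation, this]

lemma diffFluctuation_succ {F : ℂ → ℂ} {c : ℝ} (hF : IsBasicMap F c) (θ : ℕ → ℝ) (n : ℕ) {z : ℂ}
    (hz : 1 < ‖z‖) : diffFluctuation F c θ (n + 1) z =
      updateMap F c (diffFluctuation F c θ n) z
        (Complex.exp (-(θ (n + 1) * Complex.I)) * z) := by
  have hz0 : z ≠ 0 := norm_pos_iff.1 (one_pos.trans hz)
  have hrot := isExteriorMap_rotatedMap hF.isExteriorMap (θ (n + 1))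
  have hw : 1 < ‖rotatedMap F (θ (n + 1)) z‖ := hrot.mapsTo hz
  have hd := ((isExteriorMap_clusterMap hF θ n).differentiableOn.differentiableAt
    (exteriorDisk_mem_nhds hw)).hasDerivAt
  have hd2 := (hrot.differentiableOn.differentiableAt (exteriorDisk_mem_nhds hz)).hasDerivAt
  have hcomp : deriv (clusterMap F θ (n + 1)) z = _ := (hd.comp z hd2).deriv
  rw [updateMap, ← rotatedMap_eq F _ hz0]
  simp only [diffFluctuation]
  rw [deriv_fluctuation hF θ _ hz, deriv_fluctuation hF θ _ hw, hcomp, deriv_rotatedMap hF _ hz]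
  have hu : 1 < ‖Complex.exp (-(θ (n + 1) * Complex.I)) * z‖ := by rwa [norm_exp_neg_mul]
  have hFu := hF.ne_zero hu
  have hu0 : Complex.exp (-(θ (n + 1) * Complex.I)) * z ≠ 0 :=
    norm_pos_iff.1 (one_pos.trans hu)
  have e : (Real.exp (-(c * (n + 1 : ℕ))) : ℂ) = Real.exp (-c) * Real.exp (-(c * n)) := by
    rw [← Complex.ofReal_mul, ← Real.exp_add]
    congr 2
    push_cast
    ring
  rw [e]
  generalize hwd : rotatedMap F (θ (n + 1)) z = w at *
  have hwu : w = z * (F (Complex.exp (-(θ (n + 1) * Complex.I)) * z) /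
      (Complex.exp (-(θ (n + 1) * Complex.I)) * z)) := by rw [← hwd, rotatedMap_eq F _ hz0]
  generalize hud : Complex.exp (-(θ (n + 1) * Complex.I)) * z = u at *
  rw [hwu]
  field_simp
  ring

lemma exists_tendsto_clusterMap_sub {F : ℂ → ℂ} {a : ℝ} (hF : IsExteriorMap F a) :
    ∃ l, Tendsto (fun z => F z - a * z) (Bornology.cobounded ℂ) (𝓝 l) := by
  have hd : DifferentiableOn ℂ (fun z => F z / z) exteriorDisk :=
    hF.differentiableOn.div differentiableOn_id fun z hz => norm_pos_iff.1 (one_pos.trans hz)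
  obtain ⟨l, hl⟩ := exists_tendsto_mul_sub hd hF.tendsto_div
  refine ⟨l, hl.congr' ?_⟩
  filter_upwards [eventually_cobounded_lt_norm 0] with z hz
  have hz0 : z ≠ 0 := norm_pos_iff.1 hz
  field_simp

lemma tendsto_diffFluctuation {F : ℂ → ℂ} {c : ℝ} (hF : IsBasicMap F c) (θ : ℕ → ℝ) (n : ℕ) :
    Tendsto (diffFluctuation F c θ n) (Bornology.cobounded ℂ) (𝓝 0) := by
  have h := isExteriorMap_clusterMap hF θ n
  obtain ⟨l, hl⟩ := exists_tendsto_clusterMap_sub h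
  have h2 : Tendsto (fluctuation F c θ n) (Bornology.cobounded ℂ)
      (𝓝 ((Real.exp (-(c * n)) : ℂ) * l)) := by
    refine (hl.const_mul (Real.exp (-(c * n)) : ℂ)).congr fun z => ?_
    have : (Real.exp (-(c * n)) : ℂ) * Real.exp (c * n) = 1 := by
      rw [← Complex.ofReal_mul, ← Real.exp_add]; simp
    rw [fluctuation, mul_sub]
    linear_combination -z * this
  refine tendsto_mul_deriv ?_ h2
  exact (h.differentiableOn.const_mul _).sub differentiableOn_id

lemma differentiableOn_diffFluctuation {F : ℂ → ℂ} {c : ℝ} (hF : IsBasicMap F c) (θ : ℕ → ℝ)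
    (n : ℕ) : DifferentiableOn ℂ (diffFluctuation F c θ n) exteriorDisk := by
  refine differentiableOn_id.mul (DifferentiableOn.deriv ?_ isOpen_exteriorDisk)
  exact ((isExteriorMap_clusterMap hF θ n).differentiableOn.const_mul _).sub differentiableOn_id

lemma regularAtInfty_diffFluctuation {F : ℂ → ℂ} {c : ℝ} (hF : IsBasicMap F c) (θ : ℕ → ℝ)
    (n : ℕ) : RegularAtInfty (diffFluctuation F c θ n) :=
  ⟨differentiableOn_diffFluctuation hF θ n, 0, tendsto_diffFluctuation hF θ n⟩

lemma regularAtInfty_mul_diffFluctuation {F : ℂ → ℂ} {c : ℝ} (hF : IsBasicMap F c) (θ : ℕ → ℝ)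
    (n : ℕ) : RegularAtInfty fun z => z * diffFluctuation F c θ n z := by
  refine ⟨differentiableOn_id.mul (differentiableOn_diffFluctuation hF θ n), ?_⟩
  simpa using exists_tendsto_mul_sub (differentiableOn_diffFluctuation hF θ n)
    (tendsto_diffFluctuation hF θ n)

/-! ### A deterministic bound from univalence -/

/-- A univalent map of the exterior disk which is bounded by `M` on a circle is bounded by `2 M`
inside it: by the open mapping theorem the outside of the circle already covers `{|w| > 2 M}`. -/
lemma IsExteriorMap.norm_le {Φ : ℂ → ℂ} {a R M : ℝ} (hΦ : IsExteriorMap Φ a) (ha : 0 < a)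
    (hR : 1 < R) (hM : 0 < M) (hb : ∀ z : ℂ, ‖z‖ = R → ‖Φ z‖ ≤ M) {z : ℂ} (hz : 1 < ‖z‖)
    (hzR : ‖z‖ ≤ R) : ‖Φ z‖ ≤ 2 * M := by
  have hne : ∀ w ∈ exteriorDisk, Φ w ≠ 0 := fun w hw =>
    norm_pos_iff.1 (one_pos.trans (hΦ.mapsTo hw))
  set g := Function.update (fun ζ : ℂ => (fun w => (Φ w)⁻¹) ζ⁻¹) 0 0 with hg
  have hgd : DifferentiableOn ℂ g (Metric.ball 0 1) :=
    differentiableOn_update_comp_inv (hΦ.differentiableOn.inv hne)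
      (tendsto_inv₀_cobounded.comp (hΦ.tendsto_cobounded ha))
  have hg0 : g 0 = 0 := Function.update_self _ _ _
  have hgne : ∀ ζ : ℂ, ζ ≠ 0 → g ζ = (Φ ζ⁻¹)⁻¹ := fun ζ hζ => Function.update_of_ne hζ _ _
  have hR0 : 0 < R := by linarith
  have hR1 : R⁻¹ < 1 := inv_lt_one_of_one_lt₀ hR
  have hsub : Metric.closedBall (0 : ℂ) R⁻¹ ⊆ Metric.ball 0 1 :=
    Metric.closedBall_subset_ball hR1
  by_contra! hcon
  have hzlt : ‖z‖ < R := by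
    refine lt_of_le_of_ne hzR fun h => ?_
    have := hb z h
    linarith
  have himg := DiffContOnCl.ball_subset_image_closedBall (f := g) (z₀ := 0) (ε := M⁻¹) (r := R⁻¹)
    (hgd.mono hsub |>.diffContOnCl_ball Set.Subset.rfl) (by positivity) (fun ζ hζ => by
      have hζn : ‖ζ‖ = R⁻¹ := by simpa using hζ
      have hζ0 : ζ ≠ 0 := norm_pos_iff.1 (by rw [hζn]; positivity)
      rw [hg0, sub_zero, hgne ζ hζ0, norm_inv]
      have h1 : ‖ζ⁻¹‖ = R := by rw [norm_inv, hζn, inv_inv]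
      have h2 : 0 < ‖Φ ζ⁻¹‖ := norm_pos_iff.2 (hne _ (by rw [mem_exteriorDisk, h1]; exact hR))
      exact inv_anti₀ h2 (hb _ h1))
    (by
      have h1 : ∀ᶠ ζ : ℂ in 𝓝[≠] 0, g ζ ≠ g 0 := by
        filter_upwards [self_mem_nhdsWithin,
          mem_nhdsWithin_of_mem_nhds (Metric.ball_mem_nhds (0 : ℂ) one_pos)] with ζ h0 h1
        rw [hg0, hgne ζ h0]
        refine inv_ne_zero (hne _ ?_)
        rw [mem_exteriorDisk, norm_inv]
        exact (one_lt_inv₀ (norm_pos_iff.2 h0)).2 (by simpa using h1)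
      exact h1.frequently.filter_mono nhdsWithin_le_nhds)
  have hmem : (Φ z)⁻¹ ∈ Metric.ball (g 0) (M⁻¹ / 2) := by
    rw [hg0, mem_ball_zero_iff, norm_inv, inv_lt_comm₀ (by linarith) (by positivity)]
    refine lt_of_eq_of_lt ?_ hcon
    field_simp
  obtain ⟨ζ, hζ, hζz⟩ := himg hmem
  have hζ0 : ζ ≠ 0 := by
    rintro rfl
    rw [hg0] at hζz
    exact inv_ne_zero (hne z hz) hζz.symm
  rw [hgne ζ hζ0, inv_inj] at hζz
  have hζR : R ≤ ‖ζ⁻¹‖ := by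
    rw [norm_inv, le_inv_comm₀ hR0 (norm_pos_iff.2 hζ0)]
    simpa using hζ
  have := hΦ.injOn (show ζ⁻¹ ∈ exteriorDisk from hR.trans_le hζR) hz hζz
  rw [this] at hζR
  linarith

/-- Away from the unit circle `log (F u / u)` is of order `c`, so that one attachment changes the
modulus by a factor `1 + O(c)` only. -/
lemma norm_logBranch_le {c Λ : ℝ} {L : ℂ → ℂ} (hc : 0 < c) (hc1 : c ≤ 1) (hΛ : 0 ≤ Λ)
    (hreg : ∀ z ∈ exteriorDisk, ‖L z - c * ((z + 1) / (z - 1))‖ ≤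
      Λ * c ^ (3 / 2 : ℝ) * ‖z‖ / (‖z - 1‖ * (‖z‖ - 1))) {u : ℂ} (hu : 2 ≤ ‖u‖) :
    ‖L u‖ ≤ (3 + 2 * Λ) * c := by
  have h1 : ‖u‖ - 1 ≤ ‖u - 1‖ := norm_sub_one_le_norm_sub_one u
  have hx : 0 < ‖u - 1‖ := by linarith
  have h2 := hreg u (by rw [mem_exteriorDisk]; linarith)
  have h3 : Λ * c ^ (3 / 2 : ℝ) * ‖u‖ / (‖u - 1‖ * (‖u‖ - 1)) ≤ 2 * Λ * c := by
    rw [rpow_three_halves hc.le, div_le_iff₀ (mul_pos hx (by linarith))]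
    have e1 : ‖u‖ ≤ 2 * (‖u - 1‖ * (‖u‖ - 1)) := by nlinarith
    have e2 : √c ≤ 1 := Real.sqrt_le_one.2 hc1
    have e3 : 0 ≤ √c := Real.sqrt_nonneg c
    calc Λ * (c * √c) * ‖u‖ ≤ Λ * (c * 1) * (2 * (‖u - 1‖ * (‖u‖ - 1))) := by gcongr
      _ = _ := by ring
  have h4 : ‖(c : ℂ) * ((u + 1) / (u - 1))‖ ≤ 3 * c := by
    rw [norm_mul, Complex.norm_real, Real.norm_eq_abs, abs_of_pos hc, norm_div, mul_comm]
    refine mul_le_mul_of_nonneg_right ?_ hc.le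
    rw [div_le_iff₀ hx]
    have : ‖u + 1‖ ≤ ‖u‖ + 1 := by simpa using norm_add_le u 1
    linarith
  have := norm_add_le (L u - c * ((u + 1) / (u - 1))) (c * ((u + 1) / (u - 1)))
  rw [sub_add_cancel] at this
  linarith

lemma norm_rotatedMap_eq {F L : ℂ → ℂ} {c : ℝ} (hL : IsLogBranch F c L) (t : ℝ) {z : ℂ}
    (hz : 1 < ‖z‖) :
    ‖rotatedMap F t z‖ = ‖z‖ * Real.exp (L (Complex.exp (-(t * Complex.I)) * z)).re := by
  have hz0 : z ≠ 0 := norm_pos_iff.1 (one_pos.trans hz)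
  rw [rotatedMap_eq F t hz0, ← hL.exp_eq _ (by rw [mem_exteriorDisk, norm_exp_neg_mul]; exact hz),
    norm_mul, Complex.norm_exp]

/-- On circles so large that the orbit of `z` stays in `{|u| ≥ 2}`, the growth of the cluster map is
at most exponential in `c n`. -/
lemma norm_clusterMap_le {F L : ℂ → ℂ} {c κ : ℝ} (hL : IsLogBranch F c L) (hc : 0 ≤ c) (hκ : 0 ≤ κ)
    (hbd : ∀ u : ℂ, 2 ≤ ‖u‖ → ‖L u‖ ≤ κ * c) (θ : ℕ → ℝ) (n : ℕ) :
    ∀ z : ℂ, 2 * Real.exp (κ * c * n) ≤ ‖z‖ →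
      ‖clusterMap F θ n z‖ ≤ ‖z‖ * Real.exp (κ * c * n) := by
  induction n with
  | zero => intro z _; simp [clusterMap]
  | succ n ih =>
    intro z hz
    have e1 : Real.exp (κ * c * (n + 1 : ℕ)) = Real.exp (κ * c * n) * Real.exp (κ * c) := by
      rw [← Real.exp_add]; congr 1; push_cast; ring
    have e2 : 1 ≤ Real.exp (κ * c * (n + 1 : ℕ)) := Real.one_le_exp (by positivity)
    have hz2 : 2 ≤ ‖z‖ := by linarith
    have hu := hbd (Complex.exp (-(θ (n + 1) * Complex.I)) * z) (by rwa [norm_exp_neg_mul])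
    have hre := abs_le.1 ((Complex.abs_re_le_norm _).trans hu)
    have hw := norm_rotatedMap_eq hL (θ (n + 1)) (z := z) (by linarith)
    have hw1 : ‖rotatedMap F (θ (n + 1)) z‖ ≤ ‖z‖ * Real.exp (κ * c) := by
      rw [hw]; gcongr; exact hre.2
    have hw2 : 2 * Real.exp (κ * c * n) ≤ ‖rotatedMap F (θ (n + 1)) z‖ := by
      rw [hw]
      have : Real.exp (-(κ * c)) ≤
          Real.exp (L (Complex.exp (-(θ (n + 1) * Complex.I)) * z)).re := by
        gcongr; exact hre.1
      calc 2 * Real.exp (κ * c * n)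
          = 2 * Real.exp (κ * c * (n + 1 : ℕ)) * Real.exp (-(κ * c)) := by
            have : Real.exp (κ * c) * Real.exp (-(κ * c)) = 1 := by
              rw [← Real.exp_add, add_neg_cancel, Real.exp_zero]
            rw [e1]
            linear_combination (-(2 * Real.exp (κ * c * n))) * this
        _ ≤ _ := by gcongr
    refine (ih _ hw2).trans ?_
    rw [e1]
    calc ‖rotatedMap F (θ (n + 1)) z‖ * Real.exp (κ * c * n)
        ≤ ‖z‖ * Real.exp (κ * c) * Real.exp (κ * c * n) := by gcongr
      _ = _ := by ring

/-- The deterministic bound `‖Ψ_n(z)‖ ≤ C / (|z| - 1)` for `n ≤ T / c` and `|z| ≤ 2`. -/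
lemma exists_norm_diffFluctuation_le (Λ T : ℝ) (hΛ : 0 ≤ Λ) (hT : 0 ≤ T) :
    ∃ C : ℝ, 1 ≤ C ∧ ∀ (c : ℝ) (F : ℂ → ℂ), c ≤ 1 → IsBasicMap F c → HasRegularity F c Λ →
      ∀ (θ : ℕ → ℝ) (n : ℕ), (n : ℝ) ≤ T / c → ∀ z : ℂ, 1 < ‖z‖ → ‖z‖ ≤ 2 →
        ‖diffFluctuation F c θ n z‖ ≤ C / (‖z‖ - 1) := by
  set κ := 3 + 2 * Λ with hκ
  have hκ0 : 0 ≤ κ := by positivity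
  set R := 4 * Real.exp (κ * T) with hR
  set M := R * Real.exp (κ * T) with hM
  have hR4 : 4 ≤ R := by
    have : 1 ≤ Real.exp (κ * T) := Real.one_le_exp (by positivity)
    linarith
  have hM0 : 0 < M := by positivity
  refine ⟨8 * M + 2, by linarith, ?_⟩
  intro c F hc1 hF hreg θ n hn z hz hz2
  obtain ⟨L, hL, hreg⟩ := hreg
  have hc := hF.capacity_pos
  have hcn : c * n ≤ T := by rw [le_div_iff₀ hc] at hn; linarith
  have hexp : Real.exp (κ * c * n) ≤ Real.exp (κ * T) := by
    rw [mul_assoc]; gcongr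
  have hΦ := isExteriorMap_clusterMap hF θ n
  have hb : ∀ w : ℂ, ‖w‖ = R → ‖clusterMap F θ n w‖ ≤ M := by
    intro w hw
    refine (norm_clusterMap_le hL hc.le hκ0
      (fun u hu => norm_logBranch_le hc hc1 hΛ hreg hu) θ n w ?_).trans ?_
    · rw [hw, hR]; nlinarith [Real.exp_pos (κ * T)]
    · rw [hw, hM]; gcongr
  set y := ‖z‖ - 1 with hy
  have hy0 : 0 < y := by linarith
  have hball : ∀ v ∈ Metric.closedBall z (y / 2), 1 < ‖v‖ ∧ ‖v‖ ≤ R := by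
    intro v hv
    rw [mem_closedBall_iff_norm] at hv
    have e1 : ‖z‖ - ‖v‖ ≤ ‖v - z‖ := by rw [norm_sub_rev]; exact norm_sub_norm_le z v
    have e2 := norm_sub_norm_le v z
    constructor <;> linarith
  have hder := Complex.norm_deriv_le_of_forall_mem_sphere_norm_le (c := z)
    (f := clusterMap F θ n) (C := 2 * M) (half_pos hy0)
    ((hΦ.differentiableOn.mono fun v hv => (hball v hv).1).diffContOnCl_ball Set.Subset.rfl)
    (fun v hv => hΦ.norm_le (Real.exp_pos _) (by linarith) hM0 hb
      (hball v (Metric.sphere_subset_closedBall hv)).1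
      (hball v (Metric.sphere_subset_closedBall hv)).2)
  rw [diffFluctuation, deriv_fluctuation hF θ n hz, norm_mul]
  have h1 : ‖(Real.exp (-(c * n)) : ℂ) * deriv (clusterMap F θ n) z - 1‖ ≤ 2 * M / (y / 2) + 1 := by
    refine (norm_sub_le _ _).trans (add_le_add ?_ (by simp))
    rw [norm_mul, Complex.norm_real, Real.norm_eq_abs, abs_of_pos (Real.exp_pos _)]
    have : Real.exp (-(c * n)) ≤ 1 := Real.exp_le_one_iff.2 (by
      have : 0 ≤ c * n := by positivity
      linarith)
    exact (mul_le_of_le_one_left (norm_nonneg _) this).trans hder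
  calc ‖z‖ * ‖(Real.exp (-(c * n)) : ℂ) * deriv (clusterMap F θ n) z - 1‖
      ≤ 2 * (2 * M / (y / 2) + 1) := by gcongr
    _ ≤ (8 * M + 2) / y := by
      rw [le_div_iff₀ hy0]
      field_simp
      nlinarith

/-! ### Means of the kernels `1 / |u - 1|` and `1 / |u - 1| ^ 2` -/

lemma norm_rotate_sub_one (t : ℝ) (z : ℂ) :
    ‖Complex.exp (-(t * Complex.I)) * z - 1‖ = ‖z - circleMap 0 1 t‖ := by
  have h : Complex.exp (-(t * Complex.I)) * circleMap 0 1 t = 1 := by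
    rw [circleMap_zero, Complex.ofReal_one, one_mul, ← Complex.exp_add, neg_add_cancel,
      Complex.exp_zero]
  rw [← h, ← mul_sub, norm_exp_neg_mul]

lemma sub_circleMap_one_ne_zero {z : ℂ} (hz : 1 < ‖z‖) (t : ℝ) : z - circleMap 0 1 t ≠ 0 := by
  intro h
  rw [sub_eq_zero] at h
  rw [h, norm_circleMap_zero_of_nonneg zero_le_one] at hz
  exact lt_irrefl _ hz

lemma integral_inv_norm_sub_sq {z : ℂ} (hz : 1 < ‖z‖) :
    ∫ t, 1 / ‖z - circleMap 0 1 t‖ ^ 2 ∂uniformAngle = 1 / (‖z‖ ^ 2 - 1) := by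
  have h := (regularAtInfty_const 1).integral_poisson (w := 2 * z) (ρ := 2) one_lt_two
    (by rw [norm_mul]; simp; linarith)
  simp only [mul_one] at h
  rw [integral_complex_ofReal] at h
  have h2 : ∀ t, (‖2 * z‖ ^ 2 - 2 ^ 2) / ‖2 * z - circleMap 0 2 t‖ ^ 2 =
      (‖z‖ ^ 2 - 1) * (1 / ‖z - circleMap 0 1 t‖ ^ 2) := by
    intro t
    have e : 2 * z - circleMap 0 2 t = 2 * (z - circleMap 0 1 t) := by
      simp only [circleMap_zero]; push_cast; ring
    rw [e, norm_mul, norm_mul]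
    have := norm_ne_zero_iff.2 (sub_circleMap_one_ne_zero hz t)
    simp only [Complex.norm_ofNat]
    field_simp
  simp only [h2] at h
  rw [integral_const_mul] at h
  have h3 : (‖z‖ ^ 2 - 1) * ∫ t, 1 / ‖z - circleMap 0 1 t‖ ^ 2 ∂uniformAngle = 1 := by
    exact_mod_cast h
  have h4 : 0 < ‖z‖ ^ 2 - 1 := by nlinarith
  rw [eq_div_iff h4.ne', mul_comm]
  exact h3

lemma le_norm_circleMap_sub_one {r x : ℝ} (hr : 1 ≤ r) (hx : |x| ≤ Real.pi) :
    (r - 1 + |x| / 2) / 2 ≤ ‖circleMap 0 r x - 1‖ := by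
  have h1 := norm_circleMap_sub_sq r 1 x
  rw [Complex.ofReal_one] at h1
  have h2 := Real.cos_le_one_sub_mul_cos_sq hx
  have hpi := Real.pi_lt_d2
  have hpi0 := Real.pi_pos
  have h3 : |x| ^ 2 / 8 ≤ 1 - Real.cos x := by
    have : 1 / 8 ≤ 2 / Real.pi ^ 2 := by
      rw [div_le_div_iff₀ (by norm_num) (by positivity)]
      nlinarith
    have := mul_le_mul_of_nonneg_right this (sq_nonneg |x|)
    rw [sq_abs] at this ⊢
    linarith
  refine abs_le_of_sq_le_sq' ?_ (norm_nonneg _) |>.2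
  rw [h1]
  nlinarith [sq_nonneg (r - 1 - |x| / 2), abs_nonneg x, mul_nonneg (sub_nonneg.2 hr) (sq_nonneg |x|)]

lemma integral_inv_norm_sub_le {z : ℂ} (hz : 1 < ‖z‖) :
    ∫ t, 1 / ‖z - circleMap 0 1 t‖ ∂uniformAngle ≤ 2 * Real.log (1 + 4 / (‖z‖ - 1)) := by
  set r := ‖z‖ with hr
  set y := r - 1 with hy
  have hy0 : 0 < y := by linarith
  have hpi := Real.pi_pos
  have h1 : ∀ t, 1 / ‖z - circleMap 0 1 t‖ = 1 / ‖circleMap 0 r (z.arg - t) - 1‖ := by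
    intro t
    have hz' : circleMap 0 r z.arg = z := by
      rw [circleMap_zero, hr, Complex.norm_mul_exp_arg_mul_I]
    have := norm_circleMap_sub_circleMap r 1 z.arg t
    rw [hz', Complex.ofReal_one] at this
    rw [this]
  simp only [h1]
  rw [integral_uniformAngle_sub_left (f := fun t => 1 / ‖circleMap 0 r t - 1‖)
    (fun t => by simp only [periodic_circleMap 0 r t]), integral_uniformAngle, smul_eq_mul]
  have hne : ∀ t, circleMap 0 r t - 1 ≠ 0 := fun t => by
    simpa using circleMap_ne_ofReal (ρ := 1) zero_le_one hz t
  have hle : ∀ t ∈ Set.Icc 0 (2 * Real.pi), 1 / ‖circleMap 0 r t - 1‖ ≤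
      2 * (y + t / 2)⁻¹ + 2 * (y + (2 * Real.pi - t) / 2)⁻¹ := by
    rintro t ⟨ht0, ht1⟩
    have p1 : 0 < y + t / 2 := by positivity
    have p2 : 0 < y + (2 * Real.pi - t) / 2 := by
      have : 0 ≤ 2 * Real.pi - t := by linarith
      positivity
    rcases le_total t Real.pi with h | h
    · have := le_norm_circleMap_sub_one (r := r) (x := t) (by linarith) (by rwa [abs_of_nonneg ht0])
      rw [abs_of_nonneg ht0] at this
      have h2 : 1 / ‖circleMap 0 r t - 1‖ ≤ 1 / ((y + t / 2) / 2) :=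
        one_div_le_one_div_of_le (by positivity) this
      have h3 : 1 / ((y + t / 2) / 2) = 2 * (y + t / 2)⁻¹ := by field_simp
      have : 0 < 2 * (y + (2 * Real.pi - t) / 2)⁻¹ := by positivity
      linarith
    · have habs : |t - 2 * Real.pi| = 2 * Real.pi - t := by
        rw [abs_of_nonpos (by linarith)]; ring
      have := le_norm_circleMap_sub_one (r := r) (x := t - 2 * Real.pi) (by linarith)
        (by rw [habs]; linarith)
      rw [habs, (periodic_circleMap 0 r).sub_eq] at this
      have h2 : 1 / ‖circleMap 0 r t - 1‖ ≤ 1 / ((y + (2 * Real.pi - t) / 2) / 2) :=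
        one_div_le_one_div_of_le (by positivity) this
      have h3 : 1 / ((y + (2 * Real.pi - t) / 2) / 2) = 2 * (y + (2 * Real.pi - t) / 2)⁻¹ := by
        field_simp
      have : 0 < 2 * (y + t / 2)⁻¹ := by positivity
      linarith
  have hcont : Continuous fun t => 1 / ‖circleMap 0 r t - 1‖ := by
    have := continuous_circleMap 0 r
    exact continuous_const.div (by fun_prop) fun t => norm_ne_zero_iff.2 (hne t)
  have hder1 : ∀ t ∈ Set.uIcc 0 (2 * Real.pi), HasDerivAt
      (fun t => 4 * Real.log (y + t / 2) - 4 * Real.log (y + (2 * Real.pi - t) / 2))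
      (2 * (y + t / 2)⁻¹ + 2 * (y + (2 * Real.pi - t) / 2)⁻¹) t := by
    intro t ht
    rw [Set.uIcc_of_le (by positivity)] at ht
    have p1 : 0 < y + t / 2 := by linarith [ht.1]
    have p2 : 0 < y + (2 * Real.pi - t) / 2 := by linarith [ht.2]
    have d1 : HasDerivAt (fun t : ℝ => y + t / 2) (1 / 2) t :=
      ((hasDerivAt_id t).div_const 2).const_add y
    have d2 : HasDerivAt (fun t : ℝ => y + (2 * Real.pi - t) / 2) (-1 / 2) t := by
      simpa using (((hasDerivAt_id t).const_sub (2 * Real.pi)).div_const 2).const_add y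
    refine (((d1.log p1.ne').const_mul 4).sub ((d2.log p2.ne').const_mul 4)).congr_deriv ?_
    field_simp
    ring
  have hint : IntervalIntegrable
      (fun t => 2 * (y + t / 2)⁻¹ + 2 * (y + (2 * Real.pi - t) / 2)⁻¹) volume 0 (2 * Real.pi) := by
    apply ContinuousOn.intervalIntegrable
    rw [Set.uIcc_of_le (by positivity)]
    intro t ht
    have p1 : y + t / 2 ≠ 0 := by linarith [ht.1]
    have p2 : y + (2 * Real.pi - t) / 2 ≠ 0 := by linarith [ht.2]
    apply ContinuousAt.continuousWithinAt
    have c1 : ContinuousAt (fun t : ℝ => (y + t / 2)⁻¹) t := ContinuousAt.inv₀ (by fun_prop) p1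
    have c2 : ContinuousAt (fun t : ℝ => (y + (2 * Real.pi - t) / 2)⁻¹) t :=
      ContinuousAt.inv₀ (by fun_prop) p2
    fun_prop
  have hI : ∫ t in (0 : ℝ)..(2 * Real.pi), 1 / ‖circleMap 0 r t - 1‖ ≤
      8 * Real.log (1 + Real.pi / y) := by
    refine (intervalIntegral.integral_mono_on (by positivity) (hcont.intervalIntegrable _ _) hint
      hle).trans (le_of_eq ?_)
    rw [intervalIntegral.integral_eq_sub_of_hasDerivAt hder1 hint]
    have e1 : 1 + Real.pi / y = (y + Real.pi) / y := by field_simp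
    rw [e1, Real.log_div (by positivity) hy0.ne']
    simp only [sub_self, zero_div, add_zero, sub_zero]
    rw [show 2 * Real.pi / 2 = Real.pi by ring]
    ring
  have hlog0 : 0 ≤ Real.log (1 + Real.pi / y) := Real.log_nonneg (by
    have : 0 ≤ Real.pi / y := by positivity
    linarith)
  have hlog : Real.log (1 + Real.pi / y) ≤ Real.log (1 + 4 / y) := by
    apply Real.log_le_log (by positivity)
    have := Real.pi_le_four
    gcongr
  calc (2 * Real.pi)⁻¹ * ∫ t in (0 : ℝ)..(2 * Real.pi), 1 / ‖circleMap 0 r t - 1‖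
      ≤ (2 * Real.pi)⁻¹ * (8 * Real.log (1 + Real.pi / y)) := by gcongr
    _ = 4 / Real.pi * Real.log (1 + Real.pi / y) := by field_simp; ring
    _ ≤ 2 * Real.log (1 + Real.pi / y) := by
      refine mul_le_mul_of_nonneg_right ?_ hlog0
      rw [div_le_iff₀ hpi]
      linarith [Real.pi_gt_three]
    _ ≤ _ := by gcongr

/-- The mean of `1 / |u - 1|` is of logarithmic size. -/
lemma integral_inv_norm_sub_le_log {z : ℂ} {c : ℝ} (hc : 0 < c) (hc1 : c ≤ 1)
    (hz : √c ≤ ‖z‖ - 1) :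
    ∫ t, 1 / ‖z - circleMap 0 1 t‖ ∂uniformAngle ≤ 4 * (1 - Real.log c) := by
  have hs : 0 < √c := Real.sqrt_pos.2 hc
  have hs1 : √c ≤ 1 := Real.sqrt_le_one.2 hc1
  refine (integral_inv_norm_sub_le (by linarith)).trans ?_
  have h1 : 1 + 4 / (‖z‖ - 1) ≤ 5 / √c := by
    have : 4 / (‖z‖ - 1) ≤ 4 / √c := by gcongr
    have h2 : 1 ≤ 1 / √c := by rw [le_div_iff₀ hs]; linarith
    calc 1 + 4 / (‖z‖ - 1) ≤ 1 / √c + 4 / √c := add_le_add h2 this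
      _ = 5 / √c := by ring
  have h3 : 0 < 4 / (‖z‖ - 1) := by
    have : 0 < ‖z‖ - 1 := by linarith
    positivity
  have h2 := Real.log_le_log (by linarith) h1
  rw [Real.log_div (by norm_num) hs.ne', Real.log_sqrt hc.le] at h2
  have h5 : Real.log 5 ≤ 2 := by
    rw [Real.log_le_iff_le_exp (by norm_num)]
    have := Real.exp_one_gt_d9
    have e : Real.exp 2 = Real.exp 1 * Real.exp 1 := by rw [← Real.exp_add]; norm_num
    rw [e]
    nlinarith
  have h6 : Real.log c ≤ 0 := Real.log_nonpos hc.le hc1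
  linarith

/-! ### One step of the process at a fixed angle -/

lemma exp_sub_one_le_two_mul {c : ℝ} (hc : 0 ≤ c) (hc1 : c ≤ 1) : Real.exp c - 1 ≤ 2 * c := by
  have := Real.abs_exp_sub_one_le (x := c) (by rwa [abs_of_nonneg hc])
  rw [abs_of_nonneg hc] at this
  exact (le_abs_self _).trans this

/-- The inner radius at which `z F(u) / u` is guaranteed to stay in the exterior disk is about
half way between `1` and `|z|`. -/
lemma one_lt_norm_mul_div {F L : ℂ → ℂ} {c Λ Rb : ℝ} (hc : 0 < c) (hΛ : 0 ≤ Λ)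
    (hRb : 1 ≤ Rb) (hL : IsLogBranch F c L) (hreg : ∀ z ∈ exteriorDisk,
      ‖L z - c * ((z + 1) / (z - 1))‖ ≤ Λ * c ^ (3 / 2 : ℝ) * ‖z‖ / (‖z - 1‖ * (‖z‖ - 1)))
    {k : ℝ} (hk1 : 1 ≤ k) (hk : 2 * Λ * (Rb + 2) * Rb < k) {z u : ℂ} (hz : ‖z‖ ≤ Rb)
    (hkz : k * √c ≤ ‖z‖ - 1) (hu : 1 + (‖z‖ - 1) / 2 < ‖u‖) : 1 < ‖z * (F u / u)‖ := by
  have hs : 0 < √c := Real.sqrt_pos.2 hc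
  have hss : √c * √c = c := Real.mul_self_sqrt hc.le
  set y := ‖z‖ - 1 with hy
  have hy0 : 0 < y := lt_of_lt_of_le (by positivity) hkz
  have hu1 : 1 < ‖u‖ := by linarith
  have hd : ‖u‖ - 1 ≤ ‖u - 1‖ := norm_sub_one_le_norm_sub_one u
  have hd0 : 0 < ‖u - 1‖ := by linarith
  have h1 := hreg u hu1
  rw [rpow_three_halves hc.le] at h1
  have hre : 0 ≤ ((u + 1) / (u - 1)).re := by
    have hne : u - 1 ≠ 0 := norm_pos_iff.1 hd0
    rw [Complex.div_re, ← add_div]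
    refine div_nonneg ?_ (Complex.normSq_nonneg _)
    have : 1 < ‖u‖ ^ 2 := by nlinarith
    rw [← Complex.normSq_eq_norm_sq, Complex.normSq_apply] at this
    simp
    nlinarith
  set X := Λ * (c * √c) * (2 * (Rb + 2) / y ^ 2) with hX
  have h2 : Λ * (c * √c) * ‖u‖ / (‖u - 1‖ * (‖u‖ - 1)) ≤ X := by
    have hp : 0 < ‖u‖ - 1 := by linarith
    have e1 : ‖u‖ / (‖u - 1‖ * (‖u‖ - 1)) ≤ ‖u‖ / ((‖u‖ - 1) * (‖u‖ - 1)) := by gcongr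
    have e2 : ‖u‖ / ((‖u‖ - 1) * (‖u‖ - 1)) ≤ 2 * (Rb + 2) / y ^ 2 := by
      rw [div_le_div_iff₀ (by positivity) (by positivity)]
      have e3 : y / 2 < ‖u‖ - 1 := by linarith
      have e4 : y ≤ Rb := by linarith
      set s := ‖u‖ - 1 with hs'
      have : ‖u‖ = s + 1 := by rw [hs']; ring
      rw [this]
      have a1 : y * y ≤ 4 * (s * s) := by nlinarith
      have a2 : s * (y * y) ≤ 2 * y * (s * s) := by
        have : y * (s * y) ≤ y * (s * (2 * s)) := by gcongr; linarith
        linarith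
      have a3 : y * (s * s) ≤ Rb * (s * s) := by gcongr
      nlinarith
    have e5 : Λ * (c * √c) * (‖u‖ / (‖u - 1‖ * (‖u‖ - 1))) ≤ X := by
      rw [hX]
      exact mul_le_mul_of_nonneg_left (e1.trans e2) (by positivity)
    rwa [← mul_div_assoc] at e5
  have h3 : -X ≤ (L u).re := by
    have a1 := (Complex.abs_re_le_norm (L u - c * ((u + 1) / (u - 1)))).trans (h1.trans h2)
    rw [Complex.sub_re, Complex.re_ofReal_mul] at a1
    have := (abs_le.1 a1).1
    have : 0 ≤ c * ((u + 1) / (u - 1)).re := by positivity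
    linarith
  have hXlt : X < y / (1 + y) := by
    have hy3 : k * (c * √c) ≤ y ^ 3 := by
      have a1 : (k * √c) ^ 3 ≤ y ^ 3 := by gcongr
      have a2 : k ≤ k ^ 3 := by
        have : 1 ≤ k ^ 2 := one_le_pow₀ hk1
        nlinarith
      calc k * (c * √c) ≤ k ^ 3 * (c * √c) := by gcongr
        _ = (k * √c) ^ 3 := by linear_combination (-(k ^ 3 * √c)) * hss
        _ ≤ _ := a1
    rw [hX, ← mul_div_assoc, div_lt_div_iff₀ (by positivity) (by positivity)]
    have a3 : 1 + y ≤ Rb := by linarith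
    have a5 : 0 < c * √c := by positivity
    calc Λ * (c * √c) * (2 * (Rb + 2)) * (1 + y) ≤ Λ * (c * √c) * (2 * (Rb + 2)) * Rb := by gcongr
      _ = 2 * Λ * (Rb + 2) * Rb * (c * √c) := by ring
      _ < k * (c * √c) := by gcongr
      _ ≤ y ^ 3 := hy3
      _ = y * y ^ 2 := by ring
  have h4 : ‖F u / u‖ = Real.exp (L u).re := by
    rw [← hL.exp_eq u hu1, Complex.norm_exp]
  rw [norm_mul, h4]
  have h5 : 1 - X ≤ Real.exp (L u).re := by
    have := Real.add_one_le_exp (L u).re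
    linarith
  have h6 : 1 - y / (1 + y) = 1 / (1 + y) := by field_simp; ring
  have hz' : ‖z‖ = 1 + y := by rw [hy]; ring
  rw [hz']
  calc 1 = (1 + y) * (1 / (1 + y)) := by field_simp
    _ < (1 + y) * Real.exp (L u).re := by gcongr; linarith

lemma tendsto_deriv_basicMap {F : ℂ → ℂ} {c : ℝ} (hF : IsBasicMap F c) :
    Tendsto (deriv F) (Bornology.cobounded ℂ) (𝓝 (Real.exp c : ℂ)) := by
  obtain ⟨l, hl⟩ := exists_tendsto_clusterMap_sub hF.isExteriorMap
  have hd : DifferentiableOn ℂ (fun z => F z - Real.exp c * z) exteriorDisk :=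
    hF.differentiableOn.sub (differentiableOn_id.const_mul _)
  have h1 := (tendsto_mul_deriv hd hl).mul tendsto_inv₀_cobounded
  have h2 := h1.add_const (Real.exp c : ℂ)
  rw [mul_zero, zero_add] at h2
  refine h2.congr' ?_
  filter_upwards [eventually_cobounded_lt_norm 1] with u hu
  have hu0 : u ≠ 0 := norm_pos_iff.1 (one_pos.trans hu)
  have h3 : HasDerivAt (fun z => F z - Real.exp c * z) (deriv F u - Real.exp c * 1) u :=
    ((hF.differentiableOn.differentiableAt (exteriorDisk_mem_nhds hu)).hasDerivAt).sub
      ((hasDerivAt_id u).const_mul (Real.exp c : ℂ))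
  rw [h3.deriv]
  field_simp
  ring

/-- If the attachment angle were uniform, one step would act on average by `ψ ↦ e^{-c} ψ(e^c z)`. -/
lemma integral_updateMap {F ψ : ℂ → ℂ} {c : ℝ} (hF : IsBasicMap F c) (hψ : RegularAtInfty ψ)
    {z : ℂ} (hz : 1 < ‖z‖) (hin : ∀ u : ℂ, 1 + (‖z‖ - 1) / 2 < ‖u‖ → 1 < ‖z * (F u / u)‖) :
    ∫ t : ℝ, updateMap F c ψ z (Complex.exp (-(t * Complex.I)) * z) ∂uniformAngle =
      (Real.exp (-c) : ℂ) * ψ (Real.exp c * z) := by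
  set S : Set ℂ := {u | 1 + (‖z‖ - 1) / 2 < ‖u‖} with hS
  have hSsub : S ⊆ exteriorDisk := fun u hu => by
    rw [hS, Set.mem_ofPred_eq] at hu
    rw [mem_exteriorDisk]; linarith
  have hne : ∀ u ∈ S, u ≠ 0 := fun u hu => norm_pos_iff.1 (one_pos.trans (hSsub hu))
  have hdF := hF.differentiableOn.mono hSsub
  have hdF' := (hF.differentiableOn.deriv isOpen_exteriorDisk).mono hSsub
  refine integral_rotate_of_tendsto (ρ := 1 + (‖z‖ - 1) / 2) (by linarith) (by linarith) ?_ ?_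
  · change DifferentiableOn ℂ (updateMap F c ψ z) S
    have h1 : DifferentiableOn ℂ (fun u => z * (F u / u)) S :=
      (hdF.div differentiableOn_id hne).const_mul z
    have h2 : DifferentiableOn ℂ (fun u => ψ (z * (F u / u))) S :=
      hψ.differentiableOn.comp h1 fun u hu => hin u hu
    exact (((hdF'.const_mul _).sub_const _).const_mul z).add
      ((((differentiableOn_id.mul hdF').div hdF
        fun u hu => hF.ne_zero (hSsub hu)).const_mul _).mul h2)
  · have hlam := hF.tendsto_div
    have hder := tendsto_deriv_basicMap hF
    have he : (Real.exp c : ℂ) ≠ 0 := by exact_mod_cast (Real.exp_pos c).ne'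
    have hee : (Real.exp (-c) : ℂ) * Real.exp c = 1 := by
      rw [← Complex.ofReal_mul, ← Real.exp_add]; simp
    have hz1 : 1 < ‖(Real.exp c : ℂ) * z‖ := by
      rw [norm_mul, Complex.norm_real, Real.norm_of_nonneg (Real.exp_pos c).le]
      nlinarith [Real.one_le_exp hF.capacity_pos.le]
    have hψc : ContinuousAt ψ (z * Real.exp c) := by
      rw [mul_comm]; exact (hψ.differentiableAt hz1).continuousAt
    have t1 : Tendsto (fun u => ψ (z * (F u / u))) (Bornology.cobounded ℂ)
        (𝓝 (ψ (z * Real.exp c))) := hψc.tendsto.comp (hlam.const_mul z)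
    have t2 : Tendsto (fun u => deriv F u / (F u / u)) (Bornology.cobounded ℂ)
        (𝓝 ((Real.exp c : ℂ) / Real.exp c)) := hder.div hlam he
    have t3 := (((hder.const_mul (Real.exp (-c) : ℂ)).sub_const 1).const_mul z).add
      ((t2.const_mul (Real.exp (-c) : ℂ)).mul t1)
    rw [hee, sub_self, mul_zero, zero_add, div_self he, mul_one, mul_comm z] at t3
    refine t3.congr' ?_
    filter_upwards [eventually_cobounded_lt_norm 1] with u hu
    have hu0 : u ≠ 0 := norm_pos_iff.1 (one_pos.trans hu)
    have := hF.ne_zero hu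
    rw [updateMap]
    congr 2
    field_simp

/-- The mean of one step with uniform angle, and the size of the increments. -/
lemma exists_updateMap_bounds (Λ Rb : ℝ) (hΛ : 0 ≤ Λ) (hRb : 1 ≤ Rb) :
    ∃ C k : ℝ, 1 ≤ C ∧ 1 ≤ k ∧ ∀ (c : ℝ) (F : ℂ → ℂ), c ≤ 1 → IsBasicMap F c →
      HasRegularity F c Λ → ∀ ψ : ℂ → ℂ, RegularAtInfty ψ → ∀ (ρ : ℝ) (z : ℂ), 1 < ρ →
      ρ - 1 ≤ (‖z‖ - 1) / 2 → ‖z‖ ≤ Rb → k * √c ≤ ‖z‖ - 1 →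
      (∫ t : ℝ, updateMap F c ψ z (Complex.exp (-(t * Complex.I)) * z) ∂uniformAngle =
        (Real.exp (-c) : ℂ) * ψ (Real.exp c * z)) ∧
      (∀ u : ℂ, ‖u‖ = ‖z‖ → 1 < ‖z * (F u / u)‖) ∧
      ∀ u : ℂ, ‖u‖ = ‖z‖ →
        ‖updateMap F c ψ z u - (Real.exp (-c) : ℂ) * ψ (Real.exp c * z)‖ ≤
          C * (c / (‖u - 1‖ * (‖z‖ - 1)) * (1 + poissonMajorant ψ ρ z)) ∧
        ‖updateMap F c ψ z u - (Real.exp (-c) : ℂ) * ψ (Real.exp c * z) +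
            2 * c * z / (u - 1) ^ 2‖ ≤
          C * (c * √c / (‖u - 1‖ * (‖z‖ - 1) ^ 2) +
            c / (‖u - 1‖ * (‖z‖ - 1)) * poissonMajorant ψ ρ z) := by
  obtain ⟨C0, k0, hC0, hk0, H⟩ := exists_basicMap_bounds Λ Rb hΛ hRb
  refine ⟨82 * Rb * C0, k0 + (2 * Λ * (Rb + 2) * Rb + 1) + 8 * Rb * (C0 + 2 * Rb),
    one_le_mul_of_one_le_of_one_le (by linarith) hC0, ?_, ?_⟩
  · have : 0 ≤ 2 * Λ * (Rb + 2) * Rb := by positivity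
    have : 0 ≤ 8 * Rb * (C0 + 2 * Rb) := by positivity
    linarith
  intro c F hc1 hF ⟨L, hL, hreg⟩ ψ hψ ρ z hρ hρz hzR hkz
  have hc := hF.capacity_pos
  have hs : 0 < √c := Real.sqrt_pos.2 hc
  have hss : √c * √c = c := Real.mul_self_sqrt hc.le
  set y := ‖z‖ - 1 with hy
  set k := k0 + (2 * Λ * (Rb + 2) * Rb + 1) + 8 * Rb * (C0 + 2 * Rb) with hk
  have hp1 : 0 ≤ 2 * Λ * (Rb + 2) * Rb := by positivity
  have hp2 : 0 ≤ 8 * Rb * (C0 + 2 * Rb) := by positivity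
  have hy0 : 0 < y := by linarith
  have hz1 : 1 < ‖z‖ := by linarith
  have hin : ∀ u : ℂ, 1 + (‖z‖ - 1) / 2 < ‖u‖ → 1 < ‖z * (F u / u)‖ := fun u hu =>
    one_lt_norm_mul_div hc hΛ hRb hL hreg (k := k) (by linarith) (by linarith) hzR hkz hu
  refine ⟨integral_updateMap hF hψ hz1 hin, fun u hu => hin u (by linarith), fun u hu => ?_⟩
  have hk0y : k0 * √c ≤ ‖u‖ - 1 := by
    rw [hu]
    have : k0 * √c ≤ k * √c := by gcongr; linarith
    linarith
  obtain ⟨b1, b2, b3, b4⟩ := H c F L hc1 hF hL hreg u (by linarith) (by linarith) hk0y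
  rw [hu, ← hy] at b1 b2 b4
  have hx : y ≤ ‖u - 1‖ := by
    have := norm_sub_one_le_norm_sub_one u
    linarith
  set x := ‖u - 1‖ with hxd
  have hx0 : 0 < x := by linarith
  set M := poissonMajorant ψ ρ z with hM
  have hM0 : 0 ≤ M := poissonMajorant_nonneg ψ (by linarith) (by linarith)
  have hec := exp_sub_one_le_two_mul hc.le hc1
  have hec1 : 1 ≤ Real.exp c := Real.one_le_exp hc.le
  have hz0 : ‖z‖ ≤ Rb := hzR
  have hyR : y ≤ Rb := by linarith
  have hcy : 8 * Rb * (C0 + 2 * Rb) * c ≤ y * y := by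
    have a1 : 8 * Rb * (C0 + 2 * Rb) ≤ k := by linarith
    have a2 : k ≤ k * k := le_mul_of_one_le_right (by linarith) (by linarith)
    calc 8 * Rb * (C0 + 2 * Rb) * c ≤ k * k * c :=
          mul_le_mul_of_nonneg_right (a1.trans a2) hc.le
      _ = (k * √c) * (k * √c) := by linear_combination (-(k * k)) * hss
      _ ≤ y * y := by gcongr
  have hexp : ‖(Real.exp c : ℂ) - 1‖ ≤ 2 * c := by
    rw [← Complex.ofReal_one, ← Complex.ofReal_sub, Complex.norm_real,
      Real.norm_of_nonneg (by linarith)]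
    exact hec
  have hclose1 : ‖(Real.exp c : ℂ) * z - z‖ ≤ y / 8 := by
    have e : (Real.exp c : ℂ) * z - z = (Real.exp c - 1) * z := by ring
    rw [e, norm_mul]
    have a1 : ‖(Real.exp c : ℂ) - 1‖ * ‖z‖ ≤ 2 * c * Rb := by gcongr
    refine a1.trans ?_
    have a2 : 16 * Rb * Rb * c ≤ y * y := by
      have h1 : 0 ≤ 8 * Rb * C0 * c := by positivity
      have h2 : 8 * Rb * (C0 + 2 * Rb) * c = 8 * Rb * C0 * c + 16 * Rb * Rb * c := by ring
      linarith
    have a3 : y * (16 * Rb * c) ≤ Rb * (16 * Rb * c) := by gcongr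
    have a4 : 16 * Rb * c ≤ y :=
      le_of_mul_le_mul_right (by linarith : 16 * Rb * c * y ≤ y * y) hy0
    linarith
  have hclose2 : ‖z * (F u / u) - z‖ ≤ y / 8 := by
    have e : z * (F u / u) - z = z * ((F u / u - Real.exp c) + (Real.exp c - 1)) := by ring
    rw [e, norm_mul]
    have a1 : ‖F u / u - Real.exp c + (Real.exp c - 1)‖ ≤ C0 * (c / x) + 2 * c :=
      (norm_add_le _ _).trans (add_le_add b3 hexp)
    have a2 : C0 * (c / x) + 2 * c ≤ (C0 + 2 * Rb) * c / y := by
      have : C0 * (c / x) ≤ C0 * (c / y) := by gcongr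
      have h2 : 2 * c ≤ 2 * Rb * c / y := by
        rw [le_div_iff₀ hy0]
        have := mul_le_mul_of_nonneg_left hyR hc.le
        linarith
      calc C0 * (c / x) + 2 * c ≤ C0 * (c / y) + 2 * Rb * c / y := add_le_add this h2
        _ = _ := by ring
    calc ‖z‖ * ‖F u / u - Real.exp c + (Real.exp c - 1)‖ ≤ Rb * ((C0 + 2 * Rb) * c / y) := by
          gcongr
          exact a1.trans a2
      _ = 8 * Rb * (C0 + 2 * Rb) * c / (8 * y) := by field_simp
      _ ≤ y * y / (8 * y) := by gcongr
      _ = y / 8 := by field_simp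
  have hψ1 : ‖ψ (z * (F u / u))‖ ≤ 9 * M :=
    hψ.norm_le_poissonMajorant hρ hρz (by linarith)
  have hψ2 : ‖ψ (z * (F u / u)) - ψ (Real.exp c * z)‖ ≤ 72 * M / y * (Rb * (C0 * (c / x))) := by
    refine (hψ.norm_sub_le_poissonMajorant hρ hρz hclose2 hclose1).trans ?_
    rw [← hM, ← hy]
    have e : z * (F u / u) - Real.exp c * z = z * (F u / u - Real.exp c) := by ring
    rw [e, norm_mul]
    gcongr
  have hnc : ‖(Real.exp (-c) : ℂ)‖ ≤ 1 := by
    rw [Complex.norm_real, Real.norm_of_nonneg (Real.exp_pos _).le]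
    exact Real.exp_le_one_iff.2 (by linarith)
  set B := c / (x * y) with hB
  have hB0 : 0 < B := by positivity
  have hrest : ‖(Real.exp (-c) : ℂ) * ((u * deriv F u / F u - 1) * ψ (z * (F u / u)) +
      (ψ (z * (F u / u)) - ψ (Real.exp c * z)))‖ ≤ 81 * Rb * C0 * (B * M) := by
    rw [norm_mul]
    have a1 : ‖(u * deriv F u / F u - 1) * ψ (z * (F u / u))‖ ≤ C0 * B * (9 * M) := by
      rw [norm_mul]
      gcongr
    have a2 : 72 * M / y * (Rb * (C0 * (c / x))) = 72 * Rb * C0 * (B * M) := by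
      rw [hB]; field_simp
    have a3 : C0 * B * (9 * M) ≤ 9 * Rb * C0 * (B * M) := by
      have h1 : 0 ≤ C0 * (B * M) := by positivity
      have h2 := mul_le_mul_of_nonneg_right hRb h1
      linarith
    have a4 := norm_add_le ((u * deriv F u / F u - 1) * ψ (z * (F u / u)))
      (ψ (z * (F u / u)) - ψ (Real.exp c * z))
    have a5 : 0 ≤ 81 * Rb * C0 * (B * M) := by positivity
    calc _ ≤ 1 * (81 * Rb * C0 * (B * M)) := by
          gcongr
          linarith
      _ = _ := one_mul _
  have hdecomp : updateMap F c ψ z u - (Real.exp (-c) : ℂ) * ψ (Real.exp c * z) =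
      z * ((Real.exp (-c) : ℂ) * deriv F u - 1) +
      (Real.exp (-c) : ℂ) * ((u * deriv F u / F u - 1) * ψ (z * (F u / u)) +
        (ψ (z * (F u / u)) - ψ (Real.exp c * z))) := by
    rw [updateMap]; ring
  constructor
  · rw [hdecomp]
    refine (norm_add_le _ _).trans ?_
    have a1 : ‖z * ((Real.exp (-c) : ℂ) * deriv F u - 1)‖ ≤ Rb * (C0 * B) := by
      rw [norm_mul]; gcongr
    have : 0 ≤ Rb * C0 * (B * M) := by positivity
    have : 0 ≤ Rb * C0 * B := by positivity
    linarith
  · have e : updateMap F c ψ z u - (Real.exp (-c) : ℂ) * ψ (Real.exp c * z) +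
        2 * c * z / (u - 1) ^ 2 =
        z * ((Real.exp (-c) : ℂ) * deriv F u - 1 + 2 * c / (u - 1) ^ 2) +
      (Real.exp (-c) : ℂ) * ((u * deriv F u / F u - 1) * ψ (z * (F u / u)) +
        (ψ (z * (F u / u)) - ψ (Real.exp c * z))) := by
      rw [hdecomp]; ring
    rw [e]
    refine (norm_add_le _ _).trans ?_
    set D := c * √c / (x * y ^ 2) with hD
    have hD0 : 0 < D := by positivity
    have a1 : ‖z * ((Real.exp (-c) : ℂ) * deriv F u - 1 + 2 * c / (u - 1) ^ 2)‖ ≤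
        Rb * (C0 * D) := by
      rw [norm_mul]; gcongr
    have : 0 ≤ Rb * C0 * (B * M) := by positivity
    have : 0 ≤ Rb * C0 * D := by positivity
    linarith

/-! ### Conditional moments of one step -/

/-- The antiholomorphic part of the density does not contribute to the linear part of the drift. -/
lemma integral_conj_part_eq_zero {ψ : ℂ → ℂ} (hψ : RegularAtInfty ψ) {σ : ℝ} (hσ : 0 < σ) {z : ℂ}
    (hz : 1 < ‖z‖) :
    ∫ t, z / (Complex.exp (-((t : ℝ) * Complex.I)) * z - 1) ^ 2 *
      (starRingEnd ℂ) (ψ (circleMap 0 (Real.exp σ) t) / circleMap 0 (Real.exp σ) t)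
      ∂uniformAngle = 0 := by
  set R := Real.exp σ with hR
  have hR1 : 1 < R := Real.one_lt_exp_iff.2 hσ
  have hR0 : 0 < R := by linarith
  have hz0 : 0 < ‖z‖ := by linarith
  set zb := (starRingEnd ℂ) z with hzb
  have hzb0 : ‖zb‖ = ‖z‖ := Complex.norm_conj z
  set g : ℂ → ℂ := fun v => zb * R ^ 2 * (ψ v * (v⁻¹ * ((R - zb * v)⁻¹) ^ 2)) with hg
  set ρ := max 1 (R / ‖z‖) with hρ
  have hRz : R / ‖z‖ < R := by
    rw [div_lt_iff₀ hz0]; nlinarith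
  have hne : ∀ v : ℂ, ρ < ‖v‖ → (R : ℂ) - zb * v ≠ 0 := by
    intro v hv h
    have h1 : R / ‖z‖ < ‖v‖ := (le_max_right _ _).trans_lt hv
    rw [div_lt_iff₀ hz0] at h1
    have h2 : (R : ℂ) = zb * v := sub_eq_zero.1 h
    have h3 := congrArg norm h2
    rw [norm_mul, hzb0, Complex.norm_real, Real.norm_of_nonneg hR0.le] at h3
    linarith
  have hsub : {v : ℂ | ρ < ‖v‖} ⊆ exteriorDisk := fun v hv => by
    rw [Set.mem_ofPred_eq] at hv
    exact (le_max_left _ _).trans_lt hv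
  have key : ∫ t, g (circleMap 0 R t) ∂uniformAngle = 0 := by
    refine integral_circleMap_of_tendsto (ρ := ρ) (zero_le_one.trans (le_max_left _ _))
      (max_lt hR1 hRz) ?_ ?_
    · refine DifferentiableOn.const_mul ((hψ.differentiableOn.mono hsub).mul ?_) _
      refine DifferentiableOn.mul (differentiableOn_id.inv fun v hv =>
        norm_pos_iff.1 (one_pos.trans (hsub hv))) ?_
      exact (((differentiableOn_id.const_mul zb).const_sub (R : ℂ)).inv fun v hv => hne v hv).pow 2
    · obtain ⟨l, hl⟩ := hψ.exists_tendsto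
      have hzb' : zb ≠ 0 := norm_pos_iff.1 (by rw [hzb0]; exact hz0)
      have h1 : Tendsto (fun v : ℂ => ((R : ℂ) - zb * v)⁻¹) (Bornology.cobounded ℂ) (𝓝 0) := by
        have := (tendsto_sub_inv_cobounded ((R : ℂ) / zb)).const_mul (-(zb⁻¹))
        rw [mul_zero] at this
        refine this.congr fun v => ?_
        rw [neg_mul, ← mul_inv, ← inv_neg]
        congr 1
        field_simp
        ring
      have h2 := (hl.mul (tendsto_inv₀_cobounded.mul (h1.pow 2))).const_mul (zb * R ^ 2)
      rw [zero_mul, mul_zero, mul_zero] at h2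
      exact h2
  have hconj : ∀ t, z / (Complex.exp (-((t : ℝ) * Complex.I)) * z - 1) ^ 2 *
      (starRingEnd ℂ) (ψ (circleMap 0 R t) / circleMap 0 R t) =
      (starRingEnd ℂ) (g (circleMap 0 R t)) := by
    intro t
    have e1 : circleMap 0 R t = R * Complex.exp (t * Complex.I) := circleMap_zero _ _
    have e2 : (starRingEnd ℂ) (Complex.exp (t * Complex.I)) = Complex.exp (-(t * Complex.I)) := by
      rw [← Complex.exp_conj]; simp
    set x := Complex.exp (-((t : ℝ) * Complex.I)) with hx
    have e3 : (starRingEnd ℂ) (circleMap 0 R t) = R * x := by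
      rw [e1, map_mul, Complex.conj_ofReal, e2]
    have hx0 : x ≠ 0 := Complex.exp_ne_zero _
    have hR' : (R : ℂ) ≠ 0 := by exact_mod_cast hR0.ne'
    have hxz : x * z - 1 ≠ 0 := by
      intro h
      have h2 := congrArg norm (sub_eq_zero.1 h)
      rw [norm_exp_neg_mul, norm_one] at h2
      linarith
    have h3 : (R : ℂ) - z * (R * x) ≠ 0 := by
      have : (R : ℂ) - z * (R * x) = -(R * (x * z - 1)) := by ring
      rw [this]
      exact neg_ne_zero.2 (mul_ne_zero hR' hxz)
    simp only [hg, map_mul, map_div₀, map_inv₀, map_pow, map_sub, Complex.conj_ofReal, e3, hzb,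
      Complex.conj_conj]
    have h4 : (R : ℂ) - z * (R * x) = -(R * (x * z - 1)) := by ring
    rw [h4]
    field_simp
  simp only [hconj]
  rw [integral_conj, key, map_zero]

/-- The linear part of the drift of one step: the linear parts of the density and of the
increment combine to the derivative term of the drift operator. -/
lemma integral_linear_drift {ψ : ℂ → ℂ} (hψ : RegularAtInfty ψ) {c η σ : ℝ} (hσ : 0 < σ) {z : ℂ}
    (hz : 1 < ‖z‖) :
    ∫ t, 2 * c * z / (Complex.exp (-((t : ℝ) * Complex.I)) * z - 1) ^ 2 *
      ((η * (ψ (circleMap 0 (Real.exp σ) t) / circleMap 0 (Real.exp σ) t).re : ℝ) : ℂ)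
      ∂uniformAngle = driftOperator c η σ ψ z - (Real.exp (-c) : ℂ) * ψ (Real.exp c * z) := by
  set R := Real.exp σ with hR
  have hR1 : 1 < R := Real.one_lt_exp_iff.2 hσ
  have hR0 : 0 < R := by linarith
  have hw : R < ‖(R : ℂ) * z‖ := by
    rw [norm_mul, Complex.norm_real, Real.norm_of_nonneg hR0.le]
    nlinarith
  have k1 := hψ.integral_mul_div_sub_sq hR1 hw
  have k2 := integral_conj_part_eq_zero hψ hσ hz
  rw [← hR] at k2
  have hxz : ∀ t : ℝ, Complex.exp (-((t : ℝ) * Complex.I)) * z - 1 ≠ 0 := by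
    intro t h
    have h2 := congrArg norm (sub_eq_zero.1 h)
    rw [norm_exp_neg_mul, norm_one] at h2
    linarith
  have hcψ := hψ.continuous_comp_circleMap hR1
  have hcirc := continuous_circleMap 0 R
  have hv0 : ∀ t, circleMap 0 R t ≠ 0 := fun t => circleMap_ne_center hR0.ne'
  have hcx : Continuous fun t : ℝ => z / (Complex.exp (-((t : ℝ) * Complex.I)) * z - 1) ^ 2 :=
    continuous_const.div (by fun_prop) fun t => pow_ne_zero 2 (hxz t)
  have c2 : Continuous fun t : ℝ => z / (Complex.exp (-((t : ℝ) * Complex.I)) * z - 1) ^ 2 *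
      (starRingEnd ℂ) (ψ (circleMap 0 R t) / circleMap 0 R t) :=
    hcx.mul (Complex.continuous_conj.comp (hcψ.div hcirc hv0))
  have hvw : ∀ t, circleMap 0 R t - R * z ≠ 0 := by
    intro t h
    rw [sub_eq_zero] at h
    rw [← h, norm_circleMap_zero_of_nonneg hR0.le] at hw
    exact lt_irrefl _ hw
  have c1 : Continuous fun t : ℝ => ψ (circleMap 0 R t) *
      (circleMap 0 R t * (R * z) / (circleMap 0 R t - R * z) ^ 2) :=
    hcψ.mul ((hcirc.mul continuous_const).div (by fun_prop) fun t => pow_ne_zero 2 (hvw t))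
  have hsplit : ∀ t : ℝ, 2 * c * z / (Complex.exp (-((t : ℝ) * Complex.I)) * z - 1) ^ 2 *
      ((η * (ψ (circleMap 0 R t) / circleMap 0 R t).re : ℝ) : ℂ) =
      (c * η / R) * (ψ (circleMap 0 R t) *
        (circleMap 0 R t * (R * z) / (circleMap 0 R t - R * z) ^ 2)) +
      (c * η) * (z / (Complex.exp (-((t : ℝ) * Complex.I)) * z - 1) ^ 2 *
      (starRingEnd ℂ) (ψ (circleMap 0 R t) / circleMap 0 R t)) := by
    intro t
    have hR' : (R : ℂ) ≠ 0 := by exact_mod_cast hR0.ne'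
    obtain ⟨q, hq⟩ : ∃ q, q = ψ (circleMap 0 R t) / circleMap 0 R t := ⟨_, rfl⟩
    have e0 : ψ (circleMap 0 R t) = q * circleMap 0 R t := by
      rw [hq, div_mul_cancel₀ _ (hv0 t)]
    have e1 : (2 : ℂ) * (q.re : ℂ) = q + (starRingEnd ℂ) q := by
      rw [Complex.add_conj]; push_cast; ring
    have e2 : circleMap 0 R t - R * z =
        -(circleMap 0 R t * (Complex.exp (-((t : ℝ) * Complex.I)) * z - 1)) := by
      rw [circleMap_zero]
      have : Complex.exp (t * Complex.I) * Complex.exp (-(t * Complex.I)) = 1 := by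
        rw [← Complex.exp_add]; simp
      linear_combination (R * z) * this
    rw [← hq, e0, e2]
    have h1 := hxz t
    have h2 := hv0 t
    have e3 : 2 * c * z / (Complex.exp (-((t : ℝ) * Complex.I)) * z - 1) ^ 2 *
        ((η * q.re : ℝ) : ℂ) = c * η * z / (Complex.exp (-((t : ℝ) * Complex.I)) * z - 1) ^ 2 *
        (2 * (q.re : ℂ)) := by push_cast; ring
    rw [e3, e1]
    generalize Complex.exp (-((t : ℝ) * Complex.I)) * z - 1 = D at h1
    generalize (starRingEnd ℂ) q = qb
    generalize circleMap 0 R t = v at h2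
    field_simp
  simp only [hsplit]
  rw [integral_add ((integrable_uniformAngle c1).const_mul _)
    ((integrable_uniformAngle c2).const_mul _), integral_const_mul, integral_const_mul, k1, k2,
    driftOperator, Real.exp_neg σ, ← hR]
  push_cast
  ring

lemma exists_one_add_pow_le (q : ℕ) : ∃ K : ℝ, 0 ≤ K ∧ ∀ τ : ℝ, -1 ≤ τ → τ ≤ 3 →
    (1 + τ) ^ q ≤ 1 + q * τ + K * τ ^ 2 := by
  induction q with
  | zero => exact ⟨0, le_rfl, fun τ _ _ => by simp⟩
  | succ q ih =>
    obtain ⟨K, hK, h⟩ := ih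
    refine ⟨q + 4 * K, by positivity, fun τ h1 h2 => ?_⟩
    have h3 := mul_le_mul_of_nonneg_right (h τ h1 h2) (by linarith : 0 ≤ 1 + τ)
    rw [pow_succ]
    refine h3.trans ?_
    push_cast
    have : K * τ ^ 2 * τ ≤ K * τ ^ 2 * 3 := by gcongr
    nlinarith

/-- The second-order expansion of `‖a + b‖ ^ (2 q)`. -/
lemma exists_norm_add_pow_le (m : ℕ) : ∃ C : ℝ, 0 ≤ C ∧ ∀ a b : ℂ,
    ‖a + b‖ ^ (2 * m + 2) ≤ ‖a‖ ^ (2 * m + 2) +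
      2 * (m + 1) * ‖a‖ ^ (2 * m) * ((starRingEnd ℂ) a * b).re +
      C * (‖a‖ ^ (2 * m) * ‖b‖ ^ 2 + ‖b‖ ^ (2 * m + 2)) := by
  obtain ⟨K, hK, h⟩ := exists_one_add_pow_le (m + 1)
  refine ⟨2 ^ (2 * m + 2) + 2 * (m + 1) + (m + 1 + 9 * K), by positivity, fun a b => ?_⟩
  set A := ‖a‖ with hA
  set B := ‖b‖ with hB
  set R := ((starRingEnd ℂ) a * b).re with hR
  have hA0 : 0 ≤ A := norm_nonneg _
  have hB0 : 0 ≤ B := norm_nonneg _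
  have hRle : |R| ≤ A * B := by
    refine (Complex.abs_re_le_norm _).trans ?_
    rw [norm_mul, Complex.norm_conj]
  have hsq : ‖a + b‖ ^ 2 = A ^ 2 + 2 * R + B ^ 2 := by
    rw [hA, hB, hR, ← Complex.normSq_eq_norm_sq, ← Complex.normSq_eq_norm_sq,
      ← Complex.normSq_eq_norm_sq, Complex.normSq_apply, Complex.normSq_apply, Complex.normSq_apply]
    simp
    ring
  have hR1 := (abs_le.1 hRle).1
  have hR2 := (abs_le.1 hRle).2
  rcases le_or_gt A B with hAB | hAB
  · have h1 : ‖a + b‖ ^ (2 * m + 2) ≤ 2 ^ (2 * m + 2) * B ^ (2 * m + 2) := by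
      rw [← mul_pow]
      gcongr
      exact (norm_add_le a b).trans (by linarith)
    have h2 : -(B ^ (2 * m + 2)) ≤ A ^ (2 * m) * R := by
      have : A ^ (2 * m) * (A * B) ≤ B ^ (2 * m) * (B * B) := by gcongr
      have h3 : A ^ (2 * m) * (-(A * B)) ≤ A ^ (2 * m) * R := by gcongr
      have h4 : B ^ (2 * m) * (B * B) = B ^ (2 * m + 2) := by ring
      linarith
    have h3 : 0 ≤ A ^ (2 * m + 2) := by positivity
    have h4 : 0 ≤ (2 ^ (2 * m + 2) + 2 * (m + 1) + (m + 1 + 9 * K)) * (A ^ (2 * m) * B ^ 2) := by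
      positivity
    have h5 : 0 ≤ (m + 1 + 9 * K) * B ^ (2 * m + 2) := by positivity
    have h6 := mul_le_mul_of_nonneg_left h2 (by positivity : (0 : ℝ) ≤ 2 * (m + 1))
    linarith
  · have hA1 : 0 < A := by linarith
    set τ := (2 * R + B ^ 2) / A ^ 2 with hτ
    have hτA : τ * A ^ 2 = 2 * R + B ^ 2 := by rw [hτ]; field_simp
    have t1 : -1 ≤ τ := by
      rw [hτ, le_div_iff₀ (by positivity)]
      nlinarith [sq_nonneg ‖a + b‖]
    have t2 : τ ≤ 3 := by
      rw [hτ, div_le_iff₀ (by positivity)]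
      nlinarith
    have h1 := mul_le_mul_of_nonneg_right (h τ t1 t2) (by positivity : 0 ≤ A ^ (2 * m + 2))
    have e1 : (1 + τ) ^ (m + 1) * A ^ (2 * m + 2) = ‖a + b‖ ^ (2 * m + 2) := by
      have : A ^ (2 * m + 2) = (A ^ 2) ^ (m + 1) := by rw [← pow_mul]; ring_nf
      rw [this, ← mul_pow, add_mul, hτA, one_mul, ← add_assoc, ← hsq, ← pow_mul]
      ring_nf
    rw [e1] at h1
    have e2 : τ * A ^ (2 * m + 2) = A ^ (2 * m) * (2 * R + B ^ 2) := by
      rw [← hτA]; ring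
    have e3 : τ ^ 2 * A ^ (2 * m + 2) ≤ 9 * (A ^ (2 * m) * B ^ 2) := by
      have e4 : τ ^ 2 * A ^ (2 * m + 2) = A ^ (2 * m) * ((τ * A) ^ 2) := by ring
      have e5 : |τ * A| ≤ 3 * B := by
        have e6 : τ * A * A = 2 * R + B ^ 2 := by rw [← hτA]; ring
        rw [abs_le]
        constructor
        · refine le_of_mul_le_mul_right ?_ hA1
          rw [e6]; nlinarith
        · refine le_of_mul_le_mul_right ?_ hA1
          rw [e6]; nlinarith
      have e7 : (τ * A) ^ 2 ≤ (3 * B) ^ 2 := sq_le_sq' (abs_le.1 e5).1 (abs_le.1 e5).2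
      have e8 : A ^ (2 * m) * ((τ * A) ^ 2) ≤ A ^ (2 * m) * ((3 * B) ^ 2) := by gcongr
      rw [e4]
      linarith
    have e9 := mul_le_mul_of_nonneg_left e3 hK
    have e10 : (1 + ((m + 1 : ℕ) : ℝ) * τ + K * τ ^ 2) * A ^ (2 * m + 2) = A ^ (2 * m + 2) +
        (m + 1) * (τ * A ^ (2 * m + 2)) + K * (τ ^ 2 * A ^ (2 * m + 2)) := by push_cast; ring
    rw [e10, e2] at h1
    have h4 : 0 ≤ (2 ^ (2 * m + 2) + 2 * (m + 1) : ℝ) * (A ^ (2 * m) * B ^ 2) := by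
      positivity
    have h5 : 0 ≤ (2 ^ (2 * m + 2) + 2 * (m + 1) + (m + 1 + 9 * K)) * B ^ (2 * m + 2) := by
      positivity
    linarith

/-- Moments of a random variable which is close to `a`, with density `h` with respect to the
uniform angle. -/
lemma exists_integral_mul_norm_pow_le (m : ℕ) : ∃ C : ℝ, 0 ≤ C ∧ ∀ (E : ℝ → ℂ) (h : ℝ → ℝ) (a : ℂ)
    (G V S : ℝ), Continuous E → Continuous h → (∀ t, 0 ≤ h t) → ∫ t, h t ∂uniformAngle = 1 →
    ‖∫ t, (h t : ℂ) * (E t - a) ∂uniformAngle‖ ≤ G →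
    ∫ t, h t * ‖E t - a‖ ^ 2 ∂uniformAngle ≤ V → (∀ t, ‖E t - a‖ ≤ S) →
    ∫ t, h t * ‖E t‖ ^ (2 * m + 2) ∂uniformAngle ≤ ‖a‖ ^ (2 * m + 2) +
      C * (‖a‖ ^ (2 * m + 1) * G + ‖a‖ ^ (2 * m) * V + S ^ (2 * m) * V) := by
  obtain ⟨C, hC, H⟩ := exists_norm_add_pow_le m
  refine ⟨C + 2 * (m + 1), by positivity, fun E h a G V S hE hh h0 h1 hG hV hS => ?_⟩
  set A := ‖a‖ with hA
  have hA0 : 0 ≤ A := norm_nonneg _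
  have hS0 : 0 ≤ S := (norm_nonneg _).trans (hS 0)
  have hG0 : 0 ≤ G := (norm_nonneg _).trans hG
  have hV0 : 0 ≤ V := (integral_nonneg fun t => mul_nonneg (h0 t) (by positivity)).trans hV
  have cD : Continuous fun t => (h t : ℂ) * (E t - a) := by fun_prop
  have cR : Continuous fun t => ((starRingEnd ℂ) a * ((h t : ℂ) * (E t - a))).re :=
    Complex.continuous_re.comp (continuous_const.mul cD)
  have cV : Continuous fun t => h t * ‖E t - a‖ ^ 2 := by fun_prop
  have hpt : ∀ t, h t * ‖E t‖ ^ (2 * m + 2) ≤ A ^ (2 * m + 2) * h t +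
      (2 * (m + 1) * A ^ (2 * m) * ((starRingEnd ℂ) a * ((h t : ℂ) * (E t - a))).re +
      (C * (A ^ (2 * m) + S ^ (2 * m))) * (h t * ‖E t - a‖ ^ 2)) := by
    intro t
    have k := mul_le_mul_of_nonneg_left (H a (E t - a)) (h0 t)
    rw [add_sub_cancel, ← hA] at k
    have e1 : ((starRingEnd ℂ) a * ((h t : ℂ) * (E t - a))).re =
        h t * ((starRingEnd ℂ) a * (E t - a)).re := by
      rw [mul_left_comm, Complex.re_ofReal_mul]
    have e2 : ‖E t - a‖ ^ (2 * m + 2) ≤ S ^ (2 * m) * ‖E t - a‖ ^ 2 := by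
      rw [pow_add]
      gcongr
      exact hS t
    have e3 := mul_le_mul_of_nonneg_left e2 (mul_nonneg hC (h0 t))
    rw [e1]
    nlinarith
  have i1 := (integrable_uniformAngle hh).const_mul (A ^ (2 * m + 2))
  have i2 := (integrable_uniformAngle cR).const_mul (2 * (m + 1) * A ^ (2 * m))
  have i3 := (integrable_uniformAngle cV).const_mul (C * (A ^ (2 * m) + S ^ (2 * m)))
  have i23 : Integrable (fun t =>
      2 * (m + 1) * A ^ (2 * m) * ((starRingEnd ℂ) a * ((h t : ℂ) * (E t - a))).re +
      (C * (A ^ (2 * m) + S ^ (2 * m))) * (h t * ‖E t - a‖ ^ 2)) uniformAngle := i2.add i3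
  refine (integral_mono (integrable_uniformAngle (by fun_prop)) (i1.add i23) hpt).trans ?_
  change ∫ t, A ^ (2 * m + 2) * h t +
      (2 * (m + 1) * A ^ (2 * m) * ((starRingEnd ℂ) a * ((h t : ℂ) * (E t - a))).re +
      (C * (A ^ (2 * m) + S ^ (2 * m))) * (h t * ‖E t - a‖ ^ 2)) ∂uniformAngle ≤ _
  rw [integral_add i1 i23, integral_add i2 i3, integral_const_mul, integral_const_mul,
    integral_const_mul, h1, mul_one]
  have hre : ∫ t, ((starRingEnd ℂ) a * ((h t : ℂ) * (E t - a))).re ∂uniformAngle ≤ A * G := by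
    have e := integral_re (𝕜 := ℂ) ((integrable_uniformAngle cD).const_mul ((starRingEnd ℂ) a))
    simp only [RCLike.re_to_complex] at e
    rw [e, integral_const_mul]
    refine (Complex.re_le_norm _).trans ?_
    rw [norm_mul, Complex.norm_conj]
    gcongr
  have f1 := mul_le_mul_of_nonneg_left hre (by positivity : 0 ≤ 2 * (m + 1) * A ^ (2 * m))
  have f2 := mul_le_mul_of_nonneg_left hV (by positivity : 0 ≤ C * (A ^ (2 * m) + S ^ (2 * m)))
  have f3 : 0 ≤ C * (A ^ (2 * m + 1) * G) := by positivity
  have f4 : 0 ≤ 2 * (m + 1) * (A ^ (2 * m) * V + S ^ (2 * m) * V) := by positivity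
  have f5 : 2 * (m + 1) * A ^ (2 * m) * (A * G) = 2 * (m + 1) * (A ^ (2 * m + 1) * G) := by ring
  nlinarith

lemma continuous_updateMap_circle {F ψ : ℂ → ℂ} {c : ℝ} (hF : IsBasicMap F c)
    (hψ : RegularAtInfty ψ) {z : ℂ} (hz : 1 < ‖z‖)
    (hin : ∀ u : ℂ, ‖u‖ = ‖z‖ → 1 < ‖z * (F u / u)‖) :
    Continuous fun t : ℝ => updateMap F c ψ z (Complex.exp (-(t * Complex.I)) * z) := by
  rw [continuous_iff_continuousAt]
  intro t
  set u := Complex.exp (-(t * Complex.I)) * z with hu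
  have hun : ‖u‖ = ‖z‖ := norm_exp_neg_mul t z
  have hu1 : 1 < ‖u‖ := by rw [hun]; exact hz
  have hu0 : u ≠ 0 := norm_pos_iff.1 (one_pos.trans hu1)
  have c0 : ContinuousAt (fun t : ℝ => Complex.exp (-(t * Complex.I)) * z) t := by fun_prop
  have cF : ContinuousAt F u :=
    (hF.differentiableOn.differentiableAt (exteriorDisk_mem_nhds hu1)).continuousAt
  have cF' : ContinuousAt (deriv F) u :=
    ((hF.differentiableOn.deriv isOpen_exteriorDisk).differentiableAt
      (exteriorDisk_mem_nhds hu1)).continuousAt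
  have cψ : ContinuousAt ψ (z * (F u / u)) := (hψ.differentiableAt (hin u hun)).continuousAt
  have c1 : ContinuousAt (fun u => z * (F u / u)) u :=
    continuousAt_const.mul (cF.div continuousAt_id hu0)
  have c2 : ContinuousAt (fun u => ψ (z * (F u / u))) u :=
    ContinuousAt.comp (f := fun u => z * (F u / u)) cψ c1
  have c3 : ContinuousAt (updateMap F c ψ z) u :=
    (continuousAt_const.mul ((continuousAt_const.mul cF').sub continuousAt_const)).add
      ((continuousAt_const.mul ((continuousAt_id.mul cF').div cF (hF.ne_zero hu1))).mul c2)
  exact ContinuousAt.comp (f := fun t : ℝ => Complex.exp (-(t * Complex.I)) * z) c3 c0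

set_option maxHeartbeats 800000 in
/-- The drift and the fluctuations of one step, when the attachment angle has a density `h` close
to `1`: the drift is that of `driftOperator`, up to errors of second order. Here `δ` is the size
of the perturbation of the density. -/
lemma exists_one_step_bounds (Λ Rb H : ℝ) (hΛ : 0 ≤ Λ) (hRb : 1 ≤ Rb) (hH : 1 ≤ H) :
    ∃ C k : ℝ, 1 ≤ C ∧ 1 ≤ k ∧ ∀ (c : ℝ) (F : ℂ → ℂ), c ≤ 1 → IsBasicMap F c →
      HasRegularity F c Λ → ∀ ψ : ℂ → ℂ, RegularAtInfty ψ → ∀ (ρ : ℝ) (z : ℂ), 1 < ρ →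
      ρ - 1 ≤ (‖z‖ - 1) / 2 → ‖z‖ ≤ Rb → k * √c ≤ ‖z‖ - 1 →
      ∀ η σ δ : ℝ, 0 ≤ η → η ≤ 1 → 0 < σ → 0 ≤ δ → δ ≤ 1 →
      (∀ t, ‖ψ (circleMap 0 (Real.exp σ) t) / circleMap 0 (Real.exp σ) t‖ ≤ δ) →
      ∀ h : ℝ → ℝ, Continuous h → (∀ t, 0 ≤ h t) → ∫ t, h t ∂uniformAngle = 1 →
      (∀ t, |h t - 1 + η * (ψ (circleMap 0 (Real.exp σ) t) / circleMap 0 (Real.exp σ) t).re| ≤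
        H * δ ^ 2) →
      Continuous (fun t : ℝ => updateMap F c ψ z (Complex.exp (-(t * Complex.I)) * z)) ∧
      ‖∫ t, (h t : ℂ) * (updateMap F c ψ z (Complex.exp (-((t : ℝ) * Complex.I)) * z) -
        driftOperator c η σ ψ z) ∂uniformAngle‖ ≤
        C * ((δ ^ 2 + δ * poissonMajorant ψ ρ z) * (c * (1 - Real.log c) / (‖z‖ - 1)) +
          δ * (c * √c * (1 - Real.log c) / (‖z‖ - 1) ^ 2)) ∧
      ∫ t, h t * ‖updateMap F c ψ z (Complex.exp (-((t : ℝ) * Complex.I)) * z) -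
        driftOperator c η σ ψ z‖ ^ 2 ∂uniformAngle ≤
        C * (c ^ 2 / (‖z‖ - 1) ^ 3 * (1 + poissonMajorant ψ ρ z) ^ 2) ∧
      ∀ t : ℝ, ‖updateMap F c ψ z (Complex.exp (-(t * Complex.I)) * z) -
        driftOperator c η σ ψ z‖ ≤ C * (c / (‖z‖ - 1) ^ 2 * (1 + poissonMajorant ψ ρ z)) := by
  obtain ⟨C0, k0, hC0, hk0, H0⟩ := exists_updateMap_bounds Λ Rb hΛ hRb
  refine ⟨8 * H * C0 + (2 + H) * (4 * C0 ^ 2 + 8 * Rb ^ 3) + (C0 + 2 * Rb ^ 2), k0, ?_, hk0, ?_⟩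
  · have h1 : 1 ≤ H * C0 := one_le_mul_of_one_le_of_one_le hH hC0
    have h2 : 0 ≤ (2 + H) * (4 * C0 ^ 2 + 8 * Rb ^ 3) + (C0 + 2 * Rb ^ 2) := by positivity
    linarith
  intro c F hc1 hF hreg ψ hψ ρ z hρ hρz hzR hkz η σ δ hη0 hη1 hσ hδ0 hδ1 hδ h hh h0 h1 hexp
  obtain ⟨hmean, hin, hbd⟩ := H0 c F hc1 hF hreg ψ hψ ρ z hρ hρz hzR hkz
  have hc := hF.capacity_pos
  have hs : 0 < √c := Real.sqrt_pos.2 hc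
  set y := ‖z‖ - 1 with hy
  have hy0 : 0 < y := by linarith
  have hz1 : 1 < ‖z‖ := by linarith
  have hyR : y ≤ Rb := by linarith
  have hsy : √c ≤ y := by nlinarith
  set M := poissonMajorant ψ ρ z with hM
  have hM0 : 0 ≤ M := poissonMajorant_nonneg ψ (by linarith) (by linarith)
  set R := Real.exp σ with hR
  have hR1 : 1 < R := Real.one_lt_exp_iff.2 hσ
  set Lg := 1 - Real.log c with hLg
  have hLg1 : 1 ≤ Lg := by linarith [Real.log_nonpos hc.le hc1]
  have hE := continuous_updateMap_circle hF hψ hz1 hin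
  set E : ℝ → ℂ := fun t => updateMap F c ψ z (Complex.exp (-(t * Complex.I)) * z) with hEd
  set b : ℂ := (Real.exp (-c) : ℂ) * ψ (Real.exp c * z) with hb
  set a := driftOperator c η σ ψ z with ha
  set w : ℝ → ℝ := fun t => η * (ψ (circleMap 0 R t) / circleMap 0 R t).re with hw
  set x : ℝ → ℝ := fun t => ‖z - circleMap 0 1 t‖ with hx
  have hx0 : ∀ t, 0 < x t := fun t => norm_pos_iff.2 (sub_circleMap_one_ne_zero hz1 t)
  have hyx : ∀ t, y ≤ x t := fun t => by
    have := norm_sub_one_le_norm_sub_one (Complex.exp (-(t * Complex.I)) * z)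
    rwa [norm_rotate_sub_one, norm_exp_neg_mul] at this
  have cx : Continuous x := by
    have := continuous_circleMap 0 1
    fun_prop
  have cx1 : Continuous fun t => 1 / x t := continuous_const.div cx fun t => (hx0 t).ne'
  have cx2 : Continuous fun t => 1 / x t ^ 2 :=
    continuous_const.div (cx.pow 2) fun t => pow_ne_zero 2 (hx0 t).ne'
  have I1 : ∫ t, 1 / x t ∂uniformAngle ≤ 4 * Lg := integral_inv_norm_sub_le_log hc hc1 hsy
  have I2 : ∫ t, 1 / x t ^ 2 ∂uniformAngle ≤ 1 / y := by
    rw [integral_inv_norm_sub_sq hz1]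
    apply one_div_le_one_div_of_le hy0
    nlinarith
  set q : ℝ → ℂ := fun t => 2 * c * z / (Complex.exp (-(t * Complex.I)) * z - 1) ^ 2 with hq
  have hb1 : ∀ t, ‖E t - b‖ ≤ C0 * (c / (x t * y) * (1 + M)) := fun t => by
    have := (hbd _ (norm_exp_neg_mul t z)).1
    rwa [norm_rotate_sub_one] at this
  have hb2 : ∀ t, ‖E t - b + q t‖ ≤
      C0 * (c * √c / (x t * y ^ 2) + c / (x t * y) * M) := fun t => by
    have := (hbd _ (norm_exp_neg_mul t z)).2
    rwa [norm_rotate_sub_one] at this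
  have hqn : ∀ t, ‖q t‖ ≤ 2 * Rb * c * (1 / x t ^ 2) := fun t => by
    simp only [hq]
    rw [norm_div, norm_pow, norm_rotate_sub_one, norm_mul, norm_mul, Complex.norm_real,
      Real.norm_of_nonneg hc.le, Complex.norm_ofNat, mul_one_div]
    have : 2 * c * ‖z‖ ≤ 2 * Rb * c := by nlinarith
    exact div_le_div_of_nonneg_right this (by have := hx0 t; positivity)
  have cq : Continuous q := by
    refine continuous_const.div (by fun_prop) fun t => pow_ne_zero 2 ?_
    rw [← norm_pos_iff, norm_rotate_sub_one]
    exact hx0 t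
  have cw : Continuous w := by
    have h1 := hψ.continuous_comp_circleMap hR1
    have h2 : Continuous fun t => ψ (circleMap 0 R t) / circleMap 0 R t :=
      h1.div (continuous_circleMap 0 R) fun t => circleMap_ne_center (by positivity)
    exact continuous_const.mul (Complex.continuous_re.comp h2)
  have hwδ : ∀ t, |w t| ≤ δ := fun t => by
    simp only [hw]
    rw [abs_mul, abs_of_nonneg hη0]
    have := (Complex.abs_re_le_norm _).trans (hδ t)
    calc η * _ ≤ 1 * δ := by gcongr
      _ = δ := one_mul δ
  have hdrift : ∫ t, q t * (w t : ℂ) ∂uniformAngle = a - b :=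
    integral_linear_drift hψ hσ hz1
  have hδ2 : δ ^ 2 ≤ δ := by nlinarith
  -- the difference between the drift operator and the uniform mean is of order `δ c / y`
  have hab : ‖a - b‖ ≤ 2 * Rb * (c / y) := by
    rw [← hdrift]
    refine (norm_integral_le_integral_norm _).trans ?_
    have : ∀ t, ‖q t * (w t : ℂ)‖ ≤ 2 * Rb * c * (1 / x t ^ 2) := fun t => by
      rw [norm_mul, Complex.norm_real, Real.norm_eq_abs]
      have h3 : |w t| ≤ 1 := (hwδ t).trans hδ1
      calc ‖q t‖ * |w t| ≤ ‖q t‖ * 1 := by gcongr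
        _ ≤ _ := by rw [mul_one]; exact hqn t
    refine (integral_mono (integrable_uniformAngle (by fun_prop))
      ((integrable_uniformAngle cx2).const_mul _) this).trans ?_
    rw [integral_const_mul]
    calc 2 * Rb * c * _ ≤ 2 * Rb * c * (1 / y) := by gcongr
      _ = _ := by ring
  have hhle : ∀ t, h t ≤ 2 + H := fun t => by
    have h3 := (abs_le.1 (hexp t)).2
    have h4 := (abs_le.1 (hwδ t)).1
    simp only [hw] at h4
    have : H * δ ^ 2 ≤ H := by nlinarith
    linarith
  have p0 : 0 ≤ 8 * H * C0 := by positivity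
  have p1 : 0 ≤ (2 + H) * (4 * C0 ^ 2 + 8 * Rb ^ 3) := by positivity
  have p2 : 0 ≤ C0 + 2 * Rb ^ 2 := by positivity
  refine ⟨hE, ?_, ?_, ?_⟩
  · -- split the mean of `h (E - a)` into `(h - 1 + w) (E - b)` and `w (E - b + q)`
    have i1 : Integrable (fun t => ((h t - 1 + w t : ℝ) : ℂ) * (E t - b)) uniformAngle :=
      integrable_uniformAngle (by fun_prop)
    have i2 : Integrable (fun t => (w t : ℂ) * (E t - b + q t)) uniformAngle :=
      integrable_uniformAngle (by fun_prop)
    have i3 : Integrable (fun t => q t * (w t : ℂ)) uniformAngle :=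
      integrable_uniformAngle (by fun_prop)
    have i4 : Integrable (fun t => (h t : ℂ) * (a - b)) uniformAngle :=
      integrable_uniformAngle (by fun_prop)
    have i5 : Integrable (fun t => E t - b) uniformAngle :=
      integrable_uniformAngle (by fun_prop)
    have e1 : ∫ t, (E t - b) ∂uniformAngle = 0 := by
      rw [integral_sub (integrable_uniformAngle hE) (integrable_const _), hmean]
      simp
    have e2 : ∫ t, (h t : ℂ) * (a - b) ∂uniformAngle = a - b := by
      rw [integral_mul_const, integral_complex_ofReal, h1]; simp
    have e3 : ∫ t, (h t : ℂ) * (E t - a) ∂uniformAngle =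
        ∫ t, ((h t - 1 + w t : ℝ) : ℂ) * (E t - b) ∂uniformAngle -
        ∫ t, (w t : ℂ) * (E t - b + q t) ∂uniformAngle := by
      have e4 : ∀ t, (h t : ℂ) * (E t - a) = (((h t - 1 + w t : ℝ) : ℂ) * (E t - b) -
          (w t : ℂ) * (E t - b + q t)) + ((E t - b) + (q t * (w t : ℂ) - (h t : ℂ) * (a - b))) := by
        intro t; push_cast; ring
      simp only [e4]
      have i12 : Integrable (fun t => ((h t - 1 + w t : ℝ) : ℂ) * (E t - b) -
          (w t : ℂ) * (E t - b + q t)) uniformAngle := i1.sub i2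
      have i34 : Integrable (fun t => q t * (w t : ℂ) - (h t : ℂ) * (a - b)) uniformAngle :=
        i3.sub i4
      have i345 : Integrable (fun t => (E t - b) + (q t * (w t : ℂ) - (h t : ℂ) * (a - b)))
        uniformAngle := i5.add i34
      rw [integral_add i12 i345, integral_add i5 i34, integral_sub i1 i2, integral_sub i3 i4,
        e1, e2, hdrift, sub_self, add_zero, add_zero]
    rw [e3]
    have f1 : ‖∫ t, ((h t - 1 + w t : ℝ) : ℂ) * (E t - b) ∂uniformAngle‖ ≤
        H * δ ^ 2 * (C0 * (c / y * (1 + M))) * (4 * Lg) := by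
      refine (norm_integral_le_integral_norm _).trans ?_
      have : ∀ t, ‖((h t - 1 + w t : ℝ) : ℂ) * (E t - b)‖ ≤
          H * δ ^ 2 * (C0 * (c / y * (1 + M))) * (1 / x t) := fun t => by
        rw [norm_mul, Complex.norm_real, Real.norm_eq_abs]
        calc _ ≤ H * δ ^ 2 * (C0 * (c / (x t * y) * (1 + M))) := by
              gcongr
              · exact hexp t
              · exact hb1 t
          _ = _ := by have := (hx0 t).ne'; field_simp
      refine (integral_mono i1.norm ((integrable_uniformAngle cx1).const_mul _) this).trans ?_
      rw [integral_const_mul]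
      gcongr
    have f2 : ‖∫ t, (w t : ℂ) * (E t - b + q t) ∂uniformAngle‖ ≤
        δ * (C0 * (c * √c / y ^ 2 + c / y * M)) * (4 * Lg) := by
      refine (norm_integral_le_integral_norm _).trans ?_
      have : ∀ t, ‖(w t : ℂ) * (E t - b + q t)‖ ≤
          δ * (C0 * (c * √c / y ^ 2 + c / y * M)) * (1 / x t) := fun t => by
        rw [norm_mul, Complex.norm_real, Real.norm_eq_abs]
        calc _ ≤ δ * (C0 * (c * √c / (x t * y ^ 2) + c / (x t * y) * M)) := by
              gcongr
              · exact hwδ t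
              · exact hb2 t
          _ = _ := by have := (hx0 t).ne'; field_simp
      refine (integral_mono i2.norm ((integrable_uniformAngle cx1).const_mul _) this).trans ?_
      rw [integral_const_mul]
      gcongr
    refine (norm_sub_le _ _).trans ((add_le_add f1 f2).trans ?_)
    set X := c * Lg / y with hX
    set Y := c * √c * Lg / y ^ 2 with hY
    have hX0 : 0 ≤ X := by positivity
    have hY0 : 0 ≤ Y := by positivity
    have e5 : H * δ ^ 2 * (C0 * (c / y * (1 + M))) * (4 * Lg) +
        δ * (C0 * (c * √c / y ^ 2 + c / y * M)) * (4 * Lg) =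
        4 * C0 * (H * δ ^ 2 * (1 + M) * X + δ * Y + δ * M * X) := by
      rw [hX, hY]; field_simp; ring
    rw [e5]
    have g1 : H * δ ^ 2 * M ≤ H * (δ * M) := by
      have : H * M * δ ^ 2 ≤ H * M * δ := by gcongr
      linarith
    have g2 : H * δ ^ 2 * (1 + M) * X + δ * Y + δ * M * X ≤
        2 * H * ((δ ^ 2 + δ * M) * X + δ * Y) := by
      have h3 := mul_le_mul_of_nonneg_right g1 hX0
      have h4 : δ * Y ≤ H * (δ * Y) := le_mul_of_one_le_left (by positivity) hH
      have h5 : δ * M * X ≤ H * (δ * M * X) := le_mul_of_one_le_left (by positivity) hH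
      have h6 : 0 ≤ H * δ ^ 2 * X := by positivity
      have h7 : 0 ≤ H * (δ * Y) := by positivity
      linarith
    have g3 : 0 ≤ (δ ^ 2 + δ * M) * X + δ * Y := by positivity
    calc _ ≤ 4 * C0 * (2 * H * ((δ ^ 2 + δ * M) * X + δ * Y)) := by gcongr
      _ = 8 * H * C0 * ((δ ^ 2 + δ * M) * X + δ * Y) := by ring
      _ ≤ _ := by
        refine mul_le_mul_of_nonneg_right ?_ g3
        linarith
  · have i1 : ∀ t, h t * ‖E t - a‖ ^ 2 ≤
        (2 + H) * (2 * C0 ^ 2 * (c ^ 2 / y ^ 2 * (1 + M) ^ 2) * (1 / x t ^ 2) +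
          8 * Rb ^ 2 * (c ^ 2 / y ^ 2)) := fun t => by
      have k1 : ‖E t - a‖ ≤ C0 * (c / (x t * y) * (1 + M)) + 2 * Rb * (c / y) := by
        have e : E t - a = (E t - b) - (a - b) := by ring
        rw [e]
        exact (norm_sub_le _ _).trans (add_le_add (hb1 t) hab)
      have k2 : ‖E t - a‖ ^ 2 ≤ 2 * (C0 * (c / (x t * y) * (1 + M))) ^ 2 +
          2 * (2 * Rb * (c / y)) ^ 2 := by
        rw [← mul_add]
        exact (pow_le_pow_left₀ (norm_nonneg _) k1 2).trans add_sq_le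
      have k3 : 2 * (C0 * (c / (x t * y) * (1 + M))) ^ 2 + 2 * (2 * Rb * (c / y)) ^ 2 =
          2 * C0 ^ 2 * (c ^ 2 / y ^ 2 * (1 + M) ^ 2) * (1 / x t ^ 2) +
          8 * Rb ^ 2 * (c ^ 2 / y ^ 2) := by
        have := (hx0 t).ne'
        field_simp
        ring
      rw [← k3]
      exact mul_le_mul (hhle t) k2 (by positivity) (by linarith)
    refine (integral_mono (integrable_uniformAngle (by fun_prop))
      ((((integrable_uniformAngle cx2).const_mul _).add (integrable_const _)).const_mul _)
      i1).trans ?_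
    rw [integral_const_mul]
    have e1 : ∫ t, (2 * C0 ^ 2 * (c ^ 2 / y ^ 2 * (1 + M) ^ 2) * (1 / x t ^ 2) +
        8 * Rb ^ 2 * (c ^ 2 / y ^ 2)) ∂uniformAngle =
        2 * C0 ^ 2 * (c ^ 2 / y ^ 2 * (1 + M) ^ 2) * ∫ t, 1 / x t ^ 2 ∂uniformAngle +
        8 * Rb ^ 2 * (c ^ 2 / y ^ 2) := by
      rw [integral_add ((integrable_uniformAngle cx2).const_mul _) (integrable_const _),
        integral_const_mul]
      simp
    change (2 + H) * ∫ t, (2 * C0 ^ 2 * (c ^ 2 / y ^ 2 * (1 + M) ^ 2) * (1 / x t ^ 2) +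
        8 * Rb ^ 2 * (c ^ 2 / y ^ 2)) ∂uniformAngle ≤ _
    rw [e1]
    set B := c ^ 2 / y ^ 3 with hB
    have hB0 : 0 ≤ B := by positivity
    have e2 : 2 * C0 ^ 2 * (c ^ 2 / y ^ 2 * (1 + M) ^ 2) * ∫ t, 1 / x t ^ 2 ∂uniformAngle ≤
        2 * C0 ^ 2 * (B * (1 + M) ^ 2) := by
      calc _ ≤ 2 * C0 ^ 2 * (c ^ 2 / y ^ 2 * (1 + M) ^ 2) * (1 / y) := by gcongr
        _ = _ := by rw [hB]; field_simp
    have e3 : 8 * Rb ^ 2 * (c ^ 2 / y ^ 2) ≤ 8 * Rb ^ 3 * (B * (1 + M) ^ 2) := by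
      have e4 : c ^ 2 / y ^ 2 = B * y := by rw [hB]; field_simp
      have e5 : 1 ≤ (1 + M) ^ 2 := one_le_pow₀ (by linarith)
      rw [e4]
      calc 8 * Rb ^ 2 * (B * y) ≤ 8 * Rb ^ 2 * (B * Rb) := by gcongr
        _ = 8 * Rb ^ 3 * (B * 1) := by ring
        _ ≤ _ := by gcongr
    have e6 : 0 ≤ B * (1 + M) ^ 2 := by positivity
    have e7 : 0 ≤ C0 ^ 2 * (B * (1 + M) ^ 2) := by positivity
    calc _ ≤ (2 + H) * (2 * C0 ^ 2 * (B * (1 + M) ^ 2) + 8 * Rb ^ 3 * (B * (1 + M) ^ 2)) := by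
          gcongr
      _ ≤ (2 + H) * ((4 * C0 ^ 2 + 8 * Rb ^ 3) * (B * (1 + M) ^ 2)) := by
          gcongr
          linarith
      _ = (2 + H) * (4 * C0 ^ 2 + 8 * Rb ^ 3) * (B * (1 + M) ^ 2) := by ring
      _ ≤ _ := mul_le_mul_of_nonneg_right (by linarith) e6
  · intro t
    have e : E t - a = (E t - b) - (a - b) := by ring
    have k1 : ‖E t - b‖ ≤ C0 * (c / y ^ 2 * (1 + M)) := by
      refine (hb1 t).trans ?_
      have h3 : c / (x t * y) ≤ c / y ^ 2 := by
        rw [sq]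
        have := hyx t
        gcongr
      gcongr
    have k2 : 2 * Rb * (c / y) ≤ 2 * Rb ^ 2 * (c / y ^ 2 * (1 + M)) := by
      have e4 : c / y = c / y ^ 2 * y := by field_simp
      rw [e4]
      calc 2 * Rb * (c / y ^ 2 * y) ≤ 2 * Rb * (c / y ^ 2 * Rb) := by gcongr
        _ = 2 * Rb ^ 2 * (c / y ^ 2 * 1) := by ring
        _ ≤ _ := by gcongr; linarith
    have k3 : 0 ≤ c / y ^ 2 * (1 + M) := by positivity
    rw [e]
    refine (norm_sub_le _ _).trans ((add_le_add k1 (hab.trans k2)).trans ?_)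
    rw [← add_mul]
    exact mul_le_mul_of_nonneg_right (by linarith) k3

set_option maxHeartbeats 800000 in
/-- Conditional moments of one step at a fixed point. Here `M` is a target size for the moments at
`z`, and `Z` is an a priori size for the moments on the smaller circle of radius `ρ`. -/
lemma exists_one_step_moment_le (Λ Rb H : ℝ) (hΛ : 0 ≤ Λ) (hRb : 1 ≤ Rb) (hH : 1 ≤ H) (m : ℕ) :
    ∃ C k : ℝ, 1 ≤ C ∧ 1 ≤ k ∧ ∀ (c : ℝ) (F : ℂ → ℂ), c ≤ 1 → IsBasicMap F c →
      HasRegularity F c Λ → ∀ ψ : ℂ → ℂ, RegularAtInfty ψ → ∀ (ρ : ℝ) (z : ℂ), 1 < ρ →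
      ρ - 1 ≤ (‖z‖ - 1) / 2 → ‖z‖ ≤ Rb → k * √c ≤ ‖z‖ - 1 →
      ∀ η σ δ : ℝ, 0 ≤ η → η ≤ 1 → 0 < σ → 0 ≤ δ → δ ≤ 1 →
      (∀ t, ‖ψ (circleMap 0 (Real.exp σ) t) / circleMap 0 (Real.exp σ) t‖ ≤ δ) →
      ∀ h : ℝ → ℝ, Continuous h → (∀ t, 0 ≤ h t) → ∫ t, h t ∂uniformAngle = 1 →
      (∀ t, |h t - 1 + η * (ψ (circleMap 0 (Real.exp σ) t) / circleMap 0 (Real.exp σ) t).re| ≤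
        H * δ ^ 2) →
      ∀ Z M κ : ℝ, 0 < Z → 0 < M → (1 + Z) * (c / (‖z‖ - 1) ^ 2) ≤ M →
      C * (((δ ^ 2 + δ * Z) * (c * (1 - Real.log c) / (‖z‖ - 1)) +
          δ * (c * √c * (1 - Real.log c) / (‖z‖ - 1) ^ 2)) / M +
        c ^ 2 / (‖z‖ - 1) ^ 3 * (1 + Z) ^ 2 / M ^ 2) ≤ κ →
      ∫⁻ t, ENNReal.ofReal (h t) *
        ‖updateMap F c ψ z (Complex.exp (-((t : ℝ) * Complex.I)) * z)‖ₑ ^ (2 * m + 2)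
          ∂uniformAngle ≤
        ENNReal.ofReal (1 + κ) * ‖driftOperator c η σ ψ z‖ₑ ^ (2 * m + 2) +
        ENNReal.ofReal (κ * M ^ (2 * m + 2)) * (1 + ENNReal.ofReal (Z⁻¹ ^ (2 * m + 2)) *
          ENNReal.ofReal (poissonMajorant ψ ρ z) ^ (2 * m + 2)) := by
  obtain ⟨C0, k0, hC0, hk0, H0⟩ := exists_one_step_bounds Λ Rb H hΛ hRb hH
  obtain ⟨K, hK, HK⟩ := exists_integral_mul_norm_pow_le m
  set n := 2 * m + 2 with hn
  refine ⟨1 + K * (2 * C0 + C0 ^ (2 * m + 1)) * 2 ^ n, k0, ?_, hk0, ?_⟩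
  · have : 0 ≤ K * (2 * C0 + C0 ^ (2 * m + 1)) * 2 ^ n := by positivity
    linarith
  intro c F hc1 hF hreg ψ hψ ρ z hρ hρz hzR hkz η σ δ hη0 hη1 hσ hδ0 hδ1 hδ h hh h0 h1 hexp Z M κ
    hZ hM hMle hκ
  obtain ⟨hE, hG, hV, hS⟩ := H0 c F hc1 hF hreg ψ hψ ρ z hρ hρz hzR hkz η σ δ hη0 hη1 hσ hδ0 hδ1
    hδ h hh h0 h1 hexp
  have hc := hF.capacity_pos
  have hs : 0 < √c := Real.sqrt_pos.2 hc
  set y := ‖z‖ - 1 with hy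
  have hy0 : 0 < y := by linarith
  set P := poissonMajorant ψ ρ z with hP
  have hP0 : 0 ≤ P := poissonMajorant_nonneg ψ (by linarith) (by linarith)
  set Lg := 1 - Real.log c with hLg
  have hLg1 : 1 ≤ Lg := by linarith [Real.log_nonpos hc.le hc1]
  set E : ℝ → ℂ := fun t => updateMap F c ψ z (Complex.exp (-(t * Complex.I)) * z) with hEd
  set a := driftOperator c η σ ψ z with ha
  set ω := (δ ^ 2 + δ * Z) * (c * Lg / y) + δ * (c * √c * Lg / y ^ 2) with hω
  set β := c ^ 2 / y ^ 3 * (1 + Z) ^ 2 with hβ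
  have hω0 : 0 ≤ ω := by positivity
  have hβ0 : 0 ≤ β := by positivity
  set X := 1 + P / Z with hX
  have hX1 : 1 ≤ X := by
    have : 0 ≤ P / Z := by positivity
    linarith
  have hPZ : P ≤ Z * X := by
    have : Z * X = Z + P := by rw [hX]; field_simp
    linarith
  have hG' : C0 * ((δ ^ 2 + δ * P) * (c * Lg / y) + δ * (c * √c * Lg / y ^ 2)) ≤ C0 * (ω * X) := by
    gcongr
    rw [hω, add_mul]
    have e1 : δ ^ 2 + δ * P ≤ (δ ^ 2 + δ * Z) * X := by
      have a1 : δ * P ≤ δ * (Z * X) := by gcongr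
      have a2 : δ ^ 2 * 1 ≤ δ ^ 2 * X := by gcongr
      linarith
    have e2 := mul_le_mul_of_nonneg_right e1 (by positivity : 0 ≤ c * Lg / y)
    have e3 : δ * (c * √c * Lg / y ^ 2) * 1 ≤ δ * (c * √c * Lg / y ^ 2) * X := by gcongr
    linarith
  have h1P : 1 + P ≤ (1 + Z) * X := by linarith
  have hV' : C0 * (c ^ 2 / y ^ 3 * (1 + P) ^ 2) ≤ C0 * (β * X ^ 2) := by
    have : (1 + P) ^ 2 ≤ ((1 + Z) * X) ^ 2 := by gcongr
    calc C0 * (c ^ 2 / y ^ 3 * (1 + P) ^ 2) ≤ C0 * (c ^ 2 / y ^ 3 * ((1 + Z) * X) ^ 2) := by gcongr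
      _ = _ := by rw [hβ]; ring
  have hS' : C0 * (c / y ^ 2 * (1 + P)) ≤ C0 * (M * X) := by
    have : c / y ^ 2 * (1 + P) ≤ c / y ^ 2 * ((1 + Z) * X) := by gcongr
    have h2 := mul_le_mul_of_nonneg_right hMle (by linarith : 0 ≤ X)
    refine mul_le_mul_of_nonneg_left (this.trans ?_) (by linarith)
    linarith
  have key := HK E h a _ _ _ hE hh h0 h1 (hG.trans hG') (hV.trans hV') fun t => (hS t).trans hS'
  set A := ‖a‖ with hA
  have hA0 : 0 ≤ A := norm_nonneg _
  set W := M * X with hW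
  have hW0 : 0 < W := by positivity
  have hyoung : ∀ i j : ℕ, i + j = n → A ^ i * W ^ j ≤ A ^ n + W ^ n := by
    intro i j hij
    have hAn : 0 ≤ A ^ n := by positivity
    have hWn : 0 ≤ W ^ n := by positivity
    rcases le_total A W with h | h
    · have : A ^ i * W ^ j ≤ W ^ i * W ^ j := by gcongr
      rw [← pow_add, hij] at this
      linarith
    · have : A ^ i * W ^ j ≤ A ^ i * A ^ j := by gcongr
      rw [← pow_add, hij] at this
      linarith
  set U := ω / M + β / M ^ 2 with hU
  have u1 : 0 ≤ ω / M := by positivity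
  have u2 : 0 ≤ β / M ^ 2 := by positivity
  have hsum : A ^ (2 * m + 1) * (C0 * (ω * X)) + A ^ (2 * m) * (C0 * (β * X ^ 2)) +
      (C0 * (M * X)) ^ (2 * m) * (C0 * (β * X ^ 2)) ≤
      (2 * C0 + C0 ^ (2 * m + 1)) * (U * (A ^ n + W ^ n)) := by
    have t1 : A ^ (2 * m + 1) * (C0 * (ω * X)) ≤ C0 * (ω / M * (A ^ n + W ^ n)) := by
      have e : A ^ (2 * m + 1) * (C0 * (ω * X)) = C0 * (ω / M * (A ^ (2 * m + 1) * W ^ 1)) := by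
        rw [hW]; field_simp
      rw [e]
      gcongr
      exact hyoung _ _ (by omega)
    have t2 : A ^ (2 * m) * (C0 * (β * X ^ 2)) ≤ C0 * (β / M ^ 2 * (A ^ n + W ^ n)) := by
      have e : A ^ (2 * m) * (C0 * (β * X ^ 2)) = C0 * (β / M ^ 2 * (A ^ (2 * m) * W ^ 2)) := by
        rw [hW]; field_simp
      rw [e]
      gcongr
      exact hyoung _ _ (by omega)
    have t3 : (C0 * (M * X)) ^ (2 * m) * (C0 * (β * X ^ 2)) ≤
        C0 ^ (2 * m + 1) * (β / M ^ 2 * (A ^ n + W ^ n)) := by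
      have e : (C0 * (M * X)) ^ (2 * m) * (C0 * (β * X ^ 2)) =
          C0 ^ (2 * m + 1) * (β / M ^ 2 * (W ^ (2 * m) * W ^ 2)) := by
        rw [← hW, mul_pow, pow_succ C0 (2 * m)]
        have : W ^ 2 = M ^ 2 * X ^ 2 := by rw [hW]; ring
        rw [this]
        field_simp
      rw [e, ← pow_add, ← hn]
      have : 0 ≤ A ^ n := by positivity
      gcongr
      linarith
    have t4 : 0 ≤ C0 * (β / M ^ 2 * (A ^ n + W ^ n)) := by positivity
    have t5 : 0 ≤ C0 * (ω / M * (A ^ n + W ^ n)) := by positivity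
    have t6 : 0 ≤ C0 ^ (2 * m + 1) * (ω / M * (A ^ n + W ^ n)) := by positivity
    rw [hU]
    linarith
  have hWn : W ^ n ≤ 2 ^ n * (M ^ n * (1 + (Z⁻¹ * P) ^ n)) := by
    have h2 : X ^ n ≤ 2 ^ (n - 1) * (1 ^ n + (P / Z) ^ n) :=
      add_pow_le zero_le_one (by positivity) n
    have h3 : (2 : ℝ) ^ (n - 1) ≤ 2 ^ n := pow_le_pow_right₀ one_le_two (by omega)
    have h4 : Z⁻¹ * P = P / Z := by ring
    rw [hW, mul_pow, h4]
    rw [one_pow] at h2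
    calc M ^ n * X ^ n ≤ M ^ n * (2 ^ n * (1 + (P / Z) ^ n)) := by
          gcongr
          exact h2.trans (by gcongr)
      _ = _ := by ring
  have hκU : K * ((2 * C0 + C0 ^ (2 * m + 1)) * (U * (A ^ n + W ^ n))) ≤
      κ * (A ^ n + M ^ n * (1 + (Z⁻¹ * P) ^ n)) := by
    have h5 : 0 ≤ A ^ n := by positivity
    have h6 : 0 ≤ A ^ n + M ^ n * (1 + (Z⁻¹ * P) ^ n) := by positivity
    have h7 : (1 : ℝ) ≤ 2 ^ n := one_le_pow₀ one_le_two
    have h8 : A ^ n + W ^ n ≤ 2 ^ n * (A ^ n + M ^ n * (1 + (Z⁻¹ * P) ^ n)) := by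
      have : 1 * A ^ n ≤ 2 ^ n * A ^ n := by gcongr
      linarith
    have hU0 : 0 ≤ U := add_nonneg u1 u2
    calc _ ≤ K * ((2 * C0 + C0 ^ (2 * m + 1)) *
          (U * (2 ^ n * (A ^ n + M ^ n * (1 + (Z⁻¹ * P) ^ n))))) := by gcongr
      _ = (K * (2 * C0 + C0 ^ (2 * m + 1)) * 2 ^ n * U) *
          (A ^ n + M ^ n * (1 + (Z⁻¹ * P) ^ n)) := by ring
      _ ≤ κ * _ := by
          refine mul_le_mul_of_nonneg_right (le_trans ?_ hκ) h6
          refine mul_le_mul_of_nonneg_right ?_ hU0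
          linarith
  have hκ0 : 0 ≤ κ := by
    refine le_trans ?_ hκ
    have : 0 ≤ K * (2 * C0 + C0 ^ (2 * m + 1)) * 2 ^ n := by positivity
    exact mul_nonneg (by linarith) (add_nonneg u1 u2)
  have hfin : ∫ t, h t * ‖E t‖ ^ n ∂uniformAngle ≤
      (1 + κ) * A ^ n + κ * M ^ n * (1 + Z⁻¹ ^ n * P ^ n) := by
    have e : (1 + κ) * A ^ n + κ * M ^ n * (1 + Z⁻¹ ^ n * P ^ n) =
        A ^ n + κ * (A ^ n + M ^ n * (1 + (Z⁻¹ * P) ^ n)) := by rw [mul_pow]; ring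
    rw [e]
    exact key.trans (add_le_add_right ((mul_le_mul_of_nonneg_left hsum hK).trans hκU) _)
  have hcont : Continuous fun t => h t * ‖E t‖ ^ n := by fun_prop
  have e1 : ∫⁻ t, ENNReal.ofReal (h t) * ‖E t‖ₑ ^ n ∂uniformAngle =
      ENNReal.ofReal (∫ t, h t * ‖E t‖ ^ n ∂uniformAngle) := by
    rw [ofReal_integral_eq_lintegral_ofReal (integrable_uniformAngle hcont)
      (Eventually.of_forall fun t => mul_nonneg (h0 t) (by positivity))]
    refine lintegral_congr fun t => ?_
    rw [ENNReal.ofReal_mul (h0 t), ENNReal.ofReal_pow (norm_nonneg _), ofReal_norm]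
  change ∫⁻ t, ENNReal.ofReal (h t) * ‖E t‖ₑ ^ n ∂uniformAngle ≤ _
  rw [e1]
  refine (ENNReal.ofReal_le_ofReal hfin).trans (le_of_eq ?_)
  rw [ENNReal.ofReal_add (by positivity) (by positivity), ENNReal.ofReal_mul (by positivity),
    ENNReal.ofReal_mul (p := κ * M ^ n) (by positivity),
    ENNReal.ofReal_add zero_le_one (show 0 ≤ Z⁻¹ ^ n * P ^ n by positivity), ENNReal.ofReal_one,
    ENNReal.ofReal_mul (p := Z⁻¹ ^ n) (by positivity), ENNReal.ofReal_pow hP0, hA,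
    ENNReal.ofReal_pow (norm_nonneg _), ofReal_norm]

lemma continuous_updateMap_circleMap {F ψ : ℂ → ℂ} {c r : ℝ} (hF : IsBasicMap F c)
    (hψ : RegularAtInfty ψ) (hr : 1 < r)
    (hin : ∀ z u : ℂ, ‖z‖ = r → ‖u‖ = r → 1 < ‖z * (F u / u)‖) :
    Continuous fun p : ℝ × ℝ => updateMap F c ψ (circleMap 0 r p.2)
      (Complex.exp (-(p.1 * Complex.I)) * circleMap 0 r p.2) := by
  rw [continuous_iff_continuousAt]
  intro p
  have hcirc := continuous_circleMap 0 r
  have hzn : ‖circleMap 0 r p.2‖ = r := norm_circleMap_zero_of_nonneg (by linarith) _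
  have c0 : ContinuousAt (fun p : ℝ × ℝ => circleMap 0 r p.2) p :=
    (hcirc.comp continuous_snd).continuousAt
  have c1 : ContinuousAt
      (fun p : ℝ × ℝ => Complex.exp (-(p.1 * Complex.I)) * circleMap 0 r p.2) p :=
    ContinuousAt.mul (by fun_prop) c0
  set f : ℝ × ℝ → ℂ := fun p => Complex.exp (-(p.1 * Complex.I)) * circleMap 0 r p.2 with hf
  have hun : ‖f p‖ = r := by simp only [hf]; rw [norm_exp_neg_mul, hzn]
  have hu1 : 1 < ‖f p‖ := by rw [hun]; exact hr
  have hu0 : f p ≠ 0 := norm_pos_iff.1 (one_pos.trans hu1)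
  have cF : ContinuousAt (fun p => F (f p)) p := ContinuousAt.comp (f := f)
    (hF.differentiableOn.differentiableAt (exteriorDisk_mem_nhds hu1)).continuousAt c1
  have cF' : ContinuousAt (fun p => deriv F (f p)) p := ContinuousAt.comp (f := f)
    ((hF.differentiableOn.deriv isOpen_exteriorDisk).differentiableAt
      (exteriorDisk_mem_nhds hu1)).continuousAt c1
  have c2 : ContinuousAt (fun p => circleMap 0 r p.2 * (F (f p) / f p)) p :=
    c0.mul (cF.div c1 hu0)
  have cψ : ContinuousAt (fun p : ℝ × ℝ => ψ (circleMap 0 r p.2 * (F (f p) / f p))) p :=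
    ContinuousAt.comp (f := fun p : ℝ × ℝ => circleMap 0 r p.2 * (F (f p) / f p))
      (hψ.differentiableAt (hin _ _ hzn hun)).continuousAt c2
  exact (c0.mul ((continuousAt_const.mul cF').sub continuousAt_const)).add
      ((continuousAt_const.mul ((c1.mul cF').div cF (hF.ne_zero hu1))).mul cψ)

lemma RegularAtInfty.continuous_driftOperator {f : ℂ → ℂ} (hf : RegularAtInfty f) {c η σ R : ℝ}
    (hR : 1 < R) (hc : 0 ≤ c) (hσ : 0 ≤ σ) :
    Continuous fun t => driftOperator c η σ f (circleMap 0 R t) := by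
  have h1 : 1 < Real.exp c * R := by nlinarith [Real.add_one_le_exp c]
  have h2 : 1 < Real.exp σ * R := by nlinarith [Real.add_one_le_exp σ]
  have d1 := hf.continuous_comp_circleMap h1
  have d2 : Continuous fun t => deriv f (circleMap 0 (Real.exp σ * R) t) := by
    rw [continuous_iff_continuousAt]
    intro t
    have hn : 1 < ‖circleMap 0 (Real.exp σ * R) t‖ := by
      rw [norm_circleMap_zero_of_nonneg (by linarith)]; exact h2
    exact ContinuousAt.comp (f := fun t => circleMap 0 (Real.exp σ * R) t)
      ((hf.differentiableOn.deriv isOpen_exteriorDisk).differentiableAt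
        (exteriorDisk_mem_nhds hn)).continuousAt (continuous_circleMap 0 _).continuousAt
  simp only [driftOperator, exp_mul_circleMap]
  exact (continuous_const.mul d1).sub
    (continuous_const.mul ((continuous_circleMap 0 _).mul d2))

/-- Conditional moments of one step on the circle of radius `r`. -/
lemma exists_one_step_circleMoment_le (Λ Rb H : ℝ) (hΛ : 0 ≤ Λ) (hRb : 1 ≤ Rb) (hH : 1 ≤ H)
    (m : ℕ) :
    ∃ C k : ℝ, 1 ≤ C ∧ 1 ≤ k ∧ ∀ (c : ℝ) (F : ℂ → ℂ), c ≤ 1 → IsBasicMap F c →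
      HasRegularity F c Λ → ∀ ψ : ℂ → ℂ, RegularAtInfty ψ → ∀ (ρ r : ℝ), 1 < ρ →
      ρ - 1 ≤ (r - 1) / 2 → r ≤ Rb → k * √c ≤ r - 1 →
      ∀ η σ δ b : ℝ, 0 ≤ η → η ≤ 1 → 0 ≤ δ → δ ≤ 1 → 0 ≤ b → b < c → c ≤ σ →
      c * η * (1 + Real.exp (2 * (b - σ))) ≤ 1 - Real.exp (-(2 * (c - b))) →
      (∀ t, ‖ψ (circleMap 0 (Real.exp σ) t) / circleMap 0 (Real.exp σ) t‖ ≤ δ) →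
      ∀ h : ℝ → ℝ, Continuous h → (∀ t, 0 ≤ h t) → ∫ t, h t ∂uniformAngle = 1 →
      (∀ t, |h t - 1 + η * (ψ (circleMap 0 (Real.exp σ) t) / circleMap 0 (Real.exp σ) t).re| ≤
        H * δ ^ 2) →
      ∀ Z M κ : ℝ, 0 < Z → 0 < M → (1 + Z) * (c / (r - 1) ^ 2) ≤ M →
      C * (((δ ^ 2 + δ * Z) * (c * (1 - Real.log c) / (r - 1)) +
          δ * (c * √c * (1 - Real.log c) / (r - 1) ^ 2)) / M +
        c ^ 2 / (r - 1) ^ 3 * (1 + Z) ^ 2 / M ^ 2) ≤ κ →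
      ∫⁻ t, ENNReal.ofReal (h t) * circleMoment
        (fun z => updateMap F c ψ z (Complex.exp (-((t : ℝ) * Complex.I)) * z)) (2 * m + 2) r
          ∂uniformAngle ≤
        ENNReal.ofReal (1 + κ) * circleMoment ψ (2 * m + 2) (Real.exp b * r) +
        ENNReal.ofReal (κ * M ^ (2 * m + 2)) * (1 + ENNReal.ofReal (Z⁻¹ ^ (2 * m + 2)) *
          circleMoment ψ (2 * m + 2) ρ) := by
  obtain ⟨C1, k1, hC1, hk1, H1⟩ := exists_one_step_moment_le Λ Rb H hΛ hRb hH m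
  obtain ⟨C2, k2, hC2, hk2, H2⟩ := exists_updateMap_bounds Λ Rb hΛ hRb
  refine ⟨C1, max k1 k2, hC1, le_max_of_le_left hk1, ?_⟩
  intro c F hc1 hF hreg ψ hψ ρ r hρ hρr hrR hkr η σ δ b hη0 hη1 hδ0 hδ1 hb0 hbc hcσ hpos hδ h hh h0
    h1 hexp Z M κ hZ hM hMle hκ
  have hc := hF.capacity_pos
  have hr1 : 1 < r := by linarith
  have hnorm : ∀ s, ‖circleMap 0 r s‖ = r := norm_circleMap_zero_of_nonneg (by linarith)
  have hs : 0 ≤ √c := Real.sqrt_nonneg _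
  have hkr1 : k1 * √c ≤ r - 1 := (mul_le_mul_of_nonneg_right (le_max_left _ _) hs).trans hkr
  have hkr2 : k2 * √c ≤ r - 1 := (mul_le_mul_of_nonneg_right (le_max_right _ _) hs).trans hkr
  have hin : ∀ z u : ℂ, ‖z‖ = r → ‖u‖ = r → 1 < ‖z * (F u / u)‖ := fun z u hz hu =>
    (H2 c F hc1 hF hreg ψ hψ ρ z hρ (by rwa [hz]) (by rwa [hz]) (by rwa [hz])).2.1 u
      (by rw [hz, hu])
  have hjoint := continuous_updateMap_circleMap hF hψ hr1 hin
  set n := 2 * m + 2 with hn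
  have hn0 : n ≠ 0 := by omega
  have hcd := hψ.continuous_driftOperator (η := η) (σ := σ) hr1 hc.le (by linarith)
  calc ∫⁻ t, ENNReal.ofReal (h t) * circleMoment
        (fun z => updateMap F c ψ z (Complex.exp (-((t : ℝ) * Complex.I)) * z)) n r ∂uniformAngle
      = ∫⁻ t, ∫⁻ s, ENNReal.ofReal (h t) * ‖updateMap F c ψ (circleMap 0 r s)
        (Complex.exp (-((t : ℝ) * Complex.I)) * circleMap 0 r s)‖ₑ ^ n ∂uniformAngle
          ∂uniformAngle := by
        refine lintegral_congr fun t => ?_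
        rw [circleMoment, lintegral_const_mul' _ _ ENNReal.ofReal_ne_top]
    _ = ∫⁻ s, ∫⁻ t, ENNReal.ofReal (h t) * ‖updateMap F c ψ (circleMap 0 r s)
        (Complex.exp (-((t : ℝ) * Complex.I)) * circleMap 0 r s)‖ₑ ^ n ∂uniformAngle
          ∂uniformAngle := by
        refine lintegral_lintegral_swap (Measurable.aemeasurable ?_)
        exact ((hh.measurable.comp measurable_fst).ennreal_ofReal).mul
          (hjoint.measurable.enorm.pow_const n)
    _ ≤ ∫⁻ s, (ENNReal.ofReal (1 + κ) * ‖driftOperator c η σ ψ (circleMap 0 r s)‖ₑ ^ n +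
        ENNReal.ofReal (κ * M ^ n) * (1 + ENNReal.ofReal (Z⁻¹ ^ n) *
          ENNReal.ofReal (poissonMajorant ψ ρ (circleMap 0 r s)) ^ n)) ∂uniformAngle := by
        refine lintegral_mono fun s => ?_
        have hz := hnorm s
        exact H1 c F hc1 hF hreg ψ hψ ρ (circleMap 0 r s) hρ (by rwa [hz]) (by rwa [hz])
          (by rwa [hz]) η σ δ hη0 hη1 (by linarith) hδ0 hδ1 hδ h hh h0 h1 hexp Z M κ hZ hM
          (by rwa [hz]) (by rwa [hz])
    _ = ENNReal.ofReal (1 + κ) * circleMoment (driftOperator c η σ ψ) n r +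
        ENNReal.ofReal (κ * M ^ n) * (1 + ENNReal.ofReal (Z⁻¹ ^ n) *
          ∫⁻ s, ENNReal.ofReal (poissonMajorant ψ ρ (circleMap 0 r s)) ^ n ∂uniformAngle) := by
        rw [lintegral_add_left (by
            exact (hcd.measurable.enorm.pow_const n).const_mul _),
          lintegral_const_mul' _ _ ENNReal.ofReal_ne_top,
          lintegral_const_mul' _ _ ENNReal.ofReal_ne_top, lintegral_add_left measurable_const,
          lintegral_const_mul' _ _ ENNReal.ofReal_ne_top]
        simp [circleMoment]
    _ ≤ _ := by
        gcongr
        · exact circleMoment_driftOperator_le hψ hr1 hη0 hb0 hbc hcσ hpos hn0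
        · exact lintegral_poissonMajorant_le hψ hρ (by linarith) hn0

section

/-! ### The density of the attachment angle -/

lemma abs_log_one_add_sub_le {τ : ℝ} (hτ : |τ| ≤ 9 / 16) : |Real.log (1 + τ) - τ| ≤ 3 * τ ^ 2 := by
  obtain ⟨h1, h2⟩ := abs_le.1 hτ
  have h3 : 0 < 1 + τ := by linarith
  have h4 := Real.log_le_sub_one_of_pos h3
  have h5 := Real.one_sub_inv_le_log_of_pos h3
  have h6 : τ - 3 * τ ^ 2 ≤ 1 - (1 + τ)⁻¹ := by
    have h7 : (1 + τ)⁻¹ * (1 + τ) = 1 := inv_mul_cancel₀ h3.ne'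
    have h8 : (1 - (1 + τ)⁻¹ - τ + 3 * τ ^ 2) * (1 + τ) = τ ^ 2 * (2 + 3 * τ) := by
      linear_combination -h7
    have h9 : 0 ≤ τ ^ 2 * (2 + 3 * τ) := mul_nonneg (sq_nonneg _) (by linarith)
    rw [← h8] at h9
    have := nonneg_of_mul_nonneg_left h9 h3
    linarith
  rw [abs_le]
  constructor
  · linarith
  · nlinarith [sq_nonneg τ]

/-- The linearisation of `w ↦ |1 + w| ^ (-η)` at `0`. -/
lemma abs_norm_one_add_rpow_sub_le {w : ℂ} {δ η : ℝ} (hη0 : 0 ≤ η) (hη1 : η ≤ 1) (hδ : δ ≤ 1 / 8)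
    (hw : ‖w‖ ≤ δ) : |‖1 + w‖ ^ (-η) - 1 + η * w.re| ≤ 23 * δ ^ 2 := by
  have hδ0 : 0 ≤ δ := (norm_nonneg _).trans hw
  have hre : |w.re| ≤ δ := (Complex.abs_re_le_norm w).trans hw
  obtain ⟨hre1, hre2⟩ := abs_le.1 hre
  set τ := 2 * w.re + ‖w‖ ^ 2 with hτ
  have hw2 : ‖w‖ ^ 2 ≤ δ ^ 2 := by gcongr
  have hw0 : 0 ≤ ‖w‖ ^ 2 := by positivity
  have hδ2 : δ ^ 2 ≤ 1 / 8 * δ := by nlinarith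
  have hτδ : |τ| ≤ 9 / 4 * δ := by
    rw [abs_le]
    constructor <;> linarith
  have hτ1 : |τ| ≤ 9 / 16 := by linarith
  have hτ2 : τ ^ 2 ≤ 6 * δ ^ 2 := by
    have := pow_le_pow_left₀ (abs_nonneg _) hτδ 2
    rw [sq_abs] at this
    nlinarith
  have hsq : ‖1 + w‖ ^ 2 = 1 + τ := by
    rw [hτ, ← Complex.normSq_eq_norm_sq, ← Complex.normSq_eq_norm_sq, Complex.normSq_apply,
      Complex.normSq_apply]
    simp
    ring
  have h1τ : 0 < 1 + τ := by linarith [(abs_le.1 hτ1).1]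
  have hpos : 0 < ‖1 + w‖ := by
    refine lt_of_le_of_ne (norm_nonneg _) fun h => ?_
    rw [← h] at hsq
    norm_num at hsq
    linarith
  have hlog := abs_log_one_add_sub_le hτ1
  set l := Real.log (1 + τ) with hl
  have hl1 : Real.log ‖1 + w‖ = l / 2 := by
    rw [hl, ← hsq, Real.log_pow]; push_cast; ring
  set X := -(η / 2) * l with hX
  have hexp : ‖1 + w‖ ^ (-η) = Real.exp X := by
    rw [Real.rpow_def_of_pos hpos, hl1, hX]
    congr 1
    ring
  obtain ⟨hl2, hl3⟩ := abs_le.1 hlog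
  have hlabs : |l| ≤ 5 * δ := by
    obtain ⟨a1, a2⟩ := abs_le.1 hτδ
    rw [abs_le]
    constructor <;> linarith
  have hXabs : |X| ≤ 5 / 2 * δ := by
    rw [hX, abs_mul, abs_neg, abs_of_nonneg (by positivity)]
    have := abs_nonneg l
    nlinarith
  have hX2 : X ^ 2 ≤ 25 / 4 * δ ^ 2 := by
    have := pow_le_pow_left₀ (abs_nonneg _) hXabs 2
    rw [sq_abs] at this
    linarith
  have he := Real.abs_exp_sub_one_sub_id_le (x := X) (by linarith)
  rw [hexp]
  have e : Real.exp X - 1 + η * w.re = (Real.exp X - 1 - X) + (-(η / 2) * (l - τ + ‖w‖ ^ 2)) := by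
    rw [hX, hτ]; ring
  have h7 : |-(η / 2) * (l - τ + ‖w‖ ^ 2)| ≤ 10 * δ ^ 2 := by
    rw [abs_mul, abs_neg, abs_of_nonneg (by positivity)]
    have h8 : |l - τ + ‖w‖ ^ 2| ≤ 19 * δ ^ 2 := by
      rw [abs_le]
      constructor <;> linarith
    have := abs_nonneg (l - τ + ‖w‖ ^ 2)
    nlinarith
  rw [e]
  refine (abs_add_le _ _).trans ?_
  nlinarith

variable {F : ℂ → ℂ} {c : ℝ}

lemma deriv_clusterMap_eq (hF : IsBasicMap F c) (θ : ℕ → ℝ) (n : ℕ) {z : ℂ} (hz : 1 < ‖z‖) :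
    deriv (clusterMap F θ n) z =
      (Real.exp (c * n) : ℂ) * (1 + diffFluctuation F c θ n z / z) := by
  have hz0 : z ≠ 0 := norm_pos_iff.1 (one_pos.trans hz)
  rw [diffFluctuation, deriv_fluctuation hF θ n hz, mul_div_cancel_left₀ _ hz0,
    add_sub_cancel, ← mul_assoc, ← Complex.ofReal_mul, ← Real.exp_add]
  simp

/-- When the differentiated fluctuation is small on the circle of radius `e ^ σ`, the density of
the attachment angle is given by its linearisation, up to a quadratic error. -/
lemma angleDensity_bounds (hF : IsBasicMap F c) (θ : ℕ → ℝ) (n : ℕ) {η σ δ : ℝ} (hη0 : 0 ≤ η)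
    (hη1 : η ≤ 1) (hσ : 0 < σ) (hδ : δ ≤ 1 / 8)
    (hw : ∀ t, ‖diffFluctuation F c θ n (circleMap 0 (Real.exp σ) t) /
      circleMap 0 (Real.exp σ) t‖ ≤ δ) :
    Continuous (angleDensity F η σ θ n) ∧ (∀ t, 0 ≤ angleDensity F η σ θ n t) ∧
    ∫ t, angleDensity F η σ θ n t ∂uniformAngle = 1 ∧
    ∀ t, |angleDensity F η σ θ n t - 1 +
      η * (diffFluctuation F c θ n (circleMap 0 (Real.exp σ) t) /
        circleMap 0 (Real.exp σ) t).re| ≤ 115 * δ ^ 2 := by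
  set R := Real.exp σ with hR
  have hR1 : 1 < R := Real.one_lt_exp_iff.2 hσ
  have hR0 : 0 < R := by linarith
  have hδ0 : 0 ≤ δ := (norm_nonneg _).trans (hw 0)
  set ψ := diffFluctuation F c θ n with hψd
  have hψ : RegularAtInfty ψ := regularAtInfty_diffFluctuation hF θ n
  set w : ℝ → ℂ := fun t => ψ (circleMap 0 R t) / circleMap 0 R t with hwd
  have hv0 : ∀ t, circleMap 0 R t ≠ 0 := fun t => circleMap_ne_center hR0.ne'
  have hvn : ∀ t, 1 < ‖circleMap 0 R t‖ := fun t => by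
    rw [norm_circleMap_zero_of_nonneg hR0.le]; exact hR1
  have cw : Continuous w := (hψ.continuous_comp_circleMap hR1).div (continuous_circleMap 0 R) hv0
  have h1w : ∀ t, ‖1 + w t‖ ≠ 0 := fun t h => by
    have h2 : w t = -1 := by
      rw [norm_eq_zero] at h
      linear_combination h
    have h3 := hw t
    change ‖w t‖ ≤ δ at h3
    rw [h2, norm_neg, norm_one] at h3
    linarith
  set g : ℝ → ℝ := fun t => ‖1 + w t‖ ^ (-η) with hg
  have cg : Continuous g := (continuous_const.add cw).norm.rpow_const fun t => Or.inl (h1w t)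
  have hg0 : ∀ t, 0 ≤ g t := fun t => Real.rpow_nonneg (norm_nonneg _) _
  have hgw : ∀ t, |g t - 1 + η * (w t).re| ≤ 23 * δ ^ 2 := fun t =>
    abs_norm_one_add_rpow_sub_le hη0 hη1 hδ (hw t)
  set K := Real.exp (c * n) ^ (-η) with hK
  have hK0 : 0 < K := Real.rpow_pos_of_pos (Real.exp_pos _) _
  have hΦ : ∀ t, ‖deriv (clusterMap F θ n) (circleMap 0 R t)‖ ^ (-η) = K * g t := fun t => by
    rw [deriv_clusterMap_eq hF θ n (hvn t), norm_mul, Complex.norm_real,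
      Real.norm_of_nonneg (Real.exp_pos _).le, Real.mul_rpow (Real.exp_pos _).le (norm_nonneg _)]
  set G := ∫ t, g t ∂uniformAngle with hG
  have hmean : ∫ t, w t ∂uniformAngle = 0 := by
    refine integral_circleMap_of_tendsto (g := fun v => ψ v / v) zero_le_one hR1
      (hψ.differentiableOn.div differentiableOn_id fun v hv => norm_pos_iff.1 (one_pos.trans hv)) ?_
    have := (tendsto_diffFluctuation hF θ n).mul tendsto_inv₀_cobounded
    rw [zero_mul] at this
    exact this.congr fun v => (div_eq_mul_inv _ _).symm
  have cre : Continuous fun t => (w t).re := Complex.continuous_re.comp cw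
  have hmeanre : ∫ t, (w t).re ∂uniformAngle = 0 := by
    have e := integral_re (𝕜 := ℂ) (integrable_uniformAngle cw)
    simp only [RCLike.re_to_complex] at e
    rw [e, hmean, Complex.zero_re]
  have hGe : |G - 1| ≤ 23 * δ ^ 2 := by
    have i1 : Integrable (fun t => g t - 1) uniformAngle :=
      integrable_uniformAngle (cg.sub continuous_const)
    have e : ∫ t, (g t - 1 + η * (w t).re) ∂uniformAngle = G - 1 := by
      rw [integral_add i1 ((integrable_uniformAngle cre).const_mul _), integral_const_mul, hmeanre,
        integral_sub (integrable_uniformAngle cg) (integrable_const _)]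
      simp [hG]
    rw [← e, ← Real.norm_eq_abs]
    refine (norm_integral_le_of_norm_le_const (C := 23 * δ ^ 2)
      (Eventually.of_forall fun t => hgw t)).trans ?_
    simp
  have hδ2 : δ ^ 2 ≤ 1 / 64 := by nlinarith
  have hGlow : 1 / 2 ≤ G := by linarith [(abs_le.1 hGe).1]
  have hh : angleDensity F η σ θ n = fun t => g t / G := by
    funext t
    rw [angleDensity, intervalAverage_eq_integral_uniformAngle]
    simp only [← hR, hΦ]
    rw [integral_const_mul, mul_div_mul_left _ _ hK0.ne']
  rw [hh]
  refine ⟨cg.div_const _, fun t => div_nonneg (hg0 t) (by linarith), ?_, fun t => ?_⟩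
  · rw [integral_div]
    exact div_self (by linarith)
  · change |g t / G - 1 + η * (w t).re| ≤ 115 * δ ^ 2
    have e : g t / G - 1 + η * (w t).re = (g t - 1 + η * (w t).re) + g t * (1 - G) / G := by
      have : G ≠ 0 := by linarith
      field_simp
      ring
    have hre : |η * (w t).re| ≤ δ := by
      rw [abs_mul, abs_of_nonneg hη0]
      have := (Complex.abs_re_le_norm _).trans (hw t)
      calc η * |(w t).re| ≤ 1 * δ := by gcongr
        _ = δ := one_mul δ
    have hg2 : g t ≤ 2 := by
      have h1 := (abs_le.1 (hgw t)).2
      have h2 := (abs_le.1 hre).1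
      linarith
    have h3 : |g t * (1 - G) / G| ≤ 92 * δ ^ 2 := by
      rw [abs_div, abs_mul, abs_of_nonneg (hg0 t), abs_of_nonneg (by linarith : 0 ≤ G),
        div_le_iff₀ (by linarith), abs_sub_comm]
      have h4 : g t * |G - 1| ≤ 2 * (23 * δ ^ 2) := by
        have := hg0 t
        gcongr
      have h5 : 92 * δ ^ 2 * (1 / 2) ≤ 92 * δ ^ 2 * G := by gcongr
      linarith
    rw [e]
    refine (abs_add_le _ _).trans ?_
    linarith [hgw t]

end

section

/-! ### The law of the next attachment angle -/

lemma clusterMap_congr (F : ℂ → ℂ) {θ θ' : ℕ → ℝ} {n : ℕ} (h : ∀ k ∈ Finset.Icc 1 n, θ k = θ' k) :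
    clusterMap F θ n = clusterMap F θ' n := by
  induction n with
  | zero => rfl
  | succ n ih =>
    funext z
    simp only [clusterMap]
    rw [ih fun k hk => h k (Finset.Icc_subset_Icc_right (Nat.le_succ n) hk),
      h (n + 1) (Finset.mem_Icc.2 ⟨by omega, le_rfl⟩)]

lemma diffFluctuation_congr (F : ℂ → ℂ) (c : ℝ) {θ θ' : ℕ → ℝ} {n : ℕ}
    (h : ∀ k ∈ Finset.Icc 1 n, θ k = θ' k) :
    diffFluctuation F c θ n = diffFluctuation F c θ' n := by
  funext z
  have : fluctuation F c θ n = fluctuation F c θ' n := by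
    funext w; rw [fluctuation, fluctuation, clusterMap_congr F h]
  rw [diffFluctuation, diffFluctuation, this]

lemma angleDensity_congr (F : ℂ → ℂ) (η σ : ℝ) {θ θ' : ℕ → ℝ} {n : ℕ}
    (h : ∀ k ∈ Finset.Icc 1 n, θ k = θ' k) :
    angleDensity F η σ θ n = angleDensity F η σ θ' n := by
  funext t
  rw [angleDensity, angleDensity, clusterMap_congr F h]

/-- The differentiated fluctuations are jointly measurable in the angles and the point `z`. -/
lemma exists_measurable_diffFluctuation {F : ℂ → ℂ} {c : ℝ} (hF : IsBasicMap F c) (n : ℕ) :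
    ∃ g : (ℕ → ℝ) × ℂ → ℂ, Measurable g ∧
      ∀ θ z, 1 < ‖z‖ → diffFluctuation F c θ n z = g (θ, z) := by
  classical
  induction n with
  | zero => exact ⟨fun _ => 0, measurable_const, fun θ z _ => diffFluctuation_zero θ z⟩
  | succ n ih =>
    obtain ⟨g, hg, hgd⟩ := ih
    set Fm : ℂ → ℂ := exteriorDisk.piecewise F 0 with hFm
    have hFmm : Measurable Fm := hF.differentiableOn.continuousOn.measurable_piecewise
      continuousOn_const isOpen_exteriorDisk.measurableSet
    have hFe : ∀ u : ℂ, 1 < ‖u‖ → Fm u = F u := fun u hu =>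
      Set.piecewise_eq_of_mem _ _ _ hu
    have hF' : Measurable (deriv F) := measurable_deriv F
    have hu : Measurable fun p : (ℕ → ℝ) × ℂ =>
        Complex.exp (-(p.1 (n + 1) * Complex.I)) * p.2 := by fun_prop
    refine ⟨fun p => p.2 * ((Real.exp (-c) : ℂ) *
        deriv F (Complex.exp (-(p.1 (n + 1) * Complex.I)) * p.2) - 1) +
      (Real.exp (-c) : ℂ) * ((Complex.exp (-(p.1 (n + 1) * Complex.I)) * p.2) *
        deriv F (Complex.exp (-(p.1 (n + 1) * Complex.I)) * p.2) /
        Fm (Complex.exp (-(p.1 (n + 1) * Complex.I)) * p.2)) *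
      g (p.1, p.2 * (Fm (Complex.exp (-(p.1 (n + 1) * Complex.I)) * p.2) /
        (Complex.exp (-(p.1 (n + 1) * Complex.I)) * p.2))), ?_, fun θ z hz => ?_⟩
    · have h1 := hF'.comp hu
      have h2 := hFmm.comp hu
      exact (measurable_snd.mul ((h1.const_mul _).sub_const 1)).add
        ((((hu.mul h1).div h2).const_mul _).mul
          (hg.comp (measurable_fst.prodMk (measurable_snd.mul (h2.div hu)))))
    · rw [diffFluctuation_succ hF θ n hz, updateMap]
      have hun : 1 < ‖Complex.exp (-(θ (n + 1) * Complex.I)) * z‖ := by rwa [norm_exp_neg_mul]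
      have hz0 : z ≠ 0 := norm_pos_iff.1 (one_pos.trans hz)
      simp only [hFe _ hun]
      rw [hgd]
      rw [← rotatedMap_eq F _ hz0]
      exact (isExteriorMap_rotatedMap hF.isExteriorMap _).mapsTo hz

lemma measurable_angleDensity {F : ℂ → ℂ} {c : ℝ} (hF : IsBasicMap F c) (η : ℝ) {σ : ℝ}
    (hσ : 0 < σ) (n : ℕ) :
    Measurable fun p : (ℕ → ℝ) × ℝ => angleDensity F η σ p.1 n p.2 := by
  obtain ⟨g, hg, hgd⟩ := exists_measurable_diffFluctuation hF n
  have hR : 1 < Real.exp σ := Real.one_lt_exp_iff.2 hσ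
  have hv : ∀ t, 1 < ‖circleMap 0 (Real.exp σ) t‖ := fun t => by
    rw [norm_circleMap_zero_of_nonneg (by linarith)]; exact hR
  have hc := measurable_circleMap 0 (Real.exp σ)
  have hm : Measurable fun p : (ℕ → ℝ) × ℝ =>
      ‖deriv (clusterMap F p.1 n) (circleMap 0 (Real.exp σ) p.2)‖ ^ (-η) := by
    simp only [deriv_clusterMap_eq hF _ n (hv _), hgd _ _ (hv _)]
    have h1 : Measurable fun p : (ℕ → ℝ) × ℝ => circleMap 0 (Real.exp σ) p.2 :=
      hc.comp measurable_snd
    have h2 : Measurable fun p : (ℕ → ℝ) × ℝ => g (p.1, circleMap 0 (Real.exp σ) p.2) :=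
      hg.comp (measurable_fst.prodMk h1)
    exact (((h2.div h1).const_add 1).const_mul _).norm.pow_const _
  refine hm.div ?_
  have h3 := (hm.stronglyMeasurable.integral_prod_right' (ν := uniformAngle)).measurable
  exact h3.comp measurable_fst

variable {Ω : Type*}

/-- The angles `Θ_1, …, Θ_n`, extended by zero. -/
noncomputable def truncatedPath (Θ : ℕ → Ω → ℝ) (n : ℕ) (ω : Ω) (k : ℕ) : ℝ :=
  if k ∈ Finset.Icc 1 n then Θ k ω else 0

lemma truncatedPath_apply (Θ : ℕ → Ω → ℝ) (n : ℕ) (ω : Ω) {k : ℕ} (hk : k ∈ Finset.Icc 1 n) :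
    truncatedPath Θ n ω k = Θ k ω := if_pos hk

lemma measurable_truncatedPath_history (Θ : ℕ → Ω → ℝ) (n : ℕ) :
    Measurable[history Θ n] (truncatedPath Θ n) := by
  refine @measurable_pi_lambda _ _ _ (history Θ n) _ _ fun k => ?_
  by_cases hk : k ∈ Finset.Icc 1 n
  · have h1 : (fun ω => truncatedPath Θ n ω k) = Θ k := by
      funext ω; exact truncatedPath_apply Θ n ω hk
    rw [h1]
    have h2 : MeasurableSpace.comap (Θ k) inferInstance ≤ history Θ n :=
      le_iSup₂ (f := fun k (_ : k ∈ Finset.Icc 1 n) => MeasurableSpace.comap (Θ k) inferInstance)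
        k hk
    exact (comap_measurable (Θ k)).mono h2 le_rfl
  · have h1 : (fun ω => truncatedPath Θ n ω k) = fun _ => 0 := by
      funext ω; exact if_neg hk
    rw [h1]
    exact measurable_const

variable [MeasurableSpace Ω] {μ : Measure Ω} {F : ℂ → ℂ} {η σ : ℝ} {Θ : ℕ → Ω → ℝ}

lemma IsALE.history_le (h : IsALE μ F η σ Θ) (n : ℕ) : history Θ n ≤ ‹MeasurableSpace Ω› := by
  refine iSup₂_le fun k hk => ?_
  obtain ⟨j, rfl⟩ : ∃ j, k = j + 1 := ⟨k - 1, by have := (Finset.mem_Icc.1 hk).1; omega⟩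
  exact (h.measurable j).comap_le

lemma IsALE.measurable_truncatedPath (h : IsALE μ F η σ Θ) (n : ℕ) :
    Measurable (truncatedPath Θ n) :=
  (measurable_truncatedPath_history Θ n).mono (h.history_le n) le_rfl

lemma angleDensity_nonneg (F : ℂ → ℂ) (η σ : ℝ) (θ : ℕ → ℝ) (n : ℕ) (t : ℝ) :
    0 ≤ angleDensity F η σ θ n t := by
  refine div_nonneg (Real.rpow_nonneg (norm_nonneg _) _) ?_
  rw [intervalAverage_eq_integral_uniformAngle]
  exact integral_nonneg fun s => Real.rpow_nonneg (norm_nonneg _) _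

/-- The joint law of the first `n` angles and the next one. -/
lemma IsALE.map_prodMk [IsProbabilityMeasure μ] (h : IsALE μ F η σ Θ) {c : ℝ}
    (hF : IsBasicMap F c) (hσ : 0 < σ) (n : ℕ) :
    μ.map (fun ω => (truncatedPath Θ n ω, Θ (n + 1) ω)) =
      ((μ.map (truncatedPath Θ n)).prod uniformAngle).withDensity
        fun p => ENNReal.ofReal (angleDensity F η σ p.1 n p.2) := by
  have hX := h.measurable_truncatedPath n
  have hΘ := h.measurable n
  have hm := h.history_le n
  have hd := measurable_angleDensity hF η hσ n
  have hde := hd.ennreal_ofReal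
  have hpm : IsProbabilityMeasure (μ.map fun ω => (truncatedPath Θ n ω, Θ (n + 1) ω)) :=
    Measure.isProbabilityMeasure_map (hX.prodMk hΘ).aemeasurable
  have hpm2 : IsProbabilityMeasure (μ.map (truncatedPath Θ n)) :=
    Measure.isProbabilityMeasure_map hX.aemeasurable
  have hdens : ∀ ω, angleDensity F η σ (fun k => Θ k ω) n =
      angleDensity F η σ (truncatedPath Θ n ω) n := fun ω =>
    angleDensity_congr F η σ fun k hk => (truncatedPath_apply Θ n ω hk).symm
  -- the density is a.s. integrable, since its mean is `1` rather than the junk value `0`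
  have hint : ∀ᵐ ω ∂μ, Integrable (angleDensity F η σ (truncatedPath Θ n ω) n) uniformAngle := by
    have h1 := h.condProb n Set.univ MeasurableSet.univ
    simp only [Set.preimage_univ, Set.indicator_univ] at h1
    rw [condExp_const hm] at h1
    refine h1.mono fun ω hω => ?_
    have h2 : (1 : ℝ) = ∫ t, angleDensity F η σ (truncatedPath Θ n ω) n t ∂uniformAngle := by
      rw [← hdens ω]
      exact hω
    exact Integrable.of_integral_ne_zero (by rw [← h2]; exact one_ne_zero)
  refine Measure.ext_prod fun {s B} hs hB => ?_
  have hsX : MeasurableSet[history Θ n] (truncatedPath Θ n ⁻¹' s) :=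
    measurable_truncatedPath_history Θ n hs
  have hi : Integrable ((Θ (n + 1) ⁻¹' B).indicator fun _ => (1 : ℝ)) μ :=
    (integrable_const _).indicator (hΘ hB)
  have h1 := setIntegral_condExp hm hi hsX
  rw [Measure.map_apply (hX.prodMk hΘ) (hs.prod hB),
    withDensity_apply _ (hs.prod hB), ← Measure.prod_restrict,
    lintegral_prod _ hde.aemeasurable,
    setLIntegral_map hs (Measurable.lintegral_prod_right' hde) hX]
  have h2 : (fun ω => (truncatedPath Θ n ω, Θ (n + 1) ω)) ⁻¹' s ×ˢ B =
      Θ (n + 1) ⁻¹' B ∩ truncatedPath Θ n ⁻¹' s := by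
    ext ω; simp [and_comm]
  rw [h2]
  have h3 : ∫ ω in truncatedPath Θ n ⁻¹' s, (Θ (n + 1) ⁻¹' B).indicator (fun _ => (1 : ℝ)) ω ∂μ =
      μ.real (Θ (n + 1) ⁻¹' B ∩ truncatedPath Θ n ⁻¹' s) := by
    rw [integral_indicator (hΘ hB), Measure.restrict_restrict (hΘ hB)]
    simp
  have h4 : μ (Θ (n + 1) ⁻¹' B ∩ truncatedPath Θ n ⁻¹' s) =
      ENNReal.ofReal (∫ ω in truncatedPath Θ n ⁻¹' s,
        (μ[(Θ (n + 1) ⁻¹' B).indicator (fun _ => (1 : ℝ)) | history Θ n]) ω ∂μ) := by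
    rw [h1, h3, Measure.real, ENNReal.ofReal_toReal (measure_ne_top _ _)]
  have hnn : 0 ≤ᵐ[μ] μ[(Θ (n + 1) ⁻¹' B).indicator (fun _ => (1 : ℝ)) | history Θ n] :=
    condExp_nonneg (Eventually.of_forall fun ω => Set.indicator_nonneg (fun _ _ => zero_le_one) ω)
  rw [h4, ofReal_integral_eq_lintegral_ofReal integrable_condExp.integrableOn
    (ae_restrict_of_ae hnn)]
  refine lintegral_congr_ae (ae_restrict_of_ae ?_)
  filter_upwards [h.condProb n B hB, hint] with ω h5 h6
  rw [h5, intervalAverage_eq_integral_uniformAngle, hdens,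
    ofReal_integral_eq_lintegral_ofReal (h6.indicator hB)
      (Eventually.of_forall fun t =>
        Set.indicator_nonneg (fun t _ => angleDensity_nonneg F η σ _ n t) t),
    ← lintegral_indicator hB]
  refine lintegral_congr fun t => ?_
  by_cases ht : t ∈ B <;> simp [ht]

lemma IsALE.lintegral_eq [IsProbabilityMeasure μ] (h : IsALE μ F η σ Θ) {c : ℝ}
    (hF : IsBasicMap F c) (hσ : 0 < σ) (n : ℕ) {G : (ℕ → ℝ) × ℝ → ℝ≥0∞} (hG : Measurable G) :
    ∫⁻ ω, G (truncatedPath Θ n ω, Θ (n + 1) ω) ∂μ =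
      ∫⁻ ω, ∫⁻ t, ENNReal.ofReal (angleDensity F η σ (truncatedPath Θ n ω) n t) *
        G (truncatedPath Θ n ω, t) ∂uniformAngle ∂μ := by
  have hX := h.measurable_truncatedPath n
  have hΘ := h.measurable n
  have hde := (measurable_angleDensity hF η hσ n).ennreal_ofReal
  have hpm2 : IsProbabilityMeasure (μ.map (truncatedPath Θ n)) :=
    Measure.isProbabilityMeasure_map hX.aemeasurable
  rw [← lintegral_map hG (hX.prodMk hΘ), h.map_prodMk hF hσ n,
    lintegral_withDensity_eq_lintegral_mul _ hde hG, lintegral_prod _ (hde.mul hG).aemeasurable,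
    lintegral_map (Measurable.lintegral_prod_right' (hde.mul hG)) hX]
  rfl

end

section

/-! ### Moments of the stopped process -/

/-- The sequences of angles for which the derivatives of the first `n` fluctuations (those with
index less than `n`) are bounded by `δ` on the circle of radius `e ^ σ`. -/
def goodPaths (F : ℂ → ℂ) (c σ δ : ℝ) (n : ℕ) : Set (ℕ → ℝ) :=
  {θ | ∀ i < n, ∀ t, ‖diffFluctuation F c θ i (circleMap 0 (Real.exp σ) t) /
    circleMap 0 (Real.exp σ) t‖ ≤ δ}

/-- The moment `𝔼 ⨍ |Ψ_n(R e^{it})| ^ N dt` restricted to the event of good paths. The path is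
truncated because `Θ 0`, and hence the whole sequence of angles, need not be measurable. -/
noncomputable def stoppedMoment {Ω : Type*} [MeasurableSpace Ω] (μ : Measure Ω) (F : ℂ → ℂ)
    (c σ δ : ℝ) (Θ : ℕ → Ω → ℝ) (N n : ℕ) (R : ℝ) : ℝ≥0∞ :=
  ∫⁻ ω, (goodPaths F c σ δ n).indicator (fun θ => circleMoment (diffFluctuation F c θ n) N R)
    (truncatedPath Θ n ω) ∂μ

lemma mem_goodPaths_congr (F : ℂ → ℂ) (c σ δ : ℝ) {θ θ' : ℕ → ℝ} {n : ℕ}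
    (h : ∀ k ∈ Finset.Icc 1 n, θ k = θ' k) :
    θ ∈ goodPaths F c σ δ (n + 1) ↔ θ' ∈ goodPaths F c σ δ (n + 1) := by
  have : ∀ i < n + 1, diffFluctuation F c θ i = diffFluctuation F c θ' i := fun i hi =>
    diffFluctuation_congr F c fun k hk =>
      h k (Finset.Icc_subset_Icc_right (Nat.lt_succ_iff.1 hi) hk)
  simp only [goodPaths, Set.mem_ofPred_eq]
  refine forall₂_congr fun i hi => ?_
  rw [this i hi]

lemma mem_goodPaths_of_succ {F : ℂ → ℂ} {c σ δ : ℝ} {θ : ℕ → ℝ} {n : ℕ}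
    (h : θ ∈ goodPaths F c σ δ (n + 1)) : θ ∈ goodPaths F c σ δ n := fun i hi =>
  h i (hi.trans (Nat.lt_succ_self n))

lemma measurableSet_goodPaths {F : ℂ → ℂ} {c σ : ℝ} (hF : IsBasicMap F c) (hσ : 0 < σ) (δ : ℝ)
    (n : ℕ) : MeasurableSet (goodPaths F c σ δ n) := by
  have hR : 1 < Real.exp σ := Real.one_lt_exp_iff.2 hσ
  have hv : ∀ t, 1 < ‖circleMap 0 (Real.exp σ) t‖ := fun t => by
    rw [norm_circleMap_zero_of_nonneg (by linarith)]; exact hR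
  have e : goodPaths F c σ δ n = ⋂ (i : ℕ) (_ : i < n) (q : ℚ),
      {θ | ‖diffFluctuation F c θ i (circleMap 0 (Real.exp σ) q) /
        circleMap 0 (Real.exp σ) q‖ ≤ δ} := by
    ext θ
    simp only [goodPaths, Set.mem_iInter, Set.mem_ofPred_eq]
    refine forall₂_congr fun i hi => ⟨fun h q => h q, fun h t => ?_⟩
    have hc : Continuous fun t => ‖diffFluctuation F c θ i (circleMap 0 (Real.exp σ) t) /
        circleMap 0 (Real.exp σ) t‖ :=
      (((regularAtInfty_diffFluctuation hF θ i).continuous_comp_circleMap hR).div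
        (continuous_circleMap 0 _) fun t => circleMap_ne_center (by positivity)).norm
    have hclosed : IsClosed {t : ℝ | ‖diffFluctuation F c θ i (circleMap 0 (Real.exp σ) t) /
        circleMap 0 (Real.exp σ) t‖ ≤ δ} := isClosed_le hc continuous_const
    have hdense := Rat.denseRange_cast (𝕜 := ℝ)
    exact hdense.induction_on (p := fun t : ℝ =>
      ‖diffFluctuation F c θ i (circleMap 0 (Real.exp σ) t) /
        circleMap 0 (Real.exp σ) t‖ ≤ δ) t hclosed h
  rw [e]
  refine MeasurableSet.iInter fun i => MeasurableSet.iInter fun _ => MeasurableSet.iInter fun q => ?_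
  obtain ⟨g, hg, hgd⟩ := exists_measurable_diffFluctuation hF i
  simp only [hgd _ _ (hv _)]
  exact measurableSet_le (((hg.comp (measurable_id.prodMk measurable_const)).div_const _).norm)
    measurable_const

lemma measurable_circleMoment_diffFluctuation {F : ℂ → ℂ} {c : ℝ} (hF : IsBasicMap F c) (N n : ℕ)
    {R : ℝ} (hR : 1 < R) :
    Measurable fun θ => circleMoment (diffFluctuation F c θ n) N R := by
  have hv : ∀ t, 1 < ‖circleMap 0 R t‖ := fun t => by
    rw [norm_circleMap_zero_of_nonneg (by linarith)]; exact hR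
  obtain ⟨g, hg, hgd⟩ := exists_measurable_diffFluctuation hF n
  simp only [circleMoment, hgd _ _ (hv _)]
  have h1 : Measurable fun p : (ℕ → ℝ) × ℝ => ‖g (p.1, circleMap 0 R p.2)‖ₑ ^ N :=
    (hg.comp (measurable_fst.prodMk ((measurable_circleMap 0 R).comp measurable_snd))).enorm.pow_const
      N
  exact h1.lintegral_prod_right'

lemma circleMoment_congr {f g : ℂ → ℂ} {R : ℝ} (hR : 1 < R) (h : ∀ z, 1 < ‖z‖ → f z = g z) (N : ℕ) :
    circleMoment f N R = circleMoment g N R := by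
  refine lintegral_congr fun t => ?_
  rw [h _ (by rw [norm_circleMap_zero_of_nonneg (by linarith)]; exact hR)]

variable {Ω : Type*}

lemma update_truncatedPath (Θ : ℕ → Ω → ℝ) (n : ℕ) (ω : Ω) :
    Function.update (truncatedPath Θ n ω) (n + 1) (Θ (n + 1) ω) = truncatedPath Θ (n + 1) ω := by
  funext k
  by_cases hk : k = n + 1
  · subst hk
    rw [Function.update_self, truncatedPath_apply Θ _ ω (Finset.mem_Icc.2 ⟨by omega, le_rfl⟩)]
  · rw [Function.update_of_ne hk, truncatedPath, truncatedPath]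
    congr 1
    simp only [Finset.mem_Icc, eq_iff_iff]
    omega

/-- The recursive inequality for the moments of the stopped process. -/
lemma exists_stoppedMoment_succ_le (Λ Rb : ℝ) (hΛ : 0 ≤ Λ) (hRb : 1 ≤ Rb) (m : ℕ) :
    ∃ C k : ℝ, 1 ≤ C ∧ 1 ≤ k ∧ ∀ (c : ℝ) (F : ℂ → ℂ), c ≤ 1 → IsBasicMap F c →
      HasRegularity F c Λ → ∀ (ρ r : ℝ), 1 < ρ →
      ρ - 1 ≤ (r - 1) / 2 → r ≤ Rb → k * √c ≤ r - 1 →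
      ∀ η σ δ b : ℝ, 0 ≤ η → η ≤ 1 → 0 ≤ δ → δ ≤ 1 / 8 → 0 ≤ b → b < c → c ≤ σ →
      c * η * (1 + Real.exp (2 * (b - σ))) ≤ 1 - Real.exp (-(2 * (c - b))) →
      ∀ Z M κ : ℝ, 0 < Z → 0 < M → (1 + Z) * (c / (r - 1) ^ 2) ≤ M →
      C * (((δ ^ 2 + δ * Z) * (c * (1 - Real.log c) / (r - 1)) +
          δ * (c * √c * (1 - Real.log c) / (r - 1) ^ 2)) / M +
        c ^ 2 / (r - 1) ^ 3 * (1 + Z) ^ 2 / M ^ 2) ≤ κ →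
      ∀ (Ω : Type*) [MeasurableSpace Ω] (μ : Measure Ω) [IsProbabilityMeasure μ]
        (Θ : ℕ → Ω → ℝ), IsALE μ F η σ Θ → ∀ n : ℕ,
      stoppedMoment μ F c σ δ Θ (2 * m + 2) (n + 1) r ≤
        ENNReal.ofReal (1 + κ) * stoppedMoment μ F c σ δ Θ (2 * m + 2) n (Real.exp b * r) +
        ENNReal.ofReal (κ * M ^ (2 * m + 2)) * (1 + ENNReal.ofReal (Z⁻¹ ^ (2 * m + 2)) *
          stoppedMoment μ F c σ δ Θ (2 * m + 2) n ρ) := by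
  obtain ⟨C, k, hC, hk, H⟩ := exists_one_step_circleMoment_le Λ Rb 115 hΛ hRb (by norm_num) m
  refine ⟨C, k, hC, hk, ?_⟩
  intro c F hc1 hF hreg ρ r hρ hρr hrR hkr η σ δ b hη0 hη1 hδ0 hδ1 hb0 hbc hcσ hpos Z M κ hZ hM
    hMle hκ Ω _ μ _ Θ hΘ n
  have hc := hF.capacity_pos
  have hr1 : 1 < r := by linarith
  have hbr : 1 < Real.exp b * r := by nlinarith [Real.add_one_le_exp b]
  have hσ : 0 < σ := by linarith
  set N := 2 * m + 2 with hN
  set S := goodPaths F c σ δ with hS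
  have hX := hΘ.measurable_truncatedPath
  have hSm : ∀ n, MeasurableSet (S n) := fun n => measurableSet_goodPaths hF hσ δ n
  set Q : (ℕ → ℝ) → ℝ≥0∞ := fun θ => circleMoment (diffFluctuation F c θ (n + 1)) N r with hQ
  have hQm : Measurable Q := measurable_circleMoment_diffFluctuation hF N (n + 1) hr1
  have hupd : Measurable fun p : (ℕ → ℝ) × ℝ => Function.update p.1 (n + 1) p.2 := by
    refine measurable_pi_lambda _ fun k => ?_
    by_cases hk : k = n + 1
    · subst hk
      simpa using measurable_snd
    · simp only [Function.update_of_ne hk]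
      exact (measurable_pi_apply k).comp measurable_fst
  set G : (ℕ → ℝ) × ℝ → ℝ≥0∞ := fun p =>
    (S (n + 1)).indicator 1 p.1 * Q (Function.update p.1 (n + 1) p.2) with hG
  have hGm : Measurable G := ((measurable_one.indicator (hSm _)).comp measurable_fst).mul
    (hQm.comp hupd)
  have e1 : stoppedMoment μ F c σ δ Θ N (n + 1) r =
      ∫⁻ ω, G (truncatedPath Θ n ω, Θ (n + 1) ω) ∂μ := by
    refine lintegral_congr fun ω => ?_
    have h1 : truncatedPath Θ n ω ∈ S (n + 1) ↔ truncatedPath Θ (n + 1) ω ∈ S (n + 1) :=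
      mem_goodPaths_congr F c σ δ fun k hk => by
        rw [truncatedPath_apply Θ n ω hk, truncatedPath_apply Θ (n + 1) ω
          (Finset.Icc_subset_Icc_right (Nat.le_succ n) hk)]
    simp only [hG, update_truncatedPath, ← hS]
    by_cases h2 : truncatedPath Θ (n + 1) ω ∈ S (n + 1)
    · rw [Set.indicator_of_mem h2, Set.indicator_of_mem (h1.2 h2), Pi.one_apply, one_mul]
    · rw [Set.indicator_of_notMem h2, Set.indicator_of_notMem (fun h => h2 (h1.1 h)), zero_mul]
  -- Condition on the first `n` angles; whether the path is good up to step `n + 1` depends only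
  -- on these.
  rw [e1, hΘ.lintegral_eq hF hσ n hGm]
  set A : (ℕ → ℝ) → ℝ≥0∞ := (S n).indicator fun θ =>
    circleMoment (diffFluctuation F c θ n) N (Real.exp b * r) with hA
  set B : (ℕ → ℝ) → ℝ≥0∞ := (S n).indicator fun θ =>
    circleMoment (diffFluctuation F c θ n) N ρ with hB
  have hAm : Measurable A :=
    (measurable_circleMoment_diffFluctuation hF N n hbr).indicator (hSm n)
  have hpt : ∀ θ : ℕ → ℝ, ∫⁻ t, ENNReal.ofReal (angleDensity F η σ θ n t) * G (θ, t)
      ∂uniformAngle ≤ ENNReal.ofReal (1 + κ) * A θ +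
        ENNReal.ofReal (κ * M ^ N) * (1 + ENNReal.ofReal (Z⁻¹ ^ N) * B θ) := by
    intro θ
    by_cases hθ : θ ∈ S (n + 1)
    · have hθn : θ ∈ S n := mem_goodPaths_of_succ hθ
      have hw := hθ n (Nat.lt_succ_self n)
      obtain ⟨d1, d2, d3, d4⟩ := angleDensity_bounds hF θ n hη0 hη1 hσ hδ1 hw
      have key := H c F hc1 hF hreg (diffFluctuation F c θ n)
        (regularAtInfty_diffFluctuation hF θ n) ρ r hρ hρr hrR hkr η σ δ b hη0 hη1 hδ0
        (by linarith) hb0 hbc hcσ hpos hw _ d1 d2 d3 d4 Z M κ hZ hM hMle hκ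
      rw [hA, hB, Set.indicator_of_mem hθn, Set.indicator_of_mem hθn]
      refine le_trans (le_of_eq (lintegral_congr fun t => ?_)) key
      simp only [hG, Set.indicator_of_mem hθ, Pi.one_apply, one_mul, hQ]
      congr 1
      refine circleMoment_congr hr1 (fun z hz => ?_) N
      rw [diffFluctuation_succ hF _ n hz, Function.update_self,
        diffFluctuation_congr F c (θ' := θ) fun k hk => Function.update_of_ne (by
          have := (Finset.mem_Icc.1 hk).2
          omega) _ _]
    · have h0 : ∀ t, ENNReal.ofReal (angleDensity F η σ θ n t) * G (θ, t) = 0 := fun t => by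
        simp only [hG, Set.indicator_of_notMem hθ, zero_mul, mul_zero]
      simp only [h0, lintegral_zero]
      exact zero_le
  calc _ ≤ ∫⁻ ω, (ENNReal.ofReal (1 + κ) * A (truncatedPath Θ n ω) +
        ENNReal.ofReal (κ * M ^ N) * (1 + ENNReal.ofReal (Z⁻¹ ^ N) *
          B (truncatedPath Θ n ω))) ∂μ := lintegral_mono fun ω => hpt _
    _ = _ := by
      have hAX : Measurable fun ω => ENNReal.ofReal (1 + κ) * A (truncatedPath Θ n ω) :=
        (hAm.comp (hX n)).const_mul _
      rw [lintegral_add_left hAX,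
        lintegral_const_mul' _ _ ENNReal.ofReal_ne_top,
        lintegral_const_mul' _ _ ENNReal.ofReal_ne_top, lintegral_add_left measurable_const,
        lintegral_const_mul' _ _ ENNReal.ofReal_ne_top]
      simp [stoppedMoment, hA, hB, hS]

lemma stoppedMoment_zero [MeasurableSpace Ω] (μ : Measure Ω) (F : ℂ → ℂ) (c σ δ : ℝ)
    (Θ : ℕ → Ω → ℝ) {N : ℕ} (hN : N ≠ 0) (R : ℝ) : stoppedMoment μ F c σ δ Θ N 0 R = 0 := by
  have : ∀ θ, circleMoment (diffFluctuation F c θ 0) N R = 0 := fun θ => by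
    simp [circleMoment, diffFluctuation_zero, hN]
  simp [stoppedMoment, this]

/-- A deterministic bound gives a bound for the moments. -/
lemma stoppedMoment_le_of_forall_norm_le [MeasurableSpace Ω] (μ : Measure Ω)
    [IsProbabilityMeasure μ] {F : ℂ → ℂ} (c σ δ : ℝ) (Θ : ℕ → Ω → ℝ) (N n : ℕ) {R Z : ℝ}
    (hR : 0 ≤ R) (h : ∀ θ z, ‖z‖ = R → ‖diffFluctuation F c θ n z‖ ≤ Z) :
    stoppedMoment μ F c σ δ Θ N n R ≤ ENNReal.ofReal Z ^ N := by
  have h1 : ∀ θ, circleMoment (diffFluctuation F c θ n) N R ≤ ENNReal.ofReal Z ^ N := fun θ => by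
    refine (lintegral_mono (g := fun _ => ENNReal.ofReal Z ^ N) fun t => ?_).trans (by simp)
    have := h θ (circleMap 0 R t) (norm_circleMap_zero_of_nonneg hR t)
    simp only [← ofReal_norm]
    exact pow_le_pow_left' (ENNReal.ofReal_le_ofReal this) N
  refine (lintegral_mono (g := fun _ => ENNReal.ofReal Z ^ N) fun ω => ?_).trans (by simp)
  exact (Set.indicator_le_self _ _ _).trans (h1 _)

lemma mem_goodPaths_of_le_exitTime {F : ℂ → ℂ} {c σ δ : ℝ} (hδ : 0 ≤ δ)
    {θ : ℕ → ℝ} {n : ℕ} (h : (n : ℕ∞) ≤ exitTime F c σ δ θ) : θ ∈ goodPaths F c σ δ n := by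
  intro i hi t
  have hv0 : ∀ t, circleMap 0 (Real.exp σ) t ≠ 0 := fun t => circleMap_ne_center (by positivity)
  rw [diffFluctuation, mul_div_cancel_left₀ _ (hv0 t)]
  have h1 : ¬ ENNReal.ofReal δ < supNorm (deriv (fluctuation F c θ i)) (Real.exp σ) := fun hcon => by
    have h2 : exitTime F c σ δ θ ≤ i := iInf₂_le i hcon
    have h3 : n ≤ i := by exact_mod_cast h.trans h2
    omega
  rw [not_lt, supNorm] at h1
  set s := toIcoMod Real.two_pi_pos 0 t with hs
  have hs1 : s ∈ Set.Ico 0 (2 * Real.pi) := by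
    have := toIcoMod_mem_Ico Real.two_pi_pos 0 t
    rwa [zero_add] at this
  have hs2 : circleMap 0 (Real.exp σ) t = circleMap 0 (Real.exp σ) s := by
    have : s = t - toIcoDiv Real.two_pi_pos 0 t • (2 * Real.pi) := rfl
    rw [this]
    exact ((periodic_circleMap 0 (Real.exp σ)).sub_zsmul_eq _).symm
  have h4 := (le_iSup₂ (f := fun t (_ : t ∈ Set.Ico 0 (2 * Real.pi)) =>
    ‖deriv (fluctuation F c θ i) (circleMap 0 (Real.exp σ) t)‖ₑ) s hs1).trans h1
  rw [← ofReal_norm, ENNReal.ofReal_le_ofReal_iff hδ] at h4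
  rw [hs2]
  exact h4

/-- The norms of the stopped process are controlled by the moments over good paths. -/
lemma tripleNorm_stoppedDiffFluctuation_le [MeasurableSpace Ω] (μ : Measure Ω)
    (F : ℂ → ℂ) (c σ : ℝ) {δ : ℝ} (hδ : 0 ≤ δ) (Θ : ℕ → Ω → ℝ) {N : ℕ} (hN : N ≠ 0) (n : ℕ)
    (R : ℝ) :
    tripleNorm μ N R (stoppedDiffFluctuation F c σ δ Θ n) ≤
      stoppedMoment μ F c σ δ Θ N n R ^ (1 / (N : ℝ)) := by
  refine ENNReal.rpow_le_rpow (lintegral_mono fun ω => ?_) (by positivity)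
  rw [laverage_Ico_eq_lintegral_uniformAngle]
  simp only [ENNReal.rpow_natCast, stoppedDiffFluctuation]
  by_cases hω : (n : ℕ∞) ≤ exitTime F c σ δ (fun k => Θ k ω)
  · have h1 := mem_goodPaths_of_le_exitTime hδ hω
    have hcongr : ∀ k ∈ Finset.Icc 1 n, Θ k ω = truncatedPath Θ n ω k := fun k hk =>
      (truncatedPath_apply Θ n ω hk).symm
    have h2 : truncatedPath Θ n ω ∈ goodPaths F c σ δ n := by
      intro i hi
      have := h1 i hi
      rwa [diffFluctuation_congr F c (θ' := truncatedPath Θ n ω) fun k hk =>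
        hcongr k (Finset.Icc_subset_Icc_right hi.le hk)] at this
    rw [Set.indicator_of_mem h2, ← diffFluctuation_congr F c hcongr]
    refine le_of_eq (lintegral_congr fun t => ?_)
    rw [Set.indicator_of_mem (by exact hω)]
  · have h0 : ∀ t, ‖({ω | (n : ℕ∞) ≤ exitTime F c σ δ (fun k => Θ k ω)}.indicator
        (fun ω => diffFluctuation F c (fun k => Θ k ω) n) ω) (circleMap 0 R t)‖ₑ ^ N = 0 :=
        fun t => by
      rw [Set.indicator_of_notMem (by exact hω)]
      simp [hN]
    simp only [h0, lintegral_zero]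
    exact zero_le

end

/-! ### Iteration over the steps of the process -/

/-- A discrete Gronwall inequality, with the same coefficients in the linear and inhomogeneous
terms. -/
lemma le_of_gronwall {x : ℕ → ℝ≥0∞} {κ : ℕ → ℝ} {A : ℝ} {n : ℕ} (hA : 0 ≤ A)
    (hκ : ∀ j < n, 0 ≤ κ j) (h0 : x 0 = 0)
    (h : ∀ j < n, x (j + 1) ≤ ENNReal.ofReal (1 + κ j) * x j + ENNReal.ofReal (κ j * A)) :
    x n ≤ ENNReal.ofReal (A * (Real.exp (∑ j ∈ Finset.range n, κ j) - 1)) := by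
  have key : ∀ j ≤ n, 0 ≤ ∑ i ∈ Finset.range j, κ i ∧
      x j ≤ ENNReal.ofReal (A * (Real.exp (∑ i ∈ Finset.range j, κ i) - 1)) := by
    intro j
    induction j with
    | zero => intro _; simp [h0]
    | succ j ih =>
      intro hj
      obtain ⟨h1, h2⟩ := ih (by omega)
      have hk := hκ j (by omega)
      rw [Finset.sum_range_succ]
      refine ⟨by positivity, ?_⟩
      set s := ∑ i ∈ Finset.range j, κ i with hs
      have h3 : 0 ≤ Real.exp s - 1 := by linarith [Real.add_one_le_exp s]
      calc x (j + 1) ≤ ENNReal.ofReal (1 + κ j) * x j + ENNReal.ofReal (κ j * A) := h j (by omega)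
        _ ≤ ENNReal.ofReal (1 + κ j) * ENNReal.ofReal (A * (Real.exp s - 1)) +
            ENNReal.ofReal (κ j * A) := by gcongr
        _ = ENNReal.ofReal ((1 + κ j) * (A * (Real.exp s - 1)) + κ j * A) := by
            rw [← ENNReal.ofReal_mul (by positivity), ← ENNReal.ofReal_add (by positivity)
              (by positivity)]
        _ ≤ _ := by
            refine ENNReal.ofReal_le_ofReal ?_
            have h4 : (1 + κ j) * Real.exp s ≤ Real.exp (s + κ j) := by
              rw [Real.exp_add, mul_comm]
              gcongr
              linarith [Real.add_one_le_exp (κ j)]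
            have h5 := mul_le_mul_of_nonneg_left h4 hA
            linarith
  exact (key n le_rfl).2

/-- From an a priori bound `Z` for the moments on the circle of radius `(1 + r) / 2`, a bound on
the circle of radius `r`. The sums `s₁`, `s₂`, `s₃` collect the errors of the steps; they are taken
along the radii `r e^{b i}`, since the drift operator gains a factor `e^b` in the radius. -/
lemma exists_stoppedMoment_le_of_inner (Λ T : ℝ) (hΛ : 0 ≤ Λ) (hT : 0 ≤ T) (m : ℕ) :
    ∃ C k : ℝ, 1 ≤ C ∧ 1 ≤ k ∧ ∀ (c : ℝ) (F : ℂ → ℂ), c ≤ 1 → IsBasicMap F c →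
      HasRegularity F c Λ → ∀ r : ℝ, r ≤ 2 → k * √c ≤ r - 1 →
      ∀ η σ δ b : ℝ, 0 ≤ η → η ≤ 1 → 0 ≤ δ → δ ≤ 1 / 8 → 0 ≤ b → b < c → c ≤ σ →
      c * η * (1 + Real.exp (2 * (b - σ))) ≤ 1 - Real.exp (-(2 * (c - b))) →
      ∀ (Ω : Type*) [MeasurableSpace Ω] (μ : Measure Ω) [IsProbabilityMeasure μ]
        (Θ : ℕ → Ω → ℝ), IsALE μ F η σ Θ → ∀ n : ℕ, (n : ℝ) ≤ T / c →
      ∀ s₁ s₂ s₃ Z : ℝ, 0 < Z →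
      ∑ i ∈ Finset.range n, c / (r * Real.exp (b * i) - 1) ≤ s₁ →
      ∑ i ∈ Finset.range n, c / (r * Real.exp (b * i) - 1) ^ 2 ≤ s₂ →
      ∑ i ∈ Finset.range n, c ^ 2 / (r * Real.exp (b * i) - 1) ^ 3 ≤ s₃ →
      c ^ 2 / (r - 1) ^ 4 ≤ s₃ →
      (∀ j : ℕ, (j : ℝ) ≤ T / c → stoppedMoment μ F c σ δ Θ (2 * m + 2) j (1 + (r - 1) / 2) ≤
        ENNReal.ofReal Z ^ (2 * m + 2)) →
      stoppedMoment μ F c σ δ Θ (2 * m + 2) n r ≤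
        ENNReal.ofReal (C * (√s₃ * (1 + Z) + (δ ^ 2 + δ * Z) * ((1 - Real.log c) * s₁) +
          δ * (√c * (1 - Real.log c) * s₂))) ^ (2 * m + 2) := by
  have hRb : 1 ≤ 2 * Real.exp T := by
    have := Real.one_le_exp hT
    linarith
  obtain ⟨C, k, hC, hk, H⟩ := exists_stoppedMoment_succ_le Λ (2 * Real.exp T) hΛ hRb m
  set N := 2 * m + 2 with hN
  have hD1 : 1 ≤ 2 * Real.exp (2 * C) := by
    have := Real.one_le_exp (show 0 ≤ 2 * C by linarith)
    linarith
  refine ⟨2 * Real.exp (2 * C), k, hD1, hk, ?_⟩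
  intro c F hc1 hF hreg r hr2 hkr η σ δ b hη0 hη1 hδ0 hδ1 hb0 hbc hcσ hpos Ω _ μ _ Θ hΘ n hn
    s₁ s₂ s₃ Z hZ hs1 hs2 hs3 hs4 hin
  have hc := hF.capacity_pos
  have hsc : 0 < √c := Real.sqrt_pos.2 hc
  have hy0 : 0 < r - 1 := lt_of_lt_of_le (by positivity) hkr
  set Lg := 1 - Real.log c with hLg
  have hLg1 : 1 ≤ Lg := by linarith [Real.log_nonpos hc.le hc1]
  have hexp1 : ∀ i : ℕ, 1 ≤ Real.exp (b * i) := fun i => Real.one_le_exp (by positivity)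
  have hyi : ∀ i : ℕ, r - 1 ≤ r * Real.exp (b * i) - 1 := fun i => by
    nlinarith [hexp1 i]
  have hyi0 : ∀ i : ℕ, 0 < r * Real.exp (b * i) - 1 := fun i => hy0.trans_le (hyi i)
  have hs10 : 0 ≤ s₁ := le_trans (Finset.sum_nonneg fun i _ => by
    have := hyi0 i; positivity) hs1
  have hs20 : 0 ≤ s₂ := le_trans (Finset.sum_nonneg fun i _ => by
    have := hyi0 i; positivity) hs2
  have hs30 : 0 < s₃ := lt_of_lt_of_le (by positivity) hs4
  -- Measured in units of this `M`, the coefficients of all the steps together sum to `O(1)`.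
  set M := √s₃ * (1 + Z) + (δ ^ 2 + δ * Z) * (Lg * s₁) + δ * (√c * Lg * s₂) with hM
  have hM1 : 0 ≤ (δ ^ 2 + δ * Z) * (Lg * s₁) + δ * (√c * Lg * s₂) := by positivity
  have hM2 : 0 < √s₃ * (1 + Z) := by positivity
  have hM0 : 0 < M := by linarith
  have hM3 : √s₃ * (1 + Z) ≤ M := by linarith
  have hcs3 : c / (r - 1) ^ 2 ≤ √s₃ := by
    apply Real.le_sqrt_of_sq_le
    refine le_trans (le_of_eq ?_) hs4
    field_simp
  set f : ℕ → ℝ := fun i => C * (((δ ^ 2 + δ * Z) * (c * Lg / (r * Real.exp (b * i) - 1)) +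
      δ * (c * √c * Lg / (r * Real.exp (b * i) - 1) ^ 2)) / M +
        c ^ 2 / (r * Real.exp (b * i) - 1) ^ 3 * (1 + Z) ^ 2 / M ^ 2) with hf
  have hf0 : ∀ i, 0 ≤ f i := fun i => by
    have := hyi0 i
    positivity
  have hfsum : ∑ i ∈ Finset.range n, f i ≤ 2 * C := by
    have e : ∑ i ∈ Finset.range n, f i =
        C * (((δ ^ 2 + δ * Z) * (Lg * ∑ i ∈ Finset.range n, c / (r * Real.exp (b * i) - 1)) +
          δ * (√c * Lg * ∑ i ∈ Finset.range n, c / (r * Real.exp (b * i) - 1) ^ 2)) / M +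
          (∑ i ∈ Finset.range n, c ^ 2 / (r * Real.exp (b * i) - 1) ^ 3) * (1 + Z) ^ 2 / M ^ 2) := by
      simp only [Finset.mul_sum, Finset.sum_mul, Finset.sum_div, ← Finset.sum_add_distrib]
      refine Finset.sum_congr rfl fun i _ => ?_
      simp only [hf]
      ring
    rw [e]
    have e1 : ((δ ^ 2 + δ * Z) * (Lg * ∑ i ∈ Finset.range n, c / (r * Real.exp (b * i) - 1)) +
          δ * (√c * Lg * ∑ i ∈ Finset.range n, c / (r * Real.exp (b * i) - 1) ^ 2)) / M ≤ 1 := by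
      rw [div_le_one hM0]
      have : (δ ^ 2 + δ * Z) * (Lg * ∑ i ∈ Finset.range n, c / (r * Real.exp (b * i) - 1)) ≤
        (δ ^ 2 + δ * Z) * (Lg * s₁) := by gcongr
      have : δ * (√c * Lg * ∑ i ∈ Finset.range n, c / (r * Real.exp (b * i) - 1) ^ 2) ≤
        δ * (√c * Lg * s₂) := by gcongr
      linarith
    have e2 : (∑ i ∈ Finset.range n, c ^ 2 / (r * Real.exp (b * i) - 1) ^ 3) * (1 + Z) ^ 2 /
        M ^ 2 ≤ 1 := by
      rw [div_le_one (by positivity)]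
      calc _ ≤ s₃ * (1 + Z) ^ 2 := by gcongr
        _ = (√s₃ * (1 + Z)) ^ 2 := by rw [mul_pow, Real.sq_sqrt hs30.le]
        _ ≤ M ^ 2 := by gcongr
    calc _ ≤ C * (1 + 1) := by gcongr
      _ = 2 * C := by ring
  -- The radius shrinks by `e ^ b` at each step, from `r e ^ (b n)` at time `0` to `r` at time `n`.
  have hstep := le_of_gronwall (x := fun j => stoppedMoment μ F c σ δ Θ N j
      (r * Real.exp (b * ((n : ℝ) - j)))) (κ := fun j => f (n - 1 - j)) (A := 2 * M ^ N) (n := n)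
    (by positivity) (fun j _ => hf0 _) (stoppedMoment_zero μ F c σ δ Θ (by omega) _)
    (fun j hj => by
      have hcast : ((n - 1 - j : ℕ) : ℝ) = (n : ℝ) - ((j + 1 : ℕ) : ℝ) := by
        rw [Nat.sub_sub, add_comm 1 j, Nat.cast_sub (by omega)]
      have hcn : c * n ≤ T := by rwa [le_div_iff₀' hc] at hn
      have hjn : ((n - 1 - j : ℕ) : ℝ) ≤ n := by exact_mod_cast (by omega : n - 1 - j ≤ n)
      have hupper : r * Real.exp (b * (n - 1 - j : ℕ)) ≤ 2 * Real.exp T := by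
        have h1 : b * ((n - 1 - j : ℕ) : ℝ) ≤ T := by
          calc b * ((n - 1 - j : ℕ) : ℝ) ≤ c * n := by gcongr
            _ ≤ T := hcn
        gcongr
      have hjT : (j : ℝ) ≤ T / c := le_trans (by exact_mod_cast hj.le) hn
      have key := H c F hc1 hF hreg (1 + (r - 1) / 2) (r * Real.exp (b * (n - 1 - j : ℕ)))
        (by linarith) (by linarith [hyi (n - 1 - j)]) hupper (hkr.trans (hyi _)) η σ δ b hη0 hη1
        hδ0 hδ1 hb0 hbc hcσ hpos Z M (f (n - 1 - j)) hZ hM0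
        (by
          have h2 : c / (r * Real.exp (b * (n - 1 - j : ℕ)) - 1) ^ 2 ≤ c / (r - 1) ^ 2 := by
            have := hyi (n - 1 - j)
            gcongr
          calc _ ≤ (1 + Z) * √s₃ := by
                gcongr
                exact h2.trans hcs3
            _ ≤ M := by linarith) le_rfl Ω μ Θ hΘ j
      rw [hcast] at key
      have e3 : Real.exp b * (r * Real.exp (b * ((n : ℝ) - ((j + 1 : ℕ) : ℝ)))) =
          r * Real.exp (b * ((n : ℝ) - j)) := by
        rw [mul_left_comm, ← Real.exp_add]
        congr 2
        push_cast
        ring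
      rw [e3] at key
      refine key.trans (add_le_add_right ?_ _)
      have h3 : ENNReal.ofReal (Z⁻¹ ^ N) * stoppedMoment μ F c σ δ Θ N j (1 + (r - 1) / 2) ≤ 1 := by
        calc _ ≤ ENNReal.ofReal (Z⁻¹ ^ N) * ENNReal.ofReal Z ^ N := by
              gcongr
              exact hin j hjT
          _ = 1 := by
              rw [← ENNReal.ofReal_pow hZ.le, ← ENNReal.ofReal_mul (by positivity), ← mul_pow,
                inv_mul_cancel₀ hZ.ne', one_pow, ENNReal.ofReal_one]
      calc _ ≤ ENNReal.ofReal (f (n - 1 - j) * M ^ N) * (1 + 1) := by gcongr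
        _ = ENNReal.ofReal (f (n - 1 - j) * (2 * M ^ N)) := by
          rw [one_add_one_eq_two, ← ENNReal.ofReal_ofNat 2, ← ENNReal.ofReal_mul
            (mul_nonneg (hf0 _) (by positivity))]
          congr 1
          ring)
  simp only [sub_self, mul_zero, Real.exp_zero, mul_one] at hstep
  rw [Finset.sum_range_reflect f n] at hstep
  refine hstep.trans ?_
  rw [← ENNReal.ofReal_pow (by positivity)]
  refine ENNReal.ofReal_le_ofReal ?_
  rw [mul_pow]
  have h5 : Real.exp (∑ i ∈ Finset.range n, f i) - 1 ≤ Real.exp (2 * C) := by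
    have := Real.exp_le_exp.2 hfsum
    linarith
  have h6 : 2 * Real.exp (2 * C) ≤ (2 * Real.exp (2 * C)) ^ N := le_self_pow₀ hD1 (by omega)
  calc 2 * M ^ N * (Real.exp (∑ i ∈ Finset.range n, f i) - 1) ≤
      2 * M ^ N * Real.exp (2 * C) := by gcongr
    _ = 2 * Real.exp (2 * C) * M ^ N := by ring
    _ ≤ _ := by gcongr

/-- Improvement of a crude bound `C₀ / y` by iteration over halved values of `y`: `i` steps replace
it by `a y + Q ^ i / y`, up to constants. `Bd y Z` is to be read as "`Z` is a bound at `y`". -/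
lemma iterate_bound {Bd : ℝ → ℝ → Prop} {a : ℝ → ℝ} {C C₀ Q y₀ : ℝ} (hC : 1 ≤ C) (hC₀ : 1 ≤ C₀)
    (hQ : 0 < Q) (hQ1 : Q ≤ 1) (hy₀ : 0 < y₀)
    (hmono : ∀ y Z Z', Z ≤ Z' → Bd y Z → Bd y Z')
    (ha : ∀ y, 0 < y → 0 ≤ a y ∧ a (y / 2) ≤ 8 * a y)
    (h0 : ∀ y, y₀ ≤ y → y ≤ 1 → Bd y (C₀ / y))
    (hstep : ∀ y Z, y₀ ≤ y → y ≤ 1 → 0 < Z → Bd (y / 2) Z → Bd y (C * (a y + Q * Z))) :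
    ∀ (i : ℕ) (y : ℝ), y₀ * 2 ^ i ≤ y → y ≤ 1 → Bd y ((9 * C) ^ i * C₀ * (a y + Q ^ i / y)) := by
  intro i
  induction i with
  | zero =>
    intro y hy hy1
    rw [pow_zero, mul_one] at hy
    refine hmono y _ _ ?_ (h0 y hy hy1)
    have := (ha y (by linarith)).1
    rw [pow_zero, pow_zero, one_mul, mul_add, mul_one_div]
    have h1 : 0 ≤ C₀ * a y := by positivity
    linarith
  | succ i ih =>
    intro y hy hy1
    rw [pow_succ] at hy
    have hyy : y₀ ≤ y := by
      have : (1 : ℝ) ≤ 2 ^ i := one_le_pow₀ one_le_two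
      nlinarith
    have hyp : 0 < y := by linarith
    have hay := (ha y hyp).1
    have ha2 := (ha (y / 2) (by linarith)).1
    have h1 := ih (y / 2) (by linarith) (by linarith)
    set D := (9 * C) ^ i * C₀ with hD
    have hD1 : 1 ≤ D := one_le_mul_of_one_le_of_one_le (one_le_pow₀ (by linarith)) hC₀
    have hZ : 0 < D * (a (y / 2) + Q ^ i / (y / 2)) := by positivity
    refine hmono y _ _ ?_ (hstep y _ hyy hy1 hZ h1)
    have e1 : D * (a (y / 2) + Q ^ i / (y / 2)) ≤ D * (8 * a y + 2 * (Q ^ i / y)) := by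
      have : Q ^ i / (y / 2) = 2 * (Q ^ i / y) := by field_simp
      rw [this]
      gcongr
      exact (ha y hyp).2
    have e2 : Q * (D * (8 * a y + 2 * (Q ^ i / y))) ≤ D * (8 * a y) + D * (2 * (Q ^ (i + 1) / y)) := by
      have e3 : Q * (D * (8 * a y)) ≤ 1 * (D * (8 * a y)) := by gcongr
      have e4 : Q * (D * (2 * (Q ^ i / y))) = D * (2 * (Q ^ (i + 1) / y)) := by
        rw [pow_succ]; ring
      linarith
    have e5 : 0 ≤ Q ^ (i + 1) / y := by positivity
    have e6 : (9 * C) ^ (i + 1) * C₀ = 9 * C * D := by rw [hD, pow_succ]; ring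
    rw [e6]
    have e7 : a y ≤ D * a y := le_mul_of_one_le_left hay hD1
    have e8 := mul_le_mul_of_nonneg_left e1 hQ.le
    have e9 : 0 ≤ D * (Q ^ (i + 1) / y) := by positivity
    calc C * (a y + Q * (D * (a (y / 2) + Q ^ i / (y / 2)))) ≤
        C * (9 * D * (a y + Q ^ (i + 1) / y)) := by
          gcongr
          linarith
      _ = _ := by ring

section

/-- The bound obtained by iterating `exists_stoppedMoment_le_of_inner` over the circles of radius
`1 + y / 2 ^ i`, when its right side is at most `C D (a y + Q Z)`. -/
lemma exists_stoppedMoment_le_iterate (Λ T : ℝ) (hΛ : 0 ≤ Λ) (hT : 0 ≤ T) (m : ℕ) :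
    ∃ C k : ℝ, 1 ≤ C ∧ 1 ≤ k ∧ ∀ (c : ℝ) (F : ℂ → ℂ), c ≤ 1 → IsBasicMap F c →
      HasRegularity F c Λ →
      ∀ η σ δ b : ℝ, 0 ≤ η → η ≤ 1 → 0 ≤ δ → δ ≤ 1 / 8 → 0 ≤ b → b < c → c ≤ σ →
      c * η * (1 + Real.exp (2 * (b - σ))) ≤ 1 - Real.exp (-(2 * (c - b))) →
      ∀ (Ω : Type*) [MeasurableSpace Ω] (μ : Measure Ω) [IsProbabilityMeasure μ]
        (Θ : ℕ → Ω → ℝ), IsALE μ F η σ Θ →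
      ∀ (y₀ D Q : ℝ) (s₁ s₂ s₃ a : ℝ → ℝ), 0 < y₀ → k * √c ≤ y₀ → 1 ≤ D → 0 < Q → Q ≤ 1 →
      (∀ y, 0 < y → 0 ≤ a y ∧ a (y / 2) ≤ 8 * a y) →
      (∀ y, y₀ ≤ y → y ≤ 1 → ∀ n : ℕ, (n : ℝ) ≤ T / c →
        ∑ i ∈ Finset.range n, c / ((1 + y) * Real.exp (b * i) - 1) ≤ s₁ y ∧
        ∑ i ∈ Finset.range n, c / ((1 + y) * Real.exp (b * i) - 1) ^ 2 ≤ s₂ y ∧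
        ∑ i ∈ Finset.range n, c ^ 2 / ((1 + y) * Real.exp (b * i) - 1) ^ 3 ≤ s₃ y) →
      (∀ y, y₀ ≤ y → y ≤ 1 → c ^ 2 / y ^ 4 ≤ s₃ y ∧
        √(s₃ y) + δ ^ 2 * ((1 - Real.log c) * s₁ y) + δ * (√c * (1 - Real.log c) * s₂ y) ≤
          D * a y ∧
        √(s₃ y) + δ * ((1 - Real.log c) * s₁ y) ≤ D * Q) →
      ∀ (K n : ℕ), (n : ℝ) ≤ T / c → ∀ y, y₀ * 2 ^ K ≤ y → y ≤ 1 →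
      stoppedMoment μ F c σ δ Θ (2 * m + 2) n (1 + y) ≤
        ENNReal.ofReal ((C * D) ^ K * C * (a y + Q ^ K / y)) ^ (2 * m + 2) := by
  obtain ⟨C₁, k, hC₁, hk, H⟩ := exists_stoppedMoment_le_of_inner Λ T hΛ hT m
  obtain ⟨C₀, hC₀, H₀⟩ := exists_norm_diffFluctuation_le Λ T hΛ hT
  refine ⟨max (9 * C₁) C₀, k, le_max_of_le_right hC₀, hk, ?_⟩
  intro c F hc1 hF hreg η σ δ b hη0 hη1 hδ0 hδ1 hb0 hbc hcσ hpos Ω _ μ _ Θ hΘ y₀ D Q s₁ s₂ s₃ a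
    hy₀ hky₀ hD hQ hQ1 ha hsum hs K n hn y hy hy1
  have hC₁' : 0 ≤ C₁ := by linarith
  have key := iterate_bound (Bd := fun y Z => ∀ j : ℕ, (j : ℝ) ≤ T / c →
      stoppedMoment μ F c σ δ Θ (2 * m + 2) j (1 + y) ≤ ENNReal.ofReal Z ^ (2 * m + 2))
    (C := C₁ * D) (one_le_mul_of_one_le_of_one_le hC₁ hD) hC₀ hQ hQ1 hy₀
    (fun y Z Z' hZ h j hj => (h j hj).trans (by gcongr)) ha
    (fun y hy hy1 j hj => stoppedMoment_le_of_forall_norm_le μ c σ δ Θ _ j (by linarith)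
      fun θ z hz => by
        have := H₀ c F hc1 hF hreg θ j hj z (by linarith) (by linarith)
        rwa [hz, add_sub_cancel_left] at this)
    (fun y Z hy hy1 hZ h j hj => by
      obtain ⟨h1, h2, h3⟩ := hsum y hy hy1 j hj
      obtain ⟨h4, h5, h6⟩ := hs y hy hy1
      have e : 1 + y - 1 = y := by ring
      have key := H c F hc1 hF hreg (1 + y) (by linarith) (by rw [e]; linarith) η σ δ b hη0 hη1
        hδ0 hδ1 hb0 hbc hcσ hpos Ω μ Θ hΘ j hj _ _ _ Z hZ h1 h2 h3 (by rwa [e])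
        (by rw [e]; exact h)
      refine key.trans (pow_le_pow_left' (ENNReal.ofReal_le_ofReal ?_) _)
      have h7 := mul_le_mul_of_nonneg_right h6 hZ.le
      have h8 : √(s₃ y) * (1 + Z) + (δ ^ 2 + δ * Z) * ((1 - Real.log c) * s₁ y) +
          δ * (√c * (1 - Real.log c) * s₂ y) ≤ D * (a y + Q * Z) := by linarith
      calc _ ≤ C₁ * (D * (a y + Q * Z)) := mul_le_mul_of_nonneg_left h8 hC₁'
        _ = _ := by ring)
    K y hy hy1 n hn
  refine key.trans ?_
  have hy0 : 0 < y := lt_of_lt_of_le (by positivity) hy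
  have hay := (ha y hy0).1
  have h1 : 9 * (C₁ * D) ≤ max (9 * C₁) C₀ * D := by
    have := mul_le_mul_of_nonneg_right (le_max_left (9 * C₁) C₀) (by linarith : 0 ≤ D)
    linarith
  have h2 : C₀ ≤ max (9 * C₁) C₀ := le_max_right _ _
  gcongr

/-! ### Sums along growing radii -/

section Sums

variable {c b y T : ℝ} {n : ℕ}

/-- The distance to the unit circle grows at least linearly along the radii `(1 + y) e ^ (b i)`. -/
lemma add_mul_le_mul_exp_sub_one (hb : 0 ≤ b) (hy : 0 ≤ y) (i : ℕ) :
    y + b * i ≤ (1 + y) * Real.exp (b * i) - 1 := by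
  have h1 := Real.add_one_le_exp (b * i)
  have h2 : 0 ≤ b * i := by positivity
  nlinarith

lemma sum_inv_le (hc : 0 < c) (hc1 : c ≤ 1) (hb : 0 < b) (hbc : b ≤ c) (hby : b ≤ y)
    (hcy : √c ≤ y) (hT : 0 ≤ T) (hn : (n : ℝ) ≤ T / c) :
    ∑ i ∈ Finset.range n, c / ((1 + y) * Real.exp (b * i) - 1) ≤
      c / b * (2 * (T + 1) * (1 - Real.log c)) := by
  have hsc : 0 < √c := Real.sqrt_pos.2 hc
  have hsc1 : √c ≤ 1 := Real.sqrt_le_one.2 hc1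
  have hy : 0 < y := by linarith
  have h1 : ∀ i ∈ Finset.range n, c / ((1 + y) * Real.exp (b * i) - 1) ≤
      c / b * (2 * (Real.log (y + b * ((i + 1 : ℕ) : ℝ)) - Real.log (y + b * (i : ℝ)))) := by
    intro i _
    have p1 : 0 < y + b * i := by positivity
    have p2 : 0 < y + b * ((i + 1 : ℕ) : ℝ) := by positivity
    have h2 := add_mul_le_mul_exp_sub_one hb.le hy.le i
    have h3 : c / ((1 + y) * Real.exp (b * i) - 1) ≤ c / (y + b * i) := by gcongr
    have h4 := Real.one_sub_inv_le_log_of_pos (div_pos p2 p1)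
    rw [Real.log_div p2.ne' p1.ne'] at h4
    have h5 : 1 - ((y + b * ((i + 1 : ℕ) : ℝ)) / (y + b * i))⁻¹ =
        b / (y + b * ((i + 1 : ℕ) : ℝ)) := by
      rw [inv_div]
      field_simp
      push_cast
      ring
    rw [h5] at h4
    have h6 : 1 / (y + b * i) ≤ 2 * (1 / (y + b * ((i + 1 : ℕ) : ℝ))) := by
      rw [mul_one_div, div_le_div_iff₀ p1 p2]
      push_cast
      have : 0 ≤ b * i := by positivity
      linarith
    calc _ ≤ c / (y + b * i) := h3
      _ = c / b * (b * (1 / (y + b * i))) := by field_simp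
      _ ≤ c / b * (b * (2 * (1 / (y + b * ((i + 1 : ℕ) : ℝ))))) := by gcongr
      _ = c / b * (2 * (b / (y + b * ((i + 1 : ℕ) : ℝ)))) := by ring
      _ ≤ _ := by gcongr
  refine (Finset.sum_le_sum h1).trans ?_
  rw [← Finset.mul_sum, ← Finset.mul_sum,
    Finset.sum_range_sub (fun i : ℕ => Real.log (y + b * (i : ℝ)))]
  have hbn : b * n ≤ T := by
    rw [le_div_iff₀ hc] at hn
    calc b * n ≤ c * n := by gcongr
      _ ≤ T := by linarith
  have p1 : 0 < y + b * n := by positivity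
  have h7 : Real.log (y + b * n) - Real.log (y + b * (0 : ℕ)) ≤ (T + 1) * (1 - Real.log c) := by
    rw [Nat.cast_zero, mul_zero, add_zero, ← Real.log_div p1.ne' hy.ne']
    have h8 : (y + b * n) / y ≤ (1 + T) / √c := by
      have e1 : (y + b * n) / y = 1 + b * n / y := by field_simp
      have e2 : 1 ≤ 1 / √c := by rw [le_div_iff₀ hsc]; linarith
      have e3 : b * n / y ≤ T / √c := by gcongr
      rw [e1, add_div]
      exact add_le_add e2 e3
    refine (Real.log_le_log (by positivity) h8).trans ?_
    rw [Real.log_div (by positivity) hsc.ne', Real.log_sqrt hc.le]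
    have h9 := Real.log_le_sub_one_of_pos (show 0 < 1 + T by positivity)
    have h10 := Real.log_nonpos hc.le hc1
    nlinarith
  calc _ ≤ c / b * (2 * ((T + 1) * (1 - Real.log c))) := by gcongr
    _ = _ := by ring

lemma sum_inv_sq_le (hc : 0 < c) (hb : 0 < b) (hy : 0 < y) (hby : b ≤ y) :
    ∑ i ∈ Finset.range n, c / ((1 + y) * Real.exp (b * i) - 1) ^ 2 ≤ c / b * (2 / y) := by
  have h1 : ∀ i ∈ Finset.range n, c / ((1 + y) * Real.exp (b * i) - 1) ^ 2 ≤
      c / b * (2 * (1 / (y + b * (i : ℝ)) - 1 / (y + b * ((i + 1 : ℕ) : ℝ)))) := by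
    intro i _
    have p1 : 0 < y + b * i := by positivity
    have p2 : 0 < y + b * ((i + 1 : ℕ) : ℝ) := by positivity
    have h2 := add_mul_le_mul_exp_sub_one hb.le hy.le i
    have h3 : c / ((1 + y) * Real.exp (b * i) - 1) ^ 2 ≤ c / (y + b * i) ^ 2 := by gcongr
    have h6 : 1 / (y + b * i) ≤ 2 * (1 / (y + b * ((i + 1 : ℕ) : ℝ))) := by
      rw [mul_one_div, div_le_div_iff₀ p1 p2]
      push_cast
      have : 0 ≤ b * i := by positivity
      linarith
    have h7 : 1 / (y + b * (i : ℝ)) - 1 / (y + b * ((i + 1 : ℕ) : ℝ)) =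
        b * (1 / (y + b * i) * (1 / (y + b * ((i + 1 : ℕ) : ℝ)))) := by
      field_simp
      push_cast
      ring
    calc _ ≤ c / (y + b * i) ^ 2 := h3
      _ = c / b * (b * (1 / (y + b * i) * (1 / (y + b * i)))) := by field_simp
      _ ≤ c / b * (b * (1 / (y + b * i) * (2 * (1 / (y + b * ((i + 1 : ℕ) : ℝ)))))) := by gcongr
      _ = _ := by rw [h7]; ring
  refine (Finset.sum_le_sum h1).trans ?_
  rw [← Finset.mul_sum, ← Finset.mul_sum,
    Finset.sum_range_sub' (fun i : ℕ => 1 / (y + b * (i : ℝ)))]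
  have p1 : 0 < 1 / (y + b * n) := by positivity
  rw [Nat.cast_zero, mul_zero, add_zero]
  calc _ ≤ c / b * (2 * (1 / y)) := by gcongr; linarith
    _ = _ := by ring

lemma sum_inv_cube_le (hc : 0 < c) (hb : 0 < b) (hy : 0 < y) (hby : b ≤ y) :
    ∑ i ∈ Finset.range n, c ^ 2 / ((1 + y) * Real.exp (b * i) - 1) ^ 3 ≤
      c / b * (2 * c / y ^ 2) := by
  have h1 : ∀ i ∈ Finset.range n, c ^ 2 / ((1 + y) * Real.exp (b * i) - 1) ^ 3 ≤
      c / y * (c / ((1 + y) * Real.exp (b * i) - 1) ^ 2) := by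
    intro i _
    have h2 := add_mul_le_mul_exp_sub_one hb.le hy.le i
    have h3 : 0 ≤ b * i := by positivity
    set w := (1 + y) * Real.exp (b * i) - 1
    have hw : y ≤ w := by linarith
    have hw0 : 0 < w := by linarith
    calc c ^ 2 / w ^ 3 = c / w * (c / w ^ 2) := by field_simp
      _ ≤ _ := by gcongr
  refine (Finset.sum_le_sum h1).trans ?_
  rw [← Finset.mul_sum]
  calc _ ≤ c / y * (c / b * (2 / y)) := by
        gcongr
        exact sum_inv_sq_le hc hb hy hby
    _ = _ := by field_simp

end Sums

/-! ### Powers of the capacity -/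

/-- Logarithms are absorbed by arbitrarily small powers. -/
lemma one_sub_log_le {c e : ℝ} (hc : 0 < c) (hc1 : c ≤ 1) (he : 0 < e) :
    1 - Real.log c ≤ (1 + 1 / e) * c ^ (-e) := by
  have h1 := Real.log_le_rpow_div (inv_pos.2 hc).le he
  rw [Real.log_inv, Real.inv_rpow hc.le, ← Real.rpow_neg hc.le] at h1
  have h2 : 1 ≤ c ^ (-e) := Real.one_le_rpow_of_pos_of_le_one_of_nonpos hc hc1 (by linarith)
  calc 1 - Real.log c ≤ c ^ (-e) + c ^ (-e) / e := by linarith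
    _ = _ := by ring

lemma eventually_mul_rpow_le {A B e : ℝ} (he : 0 < e) (hB : 0 < B) :
    ∀ᶠ c : ℝ in 𝓝[>] 0, A * c ^ e ≤ B := by
  have h1 : Tendsto (fun c : ℝ => A * c ^ e) (𝓝[>] 0) (𝓝 (A * 0 ^ e)) :=
    ((Real.continuousAt_rpow_const 0 e (Or.inr he.le)).tendsto.mono_left
      nhdsWithin_le_nhds).const_mul A
  rw [Real.zero_rpow he.ne', mul_zero] at h1
  exact (h1.eventually (gt_mem_nhds hB)).mono fun c hc => hc.le

lemma exists_forall_of_eventually {P : ℝ → Prop} (h : ∀ᶠ c : ℝ in 𝓝[>] 0, P c) :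
    ∃ c₀ : ℝ, 0 < c₀ ∧ ∀ c, 0 < c → c ≤ c₀ → P c := by
  obtain ⟨c₀, hc₀, h1⟩ := mem_nhdsGT_iff_exists_Ioc_subset.1 h
  exact ⟨c₀, hc₀, fun c h2 h3 => h1 ⟨h2, h3⟩⟩

lemma one_sub_exp_neg_ge {x : ℝ} (hx0 : 0 ≤ x) :
    x - x ^ 2 / 2 ≤ 1 - Real.exp (-x) := by
  have h1 := Real.quadratic_le_exp_of_nonneg hx0
  have h2 : Real.exp (-x) * Real.exp x = 1 := by rw [← Real.exp_add]; simp
  have h3 : Real.exp (-x) * (1 + x + x ^ 2 / 2) ≤ 1 :=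
    (mul_le_mul_of_nonneg_left h1 (Real.exp_pos _).le).trans h2.le
  have h4 : 0 < 1 + x + x ^ 2 / 2 := by positivity
  have h5 : 1 ≤ (1 - x + x ^ 2 / 2) * (1 + x + x ^ 2 / 2) := by
    have : (1 - x + x ^ 2 / 2) * (1 + x + x ^ 2 / 2) = 1 + x ^ 4 / 4 := by ring
    rw [this]
    have : 0 ≤ x ^ 4 := by positivity
    linarith
  have h6 := le_of_mul_le_mul_right (h3.trans h5) h4
  linarith

lemma le_of_one_add_sqrt_le_exp {c σ : ℝ} (hc : 0 ≤ c) (hc4 : c ≤ 1 / 4)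
    (h : 1 + √c ≤ Real.exp σ) : c ≤ σ := by
  have h1 := exp_sub_one_le_two_mul hc (by linarith)
  have h2 : √c ≤ 1 / 2 := by
    rw [show (1 / 2 : ℝ) = √(1 / 4) by rw [eq_comm, Real.sqrt_eq_iff_mul_self_eq] <;> norm_num]
    exact Real.sqrt_le_sqrt hc4
  have h3 : √c * √c = c := Real.mul_self_sqrt hc
  have h4 := Real.sqrt_nonneg c
  rw [← Real.exp_le_exp]
  nlinarith

lemma rpow_div_le {c S p q : ℝ} (hc : 0 < c) (h : c ^ q ≤ S) : c ^ p / S ≤ c ^ (p - q) := by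
  rw [Real.rpow_sub hc]
  have := Real.rpow_pos_of_pos hc q
  have := Real.rpow_pos_of_pos hc p
  gcongr

lemma rpow_mul_one_sub_log_le {c e p : ℝ} (hc : 0 < c) (hc1 : c ≤ 1) (he : 0 < e) :
    c ^ p * (1 - Real.log c) ≤ (1 + 1 / e) * c ^ (p - e) := by
  have := mul_le_mul_of_nonneg_left (one_sub_log_le hc hc1 he) (Real.rpow_pos_of_pos hc p).le
  refine this.trans (le_of_eq ?_)
  rw [sub_eq_add_neg p e, Real.rpow_add hc]
  ring

end

/-! ### The two ranges of the parameter `η` -/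

set_option maxHeartbeats 3000000 in
/-- The moment bound for `η < 1`, for small capacities and near the unit circle. -/
lemma exists_stoppedMoment_le_of_lt_one (Λ η T ε ν : ℝ) (m : ℕ) (hΛ : 0 ≤ Λ) (hη0 : 0 ≤ η)
    (hη1 : η < 1) (hT : 0 ≤ T) (hε : 0 < ε) (hν : 0 < ν) (hνε : ν < ε / 2) :
    ∃ c₀ C : ℝ, 0 < c₀ ∧ 1 ≤ C ∧ ∀ (c σ : ℝ) (F : ℂ → ℂ), c ≤ c₀ → c ≤ 1 →
      IsBasicMap F c → HasRegularity F c Λ → 1 + c ^ (1 / 2 - ε) ≤ Real.exp σ →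
      ∀ (Ω : Type*) [MeasurableSpace Ω] (μ : Measure Ω) [IsProbabilityMeasure μ]
        (Θ : ℕ → Ω → ℝ), IsALE μ F η σ Θ →
      ∀ n : ℕ, (n : ℝ) ≤ T / c → ∀ y, c ^ (1 / 2 - ε) ≤ y → y ≤ 1 →
      stoppedMoment μ F c σ (c ^ (1 / 2 - ν) / (Real.exp σ - 1)) Θ (2 * m + 2) n (1 + y) ≤
        ENNReal.ofReal (C * (√c / y + c ^ (1 - 3 * ν) / (Real.exp σ - 1) ^ 2)) ^ (2 * m + 2) := by
  obtain ⟨C, k, hC, hk, H⟩ := exists_stoppedMoment_le_iterate Λ T hΛ hT m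
  -- The number `K` of iterations is such that `Q ^ K ≤ c`. They only involve distances to the unit
  -- circle of at least `c ^ (1 / 2 - ε) / 2 ^ K`.
  obtain ⟨K, hK⟩ := exists_nat_ge (4 / ε)
  obtain ⟨e, he, heν, heε⟩ : ∃ e : ℝ, 0 < e ∧ 2 * e ≤ ν ∧ 2 * e ≤ ε / 4 :=
    ⟨min ν (ε / 4) / 2, by positivity, by linarith [min_le_left ν (ε / 4)],
      by linarith [min_le_right ν (ε / 4)]⟩
  obtain ⟨E, hE⟩ : ∃ E : ℝ, E = 1 + 1 / e := ⟨_, rfl⟩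
  have hE1 : 1 ≤ E := by rw [hE]; linarith [show 0 < 1 / e by positivity]
  have hη' : 0 < 1 - η := by linarith
  obtain ⟨A, hA⟩ : ∃ A : ℝ, A = 4 * (T + 1) / (1 - η) := ⟨_, rfl⟩
  have hA1 : 1 ≤ A := by
    rw [hA, le_div_iff₀ hη']
    linarith
  have hA2 : A ≤ A ^ 2 := le_self_pow₀ hA1 two_ne_zero
  obtain ⟨D, hD⟩ : ∃ D : ℝ, D = A * (2 ^ K + 2 * E ^ 2) := ⟨_, rfl⟩
  have h2K : (1 : ℝ) ≤ 2 ^ K := one_le_pow₀ (by norm_num)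
  have hE2 : E ≤ E ^ 2 := le_self_pow₀ hE1 two_ne_zero
  have hD1 : 1 ≤ D := by
    rw [hD]
    exact one_le_mul_of_one_le_of_one_le hA1 (by linarith)
  obtain ⟨c₀, hc₀, hsmall⟩ := exists_forall_of_eventually
    (((eventually_mul_rpow_le (A := 1) (B := 1 / 8) (show 0 < ε / 2 by linarith)
      (by norm_num)).and
      (eventually_mul_rpow_le (A := k * 2 ^ K) (B := 1) hε one_pos)).and
      (eventually_mul_rpow_le (A := 1) (B := (1 - η) / 4) one_pos (by linarith)))
  refine ⟨c₀, (C * D) ^ K * C * 2, hc₀, ?_, ?_⟩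
  · have : 1 ≤ (C * D) ^ K := one_le_pow₀ (one_le_mul_of_one_le_of_one_le hC hD1)
    have := one_le_mul_of_one_le_of_one_le this hC
    linarith
  intro c σ F hcc₀ hc1 hF hreg hσ Ω _ μ _ Θ hΘ n hn y hy hy1
  have hc := hF.capacity_pos
  obtain ⟨⟨hsm1, hsm2⟩, hsm3⟩ := hsmall c hc hcc₀
  rw [one_mul] at hsm1 hsm3
  rw [Real.rpow_one] at hsm3
  have hsc : 0 < √c := Real.sqrt_pos.2 hc
  have hscc : √c * √c = c := Real.mul_self_sqrt hc.le
  have hsqrt : √c = c ^ (1 / 2 - ε) * c ^ ε := by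
    rw [Real.sqrt_eq_rpow, ← Real.rpow_add hc]
    ring_nf
  have hcε1 : c ^ ε ≤ 1 := Real.rpow_le_one hc.le hc1 hε.le
  have hp0 : 0 < c ^ (1 / 2 - ε) := Real.rpow_pos_of_pos hc _
  have hsp : √c ≤ c ^ (1 / 2 - ε) := by
    rw [hsqrt]
    exact mul_le_of_le_one_right hp0.le hcε1
  obtain ⟨S, hS⟩ : ∃ S : ℝ, S = Real.exp σ - 1 := ⟨_, rfl⟩
  rw [← hS]
  have hSp : c ^ (1 / 2 - ε) ≤ S := by linarith
  have hS0 : 0 < S := by linarith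
  obtain ⟨δ, hδ⟩ : ∃ δ : ℝ, δ = c ^ (1 / 2 - ν) / S := ⟨_, rfl⟩
  have hδ0 : 0 < δ := by
    rw [hδ]
    have := Real.rpow_pos_of_pos hc (1 / 2 - ν)
    positivity
  have hmono : ∀ {p q : ℝ}, q ≤ p → c ^ p ≤ c ^ q := fun h =>
    Real.rpow_le_rpow_of_exponent_ge hc hc1 h
  have hδ1 : δ ≤ 1 / 8 := by
    rw [hδ]
    exact (rpow_div_le hc hSp).trans ((hmono (by linarith)).trans hsm1)
  obtain ⟨l, hl⟩ : ∃ l : ℝ, l = 1 - Real.log c := ⟨_, rfl⟩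
  have hl1 : 1 ≤ l := by linarith [Real.log_nonpos hc.le hc1]
  have hlog : ∀ p, c ^ p * l ≤ E * c ^ (p - e) := fun p => by
    rw [hl, hE]; exact rpow_mul_one_sub_log_le hc hc1 he
  -- The logarithms cost only an arbitrarily small power of the capacity.
  have hδl : δ * l ≤ E * (c ^ (1 / 2 - ν - e) / S) := by
    rw [hδ, div_mul_eq_mul_div, ← mul_div_assoc]
    exact div_le_div_of_nonneg_right (hlog _) hS0.le
  have hδl1 : δ * l ≤ E := by
    refine hδl.trans (mul_le_of_le_one_right (by linarith) ?_)
    exact (rpow_div_le hc hSp).trans (Real.rpow_le_one hc.le hc1 (by linarith))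
  have hδll : δ * (l * l) ≤ E ^ 2 * c ^ (ε / 4) := by
    calc δ * (l * l) = δ * l * l := by ring
      _ ≤ E * (c ^ (1 / 2 - ν - e) / S) * l := by gcongr
      _ = E * (c ^ (1 / 2 - ν - e) * l / S) := by ring
      _ ≤ E * (E * c ^ (1 / 2 - ν - e - e) / S) :=
        mul_le_mul_of_nonneg_left (div_le_div_of_nonneg_right (hlog _) hS0.le) (by linarith)
      _ = E ^ 2 * (c ^ (1 / 2 - ν - e - e) / S) := by ring
      _ ≤ E ^ 2 * c ^ (ε / 4) := by
        gcongr
        exact (rpow_div_le hc hSp).trans (hmono (by linarith))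
  obtain ⟨X, hX⟩ : ∃ X : ℝ, X = c ^ (1 - 3 * ν) / S ^ 2 := ⟨_, rfl⟩
  have hX0 : 0 ≤ X := by
    rw [hX]
    have := Real.rpow_pos_of_pos hc (1 - 3 * ν)
    positivity
  have hδδll : δ ^ 2 * (l * l) ≤ E ^ 2 * X := by
    calc δ ^ 2 * (l * l) = (δ * l) ^ 2 := by ring
      _ ≤ (E * (c ^ (1 / 2 - ν - e) / S)) ^ 2 := by gcongr
      _ = E ^ 2 * (c ^ (1 / 2 - ν - e + (1 / 2 - ν - e)) / S ^ 2) := by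
        rw [Real.rpow_add hc]; ring
      _ ≤ E ^ 2 * X := by
        rw [hX]
        gcongr E ^ 2 * (?_ / S ^ 2)
        exact hmono (by linarith)
  -- Half of the decay `(1 - η) c` of the linearised dynamics is used as a gain in the radius.
  obtain ⟨b, hb⟩ : ∃ b : ℝ, b = (1 - η) / 2 * c := ⟨_, rfl⟩
  have hb0 : 0 < b := by rw [hb]; positivity
  have hbc : b < c := by rw [hb]; exact mul_lt_of_lt_one_left hc (by linarith)
  have hcb : c / b = 2 / (1 - η) := by rw [hb]; field_simp
  have hcσ : c ≤ σ := le_of_one_add_sqrt_le_exp hc.le (by linarith) (by linarith)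
  have hpos : c * η * (1 + Real.exp (2 * (b - σ))) ≤ 1 - Real.exp (-(2 * (c - b))) := by
    have h1 : Real.exp (2 * (b - σ)) ≤ 1 := Real.exp_le_one_iff.2 (by linarith)
    have h2 := one_sub_exp_neg_ge (show 0 ≤ 2 * (c - b) by linarith)
    have h3 : 2 * (c - b) = (1 + η) * c := by rw [hb]; ring
    rw [h3] at h2 ⊢
    have h4 : c * η * (1 + Real.exp (2 * (b - σ))) ≤ c * η * 2 := by gcongr; linarith
    have h5 : (1 + η) * c * ((1 + η) * c) ≤ 2 * c * (2 * ((1 - η) / 4)) := by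
      gcongr
      · linarith
      · linarith
    linarith
  have hy₀ : 0 < c ^ (1 / 2 - ε) / 2 ^ K := by positivity
  have hky₀ : k * √c ≤ c ^ (1 / 2 - ε) / 2 ^ K := by
    rw [le_div_iff₀ (by positivity), hsqrt]
    calc _ = c ^ (1 / 2 - ε) * (k * 2 ^ K * c ^ ε) := by ring
      _ ≤ c ^ (1 / 2 - ε) * 1 := by gcongr
      _ = _ := mul_one _
  have hsy : ∀ y, c ^ (1 / 2 - ε) / 2 ^ K ≤ y → √c ≤ y := fun y hy => by
    refine le_trans ?_ (hky₀.trans hy)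
    exact le_mul_of_one_le_left hsc.le hk
  have hcs : c ≤ √c := by
    have h1 : √c ≤ 1 := Real.sqrt_le_one.2 hc1
    calc c = √c * √c := hscc.symm
      _ ≤ √c := mul_le_of_le_one_left hsc.le h1
  have hs3 : ∀ y, 0 < y → √(A * c / y ^ 2) ≤ A * (√c / y) := fun y hy => by
    refine Real.sqrt_le_iff.2 ⟨by positivity, ?_⟩
    calc A * c / y ^ 2 ≤ A ^ 2 * c / y ^ 2 := by gcongr
      _ = _ := by rw [mul_pow, div_pow, Real.sq_sqrt hc.le]; ring
  have key := H c F hc1 hF hreg η σ δ b hη0 hη1.le hδ0.le hδ1 hb0.le hbc hcσ hpos Ω μ Θ hΘ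
    (c ^ (1 / 2 - ε) / 2 ^ K) D (c ^ (ε / 4)) (fun _ => A * l) (fun y => A / y)
    (fun y => A * c / y ^ 2) (fun y => √c / y + X) hy₀ hky₀ hD1 (Real.rpow_pos_of_pos hc _)
    (Real.rpow_le_one hc.le hc1 (by linarith)) ?_ ?_ ?_ K n hn y
    (by rwa [div_mul_cancel₀ _ (by positivity)]) hy1
  · rw [hX] at key
    rw [← hδ]
    refine key.trans (pow_le_pow_left' (ENNReal.ofReal_le_ofReal ?_) _)
    have hy0 : 0 < y := by linarith
    have h1 : (c ^ (ε / 4)) ^ K ≤ √c := by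
      rw [← Real.rpow_natCast, ← Real.rpow_mul hc.le]
      refine le_trans ?_ hcs
      conv_rhs => rw [← Real.rpow_one c]
      apply hmono
      rw [div_le_iff₀ hε] at hK
      linarith
    have h2 : (c ^ (ε / 4)) ^ K / y ≤ √c / y := by gcongr
    have h3 : 0 < (C * D) ^ K * C := by positivity
    rw [mul_assoc _ (2 : ℝ)]
    rw [hX] at hX0
    refine mul_le_mul_of_nonneg_left ?_ h3.le
    linarith
  · intro y hy
    refine ⟨by positivity, ?_⟩
    have : √c / (y / 2) = 2 * (√c / y) := by field_simp
    have : 0 < √c / y := by positivity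
    linarith
  · intro y hy hy1 n hn
    have hsy' := hsy y hy
    have hy0 : 0 < y := by linarith
    refine ⟨?_, ?_, ?_⟩
    · refine (sum_inv_le hc hc1 hb0 hbc.le (by linarith) hsy' hT hn).trans (le_of_eq ?_)
      rw [hcb, hA, hl]
      ring
    · refine (sum_inv_sq_le hc hb0 hy0 (by linarith)).trans ?_
      rw [hcb, hA]
      calc 2 / (1 - η) * (2 / y) = 4 * 1 / (1 - η) / y := by ring
        _ ≤ _ := by gcongr; linarith
    · refine (sum_inv_cube_le hc hb0 hy0 (by linarith)).trans ?_
      rw [hcb, hA]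
      calc 2 / (1 - η) * (2 * c / y ^ 2) = 4 * 1 / (1 - η) * c / y ^ 2 := by ring
        _ ≤ _ := by gcongr; linarith
  · intro y hy hy1
    have hsy' := hsy y hy
    have hy0 : 0 < y := by linarith
    have hcy : c ≤ y ^ 2 := (Real.sqrt_le_left hy0.le).1 hsy'
    have h3 := hs3 y hy0
    rw [← hl]
    refine ⟨?_, ?_, ?_⟩
    · rw [div_le_div_iff₀ (by positivity) (by positivity)]
      calc c ^ 2 * y ^ 2 = 1 * c * c * y ^ 2 := by ring
        _ ≤ A * c * y ^ 2 * y ^ 2 := by gcongr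
        _ = _ := by ring
    · have h4 : δ ^ 2 * (l * (A * l)) ≤ A * (E ^ 2 * X) := by
        have := mul_le_mul_of_nonneg_left hδδll (show 0 ≤ A by linarith)
        linarith
      have h5 : δ * (√c * l * (A / y)) ≤ A * (E * (√c / y)) := by
        have := mul_le_mul_of_nonneg_left hδl1 (show 0 ≤ A * (√c / y) by positivity)
        calc δ * (√c * l * (A / y)) = A * (√c / y) * (δ * l) := by ring
          _ ≤ _ := this
          _ = _ := by ring
      have h6 : 0 < √c / y := by positivity
      have h7 : (√c / y) + E ^ 2 * X + E * (√c / y) ≤ (2 ^ K + 2 * E ^ 2) * (√c / y + X) := by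
        have : (1 + E) * (√c / y) ≤ (2 ^ K + 2 * E ^ 2) * (√c / y) := by gcongr; linarith
        have : E ^ 2 * X ≤ (2 ^ K + 2 * E ^ 2) * X := by gcongr; linarith [sq_nonneg E]
        linarith
      have h8 := mul_le_mul_of_nonneg_left h7 (show 0 ≤ A by linarith)
      rw [hD]
      linarith
    · have h4 : δ * (l * (A * l)) ≤ A * (E ^ 2 * c ^ (ε / 4)) := by
        have := mul_le_mul_of_nonneg_left hδll (show 0 ≤ A by linarith)
        linarith
      have h5 : √c / y ≤ 2 ^ K * c ^ (ε / 4) := by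
        calc √c / y ≤ √c / (c ^ (1 / 2 - ε) / 2 ^ K) := by gcongr
          _ = 2 ^ K * c ^ ε := by rw [hsqrt]; field_simp
          _ ≤ _ := mul_le_mul_of_nonneg_left (hmono (by linarith)) (by positivity)
      have h6 := mul_le_mul_of_nonneg_left h5 (show 0 ≤ A by linarith)
      have h7 : 0 ≤ A * (E ^ 2 * c ^ (ε / 4)) := by
        have := Real.rpow_pos_of_pos hc (ε / 4)
        positivity
      rw [hD]
      linarith

/-- The drift operator has a nonnegative kernel for `η = 1`, without any gain in the radius. -/
lemma one_add_exp_le_of_one_add_sqrt_le_exp {c σ : ℝ} (hc : 0 ≤ c) (hc4 : c ≤ 1 / 16)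
    (h : 1 + √c ≤ Real.exp σ) : c * (1 + Real.exp (2 * (0 - σ))) ≤ 1 - Real.exp (-(2 * c)) := by
  have h0 := one_sub_exp_neg_ge (show 0 ≤ 2 * c by linarith)
  have h1 : √c ≤ 1 / 4 := Real.sqrt_le_iff.2 ⟨by norm_num, by linarith⟩
  have h2 : √c * √c = c := Real.mul_self_sqrt hc
  have h3 := Real.sqrt_nonneg c
  have h4 : Real.exp (2 * (0 - σ)) * (Real.exp σ) ^ 2 = 1 := by
    rw [← Real.exp_nat_mul, ← Real.exp_add]
    norm_num
  have h5 : (1 + √c) ^ 2 ≤ Real.exp σ ^ 2 := by gcongr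
  have h6 : 1 ≤ (1 - 2 * c) * Real.exp σ ^ 2 := by
    have e1 : 0 ≤ √c * (1 - √c - 2 * c) := mul_nonneg h3 (by linarith)
    have e2 : (1 - 2 * c) * (1 + √c) ^ 2 ≤ (1 - 2 * c) * Real.exp σ ^ 2 :=
      mul_le_mul_of_nonneg_left h5 (by linarith)
    have e3 : (1 - 2 * c) * (1 + 2 * √c) ≤ (1 - 2 * c) * (1 + √c) ^ 2 :=
      mul_le_mul_of_nonneg_left (by nlinarith) (by linarith)
    linarith
  have h7 : Real.exp (2 * (0 - σ)) ≤ 1 - 2 * c := by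
    have e1 : 0 < Real.exp σ ^ 2 := by positivity
    exact le_of_mul_le_mul_right (h4.le.trans h6) e1
  have h8 := mul_le_mul_of_nonneg_left h7 hc
  linarith

set_option maxHeartbeats 3000000 in
/-- The moment bound for `η = 1`, for small capacities and near the unit circle. -/
lemma exists_stoppedMoment_le_of_eq_one (Λ T ε ν : ℝ) (m : ℕ) (hΛ : 0 ≤ Λ)
    (hT : 0 ≤ T) (hε : 0 < ε) (hν : 0 < ν) (hνε : ν < 3 * ε / 2) :
    ∃ c₀ C : ℝ, 0 < c₀ ∧ 1 ≤ C ∧ ∀ (c σ : ℝ) (F : ℂ → ℂ), c ≤ c₀ → c ≤ 1 →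
      IsBasicMap F c → HasRegularity F c Λ → 1 + c ^ (1 / 5 - ε) ≤ Real.exp σ →
      ∀ (Ω : Type*) [MeasurableSpace Ω] (μ : Measure Ω) [IsProbabilityMeasure μ]
        (Θ : ℕ → Ω → ℝ), IsALE μ F 1 σ Θ →
      ∀ n : ℕ, (n : ℝ) ≤ T / c → ∀ y, c ^ (1 / 5 - ε) ≤ y → y ≤ 1 →
      stoppedMoment μ F c σ (c ^ (1 / 2 - ν) / (Real.exp σ - 1) ^ (3 / 2 : ℝ)) Θ (2 * m + 2) n
          (1 + y) ≤
        ENNReal.ofReal (C * (√c / (y * √y) + c ^ (1 - 3 * ν) / (Real.exp σ - 1) ^ 3 / y)) ^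
          (2 * m + 2) := by
  obtain ⟨C, k, hC, hk, H⟩ := exists_stoppedMoment_le_iterate Λ T hΛ hT m
  -- The number `K` of iterations is such that `Q ^ K ≤ c`. They only involve distances to the unit
  -- circle of at least `c ^ (1 / 5 - ε) / 2 ^ K`.
  obtain ⟨K, hK⟩ := exists_nat_ge (2 / ε)
  obtain ⟨e, he, heν, heε⟩ : ∃ e : ℝ, 0 < e ∧ e ≤ ν ∧ e ≤ ε / 2 :=
    ⟨min ν (ε / 2), by positivity, min_le_left ν (ε / 2), min_le_right ν (ε / 2)⟩
  obtain ⟨E, hE⟩ : ∃ E : ℝ, E = 1 + 1 / e := ⟨_, rfl⟩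
  have hE1 : 1 ≤ E := by rw [hE]; linarith [show 0 < 1 / e by positivity]
  obtain ⟨A, hA⟩ : ∃ A : ℝ, A = T + 1 := ⟨_, rfl⟩
  have hA1 : 1 ≤ A := by linarith
  have hA2 : A ≤ A ^ 2 := le_self_pow₀ hA1 two_ne_zero
  obtain ⟨D, hD⟩ : ∃ D : ℝ, D = A * (4 ^ K + 2 * (E * 2 ^ K)) := ⟨_, rfl⟩
  have h2K : (1 : ℝ) ≤ 2 ^ K := one_le_pow₀ (by norm_num)
  have h4K : (1 : ℝ) ≤ 4 ^ K := one_le_pow₀ (by norm_num)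
  have hEK : E ≤ E * 2 ^ K := le_mul_of_one_le_right (by linarith) h2K
  have hD1 : 1 ≤ D := by
    rw [hD]
    exact one_le_mul_of_one_le_of_one_le hA1 (by linarith)
  obtain ⟨c₀, hc₀, hsmall⟩ := exists_forall_of_eventually
    (((eventually_mul_rpow_le (A := 1) (B := 1 / 8) (show (0 : ℝ) < 1 / 5 by norm_num)
      (by norm_num)).and
      (eventually_mul_rpow_le (A := k * 2 ^ K) (B := 1) (show 0 < 3 / 10 + ε by linarith)
        one_pos)).and
      (eventually_mul_rpow_le (A := 1) (B := 1 / 16) one_pos (by norm_num)))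
  refine ⟨c₀, (C * D) ^ K * C * 2, hc₀, ?_, ?_⟩
  · have : 1 ≤ (C * D) ^ K := one_le_pow₀ (one_le_mul_of_one_le_of_one_le hC hD1)
    have := one_le_mul_of_one_le_of_one_le this hC
    linarith
  intro c σ F hcc₀ hc1 hF hreg hσ Ω _ μ _ Θ hΘ n hn y hy hy1
  have hc := hF.capacity_pos
  obtain ⟨⟨hsm1, hsm2⟩, hsm3⟩ := hsmall c hc hcc₀
  rw [one_mul] at hsm1 hsm3
  rw [Real.rpow_one] at hsm3
  have hsc : 0 < √c := Real.sqrt_pos.2 hc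
  have hscc : √c * √c = c := Real.mul_self_sqrt hc.le
  have hmono : ∀ {p q : ℝ}, q ≤ p → c ^ p ≤ c ^ q := fun h =>
    Real.rpow_le_rpow_of_exponent_ge hc hc1 h
  have hsqrt : √c = c ^ (1 / 5 - ε) * c ^ (3 / 10 + ε) := by
    rw [Real.sqrt_eq_rpow, ← Real.rpow_add hc]
    ring_nf
  have hsqrt' : √c = (c ^ (1 / 5 - ε)) ^ 2 * c ^ (1 / 10 + 2 * ε) := by
    rw [Real.sqrt_eq_rpow, sq, ← Real.rpow_add hc, ← Real.rpow_add hc]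
    ring_nf
  have hp0 : 0 < c ^ (1 / 5 - ε) := Real.rpow_pos_of_pos hc _
  have hsp : √c ≤ c ^ (1 / 5 - ε) := by
    rw [Real.sqrt_eq_rpow]
    exact hmono (by linarith)
  obtain ⟨S, hS⟩ : ∃ S : ℝ, S = Real.exp σ - 1 := ⟨_, rfl⟩
  rw [← hS]
  have hSp : c ^ (1 / 5 - ε) ≤ S := by linarith
  have hS0 : 0 < S := by linarith
  obtain ⟨W, hW⟩ : ∃ W : ℝ, W = S ^ (3 / 2 : ℝ) := ⟨_, rfl⟩
  rw [← hW]
  have hW0 : 0 < W := by rw [hW]; exact Real.rpow_pos_of_pos hS0 _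
  have hW2 : W ^ 2 = S ^ 3 := by
    rw [hW, ← Real.rpow_natCast, ← Real.rpow_mul hS0.le, ← Real.rpow_natCast]
    norm_num
  have hWp : c ^ ((1 / 5 - ε) * (3 / 2)) ≤ W := by
    rw [hW, Real.rpow_mul hc.le]
    exact Real.rpow_le_rpow hp0.le hSp (by norm_num)
  obtain ⟨δ, hδ⟩ : ∃ δ : ℝ, δ = c ^ (1 / 2 - ν) / W := ⟨_, rfl⟩
  have hδ0 : 0 < δ := by
    rw [hδ]
    have := Real.rpow_pos_of_pos hc (1 / 2 - ν)
    positivity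
  have hδ1 : δ ≤ 1 / 8 := by
    rw [hδ]
    exact (rpow_div_le hc hWp).trans ((hmono (by linarith)).trans hsm1)
  obtain ⟨l, hl⟩ : ∃ l : ℝ, l = 1 - Real.log c := ⟨_, rfl⟩
  have hl1 : 1 ≤ l := by linarith [Real.log_nonpos hc.le hc1]
  have hlog : ∀ p, c ^ p * l ≤ E * c ^ (p - e) := fun p => by
    rw [hl, hE]; exact rpow_mul_one_sub_log_le hc hc1 he
  have hy₀ : 0 < c ^ (1 / 5 - ε) / 2 ^ K := by positivity
  -- The logarithms cost only an arbitrarily small power of the capacity.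
  have hδl : ∀ y, c ^ (1 / 5 - ε) / 2 ^ K ≤ y → δ * l / y ≤ E * 2 ^ K * c ^ (ε / 2) := by
    intro y hy
    have hy0 : 0 < y := by linarith
    have h1 : δ * l ≤ E * c ^ (1 / 2 - ν - e - (1 / 5 - ε) * (3 / 2)) := by
      calc δ * l = c ^ (1 / 2 - ν) * l / W := by rw [hδ]; ring
        _ ≤ E * c ^ (1 / 2 - ν - e) / W := div_le_div_of_nonneg_right (hlog _) hW0.le
        _ = E * (c ^ (1 / 2 - ν - e) / W) := by ring
        _ ≤ _ := mul_le_mul_of_nonneg_left (rpow_div_le hc hWp) (by linarith)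
    calc δ * l / y ≤ E * c ^ (1 / 2 - ν - e - (1 / 5 - ε) * (3 / 2)) /
          (c ^ (1 / 5 - ε) / 2 ^ K) := by gcongr
      _ = E * 2 ^ K * (c ^ (1 / 2 - ν - e - (1 / 5 - ε) * (3 / 2)) / c ^ (1 / 5 - ε)) := by
        field_simp
      _ ≤ E * 2 ^ K * c ^ (ε / 2) := by
        refine mul_le_mul_of_nonneg_left ?_ (by positivity)
        exact (rpow_div_le hc le_rfl).trans (hmono (by linarith))
  obtain ⟨X, hX⟩ : ∃ X : ℝ, X = c ^ (1 - 3 * ν) / S ^ 3 := ⟨_, rfl⟩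
  have hX0 : 0 ≤ X := by
    rw [hX]
    have := Real.rpow_pos_of_pos hc (1 - 3 * ν)
    positivity
  have hδδl : δ ^ 2 * l ≤ E * X := by
    calc δ ^ 2 * l = c ^ (1 / 2 - ν + (1 / 2 - ν)) * l / S ^ 3 := by
          rw [hδ, ← hW2, Real.rpow_add hc]; ring
      _ ≤ E * c ^ (1 / 2 - ν + (1 / 2 - ν) - e) / S ^ 3 :=
        div_le_div_of_nonneg_right (hlog _) (by positivity)
      _ = E * (c ^ (1 / 2 - ν + (1 / 2 - ν) - e) / S ^ 3) := by ring
      _ ≤ E * X := by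
        rw [hX]
        refine mul_le_mul_of_nonneg_left ?_ (by linarith)
        exact div_le_div_of_nonneg_right (hmono (by linarith)) (by positivity)
  have hcσ : c ≤ σ := le_of_one_add_sqrt_le_exp hc.le (by linarith) (by linarith)
  have hpos : c * 1 * (1 + Real.exp (2 * (0 - σ))) ≤ 1 - Real.exp (-(2 * (c - 0))) := by
    rw [mul_one, sub_zero]
    exact one_add_exp_le_of_one_add_sqrt_le_exp hc.le hsm3 (by linarith)
  have hky₀ : k * √c ≤ c ^ (1 / 5 - ε) / 2 ^ K := by
    rw [le_div_iff₀ (by positivity), hsqrt]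
    calc _ = c ^ (1 / 5 - ε) * (k * 2 ^ K * c ^ (3 / 10 + ε)) := by ring
      _ ≤ c ^ (1 / 5 - ε) * 1 := by gcongr
      _ = _ := mul_one _
  have hsy : ∀ y, c ^ (1 / 5 - ε) / 2 ^ K ≤ y → √c ≤ y := fun y hy => by
    refine le_trans ?_ (hky₀.trans hy)
    exact le_mul_of_one_le_left hsc.le hk
  have hcs : c ≤ √c := by
    have h1 : √c ≤ 1 := Real.sqrt_le_one.2 hc1
    calc c = √c * √c := hscc.symm
      _ ≤ √c := mul_le_of_le_one_left hsc.le h1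
  have hs3 : ∀ y, 0 < y → √(A * c / y ^ 3) ≤ A * (√c / (y * √y)) := fun y hy => by
    refine Real.sqrt_le_iff.2 ⟨by positivity, ?_⟩
    calc A * c / y ^ 3 ≤ A ^ 2 * c / y ^ 3 := by gcongr
      _ = _ := by
        rw [mul_pow, div_pow, mul_pow, Real.sq_sqrt hc.le, Real.sq_sqrt hy.le]; ring
  have hyy : ∀ y, 0 < y → y ≤ 1 → y ≤ √y := fun y hy hy1 =>
    Real.le_sqrt_of_sq_le (by rw [sq]; exact mul_le_of_le_one_left hy.le hy1)
  have key := H c F hc1 hF hreg 1 σ δ 0 zero_le_one le_rfl hδ0.le hδ1 le_rfl hc hcσ hpos Ω μ Θ hΘ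
    (c ^ (1 / 5 - ε) / 2 ^ K) D (c ^ (ε / 2)) (fun y => A / y) (fun y => A / y ^ 2)
    (fun y => A * c / y ^ 3) (fun y => √c / (y * √y) + X / y) hy₀ hky₀ hD1
    (Real.rpow_pos_of_pos hc _)
    (Real.rpow_le_one hc.le hc1 (by linarith)) ?_ ?_ ?_ K n hn y
    (by rwa [div_mul_cancel₀ _ (by positivity)]) hy1
  · rw [← hδ, ← hX]
    refine key.trans (pow_le_pow_left' (ENNReal.ofReal_le_ofReal ?_) _)
    have hy0 : 0 < y := by linarith
    have hsy0 : 0 < √y := Real.sqrt_pos.2 hy0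
    have h1 : (c ^ (ε / 2)) ^ K ≤ √c := by
      rw [← Real.rpow_natCast, ← Real.rpow_mul hc.le]
      refine le_trans ?_ hcs
      conv_rhs => rw [← Real.rpow_one c]
      apply hmono
      rw [div_le_iff₀ hε] at hK
      linarith
    have h2 : (c ^ (ε / 2)) ^ K / y ≤ √c / (y * √y) := by
      have : y * √y ≤ y := mul_le_of_le_one_right hy0.le (Real.sqrt_le_one.2 hy1)
      gcongr
    have h3 : 0 < (C * D) ^ K * C := by positivity
    have h4 : 0 ≤ X / y := by positivity
    rw [mul_assoc _ (2 : ℝ)]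
    refine mul_le_mul_of_nonneg_left ?_ h3.le
    linarith
  · intro y hy
    have hsy0 : 0 < √y := Real.sqrt_pos.2 hy
    have h1 : √y / 2 ≤ √(y / 2) := by
      refine Real.le_sqrt_of_sq_le ?_
      rw [div_pow, Real.sq_sqrt hy.le]
      linarith
    have h2 : √c / (y / 2 * √(y / 2)) ≤ 4 * (√c / (y * √y)) := by
      calc _ ≤ √c / (y / 2 * (√y / 2)) := by gcongr
        _ = _ := by field_simp; norm_num
    have h3 : X / (y / 2) = 2 * (X / y) := by field_simp
    have h4 : 0 ≤ X / y := by positivity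
    have h5 : 0 < √c / (y * √y) := by positivity
    constructor
    · positivity
    · linarith
  · intro y hy hy1 n hn
    have hy0 : 0 < y := by linarith
    have hnc : n * c ≤ A := by
      rw [le_div_iff₀ hc] at hn
      linarith
    have e1 : ∀ i : ℕ, (1 + y) * Real.exp (0 * (i : ℝ)) - 1 = y := fun i => by
      rw [zero_mul, Real.exp_zero]; ring
    simp only [e1, Finset.sum_const, Finset.card_range, nsmul_eq_mul]
    refine ⟨?_, ?_, ?_⟩
    · rw [← mul_div_assoc]; gcongr
    · rw [← mul_div_assoc]; gcongr
    · calc (n : ℝ) * (c ^ 2 / y ^ 3) = n * c * c / y ^ 3 := by ring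
        _ ≤ _ := by gcongr
  · intro y hy hy1
    have hy0 : 0 < y := by linarith
    have hsy' := hsy y hy
    have hsy0 : 0 < √y := Real.sqrt_pos.2 hy0
    have hyy' := hyy y hy0 hy1
    have h3 := hs3 y hy0
    have hl' := hδl y hy
    rw [← hl]
    refine ⟨?_, ?_, ?_⟩
    · rw [div_le_div_iff₀ (by positivity) (by positivity)]
      calc c ^ 2 * y ^ 3 = 1 * c * c * y ^ 3 := by ring
        _ ≤ A * c * y * y ^ 3 := by gcongr; linarith
        _ = _ := by ring
    · have h4 : δ ^ 2 * (l * (A / y)) ≤ A * (E * (X / y)) := by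
        have := mul_le_mul_of_nonneg_left hδδl (show 0 ≤ A / y by positivity)
        calc δ ^ 2 * (l * (A / y)) = A / y * (δ ^ 2 * l) := by ring
          _ ≤ _ := this
          _ = _ := by ring
      have h5 : δ * (√c * l * (A / y ^ 2)) ≤ A * (E * 2 ^ K * (√c / (y * √y))) := by
        have e0 : δ * l / √y ≤ E * 2 ^ K := by
          calc δ * l / √y ≤ δ * l / y := by gcongr
            _ ≤ _ := hl'
            _ ≤ _ := mul_le_of_le_one_right (by positivity)
              (Real.rpow_le_one hc.le hc1 (by linarith))
        have := mul_le_mul_of_nonneg_left e0 (show 0 ≤ A * (√c / (y * √y)) by positivity)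
        calc δ * (√c * l * (A / y ^ 2)) = A * (√c / (y * √y)) * (δ * l / √y) := by
              have : y ^ 2 = y * (√y * √y) := by rw [Real.mul_self_sqrt hy0.le, sq]
              rw [this]
              field_simp
          _ ≤ _ := this
          _ = _ := by ring
      have h6 : 0 < √c / (y * √y) := by positivity
      have h60 : 0 ≤ X / y := by positivity
      have h7 : (√c / (y * √y)) + E * (X / y) + E * 2 ^ K * (√c / (y * √y)) ≤
          (4 ^ K + 2 * (E * 2 ^ K)) * (√c / (y * √y) + X / y) := by
        have e1 : (1 + E * 2 ^ K) * (√c / (y * √y)) ≤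
            (4 ^ K + 2 * (E * 2 ^ K)) * (√c / (y * √y)) :=
          mul_le_mul_of_nonneg_right (by linarith) h6.le
        have e2 : E * (X / y) ≤ (4 ^ K + 2 * (E * 2 ^ K)) * (X / y) :=
          mul_le_mul_of_nonneg_right (by linarith) h60
        linarith
      have h8 := mul_le_mul_of_nonneg_left h7 (show 0 ≤ A by linarith)
      rw [hD]
      linarith
    · have hQ := Real.rpow_pos_of_pos hc (ε / 2)
      have h4 : δ * (l * (A / y)) ≤ A * (E * 2 ^ K * c ^ (ε / 2)) := by
        calc δ * (l * (A / y)) = A * (δ * l / y) := by ring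
          _ ≤ _ := mul_le_mul_of_nonneg_left hl' (by linarith)
      have h5 : √c / (y * √y) ≤ 4 ^ K * c ^ (ε / 2) := by
        calc √c / (y * √y) ≤ √c / (y * y) := by gcongr
          _ ≤ √c / (c ^ (1 / 5 - ε) / 2 ^ K * (c ^ (1 / 5 - ε) / 2 ^ K)) := by gcongr
          _ = 4 ^ K * c ^ (1 / 10 + 2 * ε) := by
            have : (4 : ℝ) ^ K = 2 ^ K * 2 ^ K := by rw [← mul_pow]; norm_num
            rw [hsqrt', this]
            field_simp
          _ ≤ _ := mul_le_mul_of_nonneg_left (hmono (by linarith)) (by positivity)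
      have h6 := mul_le_mul_of_nonneg_left h5 (show 0 ≤ A by linarith)
      have h7 : 0 ≤ A * (E * 2 ^ K * c ^ (ε / 2)) := by positivity
      rw [hD]
      linarith

/-! ### Large radii and arbitrary exponents -/

lemma RegularAtInfty.circleMoment_le {f : ℂ → ℂ} (hf : RegularAtInfty f) {ρ R : ℝ} (hρ : 1 < ρ)
    (hR : ρ < R) {n : ℕ} (hn : n ≠ 0) : circleMoment f n R ≤ circleMoment f n ρ := by
  have hR0 : 0 ≤ R := by linarith
  have hc := hf.continuous_comp_circleMap hρ
  have hk := continuous_extPoisson (by linarith) hR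
  have hk0 := fun x => extPoisson_nonneg (by linarith : 0 ≤ ρ) hR.le x
  have key := lintegral_pow_le_of_le_convolution (k := extPoisson R ρ)
    (f := fun s => ‖f (circleMap 0 ρ s)‖) (g := fun t => ‖f (circleMap 0 R t)‖) hk
    (periodic_extPoisson R ρ) hk0 (integral_extPoisson hρ hR)
    hc.norm (fun _ => norm_nonneg _) (fun t => norm_nonneg _) (fun t => ?_) hn
  · simpa only [circleMoment, ofReal_norm] using key
  · rw [hf.eq_integral_extPoisson hρ hR]
    refine (norm_integral_le_integral_norm _).trans (le_of_eq ?_)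
    simp only [norm_mul, Complex.norm_real, Real.norm_eq_abs, abs_of_nonneg (hk0 _)]

/-- Since `z Ψ_n(z)` is regular at infinity, the moments of `Ψ_n` decay like those of `1 / z`. -/
lemma circleMoment_diffFluctuation_le {F : ℂ → ℂ} {c : ℝ} (hF : IsBasicMap F c) (θ : ℕ → ℝ)
    (n : ℕ) {ρ R : ℝ} (hρ : 1 < ρ) (hR : ρ < R) {N : ℕ} (hN : N ≠ 0) :
    circleMoment (diffFluctuation F c θ n) N R ≤
      ENNReal.ofReal (ρ / R) ^ N * circleMoment (diffFluctuation F c θ n) N ρ := by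
  have h1 : ∀ s : ℝ, 1 < s → circleMoment (fun z => z * diffFluctuation F c θ n z) N s =
      ENNReal.ofReal s ^ N * circleMoment (diffFluctuation F c θ n) N s := fun s hs => by
    have e1 : ∀ t, ‖circleMap 0 s t * diffFluctuation F c θ n (circleMap 0 s t)‖ₑ ^ N =
        ENNReal.ofReal s ^ N * ‖diffFluctuation F c θ n (circleMap 0 s t)‖ₑ ^ N := fun t => by
      rw [enorm_mul, mul_pow, ← ofReal_norm, norm_circleMap_zero_of_nonneg (by linarith)]
    simp only [circleMoment, e1]
    exact lintegral_const_mul' _ _ (by finiteness)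
  have h2 := (regularAtInfty_mul_diffFluctuation hF θ n).circleMoment_le hρ hR hN
  rw [h1 _ hρ, h1 _ (hρ.trans hR)] at h2
  have hR0 : 0 < R := by linarith
  have h3 : ENNReal.ofReal R ^ N ≠ 0 := by positivity
  have h4 : ENNReal.ofReal R ^ N ≠ ∞ := by finiteness
  calc _ ≤ ENNReal.ofReal ρ ^ N * circleMoment (diffFluctuation F c θ n) N ρ /
        ENNReal.ofReal R ^ N := by
        rw [ENNReal.le_div_iff_mul_le (Or.inl h3) (Or.inl h4), mul_comm]
        exact h2
    _ = _ := by
        rw [ENNReal.ofReal_div_of_pos hR0]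
        simp only [div_eq_mul_inv, mul_pow, ENNReal.inv_pow]
        ring

lemma stoppedMoment_le_mul {Ω : Type*} [MeasurableSpace Ω] (μ : Measure Ω) {F : ℂ → ℂ} {c : ℝ}
    (hF : IsBasicMap F c) (σ δ : ℝ) (Θ : ℕ → Ω → ℝ) (n : ℕ) {ρ R : ℝ} (hρ : 1 < ρ) (hR : ρ < R)
    {N : ℕ} (hN : N ≠ 0) :
    stoppedMoment μ F c σ δ Θ N n R ≤
      ENNReal.ofReal (ρ / R) ^ N * stoppedMoment μ F c σ δ Θ N n ρ := by
  unfold stoppedMoment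
  rw [← lintegral_const_mul' _ _ (by finiteness)]
  refine lintegral_mono fun ω => ?_
  by_cases h : truncatedPath Θ n ω ∈ goodPaths F c σ δ n
  · simp only [Set.indicator_of_mem h]
    exact circleMoment_diffFluctuation_le hF _ n hρ hR hN
  · simp [Set.indicator_of_notMem h]

/-- Jensen's inequality for powers. No measurability is needed, since a lower integral is the
integral of a measurable minorant. -/
lemma lintegral_rpow_le_rpow {α : Type*} [MeasurableSpace α] (μ : Measure α)
    [IsProbabilityMeasure μ] (f : α → ℝ≥0∞) {p q : ℝ} (hp : 0 < p) (hpq : p ≤ q) :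
    ∫⁻ a, f a ^ p ∂μ ≤ (∫⁻ a, f a ^ q ∂μ) ^ (p / q) := by
  have hq : 0 < q := hp.trans_le hpq
  obtain ⟨g, hg, hgf, h⟩ := exists_measurable_le_lintegral_eq μ fun a => f a ^ p
  have hm : Measurable fun a => g a ^ (1 / p) := hg.pow_const _
  have h1 := eLpNorm'_le_eLpNorm'_of_exponent_le hp hpq μ hm.aestronglyMeasurable
  simp only [eLpNorm', enorm_eq_self] at h1
  have h2 : ∀ a, (g a ^ (1 / p)) ^ p = g a := fun a => by
    rw [← ENNReal.rpow_mul, one_div_mul_cancel hp.ne', ENNReal.rpow_one]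
  simp only [h2] at h1
  have h3 : ∀ a, g a ^ (1 / p) ≤ f a := fun a => by
    calc g a ^ (1 / p) ≤ (f a ^ p) ^ (1 / p) := ENNReal.rpow_le_rpow (hgf a) (by positivity)
      _ = f a := by rw [← ENNReal.rpow_mul, mul_one_div_cancel hp.ne', ENNReal.rpow_one]
  have h4 : ∫⁻ a, (g a ^ (1 / p)) ^ q ∂μ ≤ ∫⁻ a, f a ^ q ∂μ :=
    lintegral_mono fun a => ENNReal.rpow_le_rpow (h3 a) hq.le
  rw [h]
  calc ∫⁻ a, g a ∂μ = ((∫⁻ a, g a ∂μ) ^ (1 / p)) ^ p := by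
        rw [← ENNReal.rpow_mul, one_div_mul_cancel hp.ne', ENNReal.rpow_one]
    _ ≤ ((∫⁻ a, f a ^ q ∂μ) ^ (1 / q)) ^ p :=
        ENNReal.rpow_le_rpow (h1.trans (ENNReal.rpow_le_rpow h4 (by positivity))) hp.le
    _ = _ := by rw [← ENNReal.rpow_mul, one_div_mul_eq_div]

lemma tripleNorm_mono {Ω : Type*} [MeasurableSpace Ω] (μ : Measure Ω) [IsProbabilityMeasure μ]
    (r : ℝ) (f : Ω → ℂ → ℂ) {p q : ℝ} (hp : 0 < p) (hpq : p ≤ q) :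
    tripleNorm μ p r f ≤ tripleNorm μ q r f := by
  have hq : 0 < q := hp.trans_le hpq
  unfold tripleNorm
  simp only [laverage_Ico_eq_lintegral_uniformAngle]
  have h1 : ∀ ω, ∫⁻ t, ‖f ω (circleMap 0 r t)‖ₑ ^ p ∂uniformAngle ≤
      (∫⁻ t, ‖f ω (circleMap 0 r t)‖ₑ ^ q ∂uniformAngle) ^ (p / q) := fun ω =>
    lintegral_rpow_le_rpow _ _ hp hpq
  have h2 := lintegral_rpow_le_rpow μ
    (fun ω => ∫⁻ t, ‖f ω (circleMap 0 r t)‖ₑ ^ q ∂uniformAngle) (p := p / q) (q := 1)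
    (by positivity) ((div_le_one hq).2 hpq)
  simp only [ENNReal.rpow_one, div_one] at h2
  refine (ENNReal.rpow_le_rpow ((lintegral_mono h1).trans h2) (by positivity)).trans (le_of_eq ?_)
  rw [← ENNReal.rpow_mul]
  congr 1
  field_simp

/-- Moment bounds near the unit circle give bounds of the norms at all radii. -/
lemma tripleNorm_le_of_stoppedMoment_le {Ω : Type*} [MeasurableSpace Ω] (μ : Measure Ω)
    [IsProbabilityMeasure μ] {F : ℂ → ℂ} {c σ δ : ℝ} (hF : IsBasicMap F c) (hδ : 0 ≤ δ)
    (Θ : ℕ → Ω → ℝ) (n : ℕ) {N : ℕ} (hN : N ≠ 0) {p : ℝ} (hp : 0 < p) (hpN : p ≤ N) {y₁ : ℝ}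
    (hy₁ : 0 < y₁) (hy₁' : y₁ ≤ 1) {g : ℝ → ℝ} (hg : ∀ y, 0 < y → 0 ≤ g y)
    (h : ∀ y, y₁ ≤ y → y ≤ 1 →
      stoppedMoment μ F c σ δ Θ N n (1 + y) ≤ ENNReal.ofReal (g y) ^ N) {r : ℝ}
    (hr : 1 + y₁ ≤ r) :
    tripleNorm μ p r (stoppedDiffFluctuation F c σ δ Θ n) ≤
      ENNReal.ofReal (2 / r * g (min (r - 1) 1)) := by
  have hr0 : 0 < r := by linarith
  have key : stoppedMoment μ F c σ δ Θ N n r ≤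
      ENNReal.ofReal (2 / r * g (min (r - 1) 1)) ^ N := by
    rcases le_or_gt r 2 with hr2 | hr2
    · have h1 := h (r - 1) (by linarith) (by linarith)
      rw [add_sub_cancel] at h1
      rw [min_eq_left (by linarith)]
      refine h1.trans (pow_le_pow_left' (ENNReal.ofReal_le_ofReal ?_) _)
      exact le_mul_of_one_le_left (hg _ (by linarith)) ((one_le_div hr0).2 hr2)
    · rw [min_eq_right (by linarith), ENNReal.ofReal_mul (by positivity), mul_pow]
      refine (stoppedMoment_le_mul μ hF σ δ Θ n one_lt_two hr2 hN).trans ?_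
      have h1 := h 1 hy₁' le_rfl
      rw [one_add_one_eq_two] at h1
      exact mul_le_mul_right h1 _
  have hN0 : (N : ℝ) ≠ 0 := by exact_mod_cast hN
  calc _ ≤ tripleNorm μ N r (stoppedDiffFluctuation F c σ δ Θ n) := tripleNorm_mono μ r _ hp hpN
    _ ≤ stoppedMoment μ F c σ δ Θ N n r ^ (1 / (N : ℝ)) :=
        tripleNorm_stoppedDiffFluctuation_le μ F c σ hδ Θ hN n r
    _ ≤ (ENNReal.ofReal (2 / r * g (min (r - 1) 1)) ^ N) ^ (1 / (N : ℝ)) :=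
        ENNReal.rpow_le_rpow key (by positivity)
    _ = _ := by
        rw [← ENNReal.rpow_natCast, ← ENNReal.rpow_mul, mul_one_div_cancel hN0, ENNReal.rpow_one]

/-- For capacities bounded below, the crude bound of `Ψ_n` is of the right order. -/
lemma exists_stoppedMoment_le_sqrt_div (Λ T : ℝ) (hΛ : 0 ≤ Λ) (hT : 0 ≤ T) {c₀ : ℝ}
    (hc₀ : 0 < c₀) :
    ∃ C : ℝ, 1 ≤ C ∧ ∀ (c σ δ : ℝ) (F : ℂ → ℂ), c₀ ≤ c → c ≤ 1 → IsBasicMap F c →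
      HasRegularity F c Λ →
      ∀ (Ω : Type*) [MeasurableSpace Ω] (μ : Measure Ω) [IsProbabilityMeasure μ]
        (Θ : ℕ → Ω → ℝ) (n : ℕ), (n : ℝ) ≤ T / c → ∀ (N : ℕ) (y : ℝ), 0 < y → y ≤ 1 →
      stoppedMoment μ F c σ δ Θ N n (1 + y) ≤ ENNReal.ofReal (C * (√c / y)) ^ N := by
  obtain ⟨C₀, hC₀, H⟩ := exists_norm_diffFluctuation_le Λ T hΛ hT
  have hs : 0 < √c₀ := Real.sqrt_pos.2 hc₀
  refine ⟨C₀ / √c₀ + 1, by linarith [show 0 ≤ C₀ / √c₀ by positivity], ?_⟩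
  intro c σ δ F hcc₀ hc1 hF hreg Ω _ μ _ Θ n hn N y hy hy1
  refine (stoppedMoment_le_of_forall_norm_le μ c σ δ Θ N n (Z := C₀ / y) (by linarith)
    fun θ z hz => ?_).trans (pow_le_pow_left' (ENNReal.ofReal_le_ofReal ?_) _)
  · have := H c F hc1 hF hreg θ n hn z (by linarith) (by linarith)
    rwa [hz, add_sub_cancel_left] at this
  · have h1 : √c₀ ≤ √c := Real.sqrt_le_sqrt hcc₀
    have h2 : 0 < √c / y := div_pos (hs.trans_le h1) hy
    calc C₀ / y = C₀ / √c₀ * (√c₀ / y) := by field_simp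
      _ ≤ C₀ / √c₀ * (√c / y) := by gcongr
      _ ≤ _ := by linarith

lemma one_div_min_le {r : ℝ} (hr : 1 < r) : 1 / min (r - 1) 1 ≤ r / (r - 1) := by
  have h0 : 0 < r - 1 := by linarith
  rcases le_total (r - 1) 1 with h | h
  · rw [min_eq_left h]
    gcongr
  · rw [min_eq_right h, div_one, one_le_div h0]
    linarith

end ALE

theorem proposition7p1 :
    (∀ Λ η T ε ν p : ℝ, 0 ≤ Λ → 0 ≤ η → η < 1 → 0 < T → 0 < ε → ε < 1 / 2 →
      0 < ν → ν < ε / 2 → 2 ≤ p →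
      ∃ C : ℝ, 1 ≤ C ∧
        ∀ (c σ r : ℝ) (F : ℂ → ℂ), 0 < c → c ≤ 1 →
          ALE.IsBasicMap F c → ALE.HasRegularity F c Λ →
          1 + c ^ (1 / 2 - ε) ≤ r → 1 + c ^ (1 / 2 - ε) ≤ Real.exp σ →
          ∀ (Ω : Type*) [MeasurableSpace Ω] (μ : Measure Ω) [IsProbabilityMeasure μ]
            (Θ : ℕ → Ω → ℝ), ALE.IsALE μ F η σ Θ →
          ∀ n : ℕ, (n : ℝ) ≤ T / c →
            ALE.tripleNorm μ p r
                (ALE.stoppedDiffFluctuation F c σ (c ^ (1 / 2 - ν) / (Real.exp σ - 1)) Θ n) ≤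
              ENNReal.ofReal (C / r *
                (√c * (r / (r - 1)) + c ^ (1 - 3 * ν) / (Real.exp σ - 1) ^ 2))) ∧
    (∀ Λ T ε ν p : ℝ, 0 ≤ Λ → 0 < T → 0 < ε → ε < 1 / 5 →
      0 < ν → ν < 3 * ε / 2 → 2 ≤ p →
      ∃ C : ℝ, 1 ≤ C ∧
        ∀ (c σ r : ℝ) (F : ℂ → ℂ), 0 < c → c ≤ 1 →
          ALE.IsBasicMap F c → ALE.HasRegularity F c Λ →
          1 + c ^ (1 / 5 - ε) ≤ r → 1 + c ^ (1 / 5 - ε) ≤ Real.exp σ →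
          ∀ (Ω : Type*) [MeasurableSpace Ω] (μ : Measure Ω) [IsProbabilityMeasure μ]
            (Θ : ℕ → Ω → ℝ), ALE.IsALE μ F 1 σ Θ →
          ∀ n : ℕ, (n : ℝ) ≤ T / c →
            ALE.tripleNorm μ p r
                (ALE.stoppedDiffFluctuation F c σ
                  (c ^ (1 / 2 - ν) / (Real.exp σ - 1) ^ (3 / 2 : ℝ)) Θ n) ≤
              ENNReal.ofReal (C / r *
                (√c * (r / (r - 1)) ^ (3 / 2 : ℝ) +
                  c ^ (1 - 3 * ν) / (Real.exp σ - 1) ^ 3 * (r / (r - 1))))) := by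
  constructor
  · intro Λ η T ε ν p hΛ hη0 hη1 hT hε hε2 hν hνε hp
    -- The even exponent `2 m + 2` is larger than `p`.
    obtain ⟨m, hm⟩ := exists_nat_ge p
    obtain ⟨c₀, C₁, hc₀, hC₁, H₁⟩ :=
      ALE.exists_stoppedMoment_le_of_lt_one Λ η T ε ν m hΛ hη0 hη1 hT.le hε hν hνε
    obtain ⟨C₂, hC₂, H₂⟩ := ALE.exists_stoppedMoment_le_sqrt_div Λ T hΛ hT.le hc₀
    refine ⟨2 * (C₁ + C₂), by linarith, ?_⟩
    intro c σ r F hc hc1 hF hreg hr hσ Ω _ μ _ Θ hΘ n hn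
    have hy₁ : 0 < c ^ (1 / 2 - ε) := Real.rpow_pos_of_pos hc _
    have hS : 0 < Real.exp σ - 1 := by linarith
    have hX : 0 ≤ c ^ (1 - 3 * ν) / (Real.exp σ - 1) ^ 2 := by
      have := Real.rpow_pos_of_pos hc (1 - 3 * ν)
      positivity
    have hδ : 0 ≤ c ^ (1 / 2 - ν) / (Real.exp σ - 1) := by
      have := Real.rpow_pos_of_pos hc (1 / 2 - ν)
      positivity
    obtain ⟨X, hXe⟩ : ∃ X, X = c ^ (1 - 3 * ν) / (Real.exp σ - 1) ^ 2 := ⟨_, rfl⟩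
    rw [← hXe] at hX ⊢
    have hr0 : 0 < r := by linarith
    refine (ALE.tripleNorm_le_of_stoppedMoment_le μ hF hδ Θ n (N := 2 * m + 2) (by omega)
      (by linarith) (by push_cast; linarith) hy₁ (Real.rpow_le_one hc.le hc1 (by linarith))
      (g := fun y => (C₁ + C₂) * (√c / y + X)) (fun y hy => by positivity) ?_ hr).trans ?_
    · intro y hy hy1
      have hy0 : 0 < y := by linarith
      have h1 : 0 ≤ √c / y := by positivity
      rcases le_total c c₀ with hcc | hcc
      · refine (H₁ c σ F hcc hc1 hF hreg hσ Ω μ Θ hΘ n hn y hy hy1).trans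
          (pow_le_pow_left' (ENNReal.ofReal_le_ofReal ?_) _)
        rw [← hXe]
        exact mul_le_mul_of_nonneg_right (by linarith) (by positivity)
      · refine (H₂ c σ _ F hcc hc1 hF hreg Ω μ Θ n hn _ y hy0 hy1).trans
          (pow_le_pow_left' (ENNReal.ofReal_le_ofReal ?_) _)
        exact mul_le_mul (by linarith) (by linarith) (by positivity) (by linarith)
    · refine ENNReal.ofReal_le_ofReal ?_
      have h1 := mul_le_mul_of_nonneg_left (ALE.one_div_min_le (by linarith : 1 < r))
        (Real.sqrt_nonneg c)
      rw [mul_one_div] at h1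
      calc 2 / r * ((C₁ + C₂) * (√c / min (r - 1) 1 + X)) =
          2 * (C₁ + C₂) / r * (√c / min (r - 1) 1 + X) := by ring
        _ ≤ _ := by gcongr
  · intro Λ T ε ν p hΛ hT hε hε2 hν hνε hp
    obtain ⟨m, hm⟩ := exists_nat_ge p
    obtain ⟨c₀, C₁, hc₀, hC₁, H₁⟩ :=
      ALE.exists_stoppedMoment_le_of_eq_one Λ T ε ν m hΛ hT.le hε hν hνε
    obtain ⟨C₂, hC₂, H₂⟩ := ALE.exists_stoppedMoment_le_sqrt_div Λ T hΛ hT.le hc₀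
    refine ⟨2 * (C₁ + C₂), by linarith, ?_⟩
    intro c σ r F hc hc1 hF hreg hr hσ Ω _ μ _ Θ hΘ n hn
    have hy₁ : 0 < c ^ (1 / 5 - ε) := Real.rpow_pos_of_pos hc _
    have hS : 0 < Real.exp σ - 1 := by linarith
    have hX : 0 ≤ c ^ (1 - 3 * ν) / (Real.exp σ - 1) ^ 3 := by
      have := Real.rpow_pos_of_pos hc (1 - 3 * ν)
      positivity
    have hδ : 0 ≤ c ^ (1 / 2 - ν) / (Real.exp σ - 1) ^ (3 / 2 : ℝ) := by
      have := Real.rpow_pos_of_pos hc (1 / 2 - ν)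
      have := Real.rpow_pos_of_pos hS (3 / 2)
      positivity
    obtain ⟨X, hXe⟩ : ∃ X, X = c ^ (1 - 3 * ν) / (Real.exp σ - 1) ^ 3 := ⟨_, rfl⟩
    rw [← hXe] at hX ⊢
    have hr0 : 0 < r := by linarith
    refine (ALE.tripleNorm_le_of_stoppedMoment_le μ hF hδ Θ n (N := 2 * m + 2) (by omega)
      (by linarith) (by push_cast; linarith) hy₁ (Real.rpow_le_one hc.le hc1 (by linarith))
      (g := fun y => (C₁ + C₂) * (√c / (y * √y) + X / y)) (fun y hy => by positivity) ?_
      hr).trans ?_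
    · intro y hy hy1
      have hy0 : 0 < y := by linarith
      have hsy0 : 0 < √y := Real.sqrt_pos.2 hy0
      rcases le_total c c₀ with hcc | hcc
      · refine (H₁ c σ F hcc hc1 hF hreg hσ Ω μ Θ hΘ n hn y hy hy1).trans
          (pow_le_pow_left' (ENNReal.ofReal_le_ofReal ?_) _)
        rw [← hXe]
        exact mul_le_mul_of_nonneg_right (by linarith) (by positivity)
      · refine (H₂ c σ _ F hcc hc1 hF hreg Ω μ Θ n hn _ y hy0 hy1).trans
          (pow_le_pow_left' (ENNReal.ofReal_le_ofReal ?_) _)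
        have h2 : √c / y ≤ √c / (y * √y) := by
          have : y * √y ≤ y := mul_le_of_le_one_right hy0.le (Real.sqrt_le_one.2 hy1)
          gcongr
        have h3 : 0 ≤ X / y := by positivity
        have h4 : 0 ≤ √c / (y * √y) := by positivity
        exact mul_le_mul (by linarith) (by linarith) (by positivity) (by linarith)
    · refine ENNReal.ofReal_le_ofReal ?_
      have hy0 : 0 < min (r - 1) 1 := lt_min (by linarith) one_pos
      have h1 := ALE.one_div_min_le (by linarith : 1 < r)
      generalize min (r - 1) 1 = y at *
      have h2 := mul_le_mul_of_nonneg_left h1 hX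
      rw [mul_one_div] at h2
      have h3 : √c / (y * √y) ≤ √c * (r / (r - 1)) ^ (3 / 2 : ℝ) := by
        have e1 := Real.rpow_le_rpow (by positivity) h1 (show (0 : ℝ) ≤ 3 / 2 by norm_num)
        rw [ALE.rpow_three_halves (by positivity : 0 ≤ 1 / y), Real.sqrt_div zero_le_one,
          Real.sqrt_one] at e1
        calc √c / (y * √y) = √c * (1 / y * (1 / √y)) := by field_simp
          _ ≤ _ := by gcongr
      calc 2 / r * ((C₁ + C₂) * (√c / (y * √y) + X / y)) =
          2 * (C₁ + C₂) / r * (√c / (y * √y) + X / y) := by ring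
        _ ≤ _ := by gcongr
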